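/- **Definitions.** Let $G=(V,E)$ be a DAG. A *shortcut* of $G$ is a set $H$ of edges of the (irreflexive) transitive closure of $G$. It is *certified* if for every $(u,v)\in H$ there is a vertex $w$ with $(u,w),(w,v)\in E\cup H$. The *certification complexity* of $H$ is the smallest size of a certified shortcut $H'\supseteq H$. For an unweighted undirected graph $G$ (edges of weight $1$), a *hopset* is a set $H$ of weighted edges (no loops) with $\mathrm{dist}_{G\cup H}=\mathrm{dist}_G$. It is certified if every edge $uv\in H$ of weight $x$ has a vertex $w$ and edges $uw,wv\in E\cup H$ with weights summing to $x$. Its certification complexity is the smallest size of a certified hopset containing $H$. *Greedy shortcut (Berman–Raskhodnikova–Ruan).* The potential of $H$ is the sum of $\mathrm{dist}_{G\cup H}(u,v)$ (number of edges) over all pairs with $v$ reachable from $u$. Start with $H=\emptyset$. Each round adds a new edge of the transitive closure (not in $E\cup H$) that reduces the potential the most, with ties broken arbitrarily (if no new edge is left, nothing happens). *Greedy hopset.* The same for undirected graphs: the candidates are the new edges $uv$ of weight $\mathrm{dist}_G(u,v)$ between distinct, non-adjacent, connected vertices, and the distance of $u,v$ in the potential is replaced by the least number of edges of a $u$–$v$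 path in $G\cup H$ of length $\mathrm{dist}_G(u,v)$. *Greedy Kogan–Parter variant (Bals et al.).* A chain is a sequence of vertices each of which reaches the next. Given at most $\ell= A n^{2/3}$ vertex-disjoint chains such that every path of $G$ has at most $Bn/\ell$ vertices on no chain, first take any set $H$ of new edges, each going from a vertex of a chain to a later vertex of the same chain, such that in $G\cup H$ every vertex of a chain reaches every later vertex of that chain by at most $R$ edges. Then each round adds a new edge from a vertex $u$ to the first vertex reachable from $u$ on some chain; among all such new edges, it adds one that reduces the potential (sum of all pairwise distances, as above) the most. **Statement.** 1. For every $\epsilon\in[0,1/25)$ there are constants $a,b,\kappa>0$ and DAGs $G_n$ on $n$ vertices which, for all large $n$, have $m$ edges with $a n^{1+\epsilon}\le m\le b n^{1+\epsilon}$, such that for every $c>0$, all sufficiently large $n$ and all $k\ge cn$, every set $H$ obtained by $k$ rounds of the greedy shortcut construction on $G_n$ has certification complexity at least $\kappa\, m\, n^{\epsilon}$. 2. For every $\epsilon\in[0,1/25)$ the same holds for unweighted undirected graphs $G_n$ and the greedy hopset construction. 3. For every $\epsilon\in[0,2/75)$ there are constants $a,b,\kappa>0$ and DAGs $G_n$ on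 $n$ vertices which, for all large $n$, have $m$ edges with $a n^{1+\epsilon}\le m\le b n^{1+\epsilon}$, such that for all $A,B,c>0$ and all integers $R\ge 0$, all sufficiently large $n$ and all $k\ge cn$, every set $H$ obtained on $G_n$ by the greedy Kogan–Parter variant with $k$ rounds (for any admissible choice of the chains and of the chain edges) has certification complexity at least $\kappa\, m\, n^{\epsilon}$. -/

import Mathlib

namespace CertifiedShortcuts

/-! ### Greedy potential reduction -/

/-- One round of a greedy procedure that keeps a finite set `H` and may add any element of
`cand H`: it adds a candidate for which the resulting potential is as small as possible (ties are
broken arbitrarily). If there is no candidate left, nothing changes. -/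
def GreedyStep {α : Type*} [DecidableEq α] (cand : Finset α → Set α) (pot : Finset α → ℕ)
    (H K : Finset α) : Prop :=
  (∃ e ∈ cand H, K = insert e H ∧ ∀ f ∈ cand H, pot (insert e H) ≤ pot (insert f H)) ∨
    (cand H = ∅ ∧ K = H)

/-- `GreedyRun cand pot H₀ k H`: the greedy procedure, started with `H₀`, can hold the set `H`
after `k` rounds (for some way of breaking ties). -/
inductive GreedyRun {α : Type*} [DecidableEq α] (cand : Finset α → Set α) (pot : Finset α → ℕ)
    (H₀ : Finset α) : ℕ → Finset α → Prop
  | zero : GreedyRun cand pot H₀ 0 H₀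
  | succ {k : ℕ} {H K : Finset α} : GreedyRun cand pot H₀ k H → GreedyStep cand pot H K →
      GreedyRun cand pot H₀ (k + 1) K

/-! ### Shortcuts of directed acyclic graphs -/

section Shortcuts

/-- `WalkOf r k u v`: there is a walk from `u` to `v` with exactly `k` steps of `r`. -/
inductive WalkOf {V : Type*} (r : V → V → Prop) : ℕ → V → V → Prop
  | nil (v : V) : WalkOf r 0 v v
  | cons {k : ℕ} {u v w : V} : r u v → WalkOf r k v w → WalkOf r (k + 1) u w

/-- The distance from `u` to `v`: the least number of steps of a walk from `u` to `v`
(`0` if there is none). -/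
noncomputable def stepDist {V : Type*} (r : V → V → Prop) (u v : V) : ℕ :=
  sInf {k | WalkOf r k u v}

/-- `G` has no directed cycle. -/
def IsDAG {V : Type*} (G : Digraph V) : Prop :=
  ∀ v, ¬ Relation.TransGen G.Adj v v

/-- The number of edges of a directed graph. -/
noncomputable def edgeCount {V : Type*} (G : Digraph V) : ℕ :=
  {e : V × V | G.Adj e.1 e.2}.ncard

/-- The edge relation of `G ∪ H`. -/
def AugAdj {V : Type*} (G : Digraph V) (H : Finset (V × V)) (u v : V) : Prop :=
  G.Adj u v ∨ (u, v) ∈ H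

/-- `H` is a shortcut of the acyclic graph `G`: a set of edges of its transitive closure. -/
def IsShortcut {V : Type*} (G : Digraph V) (H : Finset (V × V)) : Prop :=
  ∀ e ∈ H, Relation.TransGen G.Adj e.1 e.2

/-- Every edge `(u, v)` of `H` is certified by two edges `(u, w)`, `(w, v)` of `G ∪ H`. -/
def IsCertified {V : Type*} (G : Digraph V) (H : Finset (V × V)) : Prop :=
  ∀ u v, (u, v) ∈ H → ∃ w, AugAdj G H u w ∧ AugAdj G H w v

/-- The certification complexity of `H`: the least size of a certified shortcut containing `H`. -/
noncomputable def certComplexity {V : Type*} (G : Digraph V) (H : Finset (V × V)) : ℕ :=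
  sInf {k | ∃ K : Finset (V × V), IsShortcut G K ∧ IsCertified G K ∧ H ⊆ K ∧ K.card = k}

/-- The sum of the distances in `G ∪ H` over all ordered pairs `(u, v)` such that `v` is reachable
from `u` (the other pairs contribute `0`). -/
noncomputable def potential {V : Type*} [Fintype V] (G : Digraph V) (H : Finset (V × V)) : ℕ :=
  ∑ u : V, ∑ v : V, stepDist (AugAdj G H) u v

/-- The edges of the transitive closure of `G` that are not yet present in `G ∪ H`. -/
def newEdges {V : Type*} (G : Digraph V) (H : Finset (V × V)) : Set (V × V) :=
  {e | Relation.TransGen G.Adj e.1 e.2 ∧ ¬ AugAdj G H e.1 e.2}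

/-- `H` is a result of `k` rounds of the greedy shortcut construction on `G`. -/
def GreedyShortcut {V : Type*} [Fintype V] [DecidableEq V] (G : Digraph V) (k : ℕ)
    (H : Finset (V × V)) : Prop :=
  GreedyRun (newEdges G) (potential G) ∅ k H

end Shortcuts

/-! ### The greedy variant with chain covers -/

section Chains

/-- `𝒞` is a cover by at most `ℓ` vertex-disjoint chains, with constant `B`: each member is a
sequence of vertices each of which reaches the next one, and every path of `G` has at most
`B * n / ℓ` vertices that lie on no chain, where `n` is the number of vertices. -/
structure IsChainCover {V : Type*} [Fintype V] (G : Digraph V) (𝒞 : Finset (List V))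
    (ℓ B : ℝ) : Prop where
  chain : ∀ C ∈ 𝒞, C.IsChain (Relation.TransGen G.Adj)
  disjoint : ∀ C ∈ 𝒞, ∀ D ∈ 𝒞, C ≠ D → C.Disjoint D
  card_le : (𝒞.card : ℝ) ≤ ℓ
  covers : ∀ p : List V, p.IsChain G.Adj → ∀ s : Finset V,
    (∀ v ∈ s, v ∈ p ∧ ∀ C ∈ 𝒞, v ∉ C) → (s.card : ℝ) ≤ B * Fintype.card V / ℓ

/-- `H` is a set of new edges, each from a vertex of a chain to a later vertex of the same chain,
that reduces the diameter of every chain to at most `R`. -/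
def IsChainShortcut {V : Type*} (G : Digraph V) (𝒞 : Finset (List V)) (R : ℕ)
    (H : Finset (V × V)) : Prop :=
  (∀ e ∈ H, ¬ G.Adj e.1 e.2 ∧ ∃ C ∈ 𝒞, [e.1, e.2].Sublist C) ∧
    ∀ C ∈ 𝒞, ∀ u v, [u, v].Sublist C → ∃ k ≤ R, WalkOf (AugAdj G H) k u v

/-- `v` is the first vertex of the chain `C` that is reachable from `u`. -/
def IsFirstReachable {V : Type*} (G : Digraph V) (C : List V) (u v : V) : Prop :=
  Relation.ReflTransGen G.Adj u v ∧
    ∃ l₁ l₂ : List V, C = l₁ ++ v :: l₂ ∧ ∀ w ∈ l₁, ¬ Relation.ReflTransGen G.Adj u w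

/-- The new edges that lead from a vertex to its first reachable vertex on some chain. -/
def newChainEdges {V : Type*} (G : Digraph V) (𝒞 : Finset (List V)) (H : Finset (V × V)) :
    Set (V × V) :=
  {e | e ∈ newEdges G H ∧ ∃ C ∈ 𝒞, IsFirstReachable G C e.1 e.2}

/-- `H` is a result of the greedy chain-based construction on `G` with the chains `𝒞`: first the
diameter of every chain is reduced to at most `R`, and then `k` rounds follow, each of which adds
an edge from a vertex to its first reachable vertex on a chain that reduces the potential the
most. -/
def GreedyChainShortcut {V : Type*} [Fintype V] [DecidableEq V] (G : Digraph V)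
    (𝒞 : Finset (List V)) (R k : ℕ) (H : Finset (V × V)) : Prop :=
  ∃ H₁, IsChainShortcut G 𝒞 R H₁ ∧ GreedyRun (newChainEdges G 𝒞) (potential G) H₁ k H

end Chains

/-! ### Hopsets of unweighted undirected graphs -/

section Hopsets

/-- `uv` is an edge of weight `x` of `G ∪ H`, where the edges of `G` have weight `1` and `H` is a
set of weighted undirected edges. -/
def HopEdge {V : Type*} (G : SimpleGraph V) (H : Finset (Sym2 V × ℝ)) (u v : V) (x : ℝ) : Prop :=
  (G.Adj u v ∧ x = 1) ∨ (s(u, v), x) ∈ H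

/-- `HopWalk G H k x u v`: there is a walk from `u` to `v` in `G ∪ H` with exactly `k` edges and
with total weight `x`. -/
inductive HopWalk {V : Type*} (G : SimpleGraph V) (H : Finset (Sym2 V × ℝ)) :
    ℕ → ℝ → V → V → Prop
  | nil (v : V) : HopWalk G H 0 0 v v
  | cons {k : ℕ} {x y : ℝ} {u v w : V} : HopEdge G H u v x → HopWalk G H k y v w →
      HopWalk G H (k + 1) (x + y) u w

/-- `H` is an exact hopset of `G`: a set of weighted edges without loops such that all distances in
`G ∪ H` are the same as in `G` (they are never larger, since `G ∪ H` contains `G`). -/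
def IsHopset {V : Type*} (G : SimpleGraph V) (H : Finset (Sym2 V × ℝ)) : Prop :=
  (∀ e ∈ H, ¬ e.1.IsDiag) ∧
    ∀ (u v : V) (k : ℕ) (x : ℝ), HopWalk G H k x u v → G.Reachable u v ∧ (G.dist u v : ℝ) ≤ x

/-- Every edge `uv` of `H` is certified by two edges `uw`, `wv` of `G ∪ H`, the sum of whose weights
is the weight of `uv`. -/
def IsCertifiedHopset {V : Type*} (G : SimpleGraph V) (H : Finset (Sym2 V × ℝ)) : Prop :=
  ∀ (u v : V) (x : ℝ), (s(u, v), x) ∈ H →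
    ∃ (w : V) (y z : ℝ), HopEdge G H u w y ∧ HopEdge G H w v z ∧ x = y + z

/-- The certification complexity of `H`: the least size of a certified hopset containing `H`. -/
noncomputable def hopsetCertComplexity {V : Type*} (G : SimpleGraph V)
    (H : Finset (Sym2 V × ℝ)) : ℕ :=
  sInf {k | ∃ K : Finset (Sym2 V × ℝ),
    IsHopset G K ∧ IsCertifiedHopset G K ∧ H ⊆ K ∧ K.card = k}

/-- The hop distance: the least number of edges of a walk from `u` to `v` in `G ∪ H` whose weight is
the distance from `u` to `v` in `G` (`0` if `v` is not reachable from `u`). -/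
noncomputable def hopDist {V : Type*} (G : SimpleGraph V) (H : Finset (Sym2 V × ℝ)) (u v : V) : ℕ :=
  sInf {k | HopWalk G H k (G.dist u v) u v}

/-- The sum of the hop distances over all pairs of vertices. -/
noncomputable def hopPotential {V : Type*} [Fintype V] (G : SimpleGraph V)
    (H : Finset (Sym2 V × ℝ)) : ℕ :=
  ∑ u : V, ∑ v : V, hopDist G H u v

/-- The edges between distinct, non-adjacent, connected vertices of `G`, weighted by the distance in
`G`, that are not yet in `H`. -/
def newHopEdges {V : Type*} (G : SimpleGraph V) (H : Finset (Sym2 V × ℝ)) : Set (Sym2 V × ℝ) :=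
  {e | e ∉ H ∧ ∃ u v, u ≠ v ∧ ¬ G.Adj u v ∧ G.Reachable u v ∧ e = (s(u, v), (G.dist u v : ℝ))}

/-- `H` is a result of `k` rounds of the greedy hopset construction on `G`. -/
noncomputable def GreedyHopset {V : Type*} [Fintype V] [DecidableEq V] (G : SimpleGraph V) (k : ℕ)
    (H : Finset (Sym2 V × ℝ)) : Prop :=
  GreedyRun (newHopEdges G) (hopPotential G) ∅ k H

end Hopsets

end CertifiedShortcuts

namespace CertifiedShortcuts

/-! ### The greedy process -/

section Greedy

variable {α : Type*} [DecidableEq α] {cand : Finset α → Set α} {pot : Finset α → ℕ}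

/-! Why certification is expensive. Suppose a graph carries a family of lines, long paths with `N`
levels such that everything between two vertices of a line belongs to that line, and an edge
spanning at least three levels belongs to at most one line. Let a certified set `K` contain the
edges of a walk with few edges along a line. Splitting each edge at its certifying vertex, and the
parts again, gives binary trees whose leaves are short, so `K` has about `N / 3` long edges on this
line (`card_pieces_tree`). These edges are distinct for distinct lines, so `K` has at least about
(number of lines) · `N` / 3 elements (`LineSystem.card_mul_le`, `HopSystem.card_mul_le`).

Why greedy bridges all lines. Before the source of every line there are `W` leaves, and after its
target `Y` further vertices. If the initial potential is below `k * θ`, then at some stage no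
candidate gains `θ` (`GreedyRun.exists_stage`). With `θ = W * Y * a` the edge from source to target
is not worth adding, so some leaf and some end vertex of the line are already at distance at most `a
+ 3`. Choosing `a` as a small multiple of `N` makes the first argument apply to all lines.

Why dense families of lines exist. A line starts at a lattice point of a cube of side `s` in
dimension three and moves with constant velocity `D`, while its height grows at the rate of the sum
of the `D i ^ 2`. For each `D` there is an affine function, `lamAt D`, that is constant on lines of
direction `D` and never decreases along any edge, like the tangent plane of a paraboloid. This gives
the closure property. The levels are about `B ^ 2` times with denominators of order `B`, so that
many lines share the vertices of a level. The three coordinates move in turn, so that many lines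
share an edge as well: the lines have far more levels in total than the graph has edges.

Why the potential is small. In the directed graph, slices at a few times give routes of bounded
length from a source to everything that is not too close to its cone. Only few pairs remain distant,
and the potential is quadratic in `n` (`Par.sum_stepDist_le`, `Par.Scaled.potBound_le`).

For chain covers the end vertices of a target form a path. A cover by few chains has to contain half
of each such path, no chain meets two of them, and so most targets have a chain with many vertices
behind them. An edge to the first reachable vertex of that chain takes the place of the edge to the
target.

For hopsets the heights are reduced modulo `Q`, and the steps are subdivided so that `-lamAt D / Q`,
corrected by a delay, becomes a `1`-Lipschitz potential that grows by one per edge exactly along the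
lines of direction `D`. A root joined to all sources by paths keeps the diameter small.

In all three cases a disjoint complete graph on about `n ^ ((1 + ε) / 2)` vertices guarantees the
required number of edges. -/

theorem GreedyStep.subset {H K : Finset α} (h : GreedyStep cand pot H K) : H ⊆ K := by
  rcases h with ⟨e, _, rfl, _⟩ | ⟨_, rfl⟩
  · exact Finset.subset_insert _ _
  · exact Finset.Subset.refl _

theorem GreedyRun.start_subset {H₀ H : Finset α} {k : ℕ} (h : GreedyRun cand pot H₀ k H) :
    H₀ ⊆ H := by
  induction h with
  | zero => exact Finset.Subset.refl _
  | succ _ hs ih => exact ih.trans hs.subset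

theorem GreedyRun.mem_cand {H₀ H : Finset α} {k : ℕ} (h : GreedyRun cand pot H₀ k H) {e : α}
    (he : e ∈ H) : e ∈ H₀ ∨ ∃ K, e ∈ cand K := by
  induction h with
  | zero => exact Or.inl he
  | @succ k H K _ hs ih =>
    rcases hs with ⟨e', he', rfl, _⟩ | ⟨_, rfl⟩
    · rcases Finset.mem_insert.1 he with rfl | he
      · exact Or.inr ⟨_, he'⟩
      · exact ih he
    · exact ih he

/-- If the initial potential is less than `k * θ`, then at some stage of `k` greedy rounds no
candidate reduces the potential by `θ` or more. -/
theorem GreedyRun.exists_stage {H₀ H : Finset α} {k θ : ℕ} (h : GreedyRun cand pot H₀ k H)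
    (hθ : pot H₀ < k * θ) :
    ∃ H', H₀ ⊆ H' ∧ H' ⊆ H ∧ ∀ f ∈ cand H', pot H' < pot (insert f H') + θ := by
  -- If no such stage occurs, each of the `k` rounds lowers the potential by at least `θ`, which
  -- `hθ` excludes.
  suffices hs : (∃ H', H₀ ⊆ H' ∧ H' ⊆ H ∧ ∀ f ∈ cand H', pot H' < pot (insert f H') + θ) ∨
      pot H + k * θ ≤ pot H₀ by
    rcases hs with hs | hs
    · exact hs
    · omega
  clear hθ
  induction h with
  | zero => right; simp
  | @succ k H K hr hs ih =>
    rcases ih with ⟨H', h1, h2, h3⟩ | ih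
    · exact Or.inl ⟨H', h1, h2.trans hs.subset, h3⟩
    · by_cases hc : ∀ f ∈ cand H, pot H < pot (insert f H) + θ
      · exact Or.inl ⟨H, hr.start_subset, hs.subset, hc⟩
      · push Not at hc
        obtain ⟨f, hf, hfθ⟩ := hc
        rcases hs with ⟨e, he, rfl, hmin⟩ | ⟨hem, _⟩
        · right
          have := hmin f hf
          rw [add_mul, one_mul]
          omega
        · rw [hem] at hf
          exact absurd hf (by simp)

end Greedy

/-! ### Counting the pieces of certified edges -/

section Pieces

open Classical in
/-- The edges of `K` inside `M` whose `φ`-length is at least `g` and whose `φ`-range is contained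
in the interval from `lo` to `hi`. -/
noncomputable def pieces {V : Type*} (K : Finset (V × V)) (M : V → Prop) (φ : V → ℕ)
    (g lo hi : ℕ) : Finset (V × V) :=
  K.filter fun e => M e.1 ∧ M e.2 ∧ lo ≤ φ e.1 ∧ φ e.1 + g ≤ φ e.2 ∧ φ e.2 ≤ hi

variable {V : Type*} {K : Finset (V × V)} {M : V → Prop} {φ : V → ℕ} {g : ℕ}

theorem mem_pieces {lo hi : ℕ} {e : V × V} : e ∈ pieces K M φ g lo hi ↔
    e ∈ K ∧ M e.1 ∧ M e.2 ∧ lo ≤ φ e.1 ∧ φ e.1 + g ≤ φ e.2 ∧ φ e.2 ≤ hi := by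
  simp [pieces]

/-- An edge of positive length cannot lie in both of two adjacent intervals. This makes the counts
additive along a walk. -/
theorem card_pieces_add {lo mid hi : ℕ} (hg : 0 < g) (h1 : lo ≤ mid) (h2 : mid ≤ hi) :
    (pieces K M φ g lo mid).card + (pieces K M φ g mid hi).card ≤
      (pieces K M φ g lo hi).card := by
  classical
  rw [← Finset.card_union_of_disjoint]
  · apply Finset.card_le_card
    intro e he
    rw [Finset.mem_union, mem_pieces, mem_pieces] at he
    rw [mem_pieces]
    rcases he with ⟨a, b, c, d, e, f⟩ | ⟨a, b, c, d, e, f⟩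
    · exact ⟨a, b, c, d, e, by omega⟩
    · exact ⟨a, b, c, by omega, e, by omega⟩
  · rw [Finset.disjoint_left]
    intro e h h'
    rw [mem_pieces] at h h'
    omega

/-- Repeated splitting gives a binary tree that stops at parts of length below `g`. A tree with `c`
inner nodes has `c + 1` leaves, so the total length is less than `(c + 1) * g`, and the inner nodes
are distinct edges of `K`. The rank `rk` only makes the recursion terminate, since `φ` need not
increase strictly. -/
theorem card_pieces_tree (hg : 0 < g) (rk : V → ℕ)
    (hsplit : ∀ x y, (x, y) ∈ K → M x → M y → φ x + g ≤ φ y → ∃ w, M w ∧ φ x ≤ φ w ∧ φ w ≤ φ y ∧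
      rk x < rk w ∧ rk w < rk y ∧ ((x, w) ∈ K ∨ φ w < φ x + g) ∧ ((w, y) ∈ K ∨ φ y < φ w + g)) :
    ∀ x y, M x → M y → ((x, y) ∈ K ∨ φ y < φ x + g) →
      φ y + 1 ≤ φ x + g + g * (pieces K M φ g (φ x) (φ y)).card := by
  intro x y
  induction hn : rk y - rk x using Nat.strong_induction_on generalizing x y with
  | _ n ih =>
    intro hx hy hxy
    by_cases hlt : φ y < φ x + g
    · omega
    push Not at hlt
    replace hxy := hxy.resolve_right (by omega)
    obtain ⟨w, hw, h1, h2, r1, r2, hxw, hwy⟩ := hsplit x y hxy hx hy hlt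
    have e1 := ih (rk w - rk x) (by omega) x w rfl hx hw hxw
    have e2 := ih (rk y - rk w) (by omega) w y rfl hw hy hwy
    -- If `w` has the height of an endpoint, one half spans the whole interval and its bound
    -- suffices. Only for a height strictly in between are the edge itself and the pieces of both
    -- halves disjoint.
    rcases h1.eq_or_lt with h1' | h1'
    · rw [h1']; exact e2
    rcases h2.eq_or_lt with h2' | h2'
    · rw [← h2']; exact e1
    have hcard : (pieces K M φ g (φ x) (φ w)).card + (pieces K M φ g (φ w) (φ y)).card + 1 ≤
        (pieces K M φ g (φ x) (φ y)).card := by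
      classical
      rw [← Finset.card_union_of_disjoint, ← Finset.card_insert_of_notMem (a := (x, y))]
      · apply Finset.card_le_card
        intro e he
        rw [Finset.mem_insert, Finset.mem_union, mem_pieces, mem_pieces] at he
        rw [mem_pieces]
        rcases he with rfl | ⟨a, b, c, d, e, f⟩ | ⟨a, b, c, d, e, f⟩
        · exact ⟨hxy, hx, hy, le_rfl, hlt, le_rfl⟩
        · exact ⟨a, b, c, d, e, by omega⟩
        · exact ⟨a, b, c, by omega, e, by omega⟩
      · rw [Finset.mem_union, mem_pieces, mem_pieces]
        simp only
        omega
      · rw [Finset.disjoint_left]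
        intro e h h'
        rw [mem_pieces] at h h'
        omega
    have := Nat.mul_le_mul_left g hcard
    rw [mul_add, mul_add, mul_one] at this
    omega

/-- Pieces that determine their line are counted at most once. -/
theorem sum_card_pieces_le {Λ : Type*} (s : Finset Λ) (mem : Λ → V → Prop) (lo hi : ℕ)
    (hid : ∀ ℓ ℓ' x y, mem ℓ x → mem ℓ y → mem ℓ' x → mem ℓ' y → φ x + g ≤ φ y → ℓ = ℓ') :
    ∑ ℓ ∈ s, (pieces K (mem ℓ) φ g lo hi).card ≤ K.card := by
  classical
  rw [← Finset.card_biUnion]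
  · apply Finset.card_le_card
    intro e he
    rw [Finset.mem_biUnion] at he
    obtain ⟨ℓ, _, h⟩ := he
    exact (mem_pieces.1 h).1
  · intro ℓ _ ℓ' _ hne
    refine Finset.disjoint_left.2 ?_
    intro e h h'
    rw [mem_pieces] at h h'
    exact hne (hid ℓ ℓ' e.1 e.2 h.2.1 h.2.2.1 h'.2.1 h'.2.2.1 h.2.2.2.2.1)

end Pieces

/-! ### Walks and shortcuts -/

section Walks

variable {V : Type*}

theorem WalkOf.mono {r r' : V → V → Prop} (h : ∀ u v, r u v → r' u v) {k : ℕ} {u v : V}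
    (w : WalkOf r k u v) : WalkOf r' k u v := by
  induction w with
  | nil v => exact .nil v
  | cons e _ ih => exact .cons (h _ _ e) ih

theorem WalkOf.append {r : V → V → Prop} {k l : ℕ} {u v w : V} (h : WalkOf r k u v)
    (h' : WalkOf r l v w) : WalkOf r (k + l) u w := by
  induction h with
  | nil v => simpa using h'
  | @cons k a b c e _ ih =>
    have := WalkOf.cons e (ih h')
    rwa [add_right_comm] at this

theorem WalkOf.single {r : V → V → Prop} {u v : V} (h : r u v) : WalkOf r 1 u v :=
  .cons h (.nil v)

theorem WalkOf.reflTransGen {r : V → V → Prop} {k : ℕ} {u v : V} (h : WalkOf r k u v) :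
    Relation.ReflTransGen r u v := by
  induction h with
  | nil v => exact .refl
  | cons e _ ih => exact ih.head e

theorem WalkOf.rank_le {r : V → V → Prop} (rk : V → ℕ) (hrk : ∀ u v, r u v → rk u < rk v)
    {k : ℕ} {u v : V} (h : WalkOf r k u v) : rk u + k ≤ rk v := by
  induction h with
  | nil v => simp
  | cons e _ ih => have := hrk _ _ e; omega

theorem exists_walkOf {r : V → V → Prop} {u v : V} (h : Relation.ReflTransGen r u v) :
    ∃ k, WalkOf r k u v := by
  induction h using Relation.ReflTransGen.head_induction_on with
  | refl => exact ⟨0, .nil _⟩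
  | head e _ ih => obtain ⟨k, hk⟩ := ih; exact ⟨k + 1, .cons e hk⟩

theorem stepDist_le {r : V → V → Prop} {k : ℕ} {u v : V} (h : WalkOf r k u v) :
    stepDist r u v ≤ k := Nat.sInf_le h

theorem walkOf_stepDist {r : V → V → Prop} {u v : V} (h : Relation.ReflTransGen r u v) :
    WalkOf r (stepDist r u v) u v :=
  Nat.sInf_mem (s := {k | WalkOf r k u v}) (exists_walkOf h)

theorem stepDist_eq_zero {r : V → V → Prop} {u v : V} (h : ¬ Relation.ReflTransGen r u v) :
    stepDist r u v = 0 := by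
  have : {k | WalkOf r k u v} = ∅ := by
    ext k
    simp only [Set.mem_ofPred_eq, Set.mem_empty_iff_false, iff_false]
    exact fun hk => h hk.reflTransGen
  rw [stepDist, this, Nat.sInf_empty]

theorem stepDist_triangle {r : V → V → Prop} {u v w : V} (h : Relation.ReflTransGen r u v)
    (h' : Relation.ReflTransGen r v w) : stepDist r u w ≤ stepDist r u v + stepDist r v w :=
  stepDist_le ((walkOf_stepDist h).append (walkOf_stepDist h'))

theorem isDAG_of_rank {G : Digraph V} (rk : V → ℕ) (hrk : ∀ u v, G.Adj u v → rk u < rk v) :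
    IsDAG G := by
  intro v hv
  have : ∀ u v, Relation.TransGen G.Adj u v → rk u < rk v := by
    intro u v h
    induction h with
    | single h => exact hrk _ _ h
    | tail _ h ih => exact ih.trans (hrk _ _ h)
  exact lt_irrefl _ (this v v hv)

variable {G : Digraph V} {H K : Finset (V × V)}

theorem AugAdj.transGen (hH : IsShortcut G H) {u v : V} (h : AugAdj G H u v) :
    Relation.TransGen G.Adj u v :=
  h.elim .single fun h => hH _ h

theorem AugAdj.mono (hHK : H ⊆ K) {u v : V} (h : AugAdj G H u v) : AugAdj G K u v :=
  h.imp id fun h => hHK h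

theorem reflTransGen_augAdj (hH : IsShortcut G H) {u v : V} :
    Relation.ReflTransGen (AugAdj G H) u v ↔ Relation.ReflTransGen G.Adj u v := by
  constructor
  · intro h
    induction h with
    | refl => exact .refl
    | tail _ h ih => exact ih.trans (h.transGen hH).to_reflTransGen
  · exact Relation.ReflTransGen.mono (fun _ _ h => Or.inl h) u v

theorem stepDist_anti (hH : IsShortcut G K) (hHK : H ⊆ K) (u v : V) :
    stepDist (AugAdj G K) u v ≤ stepDist (AugAdj G H) u v := by
  by_cases h : Relation.ReflTransGen G.Adj u v
  · have h' : Relation.ReflTransGen (AugAdj G H) u v :=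
      (reflTransGen_augAdj fun e he => hH e (hHK he)).2 h
    exact stepDist_le ((walkOf_stepDist h').mono fun _ _ => AugAdj.mono hHK)
  -- Unreachable pairs have the default distance `0`, also after enlarging the shortcut.
  · rw [stepDist_eq_zero]
    · exact Nat.zero_le _
    · rwa [reflTransGen_augAdj hH]

theorem potential_anti [Fintype V] (hH : IsShortcut G K) (hHK : H ⊆ K) :
    potential G K ≤ potential G H :=
  Finset.sum_le_sum fun u _ => Finset.sum_le_sum fun v _ => stepDist_anti hH hHK u v

/-- If a larger shortcut brings all pairs of `S × T` from distance at least `a + b` to distance at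
most `b`, the potential decreases by at least `|S| |T| a`. -/
theorem potential_add_le [Fintype V] (hH : IsShortcut G K) (hHK : H ⊆ K) (S T : Finset V)
    (a b : ℕ) (h : ∀ u ∈ S, ∀ v ∈ T, stepDist (AugAdj G K) u v ≤ b ∧
      a + b ≤ stepDist (AugAdj G H) u v) :
    potential G K + S.card * T.card * a ≤ potential G H := by
  classical
  have key : ∀ u v, stepDist (AugAdj G K) u v + (if u ∈ S ∧ v ∈ T then a else 0) ≤
      stepDist (AugAdj G H) u v := by
    intro u v
    split_ifs with huv
    · have := h u huv.1 v huv.2; omega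
    · exact stepDist_anti hH hHK u v
  have e : S.card * T.card * a = ∑ u : V, ∑ v : V, if u ∈ S ∧ v ∈ T then a else 0 := by
    have : ∀ u v : V, (if u ∈ S ∧ v ∈ T then a else 0) =
        if u ∈ S then (if v ∈ T then a else 0) else 0 := by
      intro u v; split_ifs <;> simp_all
    simp [this, Finset.sum_ite_mem, mul_assoc]
  rw [e, potential, potential, ← Finset.sum_add_distrib]
  refine Finset.sum_le_sum fun u _ => ?_
  rw [← Finset.sum_add_distrib]
  exact Finset.sum_le_sum fun v _ => key u v

/-- Every set of transitive nonedges is contained in a certified shortcut of least size. -/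
theorem exists_certComplexity [Fintype V]
    (hH : ∀ e ∈ H, Relation.TransGen G.Adj e.1 e.2 ∧ ¬ G.Adj e.1 e.2) :
    ∃ K : Finset (V × V), IsShortcut G K ∧ IsCertified G K ∧ H ⊆ K ∧
      K.card = certComplexity G H := by
  classical
  -- All nonadjacent pairs of the transitive closure: the first vertex of a path certifies its pair.
  -- A witness is needed because the infimum of the empty set would be `0`.
  let K : Finset (V × V) :=
    Finset.univ.filter fun e => Relation.TransGen G.Adj e.1 e.2 ∧ ¬ G.Adj e.1 e.2
  have hne : {k | ∃ K : Finset (V × V), IsShortcut G K ∧ IsCertified G K ∧ H ⊆ K ∧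
      K.card = k}.Nonempty := by
    refine ⟨K.card, K, fun e he => (Finset.mem_filter.1 he).2.1, ?_, fun e he => ?_, rfl⟩
    · intro u v huv
      obtain ⟨h1, h2⟩ := (Finset.mem_filter.1 huv).2
      obtain ⟨w, hw, hwv⟩ := Relation.TransGen.head'_iff.1 h1
      refine ⟨w, Or.inl hw, ?_⟩
      rcases Relation.reflTransGen_iff_eq_or_transGen.1 hwv with rfl | hwv
      · exact absurd hw h2
      · by_cases ha : G.Adj w v
        · exact Or.inl ha
        · exact Or.inr (Finset.mem_filter.2 ⟨Finset.mem_univ _, hwv, ha⟩)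
    · exact Finset.mem_filter.2 ⟨Finset.mem_univ _, hH e he⟩
  exact Nat.sInf_mem hne

end Walks

end CertifiedShortcuts

namespace CertifiedShortcuts

/-! ### Systems of lines in an acyclic graph -/

/-- A system of lines in a directed graph: every line `ℓ` is a set of vertices that contains
everything between two of its members, with a height function `φ` that increases by at most one
along each edge of `G` inside the line, and such that two members of height difference at least
three determine the line. Each line comes with a source that is preceded by many leaves and a
target that is followed by many tail vertices. -/
structure LineSystem {V : Type*} (G : Digraph V) (Λ : Type*) (N W Y : ℕ) where
  mem : Λ → V → Prop
  φ : V → ℕ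
  rk : V → ℕ
  rk_lt : ∀ u v, G.Adj u v → rk u < rk v
  φ_adj : ∀ ℓ x y, mem ℓ x → mem ℓ y → G.Adj x y → φ y ≤ φ x + 1
  φ_mono : ∀ ℓ x y, mem ℓ x → mem ℓ y → Relation.TransGen G.Adj x y → φ x ≤ φ y
  closed : ∀ ℓ x y w, mem ℓ x → mem ℓ y → Relation.TransGen G.Adj x w →
    Relation.TransGen G.Adj w y → mem ℓ w
  ident : ∀ ℓ ℓ' x y, mem ℓ x → mem ℓ y → mem ℓ' x → mem ℓ' y → φ x + 3 ≤ φ y → ℓ = ℓ'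
  src : Λ → V
  tgt : Λ → V
  src_tgt : ∀ ℓ, Relation.TransGen G.Adj (src ℓ) (tgt ℓ)
  leaves : Λ → Finset V
  card_leaves : ∀ ℓ, W ≤ (leaves ℓ).card
  mem_leaves : ∀ ℓ, ∀ v ∈ leaves ℓ, mem ℓ v ∧ φ v = 0 ∧ G.Adj v (src ℓ)
  tails : V → Finset V
  card_tails : ∀ ℓ, Y ≤ (tails (tgt ℓ)).card
  mem_tails : ∀ ℓ, ∀ v ∈ tails (tgt ℓ), mem ℓ v ∧ φ v = N ∧ G.Adj (tgt ℓ) v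

namespace LineSystem

variable {V : Type*} {G : Digraph V} {Λ : Type*} {N W Y : ℕ} (D : LineSystem G Λ N W Y)
include D

theorem rk_lt_of_transGen {u v : V} (h : Relation.TransGen G.Adj u v) : D.rk u < D.rk v := by
  induction h with
  | single h => exact D.rk_lt _ _ h
  | tail _ h ih => exact ih.trans (D.rk_lt _ _ h)

/-- Every edge of the walk lies in `G ∪ K`, and its certification tree stays on the line by
`closed`. With `g = 3`, `card_pieces_tree` bounds the climb of one edge by `2` plus three times its
pieces; the trees occupy successive intervals, so no piece counts twice. -/
theorem le_card_pieces_of_walk {K H : Finset (V × V)} (hK : IsShortcut G K) (hc : IsCertified G K)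
    (hHK : H ⊆ K) (ℓ : Λ) {k : ℕ} {x y : V} (h : WalkOf (AugAdj G H) k x y) :
    D.mem ℓ x → D.mem ℓ y →
    D.φ y ≤ D.φ x + 2 * k + 3 * (pieces K (D.mem ℓ) D.φ 3 (D.φ x) (D.φ y)).card := by
  have hedge : ∀ x y, D.mem ℓ x → D.mem ℓ y → AugAdj G K x y →
      ((x, y) ∈ K ∨ D.φ y < D.φ x + 3) := fun x y hx hy hxy =>
    hxy.elim (fun h => Or.inr (by have := D.φ_adj ℓ x y hx hy h; omega)) Or.inl
  have tree := card_pieces_tree (K := K) (M := D.mem ℓ) (φ := D.φ) (g := 3) (by norm_num) D.rk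
    (by
      intro x y hxy hx hy _
      obtain ⟨w, h1, h2⟩ := hc x y hxy
      have t1 := h1.transGen hK
      have t2 := h2.transGen hK
      have hw := D.closed ℓ x y w hx hy t1 t2
      exact ⟨w, hw, D.φ_mono ℓ _ _ hx hw t1, D.φ_mono ℓ _ _ hw hy t2, D.rk_lt_of_transGen t1,
        D.rk_lt_of_transGen t2, hedge _ _ hx hw h1, hedge _ _ hw hy h2⟩)
  induction h with
  | nil v => intros; omega
  | @cons k u v w e h ih =>
    intro hu hw
    have hH : IsShortcut G H := fun e he => hK e (hHK he)
    have t1 := e.transGen hH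
    rcases Relation.reflTransGen_iff_eq_or_transGen.1 ((reflTransGen_augAdj hH).1 h.reflTransGen)
      with rfl | t2
    · have := tree u _ hu hw (hedge _ _ hu hw (e.mono hHK))
      omega
    · have hv := D.closed ℓ u w v hu hw t1 t2
      have e1 := tree u v hu hv (hedge _ _ hu hv (e.mono hHK))
      have e2 := ih hv hw
      have e3 := card_pieces_add (K := K) (M := D.mem ℓ) (φ := D.φ) (g := 3) (by norm_num)
        (D.φ_mono ℓ _ _ hu hv t1) (D.φ_mono ℓ _ _ hv hw t2)
      omega

/-- A piece spans at least three levels and so determines its line. Hence the pieces of all lines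
together are at most as many as the elements of `K`. -/
theorem card_mul_le {K H : Finset (V × V)} (hK : IsShortcut G K) (hc : IsCertified G K)
    (hHK : H ⊆ K) (s : Finset Λ) (m : ℕ)
    (hs : ∀ ℓ ∈ s, ∃ x ∈ D.leaves ℓ, ∃ y ∈ D.tails (D.tgt ℓ), stepDist (AugAdj G H) x y ≤ m) :
    s.card * N ≤ 3 * K.card + s.card * (2 * m) := by
  have h1 : ∀ ℓ ∈ s, N ≤ 3 * (pieces K (D.mem ℓ) D.φ 3 0 N).card + 2 * m := by
    intro ℓ hℓ
    obtain ⟨x, hx, y, hy, hxy⟩ := hs ℓ hℓ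
    obtain ⟨mx, px, ax⟩ := D.mem_leaves ℓ x hx
    obtain ⟨my, py, ay⟩ := D.mem_tails ℓ y hy
    have hr : Relation.TransGen G.Adj x y := ((D.src_tgt ℓ).head ax).tail ay
    have hH : IsShortcut G H := fun e he => hK e (hHK he)
    have hw := walkOf_stepDist ((reflTransGen_augAdj hH).2 hr.to_reflTransGen)
    have := D.le_card_pieces_of_walk hK hc hHK ℓ hw mx my
    rw [px, py] at this
    omega
  have h2 := Finset.sum_le_sum h1
  rw [Finset.sum_const, Finset.sum_add_distrib, ← Finset.mul_sum, Finset.sum_const] at h2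
  have h3 := sum_card_pieces_le (K := K) (φ := D.φ) (g := 3) s D.mem 0 N
    fun ℓ ℓ' x y h1 h2 h3 h4 h => D.ident ℓ ℓ' x y h1 h2 h3 h4 h
  simp only [smul_eq_mul] at h2
  omega

/-- The certification complexity of greedy shortcuts of a graph with a system of lines. -/
theorem le_certComplexity_greedyShortcut [Fintype V] [DecidableEq V] [Fintype Λ] {a k : ℕ}
    {H : Finset (V × V)} (hpot : potential G ∅ < k * (W * Y * a)) (hH : GreedyShortcut G k H) :
    Fintype.card Λ * N ≤ 3 * certComplexity G H + Fintype.card Λ * (2 * (a + 3)) := by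
  obtain ⟨K, hK, hc, hHK, hcard⟩ := exists_certComplexity (G := G) (H := H) (by
    intro e he
    rcases hH.mem_cand he with he | ⟨K, he⟩
    · simp at he
    · exact ⟨he.1, fun h => he.2 (Or.inl h)⟩)
  obtain ⟨H', -, hH', hst⟩ := GreedyRun.exists_stage hH hpot
  have hs' : IsShortcut G H' := fun e he => hK e (hHK (hH' he))
  rw [← hcard, ← Finset.card_univ]
  refine D.card_mul_le hK hc (hH'.trans hHK) _ (a + 3) ?_
  intro ℓ _
  have hthree : ∀ K', AugAdj G K' (D.src ℓ) (D.tgt ℓ) → ∀ x ∈ D.leaves ℓ,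
      ∀ y ∈ D.tails (D.tgt ℓ), stepDist (AugAdj G K') x y ≤ 3 := fun K' h x hx y hy =>
    stepDist_le (.cons (Or.inl (D.mem_leaves ℓ x hx).2.2) (.cons h (.cons
      (Or.inl (D.mem_tails ℓ y hy).2.2) (.nil _))))
  -- If all leaves were farther than `a + 3` from all tail vertices, the edge from source to target
  -- would bring at least `W * Y` pairs to distance `3`, a gain that the chosen stage excludes.
  by_contra! hcon
  have hW := D.card_leaves ℓ
  have hY := D.card_tails ℓ
  -- The strict inequality `hpot` forces all factors to be positive, so leaves and tail vertices
  -- exist.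
  have hpos : 0 < W * Y * a := by
    by_contra! h0
    have : W * Y * a = 0 := by omega
    rw [this] at hpot
    omega
  have hWpos : 0 < W := Nat.pos_of_ne_zero (by rintro rfl; simp at hpos)
  have hYpos : 0 < Y := Nat.pos_of_ne_zero (by rintro rfl; simp at hpos)
  obtain ⟨x, hx⟩ := Finset.card_pos.1 (hWpos.trans_le hW)
  obtain ⟨y, hy⟩ := Finset.card_pos.1 (hYpos.trans_le hY)
  have hnew : (D.src ℓ, D.tgt ℓ) ∈ newEdges G H' := by
    refine ⟨D.src_tgt ℓ, fun h => ?_⟩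
    have h1 := hthree H' h x hx y hy
    have h2 := hcon x hx y hy
    omega
  have hsh : IsShortcut G (insert (D.src ℓ, D.tgt ℓ) H') := by
    intro e he
    rcases Finset.mem_insert.1 he with rfl | he
    · exact D.src_tgt ℓ
    · exact hs' e he
  have hgain := potential_add_le hsh (Finset.subset_insert _ _) (D.leaves ℓ) (D.tails (D.tgt ℓ))
    a 3 fun u hu v hv => ⟨hthree _ (Or.inr (Finset.mem_insert_self _ _)) u hu v hv,
      (hcon u hu v hv).le⟩
  have := hst _ hnew
  have hle : W * Y * a ≤ (D.leaves ℓ).card * (D.tails (D.tgt ℓ)).card * a := by gcongr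
  omega

end LineSystem

/-! ### Chain covers -/

theorem exists_first_of_mem {V : Type*} (p : V → Prop) {C : List V} {x : V} (hx : x ∈ C)
    (hp : p x) : ∃ l₁ v l₂, C = l₁ ++ v :: l₂ ∧ p v ∧ ∀ w ∈ l₁, ¬ p w := by
  induction C with
  | nil => simp at hx
  | cons a C ih =>
    by_cases ha : p a
    · exact ⟨[], a, C, rfl, ha, by simp⟩
    · rcases List.mem_cons.1 hx with rfl | hx
      · exact absurd hp ha
      · obtain ⟨l₁, v, l₂, h1, h2, h3⟩ := ih hx
        refine ⟨a :: l₁, v, l₂, by simp [h1], h2, ?_⟩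
        intro w hw
        rcases List.mem_cons.1 hw with rfl | hw
        · exact ha
        · exact h3 w hw

theorem transGen_of_sublist {V : Type*} {r : V → V → Prop} {C : List V}
    (hC : C.IsChain (Relation.TransGen r)) {u v : V} (h : [u, v].Sublist C) :
    Relation.TransGen r u v := by
  have := (List.isChain_iff_pairwise.1 hC).sublist h
  simpa using this

/-- If a chain meets the tails in at most one of the sets `tails t`, then all but few `t` have a
chain that contains many elements of `tails t`. -/
theorem card_filter_no_large_chain_le {V : Type*} [DecidableEq V] (𝒞 : Finset (List V))
    (T : Finset V) (tails : V → Finset V) {M Y : ℕ}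
    (hone : ∀ C ∈ 𝒞, ∀ t ∈ T, ∀ t' ∈ T, ∀ v ∈ tails t, ∀ v' ∈ tails t', v ∈ C → v' ∈ C → t = t')
    (hY : ∀ t ∈ T, Y ≤ 2 * ((tails t).filter fun v => ∃ C ∈ 𝒞, v ∈ C).card) :
    (T.filter fun t => ∀ C ∈ 𝒞, ((tails t).filter fun v => v ∈ C).card < M).card * Y ≤
      2 * M * 𝒞.card := by
  set bad := T.filter fun t => ∀ C ∈ 𝒞, ((tails t).filter fun v => v ∈ C).card < M with hbad
  -- The chains meeting the tail of `t`; by `hone` these sets are disjoint for different `t`.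
  let inc : V → Finset (List V) := fun t => 𝒞.filter fun C => ∃ v ∈ tails t, v ∈ C
  -- A bad tail has at least `Y / 2` covered vertices, with fewer than `M` of them on any one chain.
  have h1 : ∀ t ∈ bad, Y ≤ 2 * M * (inc t).card := by
    intro t ht
    rw [hbad, Finset.mem_filter] at ht
    refine (hY t ht.1).trans ?_
    rw [mul_assoc]
    refine Nat.mul_le_mul_left 2 ?_
    have hsub : ((tails t).filter fun v => ∃ C ∈ 𝒞, v ∈ C) ⊆
        (inc t).biUnion fun C => (tails t).filter fun v => v ∈ C := by
      intro v hv
      rw [Finset.mem_filter] at hv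
      obtain ⟨hv, C, hC, hvC⟩ := hv
      rw [Finset.mem_biUnion]
      exact ⟨C, Finset.mem_filter.2 ⟨hC, v, hv, hvC⟩, Finset.mem_filter.2 ⟨hv, hvC⟩⟩
    refine (Finset.card_le_card hsub).trans ((Finset.card_biUnion_le_card_mul _ _ M ?_).trans ?_)
    · intro C hC
      exact (ht.2 C (Finset.mem_filter.1 hC).1).le
    · rw [mul_comm]
  have h2 : ∑ t ∈ bad, (inc t).card ≤ 𝒞.card := by
    rw [← Finset.card_biUnion]
    · apply Finset.card_le_card
      intro C hC
      obtain ⟨t, _, h⟩ := Finset.mem_biUnion.1 hC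
      exact (Finset.mem_filter.1 h).1
    · intro t ht t' ht' hne
      refine Finset.disjoint_left.2 fun C hC hC' => hne ?_
      obtain ⟨hC, v, hv, hvC⟩ := Finset.mem_filter.1 hC
      obtain ⟨-, v', hv', hvC'⟩ := Finset.mem_filter.1 hC'
      exact hone C hC t (Finset.mem_filter.1 ht).1 t' (Finset.mem_filter.1 ht').1 v hv v' hv' hvC
        hvC'
  have h3 := Finset.sum_le_sum h1
  rw [Finset.sum_const, ← Finset.mul_sum, smul_eq_mul] at h3
  exact h3.trans (Nat.mul_le_mul_left _ h2)

namespace LineSystem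

variable {V : Type*} {G : Digraph V} {Λ : Type*} {N W Y : ℕ} (D : LineSystem G Λ N W Y)
include D

/-- The certification complexity of greedy chain-based shortcuts of a graph with a system of lines
in which the tails are paths and no tail reaches another tail. -/
theorem le_certComplexity_greedyChainShortcut [Fintype V] [DecidableEq V] [Fintype Λ]
    {a k R M P : ℕ} {𝒞 : Finset (List V)} {H : Finset (V × V)} {L B : ℝ} (T : Finset V)
    (hT : ∀ ℓ, D.tgt ℓ ∈ T)
    (hdisj : ∀ t ∈ T, ∀ t' ∈ T, ∀ v ∈ D.tails t, ∀ v' ∈ D.tails t',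
      (v = v' ∨ Relation.TransGen G.Adj v v') → t = t')
    (hpath : ∀ t ∈ T, ∃ p : List V, p.IsChain G.Adj ∧ ∀ v ∈ D.tails t, v ∈ p)
    (hYT : ∀ t ∈ T, Y ≤ (D.tails t).card)
    (hP : ∀ t ∈ T, Nat.card {ℓ // D.tgt ℓ = t} ≤ P)
    (hPT : P * T.card ≤ 5 * Fintype.card Λ)
    (h𝒞 : IsChainCover G 𝒞 L B) (hB : B * Fintype.card V / L ≤ Y / 2)
    (hM : 20 * M * L ≤ Y * T.card) (hYpos : 0 < Y)
    (hpot : potential G ∅ < k * (W * M * a)) (hH : GreedyChainShortcut G 𝒞 R k H) :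
    Fintype.card Λ * N ≤ 6 * certComplexity G H + Fintype.card Λ * (2 * (a + R + 2) + N / 2) := by
  classical
  obtain ⟨H₁, hH₁, hrun⟩ := hH
  have hch : ∀ C ∈ 𝒞, ∀ u v, [u, v].Sublist C → Relation.TransGen G.Adj u v := fun C hC u v h =>
    transGen_of_sublist (h𝒞.chain C hC) h
  have hs1 : IsShortcut G H₁ := by
    intro e he
    obtain ⟨C, hC, h⟩ := (hH₁.1 e he).2
    exact hch C hC _ _ h
  obtain ⟨K, hK, hc, hHK, hcard⟩ := exists_certComplexity (G := G) (H := H) (by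
    intro e he
    rcases hrun.mem_cand he with he | ⟨K, he⟩
    · exact ⟨hs1 e he, (hH₁.1 e he).1⟩
    · exact ⟨he.1.1, fun h => he.1.2 (Or.inl h)⟩)
  obtain ⟨H', hH1', hH', hst⟩ := GreedyRun.exists_stage hrun
    ((potential_anti hs1 (Finset.empty_subset _)).trans_lt hpot)
  have hs' : IsShortcut G H' := fun e he => hK e (hHK (hH' he))
  rw [← hcard]
  -- the targets whose tail is met by no chain in many vertices
  let bad := T.filter fun t => ∀ C ∈ 𝒞, ((D.tails t).filter fun v => v ∈ C).card < M
  have hbad : bad.card * Y ≤ 2 * M * 𝒞.card := by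
    refine card_filter_no_large_chain_le 𝒞 T D.tails ?_ ?_
    -- Two vertices of a chain are equal or one reaches the other, so by `hdisj` they cannot lie in
    -- different tails.
    · intro C hC t ht t' ht' v hv v' hv' hvC hvC'
      by_cases hvv : v = v'
      · exact hdisj t ht t' ht' v hv v' hv' (Or.inl hvv)
      have hpw := List.isChain_iff_pairwise.1 (h𝒞.chain C hC)
      obtain ⟨l₁, l₂, rfl⟩ := List.append_of_mem hvC
      rw [List.pairwise_append, List.pairwise_cons] at hpw
      rcases List.mem_append.1 hvC' with h | h
      · exact (hdisj t' ht' t ht v' hv' v hv (Or.inr (hpw.2.2 v' h v (by simp)))).symm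
      · rcases List.mem_cons.1 h with h | h
        · exact absurd h.symm hvv
        · exact hdisj t ht t' ht' v hv v' hv' (Or.inr (hpw.2.1.1 v' h))
    -- The tail lies on a path of `G`, so by the covering condition and `hB` at most half of `Y` of
    -- its vertices lie on no chain.
    · intro t ht
      obtain ⟨p, hp, hmem⟩ := hpath t ht
      have h1 := h𝒞.covers p hp ((D.tails t).filter fun v => ¬ ∃ C ∈ 𝒞, v ∈ C) (by
        intro v hv
        rw [Finset.mem_filter] at hv
        refine ⟨hmem v hv.1, fun C hC hvC => hv.2 ⟨C, hC, hvC⟩⟩)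
      have h2 := Finset.card_filter_add_card_filter_not (s := D.tails t)
        (fun v => ∃ C ∈ 𝒞, v ∈ C)
      have h3 := hYT t ht
      have h4 : ((2 * ((D.tails t).filter fun v => ¬ ∃ C ∈ 𝒞, v ∈ C).card : ℕ) : ℝ) ≤ (Y : ℕ) := by
        push_cast
        linarith
      have h5 := Nat.cast_le.1 h4
      omega
  -- Here `bad.card * Y ≤ 2 * M * L`, and `hM` says that ten times the right side is at most `Y *
  -- T.card`.
  have hbad10 : 10 * bad.card ≤ T.card := by
    have h1 : ((bad.card * Y : ℕ) : ℝ) ≤ ((2 * M * 𝒞.card : ℕ) : ℝ) := by exact_mod_cast hbad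
    push_cast at h1
    have h2 : (2 * M * 𝒞.card : ℝ) ≤ 2 * M * L := by
      have := h𝒞.card_le
      gcongr
    have h3 : ((10 * bad.card : ℕ) : ℝ) * Y ≤ (T.card : ℝ) * Y := by push_cast; nlinarith
    have hY0 : (0 : ℝ) < Y := by exact_mod_cast hYpos
    exact_mod_cast le_of_mul_le_mul_right h3 hY0
  let good : Finset Λ := Finset.univ.filter fun ℓ => D.tgt ℓ ∉ bad
  -- At most `P` lines end at a target, so the bad targets account for at most `P * T.card / 10`,
  -- hence at most half, of the lines.
  have hgood : Fintype.card Λ ≤ 2 * good.card := by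
    have h1 := Finset.card_filter_add_card_filter_not (s := (Finset.univ : Finset Λ))
      (fun ℓ => D.tgt ℓ ∈ bad)
    have h2 : (Finset.univ.filter fun ℓ => D.tgt ℓ ∈ bad).card ≤ P * bad.card := by
      refine Finset.card_le_mul_card_image_of_maps_to (f := D.tgt) (fun ℓ hℓ => ?_) P ?_
      · exact (Finset.mem_filter.1 hℓ).2
      · intro t ht
        refine le_trans ?_ (hP t (Finset.mem_filter.1 ht).1)
        rw [Nat.card_eq_fintype_card, Fintype.card_subtype]
        apply Finset.card_le_card
        intro ℓ hℓ
        simp only [Finset.mem_filter, Finset.mem_univ, true_and] at hℓ ⊢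
        exact hℓ.2
    have h3 : P * (10 * bad.card) ≤ P * T.card := Nat.mul_le_mul_left _ hbad10
    rw [Finset.card_univ] at h1
    change _ + good.card = _ at h1
    have h4 : P * (10 * bad.card) = 10 * (P * bad.card) := by ring
    omega
  have main := D.card_mul_le hK hc (hH'.trans hHK) good (a + R + 2) (by
    intro ℓ hℓ
    have hℓ' : D.tgt ℓ ∉ bad := (Finset.mem_filter.1 hℓ).2
    simp only [bad, Finset.mem_filter, not_and, not_forall, not_lt] at hℓ'
    obtain ⟨C, hC, hCM⟩ := hℓ' (hT ℓ)
    set A := (D.tails (D.tgt ℓ)).filter fun v => v ∈ C with hA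
    have hpos : 0 < W * M * a := by
      by_contra! h0
      have : W * M * a = 0 := by omega
      rw [this] at hpot
      omega
    have hWpos : 0 < W := Nat.pos_of_ne_zero (by rintro rfl; simp at hpos)
    have hMpos : 0 < M := Nat.pos_of_ne_zero (by rintro rfl; simp at hpos)
    have hW := D.card_leaves ℓ
    obtain ⟨x, hx⟩ := Finset.card_pos.1 (hWpos.trans_le hW)
    obtain ⟨y, hy⟩ := Finset.card_pos.1 (hMpos.trans_le hCM)
    have hreach : ∀ v ∈ A, Relation.ReflTransGen G.Adj (D.src ℓ) v := fun v hv =>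
      ((D.src_tgt ℓ).tail (D.mem_tails ℓ v (Finset.mem_filter.1 hv).1).2.2).to_reflTransGen
    -- All vertices of `A` are reachable from the source, so they come at or after the first
    -- reachable vertex `v` of the chain. One edge to `v` therefore serves all of them at the cost
    -- of `R` more steps.
    obtain ⟨l₁, v, l₂, hdec, hpv, hfirst⟩ := exists_first_of_mem
      (fun v => Relation.ReflTransGen G.Adj (D.src ℓ) v) (Finset.mem_filter.1 hy).2 (hreach y hy)
    have hlater : ∀ v' ∈ A, ∃ j ≤ R, WalkOf (AugAdj G H₁) j v v' := by
      intro v' hv'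
      have hmem := (Finset.mem_filter.1 hv').2
      rw [hdec] at hmem
      rcases List.mem_append.1 hmem with h | h
      · exact absurd (hreach v' hv') (hfirst v' h)
      · rcases List.mem_cons.1 h with rfl | h
        · exact ⟨0, Nat.zero_le _, .nil _⟩
        · refine hH₁.2 C hC v v' ?_
          rw [hdec]
          refine List.Sublist.trans ?_ (List.sublist_append_right _ _)
          exact List.Sublist.cons_cons _ (List.singleton_sublist.2 h)
    -- From a leaf to the source, to `v`, and along the chain. If the source is `v` itself, no edge
    -- is needed between them.
    have hnear : ∀ K', H₁ ⊆ K' → (D.src ℓ = v ∨ AugAdj G K' (D.src ℓ) v) → ∀ x ∈ D.leaves ℓ,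
        ∀ y ∈ A, stepDist (AugAdj G K') x y ≤ R + 2 := by
      intro K' hK' h x hx y hy
      obtain ⟨j, hj, hw⟩ := hlater y hy
      have hw' := hw.mono (r' := AugAdj G K') fun _ _ => AugAdj.mono hK'
      have hx' : AugAdj G K' x (D.src ℓ) := Or.inl (D.mem_leaves ℓ x hx).2.2
      rcases h with rfl | h
      · exact (stepDist_le (.cons hx' hw')).trans (by omega)
      · exact (stepDist_le (.cons hx' (.cons h hw'))).trans (by omega)
    by_contra! hcon
    have hcon' : ∀ x ∈ D.leaves ℓ, ∀ y ∈ A, a + (R + 2) ≤ stepDist (AugAdj G H') x y := by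
      intro x hx y hy
      have := hcon x hx y (Finset.mem_filter.1 hy).1
      omega
    have hno : ¬ (D.src ℓ = v ∨ AugAdj G H' (D.src ℓ) v) := by
      intro h
      have h1 := hnear H' hH1' h x hx y hy
      have h2 := hcon x hx y (Finset.mem_filter.1 hy).1
      omega
    push Not at hno
    have htr : Relation.TransGen G.Adj (D.src ℓ) v :=
      (Relation.reflTransGen_iff_eq_or_transGen.1 hpv).resolve_left (fun h => hno.1 h.symm)
    have hnew : (D.src ℓ, v) ∈ newChainEdges G 𝒞 H' :=
      ⟨⟨htr, hno.2⟩, C, hC, hpv, l₁, l₂, hdec, hfirst⟩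
    have hsh : IsShortcut G (insert (D.src ℓ, v) H') := by
      intro e he
      rcases Finset.mem_insert.1 he with rfl | he
      · exact htr
      · exact hs' e he
    have hgain := potential_add_le hsh (Finset.subset_insert _ _) (D.leaves ℓ) A a (R + 2)
      fun u hu v hv => ⟨hnear _ (hH1'.trans (Finset.subset_insert _ _))
        (Or.inr (Or.inr (Finset.mem_insert_self _ _))) u hu v hv, hcon' u hu v hv⟩
    have := hst _ hnew
    have hle : W * M * a ≤ (D.leaves ℓ).card * A.card * a := by gcongr
    omega)
  have e1 : good.card * N ≤ 3 * K.card + good.card * (2 * (a + R + 2)) := main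
  have e2 : good.card ≤ Fintype.card Λ := Finset.card_le_univ _
  -- For large `N` the bound for the good lines is doubled; for small `N` the right side exceeds the
  -- left by its second summand alone.
  by_cases hN : 2 * (2 * (a + R + 2)) ≤ N
  · obtain ⟨d, rfl⟩ := Nat.exists_eq_add_of_le hN
    have h1 : good.card * (2 * (a + R + 2) + d) ≤ 3 * K.card := by
      have : good.card * (2 * (2 * (a + R + 2)) + d) =
        good.card * (2 * (a + R + 2) + d) + good.card * (2 * (a + R + 2)) := by ring
      omega
    have h2 : Fintype.card Λ * (2 * (a + R + 2) + d) ≤ 6 * K.card := by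
      calc _ ≤ 2 * good.card * (2 * (a + R + 2) + d) := Nat.mul_le_mul_right _ hgood
        _ = 2 * (good.card * (2 * (a + R + 2) + d)) := by ring
        _ ≤ _ := by omega
    calc _ = Fintype.card Λ * (2 * (a + R + 2) + d) + Fintype.card Λ * (2 * (a + R + 2)) := by ring
      _ ≤ 6 * K.card + Fintype.card Λ * (2 * (a + R + 2)) := by omega
      _ ≤ _ := by gcongr; omega
  · calc Fintype.card Λ * N ≤ Fintype.card Λ * (2 * (a + R + 2) + N / 2) := by gcongr; omega
      _ ≤ _ := by omega

end LineSystem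

end CertifiedShortcuts

namespace CertifiedShortcuts

/-! ### Many fractions with small denominators -/

section Fractions

theorem card_filter_dvd_Ioc_le (B d : ℕ) (hd : 0 < d) :
    (((Finset.Ioc B (2 * B)).filter fun x => d ∣ x).card : ℚ) ≤ B / d + 1 := by
  have h := Nat.Ioc_filter_modEq_card B (2 * B) hd 0
  have e : ((Finset.Ioc B (2 * B)).filter fun x => d ∣ x) =
      (Finset.Ioc B (2 * B)).filter fun x => x ≡ 0 [MOD d] := by
    ext x; simp [Nat.modEq_zero_iff_dvd]
  rw [e]
  have hd' : (0 : ℚ) < d := by exact_mod_cast hd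
  have h1 : (((Finset.Ioc B (2 * B)).filter fun x => x ≡ 0 [MOD d]).card : ℚ) =
      ((((Finset.Ioc B (2 * B)).filter fun x => x ≡ 0 [MOD d]).card : ℤ) : ℚ) := by push_cast; rfl
  rw [h1, h]
  have f1 := Int.floor_le (((2 * B : ℕ) - (0 : ℕ) : ℚ) / d)
  have f2 := Int.lt_floor_add_one ((B - (0 : ℕ) : ℚ) / d)
  push_cast at f1 f2 ⊢
  rw [max_le_iff]
  constructor
  · have : (2 * B - 0 : ℚ) / d = B / d + (B - 0) / d := by field_simp; ring
    linarith
  · positivity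

/-- Telescoping with `1 / (n + 1) ^ 2 ≤ 1 / n - 1 / (n + 1)`; the induction needs the sharper bound
`3 / 4 - 1 / n`, an equality for `n = 2`. -/
theorem sum_inv_sq_le (n : ℕ) : ∑ d ∈ Finset.Ioc 1 n, 1 / (d : ℚ) ^ 2 ≤ 3 / 4 := by
  rcases Nat.lt_or_ge n 2 with h | h
  · rw [Finset.Ioc_eq_empty (by omega)]; norm_num
  · have : ∑ d ∈ Finset.Ioc 1 n, 1 / (d : ℚ) ^ 2 ≤ 3 / 4 - 1 / (n : ℚ) := by
      induction n, h using Nat.le_induction with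
      | base => norm_num [show Finset.Ioc 1 2 = {2} from rfl]
      | succ n hn ih =>
        have hn0 : (0 : ℚ) < n := by exact_mod_cast (by omega : 0 < n)
        rw [Finset.sum_Ioc_succ_top (by omega)]
        have : 1 / ((n + 1 : ℕ) : ℚ) ^ 2 ≤ 1 / n - 1 / (n + 1 : ℕ) := by
          push_cast
          rw [div_sub_div _ _ (by positivity) (by positivity),
            div_le_div_iff₀ (by positivity) (by positivity)]
          nlinarith
        linarith
    have h0 : (0 : ℚ) ≤ 1 / n := by positivity
    linarith

/-- A union bound over common divisors `d > 1`: there are at most `(B / d + 1) ^ 2 ≤ (13 / 12) * (B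
/ d) ^ 2 + 13` pairs of multiples of `d`. By `sum_inv_sq_le` the total is at most `(13 / 16) * B ^ 2
+ 26 * B`, which is at most `(7 / 8) * B ^ 2` as soon as `B ≥ 416`. -/
theorem card_coprime_pairs_ge (B : ℕ) (hB : 416 ≤ B) :
    B ^ 2 ≤ 8 * (((Finset.Ioc B (2 * B)) ×ˢ (Finset.Ioc B (2 * B))).filter
      fun p => Nat.Coprime p.1 p.2).card := by
  set I := Finset.Ioc B (2 * B) with hI
  have hcard : (I ×ˢ I).card = B ^ 2 := by
    rw [Finset.card_product, hI, Nat.card_Ioc, sq]; congr 1 <;> omega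
  have hsplit := Finset.card_filter_add_card_filter_not (s := I ×ˢ I)
    (fun p : ℕ × ℕ => Nat.Coprime p.1 p.2)
  rw [hcard] at hsplit
  have hsub : ((I ×ˢ I).filter fun p => ¬ Nat.Coprime p.1 p.2) ⊆
      (Finset.Ioc 1 (2 * B)).biUnion fun d =>
        (I.filter fun x => d ∣ x) ×ˢ (I.filter fun x => d ∣ x) := by
    rintro ⟨a, b⟩ hp
    rw [Finset.mem_filter, Finset.mem_product] at hp
    obtain ⟨⟨ha, hb⟩, hab⟩ := hp
    simp only [] at ha hb hab
    have ha' := Finset.mem_Ioc.1 ha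
    rw [Finset.mem_biUnion]
    refine ⟨Nat.gcd a b, Finset.mem_Ioc.2 ⟨?_, ?_⟩, ?_⟩
    · have : 0 < Nat.gcd a b := Nat.gcd_pos_of_pos_left _ (by omega)
      have : Nat.gcd a b ≠ 1 := hab
      omega
    · exact (Nat.le_of_dvd (by omega) (Nat.gcd_dvd_left a b)).trans ha'.2
    · exact Finset.mem_product.2 ⟨Finset.mem_filter.2 ⟨ha, Nat.gcd_dvd_left a b⟩,
        Finset.mem_filter.2 ⟨hb, Nat.gcd_dvd_right a b⟩⟩
  have h1 : ((((I ×ˢ I).filter fun p => ¬ Nat.Coprime p.1 p.2).card : ℕ) : ℚ) ≤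
      ∑ d ∈ Finset.Ioc 1 (2 * B), ((13 / 12) * B ^ 2 * (1 / (d : ℚ) ^ 2) + 13) := by
    have := (Finset.card_le_card hsub).trans Finset.card_biUnion_le
    have h2 : ((((I ×ˢ I).filter fun p => ¬ Nat.Coprime p.1 p.2).card : ℕ) : ℚ) ≤
      ((∑ d ∈ Finset.Ioc 1 (2 * B),
        ((I.filter fun x => d ∣ x) ×ˢ (I.filter fun x => d ∣ x)).card : ℕ) : ℚ) := by
      exact_mod_cast this
    refine h2.trans ?_
    rw [Nat.cast_sum]
    refine Finset.sum_le_sum fun d hd => ?_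
    have hd' := Finset.mem_Ioc.1 hd
    have h3 := card_filter_dvd_Ioc_le B d (by omega)
    rw [← hI] at h3
    rw [Finset.card_product, Nat.cast_mul]
    have h4 : ((I.filter fun x => d ∣ x).card : ℚ) * (I.filter fun x => d ∣ x).card ≤
        (B / d + 1) * (B / d + 1) := mul_le_mul h3 h3 (by positivity) (by positivity)
    refine h4.trans ?_
    have h5 : (B : ℚ) ^ 2 * (1 / (d : ℚ) ^ 2) = (B / d) ^ 2 := by rw [div_pow]; ring
    rw [mul_assoc, h5]
    nlinarith [sq_nonneg ((B : ℚ) / d / 12 - 1), sq_nonneg ((B : ℚ) / d - 12)]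
  rw [Finset.sum_add_distrib, ← Finset.mul_sum, Finset.sum_const, Nat.card_Ioc, nsmul_eq_mul] at h1
  have h2 := sum_inv_sq_le (2 * B)
  have h3 : ((2 * B - 1 : ℕ) : ℚ) ≤ 2 * B := by
    have : ((2 * B - 1 : ℕ) : ℚ) ≤ ((2 * B : ℕ) : ℚ) := by exact_mod_cast Nat.sub_le _ _
    simpa using this
  have hB' : (416 : ℚ) ≤ B := by exact_mod_cast hB
  have h4 : (13 / 12 * (B : ℚ) ^ 2) * ∑ d ∈ Finset.Ioc 1 (2 * B), 1 / (d : ℚ) ^ 2 ≤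
      (13 / 12 * (B : ℚ) ^ 2) * (3 / 4) := mul_le_mul_of_nonneg_left h2 (by positivity)
  have h5 : ((((I ×ˢ I).filter fun p => ¬ Nat.Coprime p.1 p.2).card : ℕ) : ℚ) ≤
      7 / 8 * B ^ 2 := by nlinarith
  have h6 : ((8 * ((I ×ˢ I).filter fun p => ¬ Nat.Coprime p.1 p.2).card : ℕ) : ℚ) ≤
      ((7 * B ^ 2 : ℕ) : ℚ) := by push_cast; linarith
  have h7 := Nat.cast_le.1 h6
  omega

/-- An increasing sequence of fractions with denominators at most `4 * B`, starting with `0` and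
ending with `1`, whose other elements lie between `1 / 3` and `2 / 3`. -/
theorem exists_layers (B : ℕ) (hB : 416 ≤ B) : ∃ (L : ℕ) (f : ℕ → ℚ), f 0 = 0 ∧ f (L + 1) = 1 ∧
    (∀ l l', l < l' → l' ≤ L + 1 → f l < f l') ∧ (∀ l, 1 ≤ l → l ≤ L → 1 / 3 ≤ f l ∧ f l ≤ 2 / 3) ∧
    (∀ l, (f l).den ≤ 4 * B) ∧ B ^ 2 ≤ 8 * L ∧ L ≤ B ^ 2 := by
  set P := ((Finset.Ioc B (2 * B)) ×ˢ (Finset.Ioc B (2 * B))).filter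
      fun p => Nat.Coprime p.1 p.2 with hP
  -- For coprime `a`, `b` between `B` and `2 * B` the fraction `a / (a + b)` is reduced, so
  -- different pairs give different values; it lies between `1 / 3` and `2 / 3`.
  let q : ℕ × ℕ → ℚ := fun p => ((p.1 : ℤ) : ℚ) / ((p.1 + p.2 : ℕ) : ℤ)
  have hmemP : ∀ p ∈ P, B < p.1 ∧ p.1 ≤ 2 * B ∧ B < p.2 ∧ p.2 ≤ 2 * B ∧ Nat.Coprime p.1 p.2 := by
    intro p hp
    rw [hP, Finset.mem_filter, Finset.mem_product, Finset.mem_Ioc, Finset.mem_Ioc] at hp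
    exact ⟨hp.1.1.1, hp.1.1.2, hp.1.2.1, hp.1.2.2, hp.2⟩
  set F := P.image q with hF
  have hcardF : F.card = P.card := by
    rw [hF, Finset.card_image_of_injOn]
    intro p hp p' hp' h
    have h1 := hmemP p hp
    have h2 := hmemP p' hp'
    have h3 := Rat.div_int_inj (a := p.1) (b := (p.1 + p.2 : ℕ)) (c := p'.1)
      (d := (p'.1 + p'.2 : ℕ)) (by omega) (by omega)
      (by rw [Int.natAbs_natCast, Int.natAbs_natCast]; simpa using h1.2.2.2.2)
      (by rw [Int.natAbs_natCast, Int.natAbs_natCast]; simpa using h2.2.2.2.2) h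
    ext <;> omega
  have hFmem : ∀ x ∈ F, 1 / 3 ≤ x ∧ x ≤ 2 / 3 ∧ x.den ≤ 4 * B := by
    intro x hx
    obtain ⟨p, hp, rfl⟩ := Finset.mem_image.1 hx
    have h1 := hmemP p hp
    have hpos : (0 : ℚ) < ((p.1 + p.2 : ℕ) : ℤ) := by exact_mod_cast (by omega : 0 < p.1 + p.2)
    refine ⟨?_, ?_, ?_⟩
    · rw [div_le_div_iff₀ (by norm_num) hpos]
      have : p.1 + p.2 ≤ p.1 * 3 := by omega
      have : ((p.1 + p.2 : ℕ) : ℚ) ≤ ((p.1 * 3 : ℕ) : ℚ) := by exact_mod_cast this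
      push_cast at this ⊢
      linarith
    · rw [div_le_div_iff₀ hpos (by norm_num)]
      have : p.1 * 3 ≤ 2 * (p.1 + p.2) := by omega
      have : ((p.1 * 3 : ℕ) : ℚ) ≤ ((2 * (p.1 + p.2) : ℕ) : ℚ) := by exact_mod_cast this
      push_cast at this ⊢
      linarith
    · have hd := Rat.den_dvd p.1 (p.1 + p.2 : ℕ)
      rw [Rat.divInt_eq_div] at hd
      have hd' : (q p).den ∣ p.1 + p.2 := Int.natCast_dvd_natCast.1 hd
      exact (Nat.le_of_dvd (by omega) hd').trans (by omega)
  set L := F.card with hL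
  let e := F.orderEmbOfFin hL.symm
  let f : ℕ → ℚ := fun l => if l = 0 then 0 else if h : l - 1 < L then e ⟨l - 1, h⟩ else 1
  have hf0 : f 0 = 0 := by simp [f]
  have hfm : ∀ l, ∀ h1 : l ≠ 0, ∀ h2 : l - 1 < L, f l = e ⟨l - 1, h2⟩ := by
    intro l h1 h2; simp only [f]; rw [if_neg h1, dif_pos h2]
  have hfl : ∀ l, l ≠ 0 → ¬ (l - 1 < L) → f l = 1 := by
    intro l h1 h2; simp only [f]; rw [if_neg h1, dif_neg h2]
  have hrange : ∀ l, 1 ≤ l → l ≤ L → f l ∈ F := by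
    intro l h1 h2
    rw [hfm l (by omega) (by omega)]
    exact Finset.orderEmbOfFin_mem _ _ _
  refine ⟨L, f, hf0, hfl _ (by omega) (by omega), ?_, ?_, ?_, ?_, ?_⟩
  · intro l l' hll' hl'
    rcases Nat.eq_zero_or_pos l with rfl | hl
    · rw [hf0]
      rcases Nat.lt_or_ge L l' with h | h
      · rw [hfl _ (by omega) (by omega)]; norm_num
      · have := (hFmem _ (hrange l' (by omega) h)).1
        linarith
    · rcases Nat.lt_or_ge L l' with h | h
      · rw [hfl l' (by omega) (by omega)]
        have := (hFmem _ (hrange l hl (by omega))).2.1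
        linarith
      · rw [hfm l (by omega) (by omega), hfm l' (by omega) (by omega)]
        apply e.strictMono
        rw [Fin.lt_def]
        simp only
        omega
  · intro l h1 h2
    have := hFmem _ (hrange l h1 h2)
    exact ⟨this.1, this.2.1⟩
  · intro l
    rcases Nat.eq_zero_or_pos l with rfl | hl
    · rw [hf0]; simp; omega
    · by_cases h : l ≤ L
      · exact (hFmem _ (hrange l hl h)).2.2
      · rw [hfl _ (by omega) (by omega)]; simp; omega
  · rw [hcardF]
    exact card_coprime_pairs_ge B hB
  · rw [hcardF]
    refine (Finset.card_filter_le _ _).trans ?_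
    rw [Finset.card_product, Nat.card_Ioc, sq]
    exact Nat.mul_le_mul (by omega) (by omega)

end Fractions

end CertifiedShortcuts

namespace CertifiedShortcuts

/-! ### Lines in space-time -/

/-- A line, given by the indices of its copy, its start and end positions and its initial
height. -/
@[ext]
structure Line where
  i : ℕ
  j : ℕ
  α : Fin 3 → ℕ
  β : Fin 3 → ℕ
  ζ : ℕ

/-- The value of the affine function with slope `D` that is constant along lines of direction
`D`, at a point with height `z`, position `x` and time `c`. -/
def lamAt (D c x : Fin 3 → ℚ) (z : ℚ) : ℚ := z - ∑ i, (2 * D i * x i - D i ^ 2 * c i)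

/-- The difference of the two sides is `(dx - D * Δ) ^ 2 / Δ`, so equality holds exactly for motion
with speed `D`. -/
theorem quad_le (D dx Δ : ℚ) (hΔ : 0 < Δ) : 2 * D * dx - D ^ 2 * Δ ≤ dx ^ 2 / Δ := by
  rw [le_div_iff₀ hΔ]
  nlinarith [sq_nonneg (dx - D * Δ)]

/-- A jump in space-time that climbs at least the sum of the `dx ^ 2 / Δ` decreases no supporting
function, whatever its slope. A surplus `δ` in the climb is a surplus for all slopes at once. -/
theorem lamAt_add_le (D : Fin 3 → ℚ) {c c' x x' : Fin 3 → ℚ} {z z' δ : ℚ} (hc : ∀ i, c i < c' i)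
    (h : ∑ i, (x' i - x i) ^ 2 / (c' i - c i) + δ ≤ z' - z) :
    lamAt D c x z + δ ≤ lamAt D c' x' z' := by
  have h1 : ∑ i, (2 * D i * (x' i - x i) - D i ^ 2 * (c' i - c i)) ≤
      ∑ i, (x' i - x i) ^ 2 / (c' i - c i) :=
    Finset.sum_le_sum fun i _ => quad_le _ _ _ (sub_pos.2 (hc i))
  have h2 : ∑ i, (2 * D i * (x' i - x i) - D i ^ 2 * (c' i - c i)) =
      ∑ i, (2 * D i * x' i - D i ^ 2 * c' i) - ∑ i, (2 * D i * x i - D i ^ 2 * c i) := by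
    rw [← Finset.sum_sub_distrib]
    exact Finset.sum_congr rfl fun i _ => by ring
  unfold lamAt
  linarith

/-- The parameters of the construction: `f` is the increasing sequence of layer times, `s` the side
of the cube of start and end positions, `J` the resolution of the slices, and `N₁ * N₂` the number
of copies. There are `W` leaves per source, `Y` tail vertices per target, and a filling of `F`
vertices. -/
structure Par where
  (B s J N₁ N₂ W Y F L : ℕ)
  f : ℕ → ℚ
  f_zero : f 0 = 0
  f_last : f (L + 1) = 1
  f_lt : ∀ l l', l < l' → l' ≤ L + 1 → f l < f l'
  f_mid : ∀ l, 1 ≤ l → l ≤ L → 1 / 3 ≤ f l ∧ f l ≤ 2 / 3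
  f_den : ∀ l, (f l).den ≤ 4 * B
  s_pos : 0 < s
  J_ge : 12 ≤ J
  N₁_pos : 0 < N₁
  N₂_pos : 0 < N₂

namespace Par

variable (P : Par)

/-- The number of steps of a line. -/
def N : ℕ := 3 * (P.L + 1)

/-- The time of the coordinate `i` at level `k`. -/
def clk (k : ℕ) (i : Fin 3) : ℚ := P.f ((k + 2 - i) / 3)

/-- The offset `2 - i` in the index lets the coordinates advance in turn, coordinate `k % 3` in step
`k`, while all three clocks agree at the levels `0` and `N`. -/
theorem clk_zero (i : Fin 3) : P.clk 0 i = 0 := by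
  have : (0 + 2 - (i : ℕ)) / 3 = 0 := by omega
  rw [clk, this, P.f_zero]

theorem clk_N (i : Fin 3) : P.clk P.N i = 1 := by
  have : (P.N + 2 - (i : ℕ)) / 3 = P.L + 1 := by unfold N; omega
  rw [clk, this, P.f_last]

theorem f_le {l l' : ℕ} (h : l ≤ l') (h' : l' ≤ P.L + 1) : P.f l ≤ P.f l' := by
  rcases h.eq_or_lt with rfl | h
  · exact le_rfl
  · exact (P.f_lt _ _ h h').le

theorem clk_mono {k k' : ℕ} (h : k ≤ k') (h' : k' ≤ P.N) (i : Fin 3) : P.clk k i ≤ P.clk k' i := by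
  unfold N at h'
  exact P.f_le (by omega) (by omega)

/-- Every coordinate moves at least once within three steps. This is the origin of the level
difference three in `LineSystem.ident`. -/
theorem clk_lt {k k' : ℕ} (h : k + 3 ≤ k') (h' : k' ≤ P.N) (i : Fin 3) :
    P.clk k i < P.clk k' i := by
  unfold N at h'
  exact P.f_lt _ _ (by omega) (by omega)

theorem clk_nonneg {k : ℕ} (h : k ≤ P.N) (i : Fin 3) : 0 ≤ P.clk k i := by
  rw [← P.clk_zero i]; exact P.clk_mono (Nat.zero_le k) h i

theorem clk_le_one {k : ℕ} (h : k ≤ P.N) (i : Fin 3) : P.clk k i ≤ 1 := by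
  rw [← P.clk_N i]; exact P.clk_mono h le_rfl i

theorem third_le_clk {k : ℕ} (h : 3 ≤ k) (h' : k ≤ P.N) (i : Fin 3) : 1 / 3 ≤ P.clk k i := by
  unfold N at h'
  unfold clk
  by_cases hl : (k + 2 - (i : ℕ)) / 3 ≤ P.L
  · exact (P.f_mid _ (by omega) hl).1
  · rw [show (k + 2 - (i : ℕ)) / 3 = P.L + 1 by omega, P.f_last]; norm_num

theorem N_pos : 0 < P.N := by unfold N; omega

end Par

namespace Line

variable (P : Par) (ℓ : Line)

/-- The direction of a line. -/
def D (i : Fin 3) : ℚ := ℓ.β i - ℓ.α i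

/-- The position of a line at a level. -/
def pos (k : ℕ) (i : Fin 3) : ℚ := ℓ.α i + P.clk k i * ℓ.D i

/-- The height of a line at a level. -/
def z (k : ℕ) : ℚ := ℓ.ζ + ∑ i, P.clk k i * ℓ.D i ^ 2

theorem pos_zero : ℓ.pos P 0 = fun i => (ℓ.α i : ℚ) := by
  ext i; simp [pos, P.clk_zero]

theorem pos_N : ℓ.pos P P.N = fun i => (ℓ.β i : ℚ) := by
  ext i; simp [pos, P.clk_N, D]

theorem z_zero : ℓ.z P 0 = ℓ.ζ := by simp [z, P.clk_zero]

/-- Completing the square: along a line the function of slope `D` grows with each clock at the rate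
`(ℓ.D i - D i) ^ 2`, so it is constant on lines of direction `D`. -/
theorem lamAt_eq (k : ℕ) (D : Fin 3 → ℚ) : lamAt D (P.clk k) (ℓ.pos P k) (ℓ.z P k) =
    ℓ.ζ - ∑ i, 2 * D i * ℓ.α i + ∑ i, P.clk k i * (ℓ.D i - D i) ^ 2 := by
  have : ∑ i, P.clk k i * ℓ.D i ^ 2 - ∑ i, (2 * D i * ℓ.pos P k i - D i ^ 2 * P.clk k i) =
      - ∑ i, 2 * D i * ℓ.α i + ∑ i, P.clk k i * (ℓ.D i - D i) ^ 2 := by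
    rw [← Finset.sum_sub_distrib, ← Finset.sum_neg_distrib, ← Finset.sum_add_distrib]
    exact Finset.sum_congr rfl fun i _ => by simp only [pos]; ring
  unfold lamAt
  rw [z]
  linarith

/-- The numbers occurring in a line are in the allowed range. -/
structure Valid : Prop where
  i_lt : ℓ.i < P.N₁
  j_lt : ℓ.j < P.N₂
  α_lt : ∀ i, ℓ.α i < P.s
  β_lt : ∀ i, ℓ.β i < P.s
  ζ_lt : ℓ.ζ < P.s ^ 2

end Line

/-- The vertices of the construction for directed graphs. -/
inductive Vert
  | leaf (i : ℕ) (x : Fin 3 → ℚ) (z : ℚ) (r : ℕ)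
  | core (i j k : ℕ) (x : Fin 3 → ℚ) (z : ℚ)
  | slice₁ (i j : ℕ) (t : Fin 3 → ℚ) (x : Fin 3 → ℕ) (z : ℕ)
  | slice₂ (i j : ℕ) (t : Fin 3 → ℚ) (x : Fin 3 → ℕ) (z : ℕ)
  | tail (j : ℕ) (x : Fin 3 → ℚ) (z : ℚ) (r : ℕ)
  | extra (r : ℕ)

noncomputable instance : DecidableEq Line := Classical.decEq _

noncomputable instance : DecidableEq Vert := Classical.decEq _

namespace Par

variable (P : Par)

/-- The vertex of a line at a level. The copies of the first level depend only on the first index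
and the copies of the last level only on the second index. -/
def node (ℓ : Line) (k : ℕ) : Vert :=
  .core (if k = P.N then 0 else ℓ.i) (if k = 0 then 0 else ℓ.j) k (ℓ.pos P k) (ℓ.z P k)

/-- The time vector of the slices below level `k`. -/
def tvec (k : ℕ) (i : Fin 3) : ℚ := (⌊P.J * P.clk k i⌋ - 1) / P.J

/-- The time vectors of all slices. -/
def tvecs : Finset (Fin 3 → ℚ) := insert 1 ((Finset.Ico 3 P.N).image P.tvec)

/-- The directed graph of the construction. -/
inductive Adj : Vert → Vert → Prop
  | leaf (i : ℕ) (α : Fin 3 → ℕ) (ζ r : ℕ) (hi : i < P.N₁) (hα : ∀ i, α i < P.s)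
      (hζ : ζ < P.s ^ 2) (hr : r < P.W) (x : Fin 3 → ℚ) (hx : x = fun i => (α i : ℚ)) (z : ℚ)
      (hz : z = ζ) : Adj (.leaf i x z r) (.core i 0 0 x z)
  | line (ℓ : Line) (k : ℕ) (hℓ : ℓ.Valid P) (hk : k < P.N) (u v : Vert) (hu : u = P.node ℓ k)
      (hv : v = P.node ℓ (k + 1)) : Adj u v
  -- The entry height is the smallest integer that pays for the jump from the source, so no
  -- supporting function decreases.
  | enter (i j : ℕ) (α : Fin 3 → ℕ) (ζ : ℕ) (t : Fin 3 → ℚ) (x : Fin 3 → ℕ) (z : ℕ) (hi : i < P.N₁)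
      (hj : j < P.N₂) (hα : ∀ i, α i < P.s) (hζ : ζ < P.s ^ 2) (ht : t ∈ P.tvecs)
      (hx : ∀ i, x i < P.s) (hz : z < 4 * P.s ^ 2)
      (hzz : (z : ℤ) = ζ + ⌈∑ i, ((x i : ℚ) - α i) ^ 2 / t i⌉) (a : Fin 3 → ℚ)
      (ha : a = fun i => (α i : ℚ)) (b : ℚ) (hb : b = ζ) :
      Adj (.core i 0 0 a b) (.slice₁ i j t x z)
  -- Climbing is allowed at any position of a slice. The two layers turn every climb into a single
  -- edge.
  | rise (i j : ℕ) (t : Fin 3 → ℚ) (x : Fin 3 → ℕ) (z z' : ℕ) (hi : i < P.N₁)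
      (hj : j < P.N₂) (ht : t ∈ P.tvecs) (hx : ∀ i, x i < P.s) (hzz : z ≤ z')
      (hz : z' < 4 * P.s ^ 2) : Adj (.slice₁ i j t x z) (.slice₂ i j t x z')
  -- The exit starts at least one unit lower than the cost of the jump allows, so every supporting
  -- function gains at least one and a route through a slice cannot replace a line. The condition
  -- `hclose` bounds the number of exits to a vertex.
  | exit (ℓ : Line) (k : ℕ) (hℓ : ℓ.Valid P) (hk : 3 ≤ k) (hkN : k < P.N) (x : Fin 3 → ℕ) (z : ℕ)
      (hx : ∀ i, x i < P.s) (hz : z < 4 * P.s ^ 2)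
      (hclose : ∀ i, |(x i : ℚ) - ℓ.pos P k i| ≤ 8 * P.s / P.J + 1)
      (hzz : (z : ℤ) = ⌊ℓ.z P k - ∑ i, (ℓ.pos P k i - x i) ^ 2 / (P.clk k i - P.tvec k i)⌋ - 1)
      (v : Vert) (hv : v = P.node ℓ k) : Adj (.slice₂ ℓ.i ℓ.j (P.tvec k) x z) v
  | land (i j : ℕ) (x : Fin 3 → ℕ) (z : ℕ) (hi : i < P.N₁) (hj : j < P.N₂) (hx : ∀ i, x i < P.s)
      (hz : z + 1 < 4 * P.s ^ 2) (b : Fin 3 → ℚ) (hb : b = fun i => (x i : ℚ)) (e : ℚ)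
      (he : e = z + 1) : Adj (.slice₂ i j 1 x z) (.core 0 j P.N b e)
  | tail (j : ℕ) (β : Fin 3 → ℕ) (η r : ℕ) (hj : j < P.N₂) (hβ : ∀ i, β i < P.s)
      (hη : η < 4 * P.s ^ 2) (hr : r < P.Y) (x : Fin 3 → ℚ) (hx : x = fun i => (β i : ℚ)) (z : ℚ)
      (hz : z = η) : Adj (.core 0 j P.N x z) (.tail j x z r)
  -- These edges make a path of the tail, which every chain cover has to cover in large part.
  | next (j : ℕ) (β : Fin 3 → ℕ) (η r : ℕ) (hj : j < P.N₂) (hβ : ∀ i, β i < P.s)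
      (hη : η < 4 * P.s ^ 2) (hr : r + 1 < P.Y) (x : Fin 3 → ℚ) (hx : x = fun i => (β i : ℚ)) (z : ℚ)
      (hz : z = η) : Adj (.tail j x z r) (.tail j x z (r + 1))
  | extra (r r' : ℕ) (h : r < r') (h' : r' < P.F) : Adj (.extra r) (.extra r')

/-- The directed graph of the construction. -/
def graph : Digraph Vert := ⟨P.Adj⟩

/-- A rank function of the construction. -/
def rank : Vert → ℕ
  | .leaf _ _ _ _ => 0
  | .core _ _ k _ _ => if k = 0 then 1 else 4 + k
  | .slice₁ _ _ _ _ _ => 2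
  | .slice₂ _ _ _ _ _ => 3
  | .tail _ _ _ r => P.N + 5 + r
  | .extra r => r

/-- The level of a vertex. -/
def level : Vert → ℕ
  | .core _ _ k _ _ => k
  | .tail _ _ _ _ => P.N
  | _ => 0

/-- The affine function with slope `D`. -/
def lam (D : Fin 3 → ℚ) : Vert → ℚ
  | .leaf _ x z _ => lamAt D 0 x z
  | .core _ _ k x z => lamAt D (P.clk k) x z
  | .slice₁ _ _ t x z => lamAt D t (fun i => x i) z
  | .slice₂ _ _ t x z => lamAt D t (fun i => x i) z
  | .tail _ x z _ => lamAt D 1 x z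
  | .extra _ => 0

/-- The second index of the copy of a vertex. -/
def copy : Vert → Option ℕ
  | .core _ j k _ _ => if k = 0 then none else some j
  | .slice₁ _ j _ _ _ => some j
  | .slice₂ _ j _ _ _ => some j
  | .tail j _ _ _ => some j
  | _ => none

/-- The vertices of the slices. -/
def IsSlice : Vert → Prop
  | .slice₁ _ _ _ _ _ => True
  | .slice₂ _ _ _ _ _ => True
  | _ => False

theorem rank_lt {u v : Vert} (h : P.Adj u v) : P.rank u < P.rank v := by
  have hN := P.N_pos
  cases h with
  | leaf => simp [rank]
  | line ℓ k _ hk _ _ hu hv => subst hu hv; simp only [rank, node]; rw [if_neg (Nat.succ_ne_zero k)]; split_ifs <;> omega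
  | enter => simp [rank]
  | rise => simp [rank]
  | exit ℓ k _ hk hkN x z _ _ _ _ v hv => subst hv; simp only [rank, node]; split_ifs <;> omega
  | land => simp only [rank]; split_ifs <;> omega
  | tail => simp only [rank]; split_ifs <;> omega
  | next => simp only [rank]; omega
  | extra => simpa [rank]

theorem level_le {u v : Vert} (h : P.Adj u v) : P.level u ≤ P.level v := by
  cases h with
  | line ℓ k _ hk _ _ hu hv => subst hu hv; simp [level, node]
  | _ => simp [level]

theorem level_le_add_one {u v : Vert} (h : P.Adj u v) (hu : ¬ IsSlice u) (hv : ¬ IsSlice v) :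
    P.level v ≤ P.level u + 1 := by
  cases h with
  | line ℓ k _ hk _ _ hu hv => subst hu hv; simp [level, node]
  | enter => simp [IsSlice] at hv
  | rise => simp [IsSlice] at hv
  | exit => simp [IsSlice] at hu
  | land => simp [IsSlice] at hu
  | _ => simp [level]

theorem copy_eq {u v : Vert} (h : P.Adj u v) : copy u = none ∨ copy u = copy v := by
  have hN := P.N_pos
  cases h with
  | line ℓ k _ hk _ _ hu hv =>
    subst hu hv
    simp only [copy, node]
    by_cases h0 : k = 0
    · simp [h0]
    · simp [h0]
  | exit ℓ k _ hk hkN x z _ _ _ _ v hv => subst hv; right; simp [copy, node]; omega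
  | land => right; simp [copy]; omega
  | tail => right; simp [copy]; omega
  | _ => simp [copy]

/-- The time `J * clk` is rounded down and decreased by one more, so that between `1 / J` and `2 /
J` remains for the last jump. The lower bound `1 / 6` comes from `clk ≥ 1 / 3` and `J ≥ 12`. -/
theorem tvec_bounds {k : ℕ} (h : 3 ≤ k) (h' : k ≤ P.N) (i : Fin 3) :
    1 / (P.J : ℚ) ≤ P.tvec k i ∧ 1 / 6 ≤ P.tvec k i ∧
      1 / (P.J : ℚ) ≤ P.clk k i - P.tvec k i ∧ P.clk k i - P.tvec k i ≤ 2 / P.J := by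
  have hJ : (12 : ℚ) ≤ P.J := by exact_mod_cast P.J_ge
  have hJ0 : (0 : ℚ) < P.J := by linarith
  have hc := P.third_le_clk h h' i
  have h2 : (2 : ℤ) ≤ ⌊P.J * P.clk k i⌋ := by
    rw [Int.le_floor]; push_cast; nlinarith
  have h2' : (2 : ℚ) ≤ ⌊P.J * P.clk k i⌋ := by exact_mod_cast h2
  have f1 := Int.floor_le (P.J * P.clk k i)
  have f2 := Int.lt_floor_add_one (P.J * P.clk k i)
  have e : P.clk k i - P.tvec k i = (P.J * P.clk k i - (⌊P.J * P.clk k i⌋ - 1)) / P.J := by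
    unfold tvec; field_simp
  have t1 : 1 / (P.J : ℚ) ≤ P.tvec k i := by
    unfold tvec
    gcongr
    linarith
  have t2 : P.clk k i - P.tvec k i ≤ 2 / P.J := by
    rw [e]
    gcongr
    linarith
  have t3 : 2 / (P.J : ℚ) ≤ 1 / 6 := by
    rw [div_le_div_iff₀ hJ0 (by norm_num)]; linarith
  refine ⟨t1, by linarith, ?_, t2⟩
  rw [e]
  gcongr
  linarith

theorem tvecs_pos {t : Fin 3 → ℚ} (ht : t ∈ P.tvecs) (i : Fin 3) : 0 < t i := by
  have hJ : (12 : ℚ) ≤ P.J := by exact_mod_cast P.J_ge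
  rw [tvecs, Finset.mem_insert, Finset.mem_image] at ht
  rcases ht with rfl | ⟨k, hk, rfl⟩
  · simp
  · rw [Finset.mem_Ico] at hk
    have := (P.tvec_bounds hk.1 hk.2.le i).1
    have h0 : (0 : ℚ) < 1 / P.J := by positivity
    linarith

theorem lam_node (D : Fin 3 → ℚ) (ℓ : Line) (k : ℕ) : P.lam D (P.node ℓ k) =
    ℓ.ζ - ∑ i, 2 * D i * ℓ.α i + ∑ i, P.clk k i * (ℓ.D i - D i) ^ 2 :=
  ℓ.lamAt_eq P k D

/-- The monotonicity that controls reachability: line edges gain by the squares in `lam_node`, jumps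
by `lamAt_add_le`, and the remaining edges keep position and time without losing height. -/
theorem lam_le (D : Fin 3 → ℚ) {u v : Vert} (h : P.Adj u v) : P.lam D u ≤ P.lam D v := by
  have hJ : (12 : ℚ) ≤ P.J := by exact_mod_cast P.J_ge
  cases h with
  | leaf =>
    simp only [lam]
    rw [show P.clk 0 = 0 from funext fun i => P.clk_zero i]
  | line ℓ k _ hk _ _ hu hv =>
    subst hu hv
    rw [lam_node, lam_node]
    gcongr with i
    exact P.clk_mono (Nat.le_succ k) hk i
  | enter i j α ζ t x z hi hj hα hζ ht hx hz hzz a ha b hb =>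
    subst ha hb
    simp only [lam]
    rw [show P.clk 0 = 0 from funext fun i => P.clk_zero i]
    rw [← add_zero (lamAt D 0 _ _)]
    refine lamAt_add_le D (fun i => by simpa using P.tvecs_pos ht i) ?_
    have := Int.le_ceil (∑ i, ((x i : ℚ) - α i) ^ 2 / t i)
    have hz' : (z : ℚ) = ζ + ⌈∑ i, ((x i : ℚ) - α i) ^ 2 / t i⌉ := by exact_mod_cast hzz
    simp only [Pi.zero_apply, sub_zero, add_zero]
    linarith
  | rise i j t x z z' hi hj ht hx hzz hz =>
    simp only [lam, lamAt]
    have : (z : ℚ) ≤ z' := by exact_mod_cast hzz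
    linarith
  | exit ℓ k hℓ hk hkN x z hx hz hclose hzz v hv =>
    subst hv
    simp only [lam, node]
    rw [← add_zero (lamAt D _ _ (z : ℚ))]
    refine lamAt_add_le D (fun i => ?_) ?_
    · have := (P.tvec_bounds hk hkN.le i).2.2.1
      have h0 : (0 : ℚ) < 1 / P.J := by positivity
      linarith
    · have h1 := Int.floor_le
        (ℓ.z P k - ∑ i, (ℓ.pos P k i - x i) ^ 2 / (P.clk k i - P.tvec k i))
      have hz' : (z : ℚ) =
        ⌊ℓ.z P k - ∑ i, (ℓ.pos P k i - x i) ^ 2 / (P.clk k i - P.tvec k i)⌋ - 1 := by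
          exact_mod_cast hzz
      linarith
  | land i j x z hi hj hx hz b hb e he =>
    subst hb he
    simp only [lam, lamAt]
    rw [show P.clk P.N = 1 from funext fun i => P.clk_N i]
    linarith
  | tail =>
    simp only [lam]
    rw [show P.clk P.N = 1 from funext fun i => P.clk_N i]
  | next => simp [lam]
  | extra => simp [lam]

/-- The unit held back in `exit` and `land` appears as a strict gain. It keeps slices off the lines.
-/
theorem lam_add_one_le (D : Fin 3 → ℚ) {u v : Vert} (h : P.Adj u v) (hu : IsSlice u)
    (hv : ¬ IsSlice v) : P.lam D u + 1 ≤ P.lam D v := by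
  have hJ : (12 : ℚ) ≤ P.J := by exact_mod_cast P.J_ge
  cases h with
  | leaf => simp [IsSlice] at hu
  | line ℓ k _ hk _ _ hu' hv' => subst hu'; simp [IsSlice, node] at hu
  | enter => simp [IsSlice] at hu
  | rise => simp [IsSlice] at hv
  | exit ℓ k hℓ hk hkN x z hx hz hclose hzz v hv =>
    subst hv
    simp only [lam, node]
    refine lamAt_add_le D (fun i => ?_) ?_
    · have := (P.tvec_bounds hk hkN.le i).2.2.1
      have h0 : (0 : ℚ) < 1 / P.J := by positivity
      linarith
    · have h1 := Int.floor_le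
        (ℓ.z P k - ∑ i, (ℓ.pos P k i - x i) ^ 2 / (P.clk k i - P.tvec k i))
      have hz' : (z : ℚ) =
        ⌊ℓ.z P k - ∑ i, (ℓ.pos P k i - x i) ^ 2 / (P.clk k i - P.tvec k i)⌋ - 1 := by
          exact_mod_cast hzz
      linarith
  | land i j x z hi hj hx hz b hb e he =>
    subst hb he
    simp only [lam, lamAt]
    rw [show P.clk P.N = 1 from funext fun i => P.clk_N i]
    linarith
  | tail => simp [IsSlice] at hu
  | next => simp [IsSlice] at hu
  | extra => simp [IsSlice] at hu

open Relation

theorem lam_le_of_reach (D : Fin 3 → ℚ) {u v : Vert} (h : ReflTransGen P.Adj u v) :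
    P.lam D u ≤ P.lam D v := by
  induction h with
  | refl => exact le_rfl
  | tail _ h ih => exact ih.trans (P.lam_le D h)

theorem level_le_of_reach {u v : Vert} (h : ReflTransGen P.Adj u v) :
    P.level u ≤ P.level v := by
  induction h with
  | refl => exact le_rfl
  | tail _ h ih => exact ih.trans (P.level_le h)

theorem copy_eq_of_reach {u v : Vert} (h : ReflTransGen P.Adj u v) :
    copy u = none ∨ copy u = copy v := by
  induction h with
  | refl => exact Or.inr rfl
  | tail _ h ih =>
    rcases ih with ih | ih
    · exact Or.inl ih
    · rw [ih]; exact P.copy_eq h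

theorem lam_add_one_le_of_reach (D : Fin 3 → ℚ) {u v : Vert} (h : ReflTransGen P.Adj u v)
    (hu : IsSlice u) (hv : ¬ IsSlice v) : P.lam D u + 1 ≤ P.lam D v := by
  induction h using ReflTransGen.head_induction_on with
  | refl => exact absurd hu hv
  | @head a c h h' ih =>
    by_cases hc : IsSlice c
    · exact (by have := P.lam_le D h; have := ih hc; linarith)
    · have := P.lam_add_one_le D h hu hc
      have := P.lam_le_of_reach D h'
      linarith

/-- The vertices that belong to a line: the leaves of its source, the vertices along it, and the
tail of its target. -/
inductive Mem (ℓ : Line) : Vert → Prop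
  | leaf (r : ℕ) (hr : r < P.W) : Mem ℓ (.leaf ℓ.i (ℓ.pos P 0) (ℓ.z P 0) r)
  | node (k : ℕ) (hk : k ≤ P.N) : Mem ℓ (P.node ℓ k)
  | tail (r : ℕ) (hr : r < P.Y) : Mem ℓ (.tail ℓ.j (ℓ.pos P P.N) (ℓ.z P P.N) r)

variable {P} {ℓ : Line}

theorem Mem.not_isSlice {v : Vert} (h : P.Mem ℓ v) : ¬ IsSlice v := by
  cases h <;> simp [IsSlice, Par.node]

theorem Mem.lam_eq {v : Vert} (h : P.Mem ℓ v) :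
    P.lam ℓ.D v = ℓ.ζ - ∑ i, 2 * ℓ.D i * ℓ.α i := by
  have key : ∀ k, P.lam ℓ.D (P.node ℓ k) = ℓ.ζ - ∑ i, 2 * ℓ.D i * ℓ.α i := fun k => by
    rw [lam_node]; simp
  cases h with
  | leaf r =>
    rw [← key 0]
    simp only [lam, Par.node]
    rw [show P.clk 0 = 0 from funext fun i => P.clk_zero i]
  | node k hk => exact key k
  | tail r =>
    rw [← key P.N]
    simp only [lam, Par.node]
    rw [show P.clk P.N = 1 from funext fun i => P.clk_N i]

theorem Mem.copy_eq {v : Vert} (h : P.Mem ℓ v) : copy v = none ∨ copy v = some ℓ.j := by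
  cases h with
  | leaf => simp [copy]
  | node k hk =>
    by_cases h0 : k = 0
    · simp [copy, Par.node, h0]
    · simp [copy, Par.node, h0]
  | tail => simp [copy]

/-- Everything that is adjacent from a line and reaches the line belongs to the line. -/
theorem Mem.of_adj {u v y : Vert} (hu : P.Mem ℓ u) (hy : P.Mem ℓ y) (huv : P.Adj u v)
    (hvy : ReflTransGen P.Adj v y) : P.Mem ℓ v := by
  have hN := P.N_pos
  have l1 := P.lam_le ℓ.D huv
  have l2 := P.lam_le_of_reach ℓ.D hvy
  have e1 := hu.lam_eq
  have e2 := hy.lam_eq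
  -- The function of slope `ℓ.D` has the same value at `u` and `y`, so it is constant in between,
  -- whereas leaving a slice would raise it.
  have hslice : ¬ IsSlice v := fun hv => by
    have := P.lam_add_one_le_of_reach ℓ.D hvy hv hy.not_isSlice
    linarith
  have hcv : copy v = none ∨ copy v = some ℓ.j := by
    rcases P.copy_eq_of_reach hvy with h | h
    · exact Or.inl h
    · rw [h]; exact hy.copy_eq
  cases hu with
  | leaf r =>
    generalize hw : Vert.leaf ℓ.i (ℓ.pos P 0) (ℓ.z P 0) r = w at huv
    cases huv with
    | line ℓ' k' hℓ' hk' _ _ hu' hv' => rw [hu'] at hw; simp [Par.node] at hw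
    | leaf =>
      simp only [Vert.leaf.injEq] at hw
      obtain ⟨rfl, rfl, rfl, rfl⟩ := hw
      have := Mem.node (P := P) (ℓ := ℓ) 0 (Nat.zero_le _)
      simpa [Par.node, hN.ne] using this
    | _ => simp at hw
  | tail r =>
    generalize hw : Vert.tail ℓ.j (ℓ.pos P P.N) (ℓ.z P P.N) r = w at huv
    cases huv with
    | line ℓ' k' hℓ' hk' _ _ hu' hv' => rw [hu'] at hw; simp [Par.node] at hw
    | next j β η r hj hβ hη hr =>
      simp only [Vert.tail.injEq] at hw
      obtain ⟨rfl, rfl, rfl, rfl⟩ := hw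
      exact Mem.tail _ hr
    | _ => simp at hw
  | node k hk =>
    generalize hw : P.node ℓ k = w at huv
    cases huv with
    | leaf => simp [Par.node] at hw
    | line ℓ' k' hℓ' hk' _ _ hu' hv' =>
      subst hv'
      rw [hu'] at hw
      have hw' := hw
      simp only [Par.node, Vert.core.injEq] at hw
      obtain ⟨hi, hj, rfl, hpos, hz⟩ := hw
      rw [if_neg (by omega), if_neg (by omega)] at hi
      rw [hw', lam_node] at e1
      rw [lam_node] at l1 l2
      have hterm : ∀ i ∈ Finset.univ, 0 ≤ (P.clk (k + 1) i - P.clk k i) * (ℓ'.D i - ℓ.D i) ^ 2 :=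
        fun i _ => mul_nonneg (sub_nonneg.2 (P.clk_mono (Nat.le_succ k) hk' i)) (sq_nonneg _)
      -- The edge of `ℓ'` cannot raise the function of slope `ℓ.D`, so in every coordinate that
      -- moves `ℓ'` has the speed of `ℓ`. Thus both lines take the same step.
      have hsum : ∑ i, (P.clk (k + 1) i - P.clk k i) * (ℓ'.D i - ℓ.D i) ^ 2 = 0 := by
        refine le_antisymm ?_ (Finset.sum_nonneg hterm)
        simp only [sub_mul, Finset.sum_sub_distrib]
        linarith
      rw [Finset.sum_eq_zero_iff_of_nonneg hterm] at hsum
      have hclk : ∀ i, P.clk (k + 1) i = P.clk k i ∨ ℓ'.D i = ℓ.D i := fun i => by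
        rcases mul_eq_zero.1 (hsum i (Finset.mem_univ i)) with h | h
        · exact Or.inl (by linarith)
        · exact Or.inr (by have := pow_eq_zero_iff (two_ne_zero) |>.1 h; linarith)
      have hpos' : ℓ'.pos P (k + 1) = ℓ.pos P (k + 1) := by
        ext i
        have := congrFun hpos i
        simp only [Line.pos] at this ⊢
        rcases hclk i with h | h
        · rw [h, this]
        · rw [h] at this ⊢; linarith
      have hz' : ℓ'.z P (k + 1) = ℓ.z P (k + 1) := by
        have h1 : ∑ i, (P.clk (k + 1) i - P.clk k i) * ℓ'.D i ^ 2 =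
            ∑ i, (P.clk (k + 1) i - P.clk k i) * ℓ.D i ^ 2 :=
          Finset.sum_congr rfl fun i _ => by
            rcases hclk i with h | h
            · rw [h]; ring
            · rw [h]
        simp only [sub_mul, Finset.sum_sub_distrib] at h1
        simp only [Line.z] at hz ⊢
        linarith
      -- At level `0` the vertex does not record the second index; it is recovered from the fact
      -- that `v` reaches the line.
      have hj' : ℓ'.j = ℓ.j := by simpa [copy, Par.node] using hcv
      have := Mem.node (P := P) (ℓ := ℓ) (k + 1) hk'
      simpa only [Par.node, hpos', hz', hj', hi] using this
    | enter => simp [IsSlice] at hslice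
    | rise => simp [Par.node] at hw
    | exit => simp [Par.node] at hw
    | land => simp [Par.node] at hw
    | tail j β η r hj hβ hη hr =>
      simp only [Par.node, Vert.core.injEq] at hw
      obtain ⟨-, hj, rfl, rfl, rfl⟩ := hw
      rw [if_neg hN.ne'] at hj
      subst hj
      exact Mem.tail r hr
    | next => simp [Par.node] at hw
    | extra => simp [Par.node] at hw

end Par

end CertifiedShortcuts

/-! ### The line system of the directed construction -/

namespace CertifiedShortcuts

namespace Par

open Relation

variable (P : Par)

theorem mem_closed {ℓ : Line} {x y w : Vert} (hx : P.Mem ℓ x) (hy : P.Mem ℓ y)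
    (hxw : ReflTransGen P.Adj x w) (hwy : ReflTransGen P.Adj w y) : P.Mem ℓ w := by
  induction hxw using ReflTransGen.head_induction_on with
  | refl => exact hx
  | head h h' ih => exact ih (hx.of_adj hy h (h'.trans hwy))

variable {P}

theorem Mem.data {ℓ ℓ' : Line} {v : Vert} (h : P.Mem ℓ v) (h' : P.Mem ℓ' v) :
    ℓ.pos P (P.level v) = ℓ'.pos P (P.level v) ∧ ℓ.z P (P.level v) = ℓ'.z P (P.level v) ∧
      (P.level v < P.N → ℓ.i = ℓ'.i) ∧ (0 < P.level v → ℓ.j = ℓ'.j) := by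
  have hN := P.N_pos
  cases h with
  | leaf r =>
    generalize hw : Vert.leaf ℓ.i (ℓ.pos P 0) (ℓ.z P 0) r = w at h'
    cases h' with
    | leaf => simp only [Vert.leaf.injEq] at hw; simp [level, hw.1, hw.2.1, hw.2.2.1]
    | _ => simp [Par.node] at hw
  | tail r =>
    generalize hw : Vert.tail ℓ.j (ℓ.pos P P.N) (ℓ.z P P.N) r = w at h'
    cases h' with
    | tail => simp only [Vert.tail.injEq] at hw; simp [level, hw.1, hw.2.1, hw.2.2.1]
    | _ => simp [Par.node] at hw
  | node k hk =>
    generalize hw : P.node ℓ k = w at h'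
    cases h' with
    | node k' hk' =>
      simp only [Par.node, Vert.core.injEq] at hw
      obtain ⟨hi, hj, rfl, hp, hz⟩ := hw
      refine ⟨hp, hz, fun h => ?_, fun h => ?_⟩
      · simp only [level, Par.node] at h
        rwa [if_neg h.ne, if_neg h.ne] at hi
      · simp only [level, Par.node] at h
        rwa [if_neg h.ne', if_neg h.ne'] at hj
    | _ => simp [Par.node] at hw

theorem Mem.level_le {ℓ : Line} {v : Vert} (h : P.Mem ℓ v) : P.level v ≤ P.N := by
  cases h with
  | leaf => simp [level]
  | node k hk => exact hk
  | tail => simp [level]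

/-- Two members of a line whose levels differ by at least three determine the line. -/
theorem Mem.eq_of_level {ℓ ℓ' : Line} {x y : Vert} (h1 : P.Mem ℓ x) (h2 : P.Mem ℓ y)
    (h3 : P.Mem ℓ' x) (h4 : P.Mem ℓ' y) (h : P.level x + 3 ≤ P.level y) : ℓ = ℓ' := by
  have hy := h2.level_le
  obtain ⟨px, zx, ix, -⟩ := h1.data h3
  obtain ⟨py, -, -, jy⟩ := h2.data h4
  -- Each coordinate has moved between the two levels, and two positions at different times
  -- determine its speed.
  have hD : ∀ i, ℓ.D i = ℓ'.D i := fun i => by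
    have e1 := congrFun px i
    have e2 := congrFun py i
    simp only [Line.pos] at e1 e2
    have hc := P.clk_lt h hy i
    have : (P.clk (P.level y) i - P.clk (P.level x) i) * (ℓ.D i - ℓ'.D i) = 0 := by linarith
    rcases mul_eq_zero.1 this with h | h <;> linarith
  have hα : ∀ i, ℓ.α i = ℓ'.α i := fun i => by
    have e1 := congrFun px i
    simp only [Line.pos] at e1
    rw [hD i] at e1
    exact_mod_cast add_right_cancel e1
  have hβ : ∀ i, ℓ.β i = ℓ'.β i := fun i => by
    have e1 := hD i
    simp only [Line.D, hα i] at e1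
    exact_mod_cast sub_left_injective e1
  have hζ : ℓ.ζ = ℓ'.ζ := by
    simp only [Line.z, hD] at zx
    exact_mod_cast add_right_cancel zx
  -- The lower vertex lies below level `N` and so shows the first index; the upper one lies above
  -- level `0` and shows the second.
  exact Line.ext (ix (by omega)) (jy (by omega)) (funext hα) (funext hβ) hζ

variable (P)

/-- All clocks end at `1`, so the total climb is the integer sum of the `(β i - α i) ^ 2`, at most
`3 * s ^ 2` for valid lines. -/
theorem z_N (ℓ : Line) : ∃ η : ℕ, ℓ.z P P.N = η ∧ (ℓ.Valid P → η < 4 * P.s ^ 2) := by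
  refine ⟨(ℓ.ζ + ∑ i, ((ℓ.β i : ℤ) - ℓ.α i) ^ 2).toNat, ?_, fun h => ?_⟩
  · have h0 : 0 ≤ ∑ i, ((ℓ.β i : ℤ) - ℓ.α i) ^ 2 := Finset.sum_nonneg fun i _ => sq_nonneg _
    have e : (((ℓ.ζ + ∑ i, ((ℓ.β i : ℤ) - ℓ.α i) ^ 2).toNat : ℤ) : ℚ) =
      ((ℓ.ζ + ∑ i, ((ℓ.β i : ℤ) - ℓ.α i) ^ 2 : ℤ) : ℚ) := by
        rw [Int.toNat_of_nonneg (by positivity)]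
    rw [← Int.cast_natCast (R := ℚ) (Int.toNat _), e]
    simp [Line.z, P.clk_N, Line.D]
  · have h0 : ∀ i, ((ℓ.β i : ℤ) - ℓ.α i) ^ 2 ≤ (P.s : ℤ) ^ 2 := fun i => by
      have := h.α_lt i
      have := h.β_lt i
      refine sq_le_sq' ?_ ?_ <;> omega
    have h1 : ∑ i, ((ℓ.β i : ℤ) - ℓ.α i) ^ 2 ≤ ∑ _i : Fin 3, (P.s : ℤ) ^ 2 :=
      Finset.sum_le_sum fun i _ => h0 i
    have h2 : (ℓ.ζ : ℤ) < (P.s : ℤ) ^ 2 := by exact_mod_cast h.ζ_lt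
    rw [Finset.sum_const, Finset.card_univ, Fintype.card_fin] at h1
    have h3 : 0 < P.s ^ 2 := pow_pos P.s_pos 2
    zify at h3 ⊢
    simp only [nsmul_eq_mul, Nat.cast_ofNat] at h1
    omega

theorem reach_node {ℓ : Line} (hℓ : ℓ.Valid P) {k k' : ℕ} (h : k ≤ k') (h' : k' ≤ P.N) :
    ReflTransGen P.Adj (P.node ℓ k) (P.node ℓ k') := by
  induction k', h using Nat.le_induction with
  | base => exact .refl
  | succ k' hk ih => exact (ih (by omega)).tail (.line ℓ k' hℓ h' _ _ rfl rfl)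

/-- The tail vertices that follow a vertex. -/
noncomputable def tailsOf : Vert → Finset Vert
  | .core _ j _ x z => (Finset.range P.Y).image fun r => .tail j x z r
  | _ => ∅

theorem card_tailsOf (i j k : ℕ) (x : Fin 3 → ℚ) (z : ℚ) :
    (P.tailsOf (.core i j k x z)).card = P.Y := by
  classical
  rw [tailsOf, Finset.card_image_of_injective, Finset.card_range]
  intro r r' h
  simpa using h

/-- The lines of the construction. -/
noncomputable def lineSystem : LineSystem P.graph {ℓ : Line // ℓ.Valid P} P.N P.W P.Y where
  mem ℓ := P.Mem ℓ
  φ := P.level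
  rk := P.rank
  rk_lt _ _ h := P.rank_lt h
  φ_adj _ _ _ hx hy h := P.level_le_add_one h hx.not_isSlice hy.not_isSlice
  φ_mono _ _ _ _ _ h := P.level_le_of_reach h.to_reflTransGen
  closed _ _ _ _ hx hy h h' := P.mem_closed hx hy h.to_reflTransGen h'.to_reflTransGen
  ident _ _ _ _ h1 h2 h3 h4 h := Subtype.ext (h1.eq_of_level h2 h3 h4 h)
  src ℓ := P.node ℓ 0
  tgt ℓ := P.node ℓ P.N
  src_tgt ℓ := by
    have hr := P.reach_node ℓ.2 (Nat.zero_le P.N) le_rfl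
    refine (reflTransGen_iff_eq_or_transGen.1 hr).resolve_left fun h => ?_
    simp only [node, Vert.core.injEq] at h
    have := P.N_pos
    omega
  leaves ℓ := (Finset.range P.W).image fun r => .leaf ℓ.1.i (ℓ.1.pos P 0) (ℓ.1.z P 0) r
  card_leaves ℓ := by
    rw [Finset.card_image_of_injective, Finset.card_range]
    intro r r' h
    simpa using h
  mem_leaves ℓ v hv := by
    obtain ⟨r, hr, rfl⟩ := Finset.mem_image.1 hv
    refine ⟨.leaf r (Finset.mem_range.1 hr), rfl, ?_⟩
    have := Adj.leaf (P := P) ℓ.1.i ℓ.1.α ℓ.1.ζ r ℓ.2.i_lt ℓ.2.α_lt ℓ.2.ζ_lt (Finset.mem_range.1 hr)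
      _ (ℓ.1.pos_zero P) _ (ℓ.1.z_zero P)
    simpa [graph, node, P.N_pos.ne] using this
  tails := P.tailsOf
  card_tails ℓ := (P.card_tailsOf _ _ _ _ _).ge
  mem_tails ℓ v hv := by
    obtain ⟨η, hη, hη'⟩ := P.z_N ℓ
    rw [node, tailsOf] at hv
    obtain ⟨r, hr, rfl⟩ := Finset.mem_image.1 hv
    have h := Adj.tail (P := P) ℓ.1.j ℓ.1.β η r ℓ.2.j_lt ℓ.2.β_lt (hη' ℓ.2) (Finset.mem_range.1 hr)
      _ (ℓ.1.pos_N P) _ hη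
    have hm := Mem.tail (P := P) (ℓ := ℓ) r (Finset.mem_range.1 hr)
    rw [if_neg P.N_pos.ne']
    refine ⟨hm, rfl, ?_⟩
    simpa [graph, node, P.N_pos.ne'] using h

end Par

/-! ### Restriction to finite vertex sets -/

section Comap

variable {V V' : Type*} {G : Digraph V}

/-- No walk leaves the range of `e`, because all edges have both ends in it. -/
theorem transGen_comap {e : V' → V}
    (hr : ∀ u v, G.Adj u v → u ∈ Set.range e ∧ v ∈ Set.range e) {x y : V'} :
    Relation.TransGen (fun a b => G.Adj (e a) (e b)) x y ↔ Relation.TransGen G.Adj (e x) (e y) := by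
  constructor
  · intro h
    induction h with
    | single h => exact .single h
    | tail _ h ih => exact ih.tail h
  · intro h
    generalize hy : e y = w at h
    induction h generalizing y with
    | single h => subst hy; exact .single h
    | @tail b c hb h ih =>
      subst hy
      obtain ⟨b', rfl⟩ := (hr _ _ h).1
      exact (ih rfl).tail h

theorem LineSystem.exists_src_tgt {Λ : Type*} {N W Y : ℕ} (D : LineSystem G Λ N W Y) (e : V' → V)
    (hr : ∀ u v, G.Adj u v → u ∈ Set.range e ∧ v ∈ Set.range e) :
    ∃ src tgt : Λ → V', (∀ ℓ, e (src ℓ) = D.src ℓ) ∧ ∀ ℓ, e (tgt ℓ) = D.tgt ℓ := by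
  have h1 : ∀ ℓ, ∃ v, e v = D.src ℓ := fun ℓ => by
    obtain ⟨w, h, -⟩ := Relation.TransGen.head'_iff.1 (D.src_tgt ℓ)
    exact (hr _ _ h).1
  have h2 : ∀ ℓ, ∃ v, e v = D.tgt ℓ := fun ℓ => by
    obtain ⟨w, -, h⟩ := Relation.TransGen.tail'_iff.1 (D.src_tgt ℓ)
    exact (hr _ _ h).2
  choose src hsrc using h1
  choose tgt htgt using h2
  exact ⟨src, tgt, hsrc, htgt⟩

/-- The restriction of a system of lines to a set that contains all edges. -/
noncomputable def LineSystem.comap {Λ : Type*} {N W Y : ℕ} (D : LineSystem G Λ N W Y) (e : V' → V)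
    (he : Function.Injective e)
    (hr : ∀ u v, G.Adj u v → u ∈ Set.range e ∧ v ∈ Set.range e) (src tgt : Λ → V')
    (hsrc : ∀ ℓ, e (src ℓ) = D.src ℓ) (htgt : ∀ ℓ, e (tgt ℓ) = D.tgt ℓ) :
    LineSystem (⟨fun a b => G.Adj (e a) (e b)⟩ : Digraph V') Λ N W Y where
  mem ℓ v := D.mem ℓ (e v)
  φ v := D.φ (e v)
  rk v := D.rk (e v)
  rk_lt _ _ h := D.rk_lt _ _ h
  φ_adj ℓ _ _ hx hy h := D.φ_adj ℓ _ _ hx hy h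
  φ_mono ℓ _ _ hx hy h := D.φ_mono ℓ _ _ hx hy ((transGen_comap hr).1 h)
  closed ℓ _ _ _ hx hy h h' :=
    D.closed ℓ _ _ _ hx hy ((transGen_comap hr).1 h) ((transGen_comap hr).1 h')
  ident ℓ ℓ' _ _ h1 h2 h3 h4 h := D.ident ℓ ℓ' _ _ h1 h2 h3 h4 h
  src := src
  tgt := tgt
  src_tgt ℓ := by
    rw [transGen_comap hr, hsrc, htgt]
    exact D.src_tgt ℓ
  leaves ℓ := (D.leaves ℓ).preimage e he.injOn
  card_leaves ℓ := by
    classical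
    refine (D.card_leaves ℓ).trans (le_of_eq ?_)
    rw [Finset.card_preimage, Finset.filter_true_of_mem]
    exact fun v hv => (hr _ _ (D.mem_leaves ℓ v hv).2.2).1
  mem_leaves ℓ v hv := by
    have := D.mem_leaves ℓ _ (Finset.mem_preimage.1 hv)
    rwa [← hsrc] at this
  tails v := (D.tails (e v)).preimage e he.injOn
  card_tails ℓ := by
    classical
    rw [htgt]
    refine (D.card_tails ℓ).trans (le_of_eq ?_)
    rw [Finset.card_preimage, Finset.filter_true_of_mem]
    exact fun v hv => (hr _ _ (D.mem_tails ℓ v hv).2.2).2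
  mem_tails ℓ v hv := by
    rw [htgt] at hv
    have := D.mem_tails ℓ _ (Finset.mem_preimage.1 hv)
    rwa [← htgt] at this

theorem walkOf_comap {r : V → V → Prop} {e : V' → V} (he : Function.Injective e)
    (hr : ∀ u v, r u v → u ∈ Set.range e ∧ v ∈ Set.range e) {k : ℕ} {x y : V'} :
    WalkOf (fun a b => r (e a) (e b)) k x y ↔ WalkOf r k (e x) (e y) := by
  constructor
  · intro h
    induction h with
    | nil v => exact .nil _
    | cons h _ ih => exact .cons h ih
  · intro h
    generalize hx : e x = w at h
    generalize hy : e y = w' at h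
    induction h generalizing x with
    | nil v => subst hx; rw [he hy]; exact .nil _
    | cons h _ ih =>
      subst hx
      obtain ⟨b', rfl⟩ := (hr _ _ h).2
      exact .cons h (ih rfl hy)

theorem stepDist_comap {r : V → V → Prop} {e : V' → V} (he : Function.Injective e)
    (hr : ∀ u v, r u v → u ∈ Set.range e ∧ v ∈ Set.range e) (x y : V') :
    stepDist (fun a b => r (e a) (e b)) x y = stepDist r (e x) (e y) := by
  simp only [stepDist, walkOf_comap he hr]

end Comap

end CertifiedShortcuts

/-! ### Counting the vertices and edges of the lines -/

namespace CertifiedShortcuts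

instance : Inhabited Line := ⟨⟨0, 0, 0, 0, 0⟩⟩

namespace Line

variable (P : Par)

theorem pos_nonneg (ℓ : Line) {k : ℕ} (hk : k ≤ P.N) (i : Fin 3) : 0 ≤ ℓ.pos P k i := by
  have h0 := P.clk_nonneg hk i
  have h1 := P.clk_le_one hk i
  have e : ℓ.pos P k i = (1 - P.clk k i) * ℓ.α i + P.clk k i * ℓ.β i := by
    simp only [pos, D]; ring
  rw [e]
  have := sub_nonneg.2 h1
  positivity

theorem Valid.pos_le {P : Par} {ℓ : Line} (h : ℓ.Valid P) {k : ℕ} (hk : k ≤ P.N) (i : Fin 3) :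
    ℓ.pos P k i ≤ P.s - 1 := by
  have h0 := P.clk_nonneg hk i
  have h1 := P.clk_le_one hk i
  have e : ℓ.pos P k i = (1 - P.clk k i) * ℓ.α i + P.clk k i * ℓ.β i := by
    simp only [pos, D]; ring
  have ha : (ℓ.α i : ℚ) + 1 ≤ P.s := by exact_mod_cast h.α_lt i
  have hb : (ℓ.β i : ℚ) + 1 ≤ P.s := by exact_mod_cast h.β_lt i
  rw [e]
  have h2 : (1 - P.clk k i) * (ℓ.α i : ℚ) ≤ (1 - P.clk k i) * (P.s - 1) :=
    mul_le_mul_of_nonneg_left (by linarith) (sub_nonneg.2 h1)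
  have h3 : P.clk k i * (ℓ.β i : ℚ) ≤ P.clk k i * (P.s - 1) :=
    mul_le_mul_of_nonneg_left (by linarith) h0
  linarith

theorem z_nonneg (ℓ : Line) {k : ℕ} (hk : k ≤ P.N) : 0 ≤ ℓ.z P k := by
  have : 0 ≤ ∑ i, P.clk k i * ℓ.D i ^ 2 :=
    Finset.sum_nonneg fun i _ => mul_nonneg (P.clk_nonneg hk i) (sq_nonneg _)
  unfold z
  positivity

theorem Valid.z_lt {P : Par} {ℓ : Line} (h : ℓ.Valid P) {k : ℕ} (hk : k ≤ P.N) :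
    ℓ.z P k < 4 * P.s ^ 2 := by
  have h0 : ∀ i, P.clk k i * ℓ.D i ^ 2 ≤ (P.s : ℚ) ^ 2 := fun i => by
    have ha : (ℓ.α i : ℚ) + 1 ≤ P.s := by exact_mod_cast h.α_lt i
    have hb : (ℓ.β i : ℚ) + 1 ≤ P.s := by exact_mod_cast h.β_lt i
    have h1 : ℓ.D i ^ 2 ≤ (P.s : ℚ) ^ 2 := by
      have : (0 : ℚ) ≤ ℓ.α i := by positivity
      have : (0 : ℚ) ≤ ℓ.β i := by positivity
      refine sq_le_sq' ?_ ?_ <;> simp only [D] <;> linarith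
    calc P.clk k i * ℓ.D i ^ 2 ≤ 1 * ℓ.D i ^ 2 :=
          mul_le_mul_of_nonneg_right (P.clk_le_one hk i) (sq_nonneg _)
      _ ≤ _ := by linarith
  have h1 : ∑ i, P.clk k i * ℓ.D i ^ 2 ≤ ∑ _i : Fin 3, (P.s : ℚ) ^ 2 :=
    Finset.sum_le_sum fun i _ => h0 i
  rw [Finset.sum_const, Finset.card_univ, Fintype.card_fin, nsmul_eq_mul] at h1
  have h2 : (ℓ.ζ : ℚ) < (P.s : ℚ) ^ 2 := by exact_mod_cast h.ζ_lt
  unfold z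
  push_cast at h1
  linarith

/-- The heights of two lines at the same position differ by an integer. -/
theorem exists_int_z_sub {ℓ ℓ' : Line} {k : ℕ} (h : ℓ.pos P k = ℓ'.pos P k) :
    ∃ m : ℤ, ℓ.z P k - ℓ'.z P k = m := by
  refine ⟨ℓ.ζ - ℓ'.ζ + ∑ i, ((ℓ'.α i : ℤ) - ℓ.α i) *
    ((ℓ.β i - ℓ.α i) + (ℓ'.β i - ℓ'.α i)), ?_⟩
  -- Equal positions give `clk * (D - D') = α' - α`, an integer, and multiplying by the integer `D +
  -- D'` gives the difference of the climbs.
  have : ∑ i, P.clk k i * ℓ.D i ^ 2 - ∑ i, P.clk k i * ℓ'.D i ^ 2 =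
      ∑ i, ((ℓ'.α i : ℚ) - ℓ.α i) * (ℓ.D i + ℓ'.D i) := by
    rw [← Finset.sum_sub_distrib]
    refine Finset.sum_congr rfl fun i _ => ?_
    have := congrFun h i
    simp only [pos] at this
    have e : (ℓ'.α i : ℚ) - ℓ.α i = P.clk k i * (ℓ.D i - ℓ'.D i) := by linarith
    rw [e]; ring
  push_cast
  simp only [z, D] at this ⊢
  linarith

/-- The positions at a given level have bounded denominators. -/
theorem Valid.exists_num {P : Par} {ℓ : Line} (h : ℓ.Valid P) {k : ℕ} (hk : k ≤ P.N) (i : Fin 3) :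
    ∃ m < 4 * P.B * P.s, ℓ.pos P k i * (P.clk k i).den = m := by
  set q := P.clk k i with hq
  have hden : (q * q.den : ℚ) = q.num := Rat.mul_den_eq_num q
  have e : ℓ.pos P k i * q.den =
      ((q.den * ℓ.α i + q.num * (ℓ.β i - ℓ.α i) : ℤ) : ℚ) := by
    simp only [pos, D, ← hq]
    push_cast
    rw [← hden]
    ring
  have hdpos : (0 : ℚ) < q.den := by exact_mod_cast q.den_pos
  have h0 : 0 ≤ ℓ.pos P k i * q.den := mul_nonneg (ℓ.pos_nonneg P hk i) hdpos.le
  have h0' : 0 ≤ (q.den * ℓ.α i + q.num * (ℓ.β i - ℓ.α i) : ℤ) := by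
    rw [e] at h0; exact_mod_cast h0
  obtain ⟨m, hm⟩ := Int.eq_ofNat_of_zero_le h0'
  refine ⟨m, ?_, ?_⟩
  · have h1 : ℓ.pos P k i * q.den < 4 * P.B * P.s := by
      have h2 := h.pos_le hk i
      have h3 : (q.den : ℚ) ≤ 4 * P.B := by exact_mod_cast P.f_den _
      have hs : (0 : ℚ) < P.s := by exact_mod_cast P.s_pos
      calc ℓ.pos P k i * q.den ≤ (P.s - 1) * q.den := mul_le_mul_of_nonneg_right h2 hdpos.le
        _ < P.s * q.den := by linarith
        _ ≤ P.s * (4 * P.B) := mul_le_mul_of_nonneg_left h3 hs.le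
        _ = _ := by ring
    rw [e, hm] at h1
    exact_mod_cast h1
  · rw [e, hm]; simp

end Line

namespace Par

variable (P : Par)

/-- The positions in the cube. -/
def cube : Finset (Fin 3 → ℕ) := Fintype.piFinset fun _ => Finset.range P.s

theorem mem_cube {x : Fin 3 → ℕ} : x ∈ P.cube ↔ ∀ i, x i < P.s := by simp [cube]

theorem card_cube : P.cube.card = P.s ^ 3 := by simp [cube]

/-- The lines of the construction. -/
noncomputable def lines : Finset Line :=
  (Finset.range P.N₁ ×ˢ Finset.range P.N₂ ×ˢ P.cube ×ˢ P.cube ×ˢ Finset.range (P.s ^ 2)).image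
    fun p => ⟨p.1, p.2.1, p.2.2.1, p.2.2.2.1, p.2.2.2.2⟩

theorem mem_lines {ℓ : Line} : ℓ ∈ P.lines ↔ ℓ.Valid P := by
  simp only [lines, Finset.mem_image, Finset.mem_product, Finset.mem_range, mem_cube, Prod.exists]
  constructor
  · rintro ⟨i, j, a, b, c, ⟨h1, h2, h3, h4, h5⟩, rfl⟩
    exact ⟨h1, h2, h3, h4, h5⟩
  · intro h
    exact ⟨ℓ.i, ℓ.j, ℓ.α, ℓ.β, ℓ.ζ, ⟨h.1, h.2, h.3, h.4, h.5⟩, rfl⟩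

theorem card_lines : P.lines.card = P.N₁ * P.N₂ * P.s ^ 8 := by
  classical
  rw [lines, Finset.card_image_of_injective]
  · simp only [Finset.card_product, Finset.card_range, card_cube]; ring
  · rintro ⟨i, j, a, b, c⟩ ⟨i', j', a', b', c'⟩ h
    simpa using h

noncomputable instance : Fintype {ℓ : Line // ℓ.Valid P} :=
  Fintype.subtype P.lines fun _ => P.mem_lines

theorem card_validLines : Fintype.card {ℓ : Line // ℓ.Valid P} = P.N₁ * P.N₂ * P.s ^ 8 := by
  rw [Fintype.card_of_subtype P.lines fun _ => P.mem_lines, card_lines]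

/-- The number of vertices at a level whose height lies in a window of length `M`, depending on
the position. -/
theorem card_core_le {k : ℕ} (hk : k ≤ P.N) (A : Finset (ℕ × ℕ)) (low : (Fin 3 → ℚ) → ℚ) (M : ℕ)
    (S : Finset Vert) (hS : ∀ v ∈ S, ∃ ℓ : Line, ℓ.Valid P ∧ ∃ a ∈ A,
      v = .core a.1 a.2 k (ℓ.pos P k) (ℓ.z P k) ∧ low (ℓ.pos P k) ≤ ℓ.z P k ∧
      ℓ.z P k < low (ℓ.pos P k) + M) :
    S.card ≤ A.card * ((4 * P.B * P.s) ^ 3 * M) := by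
  classical
  -- A vertex is encoded by the numerators of its position and the integer part of its height above
  -- `low`. Heights over the same position differ by integers, so rounding loses nothing.
  let g : Vert → (ℕ × ℕ) × (Fin 3 → ℕ) × ℕ := fun v => match v with
    | .core i j _ x z => ((i, j), fun c => ⌊x c * (P.clk k c).den⌋₊, ⌊z - low x⌋₊)
    | _ => 0
  have hcard : (A ×ˢ (Fintype.piFinset fun _ : Fin 3 => Finset.range (4 * P.B * P.s)) ×ˢ
      Finset.range M).card = A.card * ((4 * P.B * P.s) ^ 3 * M) := by simp
  rw [← hcard]
  refine Finset.card_le_card_of_injOn g ?_ ?_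
  · intro v hv
    obtain ⟨ℓ, hℓ, a, ha, rfl, h1, h2⟩ := hS v hv
    simp only [Finset.coe_product, Set.mem_prod, Finset.mem_coe, Fintype.mem_piFinset,
      Finset.mem_range, g]
    refine ⟨ha, fun c => ?_, ?_⟩
    · obtain ⟨m, hm, e⟩ := hℓ.exists_num hk c
      rw [e, Nat.floor_natCast]
      exact hm
    · rw [Nat.floor_lt (by linarith)]
      linarith
  · intro v hv v' hv' h
    obtain ⟨ℓ, hℓ, a, ha, rfl, h1, h2⟩ := hS v hv
    obtain ⟨ℓ', hℓ', a', ha', rfl, h1', h2'⟩ := hS v' hv'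
    simp only [g, Prod.mk.injEq] at h
    obtain ⟨⟨hi, hj⟩, hx, hz⟩ := h
    have hpos : ℓ.pos P k = ℓ'.pos P k := by
      ext c
      have := congrFun hx c
      obtain ⟨m, _, e⟩ := hℓ.exists_num hk c
      obtain ⟨m', _, e'⟩ := hℓ'.exists_num hk c
      rw [e, e', Nat.floor_natCast, Nat.floor_natCast] at this
      have hd : ((P.clk k c).den : ℚ) ≠ 0 := by exact_mod_cast (P.clk k c).den_pos.ne'
      apply mul_right_cancel₀ hd
      rw [e, e', this]
    have hzz : ℓ.z P k = ℓ'.z P k := by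
      obtain ⟨m, hm⟩ := Line.exists_int_z_sub P hpos
      rw [← hpos] at hz h1'
      have f1 := Nat.floor_le (sub_nonneg.2 h1)
      have f2 := Nat.lt_floor_add_one (ℓ.z P k - low (ℓ.pos P k))
      have f3 := Nat.floor_le (sub_nonneg.2 h1')
      have f4 := Nat.lt_floor_add_one (ℓ'.z P k - low (ℓ.pos P k))
      rw [hz] at f1 f2
      have g1 : (m : ℚ) < 1 := by linarith
      have g2 : (-1 : ℚ) < m := by linarith
      have g1' : m < 1 := by exact_mod_cast g1
      have g2' : -1 < m := by exact_mod_cast g2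
      have : m = 0 := by omega
      rw [this] at hm
      push_cast at hm
      linarith
    rw [hi, hj, hpos, hzz]

theorem prod_ite_fin_three (c : Fin 3) (a b : ℕ) :
    ∏ i : Fin 3, (if i = c then a else b) = a * b ^ 2 := by
  fin_cases c <;> simp [Fin.prod_univ_three] <;> ring

theorem clk_succ_eq {k : ℕ} {c : Fin 3} (h : (c : ℕ) ≠ k % 3) : P.clk (k + 1) c = P.clk k c := by
  have : (k + 1 + 2 - (c : ℕ)) / 3 = (k + 2 - (c : ℕ)) / 3 := by omega
  rw [clk, clk, this]

theorem z_eq_of_floor_eq {ℓ ℓ' : Line} {k : ℕ} (hk : k ≤ P.N) (hpos : ℓ.pos P k = ℓ'.pos P k)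
    (h : ⌊ℓ.z P k⌋₊ = ⌊ℓ'.z P k⌋₊) : ℓ.z P k = ℓ'.z P k := by
  obtain ⟨m, hm⟩ := Line.exists_int_z_sub P hpos
  have f1 := Nat.floor_le (ℓ.z_nonneg P hk)
  have f2 := Nat.lt_floor_add_one (ℓ.z P k)
  have f3 := Nat.floor_le (ℓ'.z_nonneg P hk)
  have f4 := Nat.lt_floor_add_one (ℓ'.z P k)
  rw [h] at f1 f2
  have g1 : (m : ℚ) < 1 := by linarith
  have g2 : (-1 : ℚ) < m := by linarith
  have g1' : m < 1 := by exact_mod_cast g1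
  have g2' : -1 < m := by exact_mod_cast g2
  have : m = 0 := by omega
  rw [this] at hm
  push_cast at hm
  linarith

/-- An edge along a line is determined by the data that are counted. -/
theorem node_eq_node {ℓ ℓ' : Line} {k : ℕ} (hk : k < P.N) {c₀ : Fin 3} (hc₀ : (c₀ : ℕ) = k % 3)
    (hi : ℓ.i = ℓ'.i) (hj : ℓ.j = ℓ'.j) (hα : ℓ.α c₀ = ℓ'.α c₀) (hβ : ℓ.β c₀ = ℓ'.β c₀)
    (hx : ∀ c, c ≠ c₀ → ℓ.pos P k c = ℓ'.pos P k c) (hz : ⌊ℓ.z P k⌋₊ = ⌊ℓ'.z P k⌋₊) :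
    P.node ℓ k = P.node ℓ' k ∧ P.node ℓ (k + 1) = P.node ℓ' (k + 1) := by
  have hD : ℓ.D c₀ = ℓ'.D c₀ := by simp only [Line.D, hα, hβ]
  have hpos : ℓ.pos P k = ℓ'.pos P k := by
    ext c
    by_cases hc : c = c₀
    · subst hc; simp only [Line.pos, hα, hD]
    · exact hx c hc
  have hzz := P.z_eq_of_floor_eq hk.le hpos hz
  have hstep : ∀ c, P.clk (k + 1) c = P.clk k c ∨ ℓ.D c = ℓ'.D c := fun c => by
    by_cases hc : c = c₀
    · subst hc; exact Or.inr hD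
    · exact Or.inl (P.clk_succ_eq fun h => hc (Fin.ext (h.trans hc₀.symm)))
  have hpos' : ℓ.pos P (k + 1) = ℓ'.pos P (k + 1) := by
    ext c
    have := congrFun hpos c
    simp only [Line.pos] at this ⊢
    rcases hstep c with h | h
    · rw [h, this]
    · rw [h] at this ⊢; linarith
  have hz' : ℓ.z P (k + 1) = ℓ'.z P (k + 1) := by
    have h1 : ∑ c, (P.clk (k + 1) c - P.clk k c) * ℓ.D c ^ 2 =
        ∑ c, (P.clk (k + 1) c - P.clk k c) * ℓ'.D c ^ 2 :=
      Finset.sum_congr rfl fun c _ => by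
        rcases hstep c with h | h
        · rw [h]; ring
        · rw [h]
    simp only [sub_mul, Finset.sum_sub_distrib] at h1
    simp only [Line.z] at hzz ⊢
    linarith
  simp only [node, hi, hj, hpos, hzz, hpos', hz', and_self]

/-- The number of edges along lines at a level. -/
theorem card_line_edges_le {k : ℕ} (hk : k < P.N) (S : Finset (Vert × Vert))
    (hS : ∀ e ∈ S, ∃ ℓ : Line, ℓ.Valid P ∧ e = (P.node ℓ k, P.node ℓ (k + 1))) :
    S.card ≤ P.N₁ * P.N₂ * (P.s ^ 2 * (4 * P.B * P.s) ^ 2 * (4 * P.s ^ 2)) := by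
  classical
  choose! L hL heq using hS
  -- Only this coordinate moves. An edge is determined by its lower end and the motion in this
  -- coordinate, so the pair of its start and end position replaces the numerator there: a factor `s
  -- ^ 2` instead of `4 * B * s`. The direction in the other coordinates does not matter.
  let c₀ : Fin 3 := ⟨k % 3, Nat.mod_lt _ (by norm_num)⟩
  let g : Vert × Vert → (ℕ × ℕ) × (Fin 3 → ℕ) × ℕ := fun e =>
    (((L e).i, (L e).j), fun c => if c = c₀ then (L e).α c * P.s + (L e).β c else
      ⌊(L e).pos P k c * (P.clk k c).den⌋₊, ⌊(L e).z P k⌋₊)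
  have hcard : ((Finset.range P.N₁ ×ˢ Finset.range P.N₂) ×ˢ
      (Fintype.piFinset fun c : Fin 3 => Finset.range (if c = c₀ then P.s ^ 2 else
        4 * P.B * P.s)) ×ˢ Finset.range (4 * P.s ^ 2)).card =
      P.N₁ * P.N₂ * (P.s ^ 2 * (4 * P.B * P.s) ^ 2 * (4 * P.s ^ 2)) := by
    simp only [Finset.card_product, Finset.card_range, Fintype.card_piFinset, prod_ite_fin_three]
  rw [← hcard]
  refine Finset.card_le_card_of_injOn g ?_ ?_
  · intro e he
    have hv := hL e he
    simp only [Finset.coe_product, Set.mem_prod, Finset.mem_coe, Fintype.mem_piFinset,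
      Finset.mem_range, g]
    refine ⟨⟨hv.i_lt, hv.j_lt⟩, fun c => ?_, ?_⟩
    · split_ifs with h
      · have h1 := hv.α_lt c
        have h2 := hv.β_lt c
        nlinarith
      · obtain ⟨m, hm, e⟩ := hv.exists_num hk.le c
        rw [e, Nat.floor_natCast]
        exact hm
    · rw [Nat.floor_lt ((L e).z_nonneg P hk.le)]
      exact_mod_cast hv.z_lt hk.le
  · intro e he e' he' h
    have hv := hL e he
    have hv' := hL e' he'
    simp only [g, Prod.mk.injEq] at h
    obtain ⟨⟨hi, hj⟩, hx, hz⟩ := h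
    have h0 := congrFun hx c₀
    simp only [if_true] at h0
    have hb := hv.β_lt c₀
    have hb' := hv'.β_lt c₀
    have hα : (L e).α c₀ = (L e').α c₀ := by
      have h1 := congrArg (· / P.s) h0
      simp only [mul_comm _ P.s, Nat.mul_add_div P.s_pos, Nat.div_eq_of_lt hb,
        Nat.div_eq_of_lt hb'] at h1
      omega
    have hβ : (L e).β c₀ = (L e').β c₀ := by
      rw [hα] at h0; omega
    obtain ⟨q1, q2⟩ := P.node_eq_node hk (c₀ := c₀) rfl hi hj hα hβ (fun c hc => by
      have h1 := congrFun hx c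
      simp only [if_neg hc] at h1
      obtain ⟨m, _, e⟩ := hv.exists_num hk.le c
      obtain ⟨m', _, e'⟩ := hv'.exists_num hk.le c
      rw [e, e', Nat.floor_natCast, Nat.floor_natCast] at h1
      have hd : ((P.clk k c).den : ℚ) ≠ 0 := by exact_mod_cast (P.clk k c).den_pos.ne'
      apply mul_right_cancel₀ hd
      rw [e, e', h1]) hz
    rw [heq e he, heq e' he', q1, q2]

end Par

end CertifiedShortcuts

/-! ### The finite vertex and edge sets of the directed construction -/

namespace CertifiedShortcuts

namespace Par

variable (P : Par)

/-- The integer vectors `⌊J * clk⌋` increase with the level in each coordinate, so they are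
determined by their coordinate sum, which is at most `3 * J`. The constant vector `1` adds one more.
-/
theorem card_tvecs_le : P.tvecs.card ≤ 3 * P.J + 2 := by
  classical
  have hJ : (12 : ℚ) ≤ P.J := by exact_mod_cast P.J_ge
  refine (Finset.card_insert_le _ _).trans (Nat.succ_le_succ ?_)
  have hval : ∀ k i, P.J * P.tvec k i + 1 = ⌊P.J * P.clk k i⌋ := fun k i => by
    unfold tvec; field_simp; ring
  have hmono : ∀ k k', k ≤ k' → k' < P.N → ∀ i, P.J * P.tvec k i + 1 ≤ P.J * P.tvec k' i + 1 := by
    intro k k' h h' i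
    rw [hval, hval]
    have := P.clk_mono h h'.le i
    exact_mod_cast Int.floor_mono (by gcongr)
  rw [← Finset.card_range (3 * P.J + 1)]
  refine Finset.card_le_card_of_injOn (fun t => ⌊∑ i, (P.J * t i + 1)⌋₊) ?_ ?_
  · intro t ht
    obtain ⟨k, hk, rfl⟩ := Finset.mem_image.1 ht
    rw [Finset.mem_Ico] at hk
    have h1 : ∑ i, (P.J * P.tvec k i + 1) ≤ ∑ _i : Fin 3, (P.J : ℚ) := by
      refine Finset.sum_le_sum fun i _ => ?_
      rw [hval]
      refine (Int.floor_le _).trans ?_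
      have := P.clk_le_one hk.2.le i
      nlinarith
    rw [Finset.sum_const, Finset.card_univ, Fintype.card_fin, nsmul_eq_mul] at h1
    simp only [Finset.coe_range, Set.mem_Iio]
    refine Nat.lt_succ_of_le (Nat.floor_le_of_le ?_)
    push_cast at h1 ⊢
    exact h1
  · have key : ∀ k k', k ≤ k' → k' < P.N → ⌊∑ i, (P.J * P.tvec k i + 1)⌋₊ =
        ⌊∑ i, (P.J * P.tvec k' i + 1)⌋₊ → P.tvec k = P.tvec k' := by
      intro k k' h h' he
      have h1 : ∑ i, (P.J * P.tvec k i + 1) = ∑ i, (P.J * P.tvec k' i + 1) := by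
        have e1 : ∀ k, k < P.N → ((⌊∑ i, (P.J * P.tvec k i + 1)⌋₊ : ℤ) : ℚ) =
            ∑ i, (P.J * P.tvec k i + 1) := fun k hk => by
          have h0 : ∀ i ∈ Finset.univ, (0 : ℚ) ≤ ⌊P.J * P.clk k i⌋ := fun i _ => by
            have := P.clk_nonneg hk.le i
            exact_mod_cast Int.floor_nonneg.2 (by positivity)
          simp only [hval]
          have h1 : (∑ i, (⌊P.J * P.clk k i⌋ : ℚ)) = ((∑ i, ⌊P.J * P.clk k i⌋ : ℤ) : ℚ) := by
            push_cast; rfl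
          rw [Int.natCast_floor_eq_floor (Finset.sum_nonneg h0), h1, Int.floor_intCast]
        rw [← e1 k (by omega), ← e1 k' h', he]
      rw [Finset.sum_eq_sum_iff_of_le fun i _ => hmono k k' h h' i] at h1
      ext i
      have := h1 i (Finset.mem_univ i)
      have h2 : (P.J : ℚ) ≠ 0 := by positivity
      exact mul_left_cancel₀ h2 (add_right_cancel this)
    intro t ht t' ht' h
    obtain ⟨k, hk, rfl⟩ := Finset.mem_image.1 ht
    obtain ⟨k', hk', rfl⟩ := Finset.mem_image.1 ht'
    rw [Finset.mem_Ico] at hk hk'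
    rcases le_total k k' with hkk | hkk
    · exact key k k' hkk hk'.2 h
    · exact (key k' k hkk hk.2 h.symm).symm

/-- The vector of a natural vector. -/
abbrev toQ (x : Fin 3 → ℕ) : Fin 3 → ℚ := fun i => x i

/-- The leaves. -/
noncomputable def leafSet : Finset Vert :=
  (Finset.range P.N₁ ×ˢ P.cube ×ˢ Finset.range (P.s ^ 2) ×ˢ Finset.range P.W).image
    fun p => .leaf p.1 (toQ p.2.1) p.2.2.1 p.2.2.2

/-- The vertices on lines. -/
noncomputable def coreSet : Finset Vert :=
  (Finset.range (P.N + 1)).biUnion fun k => P.lines.image fun ℓ => P.node ℓ k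

/-- The targets. -/
noncomputable def tgtSet : Finset Vert :=
  (Finset.range P.N₂ ×ˢ P.cube ×ˢ Finset.range (4 * P.s ^ 2)).image
    fun p => .core 0 p.1 P.N (toQ p.2.1) p.2.2

/-- The vertices of the first half of the slices. -/
noncomputable def slice₁Set : Finset Vert :=
  (Finset.range P.N₁ ×ˢ Finset.range P.N₂ ×ˢ P.tvecs ×ˢ P.cube ×ˢ Finset.range (4 * P.s ^ 2)).image
    fun p => .slice₁ p.1 p.2.1 p.2.2.1 p.2.2.2.1 p.2.2.2.2

/-- The vertices of the second half of the slices. -/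
noncomputable def slice₂Set : Finset Vert :=
  (Finset.range P.N₁ ×ˢ Finset.range P.N₂ ×ˢ P.tvecs ×ˢ P.cube ×ˢ Finset.range (4 * P.s ^ 2)).image
    fun p => .slice₂ p.1 p.2.1 p.2.2.1 p.2.2.2.1 p.2.2.2.2

/-- The tail vertices. -/
noncomputable def tailSet : Finset Vert :=
  (Finset.range P.N₂ ×ˢ P.cube ×ˢ Finset.range (4 * P.s ^ 2) ×ˢ Finset.range P.Y).image
    fun p => .tail p.1 (toQ p.2.1) p.2.2.1 p.2.2.2

theorem mem_leafSet {v : Vert} : v ∈ P.leafSet ↔ ∃ i < P.N₁, ∃ α : Fin 3 → ℕ, (∀ c, α c < P.s) ∧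
    ∃ ζ < P.s ^ 2, ∃ r < P.W, v = .leaf i (toQ α) ζ r := by
  simp only [leafSet, Finset.mem_image, Finset.mem_product, Finset.mem_range, mem_cube, Prod.exists]
  constructor
  · rintro ⟨i, α, ζ, r, ⟨h1, h2, h3, h4⟩, rfl⟩
    exact ⟨i, h1, α, h2, ζ, h3, r, h4, rfl⟩
  · rintro ⟨i, h1, α, h2, ζ, h3, r, h4, rfl⟩
    exact ⟨i, α, ζ, r, ⟨h1, h2, h3, h4⟩, rfl⟩

theorem mem_coreSet {v : Vert} : v ∈ P.coreSet ↔ ∃ ℓ : Line, ℓ.Valid P ∧ ∃ k ≤ P.N,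
    v = P.node ℓ k := by
  simp only [coreSet, Finset.mem_biUnion, Finset.mem_image, Finset.mem_range, mem_lines]
  constructor
  · rintro ⟨k, hk, ℓ, hℓ, rfl⟩
    exact ⟨ℓ, hℓ, k, by omega, rfl⟩
  · rintro ⟨ℓ, hℓ, k, hk, rfl⟩
    exact ⟨k, by omega, ℓ, hℓ, rfl⟩

theorem mem_tgtSet {v : Vert} : v ∈ P.tgtSet ↔ ∃ j < P.N₂, ∃ β : Fin 3 → ℕ, (∀ c, β c < P.s) ∧
    ∃ η < 4 * P.s ^ 2, v = .core 0 j P.N (toQ β) η := by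
  simp only [tgtSet, Finset.mem_image, Finset.mem_product, Finset.mem_range, mem_cube, Prod.exists]
  constructor
  · rintro ⟨i, α, ζ, ⟨h1, h2, h3⟩, rfl⟩
    exact ⟨i, h1, α, h2, ζ, h3, rfl⟩
  · rintro ⟨i, h1, α, h2, ζ, h3, rfl⟩
    exact ⟨i, α, ζ, ⟨h1, h2, h3⟩, rfl⟩

theorem mem_slice₁Set {v : Vert} : v ∈ P.slice₁Set ↔ ∃ i < P.N₁, ∃ j < P.N₂, ∃ t ∈ P.tvecs,
    ∃ x : Fin 3 → ℕ, (∀ c, x c < P.s) ∧ ∃ z < 4 * P.s ^ 2, v = .slice₁ i j t x z := by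
  simp only [slice₁Set, Finset.mem_image, Finset.mem_product, Finset.mem_range, mem_cube,
    Prod.exists]
  constructor
  · rintro ⟨i, j, t, x, z, ⟨h1, h2, h3, h4, h5⟩, rfl⟩
    exact ⟨i, h1, j, h2, t, h3, x, h4, z, h5, rfl⟩
  · rintro ⟨i, h1, j, h2, t, h3, x, h4, z, h5, rfl⟩
    exact ⟨i, j, t, x, z, ⟨h1, h2, h3, h4, h5⟩, rfl⟩

theorem mem_slice₂Set {v : Vert} : v ∈ P.slice₂Set ↔ ∃ i < P.N₁, ∃ j < P.N₂, ∃ t ∈ P.tvecs,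
    ∃ x : Fin 3 → ℕ, (∀ c, x c < P.s) ∧ ∃ z < 4 * P.s ^ 2, v = .slice₂ i j t x z := by
  simp only [slice₂Set, Finset.mem_image, Finset.mem_product, Finset.mem_range, mem_cube,
    Prod.exists]
  constructor
  · rintro ⟨i, j, t, x, z, ⟨h1, h2, h3, h4, h5⟩, rfl⟩
    exact ⟨i, h1, j, h2, t, h3, x, h4, z, h5, rfl⟩
  · rintro ⟨i, h1, j, h2, t, h3, x, h4, z, h5, rfl⟩
    exact ⟨i, j, t, x, z, ⟨h1, h2, h3, h4, h5⟩, rfl⟩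

theorem mem_tailSet {v : Vert} : v ∈ P.tailSet ↔ ∃ j < P.N₂, ∃ β : Fin 3 → ℕ, (∀ c, β c < P.s) ∧
    ∃ η < 4 * P.s ^ 2, ∃ r < P.Y, v = .tail j (toQ β) η r := by
  simp only [tailSet, Finset.mem_image, Finset.mem_product, Finset.mem_range, mem_cube, Prod.exists]
  constructor
  · rintro ⟨i, α, ζ, r, ⟨h1, h2, h3, h4⟩, rfl⟩
    exact ⟨i, h1, α, h2, ζ, h3, r, h4, rfl⟩
  · rintro ⟨i, h1, α, h2, ζ, h3, r, h4, rfl⟩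
    exact ⟨i, α, ζ, r, ⟨h1, h2, h3, h4⟩, rfl⟩

/-- The vertices outside the filling. -/
noncomputable def hard : Finset Vert :=
  P.leafSet ∪ P.coreSet ∪ P.tgtSet ∪ P.slice₁Set ∪ P.slice₂Set ∪ P.tailSet

theorem mem_hard {v : Vert} : v ∈ P.hard ↔ v ∈ P.leafSet ∨ v ∈ P.coreSet ∨ v ∈ P.tgtSet ∨
    v ∈ P.slice₁Set ∨ v ∈ P.slice₂Set ∨ v ∈ P.tailSet := by
  simp [hard]

theorem card_leafSet_le : P.leafSet.card ≤ P.N₁ * P.s ^ 5 * P.W := by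
  refine Finset.card_image_le.trans (le_of_eq ?_)
  simp only [Finset.card_product, Finset.card_range, card_cube]; ring

theorem card_tgtSet_le : P.tgtSet.card ≤ 4 * P.N₂ * P.s ^ 5 := by
  refine Finset.card_image_le.trans (le_of_eq ?_)
  simp only [Finset.card_product, Finset.card_range, card_cube]; ring

theorem card_tailSet_le : P.tailSet.card ≤ 4 * P.N₂ * P.s ^ 5 * P.Y := by
  refine Finset.card_image_le.trans (le_of_eq ?_)
  simp only [Finset.card_product, Finset.card_range, card_cube]; ring

theorem card_slice₁Set_le : P.slice₁Set.card ≤ 4 * P.N₁ * P.N₂ * (3 * P.J + 2) * P.s ^ 5 := by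
  refine Finset.card_image_le.trans ?_
  simp only [Finset.card_product, Finset.card_range, card_cube]
  have := P.card_tvecs_le
  calc _ ≤ P.N₁ * (P.N₂ * ((3 * P.J + 2) * (P.s ^ 3 * (4 * P.s ^ 2)))) := by gcongr
    _ = _ := by ring

theorem card_slice₂Set_le : P.slice₂Set.card ≤ 4 * P.N₁ * P.N₂ * (3 * P.J + 2) * P.s ^ 5 := by
  refine Finset.card_image_le.trans ?_
  simp only [Finset.card_product, Finset.card_range, card_cube]
  have := P.card_tvecs_le
  calc _ ≤ P.N₁ * (P.N₂ * ((3 * P.J + 2) * (P.s ^ 3 * (4 * P.s ^ 2)))) := by gcongr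
    _ = _ := by ring

theorem card_coreSet_le : P.coreSet.card ≤
    (P.N + 1) * (P.N₁ * P.N₂ * ((4 * P.B * P.s) ^ 3 * (4 * P.s ^ 2))) := by
  classical
  refine (Finset.card_biUnion_le_card_mul _ _ (P.N₁ * P.N₂ * ((4 * P.B * P.s) ^ 3 * (4 * P.s ^ 2)))
    fun k hk => ?_).trans (by rw [Finset.card_range])
  rw [Finset.mem_range] at hk
  have := P.card_core_le (k := k) (by omega) (Finset.range P.N₁ ×ˢ Finset.range P.N₂) (fun _ => 0)
    (4 * P.s ^ 2) (P.lines.image fun ℓ => P.node ℓ k) (by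
      intro v hv
      obtain ⟨ℓ, hℓ, rfl⟩ := Finset.mem_image.1 hv
      rw [mem_lines] at hℓ
      refine ⟨ℓ, hℓ, (if k = P.N then 0 else ℓ.i, if k = 0 then 0 else ℓ.j), ?_, rfl,
        ℓ.z_nonneg P (by omega), ?_⟩
      · have h1 := hℓ.i_lt
        have h2 := hℓ.j_lt
        simp only [Finset.mem_product, Finset.mem_range]
        constructor <;> split_ifs <;> omega
      · have := hℓ.z_lt (k := k) (by omega)
        push_cast
        linarith)
  simpa using this

/-- The source of an edge outside the filling lies in the construction. -/
theorem mem_hard_of_adj {u v : Vert} (h : P.Adj u v) :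
    (u ∈ P.hard ∧ v ∈ P.hard) ∨ ∃ r r', u = .extra r ∧ v = .extra r' ∧ r < r' ∧ r' < P.F := by
  have hN := P.N_pos
  have hs := P.s_pos
  have hsrc : ∀ i < P.N₁, ∀ α : Fin 3 → ℕ, (∀ c, α c < P.s) → ∀ ζ < P.s ^ 2,
      Vert.core i 0 0 (toQ α) ζ ∈ P.coreSet := by
    intro i hi α hα ζ hζ
    rw [mem_coreSet]
    -- The resting line with equal start and end shows that every source lies on a line; its second
    -- index is invisible at level `0`.
    refine ⟨⟨i, 0, α, α, ζ⟩, ⟨hi, P.N₂_pos, hα, hα, hζ⟩, 0, Nat.zero_le _, ?_⟩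
    simp [node, hN.ne, Line.pos_zero, Line.z_zero]
  cases h with
  | leaf i α ζ r hi hα hζ hr x hx z hz =>
    subst hx hz
    exact Or.inl ⟨P.mem_hard.2 (Or.inl (P.mem_leafSet.2 ⟨i, hi, α, hα, ζ, hζ, r, hr, rfl⟩)),
      P.mem_hard.2 (Or.inr (Or.inl (hsrc i hi α hα ζ hζ)))⟩
  | line ℓ k hℓ hk _ _ hu hv =>
    subst hu hv
    exact Or.inl ⟨P.mem_hard.2 (Or.inr (Or.inl (P.mem_coreSet.2 ⟨ℓ, hℓ, k, hk.le, rfl⟩))),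
      P.mem_hard.2 (Or.inr (Or.inl (P.mem_coreSet.2 ⟨ℓ, hℓ, k + 1, hk, rfl⟩)))⟩
  | enter i j α ζ t x z hi hj hα hζ ht hx hz hzz a ha b hb =>
    subst ha hb
    exact Or.inl ⟨P.mem_hard.2 (Or.inr (Or.inl (hsrc i hi α hα ζ hζ))),
      P.mem_hard.2 (Or.inr (Or.inr (Or.inr (Or.inl
        (P.mem_slice₁Set.2 ⟨i, hi, j, hj, t, ht, x, hx, z, hz, rfl⟩)))))⟩
  | rise i j t x z z' hi hj ht hx hzz hz =>
    exact Or.inl ⟨P.mem_hard.2 (Or.inr (Or.inr (Or.inr (Or.inl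
        (P.mem_slice₁Set.2 ⟨i, hi, j, hj, t, ht, x, hx, z, by omega, rfl⟩))))),
      P.mem_hard.2 (Or.inr (Or.inr (Or.inr (Or.inr (Or.inl
        (P.mem_slice₂Set.2 ⟨i, hi, j, hj, t, ht, x, hx, z', hz, rfl⟩))))))⟩
  | exit ℓ k hℓ hk hkN x z hx hz hclose hzz v hv =>
    subst hv
    refine Or.inl ⟨P.mem_hard.2 (Or.inr (Or.inr (Or.inr (Or.inr (Or.inl
        (P.mem_slice₂Set.2 ⟨ℓ.i, hℓ.i_lt, ℓ.j, hℓ.j_lt, P.tvec k, ?_, x, hx, z, hz, rfl⟩)))))),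
      P.mem_hard.2 (Or.inr (Or.inl (P.mem_coreSet.2 ⟨ℓ, hℓ, k, hkN.le, rfl⟩)))⟩
    exact Finset.mem_insert_of_mem (Finset.mem_image_of_mem _ (Finset.mem_Ico.2 ⟨hk, hkN⟩))
  | land i j x z hi hj hx hz b hb e he =>
    subst hb he
    exact Or.inl ⟨P.mem_hard.2 (Or.inr (Or.inr (Or.inr (Or.inr (Or.inl
        (P.mem_slice₂Set.2 ⟨i, hi, j, hj, 1, Finset.mem_insert_self _ _, x, hx, z, by omega,
          rfl⟩)))))),
      P.mem_hard.2 (Or.inr (Or.inr (Or.inl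
        (P.mem_tgtSet.2 ⟨j, hj, x, hx, z + 1, hz, by push_cast; rfl⟩))))⟩
  | tail j β η r hj hβ hη hr x hx z hz =>
    subst hx hz
    exact Or.inl ⟨P.mem_hard.2 (Or.inr (Or.inr (Or.inl (P.mem_tgtSet.2 ⟨j, hj, β, hβ, η, hη, rfl⟩)))),
      P.mem_hard.2 (Or.inr (Or.inr (Or.inr (Or.inr (Or.inr
        (P.mem_tailSet.2 ⟨j, hj, β, hβ, η, hη, r, hr, rfl⟩))))))⟩
  | next j β η r hj hβ hη hr x hx z hz =>
    subst hx hz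
    exact Or.inl ⟨P.mem_hard.2 (Or.inr (Or.inr (Or.inr (Or.inr (Or.inr
        (P.mem_tailSet.2 ⟨j, hj, β, hβ, η, hη, r, by omega, rfl⟩)))))),
      P.mem_hard.2 (Or.inr (Or.inr (Or.inr (Or.inr (Or.inr
        (P.mem_tailSet.2 ⟨j, hj, β, hβ, η, hη, r + 1, hr, rfl⟩))))))⟩
  | extra r r' h h' => exact Or.inr ⟨r, r', rfl, rfl, h, h'⟩

/-- An upper bound for the number of vertices outside the filling. -/
def hardBound : ℕ := P.N₁ * P.s ^ 5 * P.W + (P.N + 1) * (P.N₁ * P.N₂ *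
  ((4 * P.B * P.s) ^ 3 * (4 * P.s ^ 2))) + 4 * P.N₂ * P.s ^ 5 +
  2 * (4 * P.N₁ * P.N₂ * (3 * P.J + 2) * P.s ^ 5) + 4 * P.N₂ * P.s ^ 5 * P.Y

theorem card_hard_le : P.hard.card ≤ P.hardBound := by
  classical
  have h1 := P.card_leafSet_le
  have h2 := P.card_coreSet_le
  have h3 := P.card_tgtSet_le
  have h4 := P.card_slice₁Set_le
  have h5 := P.card_slice₂Set_le
  have h6 := P.card_tailSet_le
  have e1 := Finset.card_union_le (P.leafSet ∪ P.coreSet ∪ P.tgtSet ∪ P.slice₁Set ∪ P.slice₂Set)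
    P.tailSet
  have e2 := Finset.card_union_le (P.leafSet ∪ P.coreSet ∪ P.tgtSet ∪ P.slice₁Set) P.slice₂Set
  have e3 := Finset.card_union_le (P.leafSet ∪ P.coreSet ∪ P.tgtSet) P.slice₁Set
  have e4 := Finset.card_union_le (P.leafSet ∪ P.coreSet) P.tgtSet
  have e5 := Finset.card_union_le P.leafSet P.coreSet
  unfold hard hardBound
  omega

/-- An upper bound for the number of edges outside the filling. -/
def edgeBound : ℕ := P.N₁ * P.s ^ 5 * P.W +
  P.N * (P.N₁ * P.N₂ * (P.s ^ 2 * (4 * P.B * P.s) ^ 2 * (4 * P.s ^ 2))) +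
  P.N₁ * P.N₂ * (3 * P.J + 2) * P.s ^ 8 +
  16 * P.N₁ * P.N₂ * (3 * P.J + 2) * P.s ^ 7 +
  (P.N + 1) * (P.N₁ * P.N₂ * ((4 * P.B * P.s) ^ 3 * (4 * P.s ^ 2))) * (16 * P.s / P.J + 4) ^ 3 +
  4 * P.N₁ * P.N₂ * P.s ^ 5 + 2 * (4 * P.N₂ * P.s ^ 5 * P.Y)

/-- A finite set that contains all edges. -/
theorem exists_edges : ∃ E : Finset (Vert × Vert), (∀ u v, P.Adj u v → (u, v) ∈ E) ∧
    E.card ≤ P.edgeBound + P.F ^ 2 := by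
  have hJ : (12 : ℚ) ≤ P.J := by exact_mod_cast P.J_ge
  let R := Finset.range
  let E₁ : Finset (Vert × Vert) := (R P.N₁ ×ˢ P.cube ×ˢ R (P.s ^ 2) ×ˢ R P.W).image
    fun p => (.leaf p.1 (toQ p.2.1) p.2.2.1 p.2.2.2, .core p.1 0 0 (toQ p.2.1) p.2.2.1)
  let E₂ : Finset (Vert × Vert) := (R P.N).biUnion fun k =>
    P.lines.image fun ℓ => (P.node ℓ k, P.node ℓ (k + 1))
  let E₃ : Finset (Vert × Vert) :=
    (R P.N₁ ×ˢ R P.N₂ ×ˢ P.cube ×ˢ R (P.s ^ 2) ×ˢ P.tvecs ×ˢ P.cube).image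
    fun p => (.core p.1 0 0 (toQ p.2.2.1) p.2.2.2.1, .slice₁ p.1 p.2.1 p.2.2.2.2.1 p.2.2.2.2.2
      (p.2.2.2.1 + ⌈∑ i, ((p.2.2.2.2.2 i : ℚ) - p.2.2.1 i) ^ 2 / p.2.2.2.2.1 i⌉).toNat)
  let E₄ : Finset (Vert × Vert) :=
    (R P.N₁ ×ˢ R P.N₂ ×ˢ P.tvecs ×ˢ P.cube ×ˢ R (4 * P.s ^ 2) ×ˢ R (4 * P.s ^ 2)).image
    fun p => (.slice₁ p.1 p.2.1 p.2.2.1 p.2.2.2.1 p.2.2.2.2.1,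
      .slice₂ p.1 p.2.1 p.2.2.1 p.2.2.2.1 p.2.2.2.2.2)
  -- An exit is determined by its upper end and the offset of its lower position in a box of side
  -- `16 * s / J + 4`; the lower height is a function of both.
  let g : Vert × (Fin 3 → ℕ) → Vert × Vert := fun p => match p.1 with
    | .core i j k y z =>
      let x : Fin 3 → ℕ := fun c => (⌈y c - (8 * P.s / P.J + 1)⌉ + (p.2 c : ℤ)).toNat
      (.slice₂ i j (P.tvec k) x
        (⌊z - ∑ c, (y c - x c) ^ 2 / (P.clk k c - P.tvec k c)⌋ - 1).toNat, p.1)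
    | _ => (p.1, p.1)
  let E₅ : Finset (Vert × Vert) :=
    (P.coreSet ×ˢ Fintype.piFinset fun _ => R (16 * P.s / P.J + 4)).image g
  let E₆ : Finset (Vert × Vert) := (R P.N₁ ×ˢ R P.N₂ ×ˢ P.cube ×ˢ R (4 * P.s ^ 2)).image
    fun p => (.slice₂ p.1 p.2.1 1 p.2.2.1 p.2.2.2, .core 0 p.2.1 P.N (toQ p.2.2.1) (p.2.2.2 + 1))
  let E₇ : Finset (Vert × Vert) := (R P.N₂ ×ˢ P.cube ×ˢ R (4 * P.s ^ 2) ×ˢ R P.Y).image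
    fun p => (.core 0 p.1 P.N (toQ p.2.1) p.2.2.1, .tail p.1 (toQ p.2.1) p.2.2.1 p.2.2.2)
  let E₈ : Finset (Vert × Vert) := (R P.N₂ ×ˢ P.cube ×ˢ R (4 * P.s ^ 2) ×ˢ R P.Y).image
    fun p => (.tail p.1 (toQ p.2.1) p.2.2.1 p.2.2.2, .tail p.1 (toQ p.2.1) p.2.2.1 (p.2.2.2 + 1))
  let E₉ : Finset (Vert × Vert) := (R P.F ×ˢ R P.F).image fun p => (.extra p.1, .extra p.2)
  have c₁ : E₁.card ≤ P.N₁ * P.s ^ 5 * P.W := by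
    refine Finset.card_image_le.trans (le_of_eq ?_)
    simp only [R, Finset.card_product, Finset.card_range, card_cube]; ring
  have c₂ : E₂.card ≤
      P.N * (P.N₁ * P.N₂ * (P.s ^ 2 * (4 * P.B * P.s) ^ 2 * (4 * P.s ^ 2))) := by
    refine (Finset.card_biUnion_le_card_mul _ _
      (P.N₁ * P.N₂ * (P.s ^ 2 * (4 * P.B * P.s) ^ 2 * (4 * P.s ^ 2)))
      fun k hk => ?_).trans (by simp only [R, Finset.card_range]; rfl)
    refine P.card_line_edges_le (Finset.mem_range.1 hk) _ fun e he => ?_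
    obtain ⟨ℓ, hℓ, rfl⟩ := Finset.mem_image.1 he
    exact ⟨ℓ, P.mem_lines.1 hℓ, rfl⟩
  have hT := P.card_tvecs_le
  have c₃ : E₃.card ≤ P.N₁ * P.N₂ * (3 * P.J + 2) * P.s ^ 8 := by
    refine Finset.card_image_le.trans ?_
    simp only [R, Finset.card_product, Finset.card_range, card_cube]
    calc _ ≤ P.N₁ * (P.N₂ * (P.s ^ 3 * (P.s ^ 2 * ((3 * P.J + 2) * P.s ^ 3)))) := by gcongr
      _ = _ := by ring
  have c₄ : E₄.card ≤ 16 * P.N₁ * P.N₂ * (3 * P.J + 2) * P.s ^ 7 := by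
    refine Finset.card_image_le.trans ?_
    simp only [R, Finset.card_product, Finset.card_range, card_cube]
    calc _ ≤ P.N₁ * (P.N₂ * ((3 * P.J + 2) * (P.s ^ 3 * ((4 * P.s ^ 2) * (4 * P.s ^ 2))))) := by
          gcongr
      _ = _ := by ring
  have c₅ : E₅.card ≤ (P.N + 1) * (P.N₁ * P.N₂ * ((4 * P.B * P.s) ^ 3 * (4 * P.s ^ 2))) *
      (16 * P.s / P.J + 4) ^ 3 := by
    refine Finset.card_image_le.trans ?_
    simp only [R, Finset.card_product, Fintype.card_piFinset, Finset.card_range, Finset.prod_const,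
      Finset.card_univ, Fintype.card_fin]
    exact Nat.mul_le_mul_right _ P.card_coreSet_le
  have c₆ : E₆.card ≤ 4 * P.N₁ * P.N₂ * P.s ^ 5 := by
    refine Finset.card_image_le.trans (le_of_eq ?_)
    simp only [R, Finset.card_product, Finset.card_range, card_cube]; ring
  have c₇ : E₇.card ≤ 4 * P.N₂ * P.s ^ 5 * P.Y := by
    refine Finset.card_image_le.trans (le_of_eq ?_)
    simp only [R, Finset.card_product, Finset.card_range, card_cube]; ring
  have c₈ : E₈.card ≤ 4 * P.N₂ * P.s ^ 5 * P.Y := by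
    refine Finset.card_image_le.trans (le_of_eq ?_)
    simp only [R, Finset.card_product, Finset.card_range, card_cube]; ring
  have c₉ : E₉.card ≤ P.F ^ 2 := by
    refine Finset.card_image_le.trans (le_of_eq ?_)
    simp only [R, Finset.card_product, Finset.card_range]; ring
  refine ⟨E₁ ∪ (E₂ ∪ (E₃ ∪ (E₄ ∪ (E₅ ∪ (E₆ ∪ (E₇ ∪ (E₈ ∪ E₉))))))), ?_, ?_⟩
  · intro u v h
    simp only [Finset.mem_union]
    cases h with
    | leaf i α ζ r hi hα hζ hr x hx z hz =>
      subst hx hz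
      refine Or.inl (Finset.mem_image.2 ⟨(i, α, ζ, r), ?_, rfl⟩)
      simp only [R, Finset.mem_product, Finset.mem_range, mem_cube]
      exact ⟨hi, hα, hζ, hr⟩
    | line ℓ k hℓ hk _ _ hu hv =>
      subst hu hv
      exact Or.inr (Or.inl (Finset.mem_biUnion.2 ⟨k, Finset.mem_range.2 hk,
        Finset.mem_image.2 ⟨ℓ, P.mem_lines.2 hℓ, rfl⟩⟩))
    | enter i j α ζ t x z hi hj hα hζ ht hx hz hzz a ha b hb =>
      subst ha hb
      refine Or.inr (Or.inr (Or.inl (Finset.mem_image.2 ⟨(i, j, α, ζ, t, x), ?_, ?_⟩)))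
      · simp only [R, Finset.mem_product, Finset.mem_range, mem_cube]
        exact ⟨hi, hj, hα, hζ, ht, hx⟩
      · simp only [← hzz, Int.toNat_natCast]
    | rise i j t x z z' hi hj ht hx hzz hz =>
      refine Or.inr (Or.inr (Or.inr (Or.inl (Finset.mem_image.2 ⟨(i, j, t, x, z, z'), ?_, rfl⟩))))
      simp only [R, Finset.mem_product, Finset.mem_range, mem_cube]
      exact ⟨hi, hj, ht, hx, by omega, hz⟩
    | exit ℓ k hℓ hk hkN x z hx hz hclose hzz v hv =>
      subst hv
      have hx' : ∀ c, (⌈ℓ.pos P k c - (8 * P.s / P.J + 1)⌉ : ℤ) ≤ x c := fun c => by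
        rw [Int.ceil_le]
        have := (abs_le.1 (hclose c)).1
        push_cast
        linarith
      refine Or.inr (Or.inr (Or.inr (Or.inr (Or.inl (Finset.mem_image.2 ⟨(P.node ℓ k, fun c =>
        (x c - ⌈ℓ.pos P k c - (8 * P.s / P.J + 1)⌉ : ℤ).toNat), ?_, ?_⟩)))))
      · simp only [R, Finset.mem_product, Fintype.mem_piFinset, Finset.mem_range]
        refine ⟨P.mem_coreSet.2 ⟨ℓ, hℓ, k, hkN.le, rfl⟩, fun c => ?_⟩
        have h1 := Int.le_ceil (ℓ.pos P k c - (8 * P.s / P.J + 1))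
        have h2 := (abs_le.1 (hclose c)).2
        have h3 : (16 * P.s / P.J : ℚ) < ((16 * P.s / P.J : ℕ) : ℚ) + 1 := by
          have := Nat.lt_div_mul_add (a := 16 * P.s) (b := P.J) (by have := P.J_ge; omega)
          rw [div_lt_iff₀ (by linarith)]
          have h4 : ((16 * P.s : ℕ) : ℚ) < ((16 * P.s / P.J * P.J + P.J : ℕ) : ℚ) := by
            exact_mod_cast this
          push_cast at h4 ⊢
          linarith
        generalize 16 * P.s / P.J = O at h3 ⊢
        have h4 : ((x c - ⌈ℓ.pos P k c - (8 * P.s / P.J + 1)⌉ : ℤ) : ℚ) < ((O + 4 : ℕ) : ℤ) := by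
          push_cast at h3 ⊢
          have e : (16 * P.s / P.J : ℚ) = 2 * (8 * P.s / P.J) := by ring
          linarith
        have h5 := Int.cast_lt.1 h4
        have := hx' c
        omega
      · have hxx : ∀ c, (⌈ℓ.pos P k c - (8 * P.s / P.J + 1)⌉ +
            (((x c - ⌈ℓ.pos P k c - (8 * P.s / P.J + 1)⌉ : ℤ).toNat : ℕ) : ℤ)).toNat = x c := by
          intro c
          have := hx' c
          omega
        simp only [g, node, hxx]
        rw [if_neg hkN.ne, if_neg (by omega), ← hzz, Int.toNat_natCast]
    | land i j x z hi hj hx hz b hb e he =>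
      subst hb he
      refine Or.inr (Or.inr (Or.inr (Or.inr (Or.inr (Or.inl (Finset.mem_image.2
        ⟨(i, j, x, z), ?_, rfl⟩))))))
      simp only [R, Finset.mem_product, Finset.mem_range, mem_cube]
      exact ⟨hi, hj, hx, by omega⟩
    | tail j β η r hj hβ hη hr x hx z hz =>
      subst hx hz
      refine Or.inr (Or.inr (Or.inr (Or.inr (Or.inr (Or.inr (Or.inl (Finset.mem_image.2
        ⟨(j, β, η, r), ?_, rfl⟩)))))))
      simp only [R, Finset.mem_product, Finset.mem_range, mem_cube]
      exact ⟨hj, hβ, hη, hr⟩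
    | next j β η r hj hβ hη hr x hx z hz =>
      subst hx hz
      refine Or.inr (Or.inr (Or.inr (Or.inr (Or.inr (Or.inr (Or.inr (Or.inl (Finset.mem_image.2
        ⟨(j, β, η, r), ?_, rfl⟩))))))))
      simp only [R, Finset.mem_product, Finset.mem_range, mem_cube]
      exact ⟨hj, hβ, hη, by omega⟩
    | extra r r' h h' =>
      refine Or.inr (Or.inr (Or.inr (Or.inr (Or.inr (Or.inr (Or.inr (Or.inr (Finset.mem_image.2
        ⟨(r, r'), ?_, rfl⟩))))))))
      simp only [R, Finset.mem_product, Finset.mem_range]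
      exact ⟨by omega, h'⟩
  · have e₁ := Finset.card_union_le E₁ (E₂ ∪ (E₃ ∪ (E₄ ∪ (E₅ ∪ (E₆ ∪ (E₇ ∪ (E₈ ∪ E₉)))))))
    have e₂ := Finset.card_union_le E₂ (E₃ ∪ (E₄ ∪ (E₅ ∪ (E₆ ∪ (E₇ ∪ (E₈ ∪ E₉))))))
    have e₃ := Finset.card_union_le E₃ (E₄ ∪ (E₅ ∪ (E₆ ∪ (E₇ ∪ (E₈ ∪ E₉)))))
    have e₄ := Finset.card_union_le E₄ (E₅ ∪ (E₆ ∪ (E₇ ∪ (E₈ ∪ E₉))))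
    have e₅ := Finset.card_union_le E₅ (E₆ ∪ (E₇ ∪ (E₈ ∪ E₉)))
    have e₆ := Finset.card_union_le E₆ (E₇ ∪ (E₈ ∪ E₉))
    have e₇ := Finset.card_union_le E₇ (E₈ ∪ E₉)
    have e₈ := Finset.card_union_le E₈ E₉
    unfold edgeBound
    omega

end Par

end CertifiedShortcuts

/-! ### Short walks through the slices, and reachability -/

namespace CertifiedShortcuts

namespace Par

open Relation

variable (P : Par)

theorem enter_walk {i j : ℕ} {α : Fin 3 → ℕ} {ζ : ℕ} {t : Fin 3 → ℚ} {x : Fin 3 → ℕ} {z : ℕ}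
    (hi : i < P.N₁) (hj : j < P.N₂) (hα : ∀ c, α c < P.s) (hζ : ζ < P.s ^ 2) (ht : t ∈ P.tvecs)
    (hx : ∀ c, x c < P.s) (hz : z < 4 * P.s ^ 2)
    (hzz : (ζ : ℤ) + ⌈∑ c, ((x c : ℚ) - α c) ^ 2 / t c⌉ ≤ z) :
    WalkOf P.Adj 2 (.core i 0 0 (toQ α) ζ) (.slice₂ i j t x z) := by
  have h0 : 0 ≤ ⌈∑ c, ((x c : ℚ) - α c) ^ 2 / t c⌉ := Int.ceil_nonneg
    (Finset.sum_nonneg fun c _ => div_nonneg (sq_nonneg _) (P.tvecs_pos ht c).le)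
  obtain ⟨w, hw⟩ := Int.eq_ofNat_of_zero_le h0
  rw [hw] at hzz
  have hzz' : ζ + w ≤ z := by exact_mod_cast hzz
  refine .cons (.enter i j α ζ t x (ζ + w) hi hj hα hζ ht hx (by omega) ?_ _ rfl _ rfl)
    (.single (.rise i j t x _ z hi hj ht hx hzz' hz))
  rw [hw]; push_cast; rfl

/-- A vertex on a line is reached by three edges from every source of the same copy that lies
sufficiently far below. -/
theorem walk_to_node {ℓ : Line} (hℓ : ℓ.Valid P) {k : ℕ} (hk : 3 ≤ k) (hkN : k < P.N)
    {α : Fin 3 → ℕ} {ζ : ℕ} (hα : ∀ c, α c < P.s) (hζ : ζ < P.s ^ 2)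
    (hE : 3 * (P.J : ℚ) + 21 ≤ ℓ.z P k - ζ - ∑ c, (ℓ.pos P k c - α c) ^ 2 / P.clk k c) :
    WalkOf P.Adj 3 (.core ℓ.i 0 0 (toQ α) ζ) (P.node ℓ k) := by
  have hJ : (12 : ℚ) ≤ P.J := by exact_mod_cast P.J_ge
  -- The slice is crossed near the straight segment from the source to the vertex, with coordinates
  -- rounded down. Rounding by `θ` costs `θ ^ 2 * (1 / t + 1 / (T - t))`, at most `6 + J`.
  have key : ∀ c, ∃ x : ℕ, x < P.s ∧ |(x : ℚ) - ℓ.pos P k c| ≤ 8 * P.s / P.J + 1 ∧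
      ((x : ℚ) - α c) ^ 2 / P.tvec k c + (ℓ.pos P k c - x) ^ 2 / (P.clk k c - P.tvec k c) ≤
        (ℓ.pos P k c - α c) ^ 2 / P.clk k c + (6 + P.J) := by
    intro c
    obtain ⟨-, t1, t2, t3⟩ := P.tvec_bounds hk hkN.le c
    have hc := P.third_le_clk hk hkN.le c
    have p0 := ℓ.pos_nonneg P hkN.le c
    have p1 := hℓ.pos_le hkN.le c
    have a1 : (α c : ℚ) + 1 ≤ P.s := by exact_mod_cast hα c
    have a0 : (0 : ℚ) ≤ α c := by positivity
    generalize P.tvec k c = t at *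
    generalize P.clk k c = T at *
    generalize ℓ.pos P k c = p at *
    generalize (α c : ℚ) = a at *
    have hT : 0 < T := by linarith
    have ht : 0 < t := by linarith
    have hd : 0 < T - t := by have : (0 : ℚ) < 1 / P.J := by positivity
                              linarith
    obtain ⟨v, hv⟩ : ∃ v, v = (p - a) / T := ⟨_, rfl⟩
    have hpa : p = a + T * v := by rw [hv]; field_simp; ring
    have hq : a + t * v = (1 - t / T) * a + t / T * p := by rw [hpa]; field_simp; ring
    have hr0 : 0 ≤ t / T := by positivity
    have hr1 : t / T ≤ 1 := by rw [div_le_one hT]; linarith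
    have q0 : 0 ≤ a + t * v := by
      rw [hq]
      have := sub_nonneg.2 hr1
      positivity
    have q1 : a + t * v ≤ P.s - 1 := by
      rw [hq]
      have h2 : (1 - t / T) * a ≤ (1 - t / T) * (P.s - 1) :=
        mul_le_mul_of_nonneg_left (by linarith) (sub_nonneg.2 hr1)
      have h3 : t / T * p ≤ t / T * (P.s - 1) := mul_le_mul_of_nonneg_left (by linarith) hr0
      linarith
    have f1 := Nat.floor_le q0
    have f2 := Nat.lt_floor_add_one (a + t * v)
    generalize ⌊a + t * v⌋₊ = x at *
    refine ⟨x, ?_, ?_, ?_⟩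
    · have : (x : ℚ) < P.s := by linarith
      exact_mod_cast this
    · have hs : (0 : ℚ) < P.s := by exact_mod_cast P.s_pos
      -- The speed is at most `3 * s` since `T ≥ 1 / 3`, and the remaining time is at most `2 / J`;
      -- with the rounding this gives the bound required of exits.
      have hv1 : |v| ≤ 3 * P.s := by
        have h1 : |p - a| ≤ P.s := by rw [abs_le]; constructor <;> linarith
        rw [hv, abs_div, abs_of_pos hT, div_le_iff₀ hT]
        nlinarith
      have h2 : |(T - t) * v| ≤ 2 / P.J * (3 * P.s) := by
        rw [abs_mul, abs_of_pos hd]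
        exact mul_le_mul t3 hv1 (abs_nonneg _) (by positivity)
      have h3 : 2 / (P.J : ℚ) * (3 * P.s) ≤ 8 * P.s / P.J := by
        rw [div_mul_eq_mul_div]
        exact div_le_div_of_nonneg_right (by linarith) (by linarith)
      have h4 := abs_le.1 h2
      rw [hpa, abs_le]
      constructor <;> linarith [h4.1, h4.2]
    · obtain ⟨θ, hθ⟩ : ∃ θ, θ = a + t * v - x := ⟨_, rfl⟩
      have e1 : (x : ℚ) - a = t * v - θ := by rw [hθ]; ring
      have e2 : p - x = (T - t) * v + θ := by rw [hθ, hpa]; ring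
      have e3 : p - a = T * v := by rw [hpa]; ring
      have e4 : (t * v - θ) ^ 2 / t + ((T - t) * v + θ) ^ 2 / (T - t) =
          (T * v) ^ 2 / T + θ ^ 2 * (1 / t + 1 / (T - t)) := by
        field_simp
        ring
      rw [e1, e2, e3, e4]
      have hθ0 : 0 ≤ θ := by linarith
      have hθ1 : θ ≤ 1 := by linarith
      have h1 : 1 / t ≤ 6 := by rw [div_le_iff₀ ht]; linarith
      have h2 : 1 / (T - t) ≤ P.J := by
        rw [div_le_iff₀ (by linarith)] at t2
        rw [div_le_iff₀ hd]; linarith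
      have h3 : 0 ≤ 1 / t + 1 / (T - t) := by positivity
      have h4 : θ ^ 2 ≤ 1 := by nlinarith
      have : θ ^ 2 * (1 / t + 1 / (T - t)) ≤ 1 * (6 + P.J) :=
        mul_le_mul h4 (by linarith) h3 (by norm_num)
      linarith
  choose x hx hclose hsum using key
  have hS := Finset.sum_le_sum fun c (_ : c ∈ Finset.univ) => hsum c
  rw [Finset.sum_add_distrib, Finset.sum_add_distrib, Finset.sum_const, Finset.card_univ,
    Fintype.card_fin, nsmul_eq_mul] at hS
  push_cast at hS
  have c1 := Int.ceil_lt_add_one (∑ c, ((x c : ℚ) - α c) ^ 2 / P.tvec k c)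
  have c2 := Int.lt_floor_add_one
    (ℓ.z P k - ∑ c, (ℓ.pos P k c - x c) ^ 2 / (P.clk k c - P.tvec k c))
  have c3 := Int.floor_le (ℓ.z P k - ∑ c, (ℓ.pos P k c - x c) ^ 2 / (P.clk k c - P.tvec k c))
  -- Three coordinates cost `3 * (6 + J)`, and the ceiling, the floor and the unit held back cost
  -- less than `3` more, which explains the threshold `3 * J + 21`.
  have hlt : ((ζ + ⌈∑ c, ((x c : ℚ) - α c) ^ 2 / P.tvec k c⌉ : ℤ) : ℚ) <
      ((⌊ℓ.z P k - ∑ c, (ℓ.pos P k c - x c) ^ 2 / (P.clk k c - P.tvec k c)⌋ - 1 : ℤ) : ℚ) := by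
    push_cast
    linarith
  have hlt' := Int.cast_lt.1 hlt
  have htm : P.tvec k ∈ P.tvecs :=
    Finset.mem_insert_of_mem (Finset.mem_image_of_mem _ (Finset.mem_Ico.2 ⟨hk, hkN⟩))
  have h0 : 0 ≤ ⌈∑ c, ((x c : ℚ) - α c) ^ 2 / P.tvec k c⌉ := Int.ceil_nonneg
    (Finset.sum_nonneg fun c _ => div_nonneg (sq_nonneg _) (P.tvecs_pos htm c).le)
  have hnn : 0 ≤ ∑ c, (ℓ.pos P k c - x c) ^ 2 / (P.clk k c - P.tvec k c) :=
    Finset.sum_nonneg fun c _ => div_nonneg (sq_nonneg _) (by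
      have := (P.tvec_bounds hk hkN.le c).2.2.1
      have h0 : (0 : ℚ) < 1 / P.J := by positivity
      linarith)
  obtain ⟨z, hz⟩ : ∃ z : ℕ,
      ⌊ℓ.z P k - ∑ c, (ℓ.pos P k c - x c) ^ 2 / (P.clk k c - P.tvec k c)⌋ - 1 = z :=
    Int.eq_ofNat_of_zero_le (by omega)
  have hz4 : z < 4 * P.s ^ 2 := by
    have h1 := hℓ.z_lt hkN.le
    have h2 : ((z : ℤ) : ℚ) < 4 * P.s ^ 2 := by
      rw [← hz]; push_cast; linarith
    exact_mod_cast h2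
  exact (P.enter_walk hℓ.i_lt hℓ.j_lt hα hζ htm hx hz4 (by rw [← hz]; omega)).append
    (.single (.exit ℓ k hℓ hk hkN x z hx hz4 hclose hz.symm _ rfl))

/-- A target is reached by three edges from every source below it. -/
theorem walk_to_tgt {i j : ℕ} {α β : Fin 3 → ℕ} {ζ η : ℕ} (hi : i < P.N₁) (hj : j < P.N₂)
    (hα : ∀ c, α c < P.s) (hβ : ∀ c, β c < P.s) (hζ : ζ < P.s ^ 2) (hη : η < 4 * P.s ^ 2)
    (hE : (ζ : ℤ) + ∑ c, ((β c : ℤ) - α c) ^ 2 + 1 ≤ η) :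
    WalkOf P.Adj 3 (.core i 0 0 (toQ α) ζ) (.core 0 j P.N (toQ β) η) := by
  have h0 : 0 ≤ ∑ c, ((β c : ℤ) - α c) ^ 2 := Finset.sum_nonneg fun i _ => sq_nonneg _
  obtain ⟨z, rfl⟩ : ∃ z, η = z + 1 := ⟨η - 1, by omega⟩
  refine (P.enter_walk hi hj hα hζ (Finset.mem_insert_self _ _) hβ (z := z) (by omega) ?_).append
    (.single (.land i j β z hi hj hβ hη _ rfl _ (by push_cast; rfl)))
  have : ∑ c, ((β c : ℚ) - α c) ^ 2 / (1 : Fin 3 → ℚ) c =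
      ((∑ c, ((β c : ℤ) - α c) ^ 2 : ℤ) : ℚ) := by push_cast; simp
  rw [this, Int.ceil_intCast]
  push_cast at hE
  omega

/-- The excess of a vertex reachable from a source is nonnegative. -/
theorem excess_nonneg {i i' j k : ℕ} {a x : Fin 3 → ℚ} {b z : ℚ} (hk : ∀ c, 0 < P.clk k c)
    (h : ReflTransGen P.Adj (.core i 0 0 a b) (.core i' j k x z)) :
    0 ≤ z - b - ∑ c, (x c - a c) ^ 2 / P.clk k c := by
  -- The slope is the velocity from source to vertex, the case of equality in `quad_le`.
  have h1 := P.lam_le_of_reach (fun c => (x c - a c) / P.clk k c) h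
  simp only [lam, lamAt] at h1
  have h2 : ∑ c, (x c - a c) ^ 2 / P.clk k c =
      ∑ c, (2 * ((x c - a c) / P.clk k c) * x c - ((x c - a c) / P.clk k c) ^ 2 * P.clk k c) -
      ∑ c, (2 * ((x c - a c) / P.clk k c) * a c - ((x c - a c) / P.clk k c) ^ 2 * P.clk 0 c) := by
    rw [← Finset.sum_sub_distrib]
    refine Finset.sum_congr rfl fun c _ => ?_
    have := (hk c).ne'
    rw [P.clk_zero]
    field_simp
    ring
  linarith

theorem excess_tgt_nonneg {i j : ℕ} {α β : Fin 3 → ℕ} {ζ η : ℕ}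
    (h : ReflTransGen P.Adj (.core i 0 0 (toQ α) ζ) (.core 0 j P.N (toQ β) η)) :
    (ζ : ℤ) + ∑ c, ((β c : ℤ) - α c) ^ 2 ≤ η := by
  have := P.excess_nonneg (fun c => by rw [P.clk_N]; norm_num) h
  simp only [P.clk_N, div_one] at this
  have h2 : ((ζ + ∑ c, ((β c : ℤ) - α c) ^ 2 : ℤ) : ℚ) ≤ ((η : ℤ) : ℚ) := by
    push_cast
    linarith
  exact_mod_cast h2

/-- The first index of the copy of a vertex. -/
def copy₁ : Vert → Option ℕ
  | .leaf i _ _ _ => some i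
  | .core i _ k _ _ => if k = P.N then none else some i
  | .slice₁ i _ _ _ _ => some i
  | .slice₂ i _ _ _ _ => some i
  | _ => none

theorem copy₁_eq_of_reach {u v : Vert} (h : ReflTransGen P.Adj u v) :
    P.copy₁ v = none ∨ P.copy₁ u = P.copy₁ v := by
  have hN := P.N_pos
  induction h using ReflTransGen.head_induction_on with
  | refl => exact Or.inr rfl
  | head h _ ih =>
    rcases ih with ih | ih
    · exact Or.inl ih
    rw [← ih]
    cases h with
    | leaf => simp [copy₁, hN.ne]
    | line ℓ k _ hk _ _ hu hv =>
      subst hu hv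
      simp only [copy₁, node]
      rw [if_neg hk.ne, if_neg hk.ne]
      split_ifs <;> simp
    | enter => simp [copy₁, hN.ne]
    | rise => simp [copy₁]
    | exit ℓ k _ hk hkN x z _ _ _ _ v hv => subst hv; simp [copy₁, node, hkN.ne]
    | _ => simp [copy₁]

theorem reach_from_tail {j r : ℕ} {x : Fin 3 → ℚ} {z : ℚ} {v : Vert}
    (h : ReflTransGen P.Adj (.tail j x z r) v) : ∃ r', v = .tail j x z r' := by
  induction h with
  | refl => exact ⟨r, rfl⟩
  | tail _ h ih =>
    obtain ⟨r', rfl⟩ := ih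
    generalize hw : Vert.tail j x z r' = w at h
    cases h with
    | line ℓ k _ hk _ _ hu hv => rw [hu] at hw; simp [node] at hw
    | next =>
      simp only [Vert.tail.injEq] at hw
      obtain ⟨rfl, rfl, rfl, rfl⟩ := hw
      exact ⟨_, rfl⟩
    | _ => simp at hw

theorem reach_to_tail {j r : ℕ} {x : Fin 3 → ℚ} {z : ℚ} {u : Vert}
    (h : ReflTransGen P.Adj u (.tail j x z r)) : (∃ r', u = .tail j x z r') ∨
      (ReflTransGen P.Adj u (.core 0 j P.N x z) ∧ P.Adj (.core 0 j P.N x z) (.tail j x z r)) := by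
  generalize hw : Vert.tail j x z r = w at h
  induction h generalizing r with
  | refl => exact Or.inl ⟨r, hw.symm⟩
  | @tail b c hb h ih =>
    subst hw
    generalize hw : Vert.tail j x z r = w at h
    cases h with
    | line ℓ k _ hk _ _ hu hv => rw [hv] at hw; simp [node] at hw
    | exit ℓ k _ hk hkN x z _ _ _ _ v hv => rw [hv] at hw; simp [node] at hw
    | tail j' β η r' hj hβ hη hr x' hx z' hz =>
      simp only [Vert.tail.injEq] at hw
      obtain ⟨rfl, rfl, rfl, rfl⟩ := hw
      exact Or.inr ⟨hb, .tail _ β η _ hj hβ hη hr _ hx _ hz⟩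
    | next j' β η r' hj hβ hη hr x' hx z' hz =>
      simp only [Vert.tail.injEq] at hw
      obtain ⟨rfl, rfl, rfl, rfl⟩ := hw
      rcases ih rfl with h | h
      · exact Or.inl h
      · exact Or.inr ⟨h.1, .tail _ β η _ hj hβ hη hr _ hx _ hz⟩
    | _ => simp at hw

theorem reach_from_tgt {j : ℕ} {x : Fin 3 → ℚ} {z : ℚ} {v : Vert}
    (h : ReflTransGen P.Adj (.core 0 j P.N x z) v) :
    v = .core 0 j P.N x z ∨ P.Adj (.core 0 j P.N x z) v := by
  rcases ReflTransGen.cases_head h with h | ⟨w, h1, h2⟩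
  · exact Or.inl h.symm
  · right
    have hw : ∃ r, w = .tail j x z r := by
      generalize hu : Vert.core 0 j P.N x z = u at h1
      cases h1 with
      | line ℓ k _ hk _ _ hu' hv =>
        rw [hu'] at hu; simp only [node, Vert.core.injEq] at hu; omega
      | enter => simp only [Vert.core.injEq] at hu; have := P.N_pos; omega
      | tail =>
        simp only [Vert.core.injEq] at hu
        obtain ⟨-, rfl, -, rfl, rfl⟩ := hu
        exact ⟨_, rfl⟩
      | _ => simp at hu
    obtain ⟨r, rfl⟩ := hw
    obtain ⟨r', rfl⟩ := P.reach_from_tail h2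
    rcases P.reach_to_tail h with ⟨r', h⟩ | h
    · simp at h
    · exact h.2

theorem reach_from_extra {r : ℕ} {v : Vert} (h : ReflTransGen P.Adj (.extra r) v) :
    v = .extra r ∨ P.Adj (.extra r) v := by
  induction h with
  | refl => exact Or.inl rfl
  | @tail b c _ h ih =>
    right
    have hb : ∃ r', b = .extra r' ∧ r ≤ r' := by
      rcases ih with rfl | ih
      · exact ⟨r, rfl, le_rfl⟩
      · generalize hw : Vert.extra r = w at ih
        cases ih with
        | line ℓ k _ hk _ _ hu' hv' => rw [hu'] at hw; simp [node] at hw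
        | extra r₁ r₂ h' => simp only [Vert.extra.injEq] at hw; exact ⟨r₂, rfl, by omega⟩
        | _ => simp at hw
    obtain ⟨r', rfl, hr⟩ := hb
    generalize hw : Vert.extra r' = w at h
    cases h with
    | line ℓ k _ hk _ _ hu' hv' => rw [hu'] at hw; simp [node] at hw
    | extra r₁ r₂ h' h'' =>
      simp only [Vert.extra.injEq] at hw; exact .extra _ _ (by omega) h''
    | _ => simp at hw

theorem reach_to_extra {r : ℕ} {u : Vert} (h : ReflTransGen P.Adj u (.extra r)) :
    ∃ r', u = .extra r' := by
  induction h using ReflTransGen.head_induction_on with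
  | refl => exact ⟨r, rfl⟩
  | head h _ ih =>
    obtain ⟨r', rfl⟩ := ih
    generalize hw : Vert.extra r' = w at h
    cases h with
    | line ℓ k _ hk _ _ hu' hv' => rw [hv'] at hw; simp [node] at hw
    | exit ℓ k _ hk hkN x z _ _ _ _ v hv => rw [hv] at hw; simp [node] at hw
    | extra r₁ r₂ h' => exact ⟨r₁, rfl⟩
    | _ => simp at hw

theorem stepDist_le_rank {u v : Vert} (h : ReflTransGen P.Adj u v) :
    P.rank u + stepDist P.Adj u v ≤ P.rank v :=
  (walkOf_stepDist h).rank_le P.rank fun _ _ => P.rank_lt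

theorem rank_node_le (ℓ : Line) (k : ℕ) : P.rank (P.node ℓ k) ≤ k + 4 := by
  simp only [rank, node]
  split_ifs <;> omega

/-- Ranks bound the distance, except that they grow along a tail. A tail vertex, however, is a
direct successor of its target, through which every walk from outside passes. -/
theorem stepDist_le_add_six {u v : Vert} (hu : ∀ j x z r, u ≠ .tail j x z r) (hv : v ∈ P.hard) :
    stepDist P.Adj u v ≤ P.N + 6 := by
  by_cases h : ReflTransGen P.Adj u v
  · have h1 := P.stepDist_le_rank h
    rw [mem_hard, mem_leafSet, mem_coreSet, mem_tgtSet, mem_slice₁Set, mem_slice₂Set,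
      mem_tailSet] at hv
    rcases hv with ⟨i, _, α, _, ζ, _, r, _, rfl⟩ | ⟨ℓ, _, k, hk, rfl⟩ | ⟨j, _, β, _, η, _, rfl⟩ |
      ⟨i, _, j, _, t, _, x, _, z, _, rfl⟩ | ⟨i, _, j, _, t, _, x, _, z, _, rfl⟩ |
      ⟨j, _, β, _, η, _, r, _, rfl⟩
    · simp only [rank] at h1; omega
    · have h2 := P.rank_node_le ℓ k
      omega
    · simp only [rank] at h1; split_ifs at h1 <;> omega
    · simp only [rank] at h1; omega
    · simp only [rank] at h1; omega
    · rcases P.reach_to_tail h with ⟨r', h⟩ | ⟨h2, h3⟩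
      · exact absurd h (hu _ _ _ _)
      · have h4 := stepDist_triangle h2 (.single h3)
        have h5 := stepDist_le (WalkOf.single h3)
        have h6 := P.stepDist_le_rank h2
        have h7 : P.rank (.core 0 j P.N (toQ β) η) ≤ P.N + 4 := by
          simp only [rank]; split_ifs <;> omega
        omega
  · rw [stepDist_eq_zero h]; omega

end Par

end CertifiedShortcuts

/-! ### Distant pairs and the initial potential -/

namespace CertifiedShortcuts

namespace Par

open Relation

variable (P : Par)

/-- The pairs of vertices at the two ends of a line. -/
noncomputable def criticalPairs : Finset (Vert × Vert) :=
  (P.lines ×ˢ Finset.range (P.W + 1) ×ˢ Finset.range (P.Y + 1)).image fun p =>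
    (if p.2.1 = P.W then P.node p.1 0 else .leaf p.1.i (p.1.pos P 0) (p.1.z P 0) p.2.1,
      if p.2.2 = P.Y then P.node p.1 P.N else .tail p.1.j (p.1.pos P P.N) (p.1.z P P.N) p.2.2)

/-- The vertices on lines that are not high above a source. -/
noncomputable def nearSet (i : ℕ) (α : Fin 3 → ℕ) (ζ : ℕ) : Finset Vert :=
  ((Finset.Ico 1 3).biUnion fun k => (P.lines.filter fun ℓ => ℓ.i = i).image fun ℓ => P.node ℓ k) ∪
  (Finset.Ico 3 P.N).biUnion fun k => (P.lines.filter fun ℓ => ℓ.i = i ∧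
    (ζ : ℚ) + ∑ c, (ℓ.pos P k c - α c) ^ 2 / P.clk k c ≤ ℓ.z P k ∧
    ℓ.z P k < (ζ : ℚ) + ∑ c, (ℓ.pos P k c - α c) ^ 2 / P.clk k c + (3 * P.J + 21 : ℕ)).image
    fun ℓ => P.node ℓ k

/-- The pairs of a source or leaf and a vertex not high above it. -/
noncomputable def nearPairs : Finset (Vert × Vert) :=
  (Finset.range P.N₁ ×ˢ P.cube ×ˢ Finset.range (P.s ^ 2) ×ˢ Finset.range (P.W + 1)).biUnion
    fun p => {if p.2.2.2 = P.W then .core p.1 0 0 (toQ p.2.1) p.2.2.1 else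
      .leaf p.1 (toQ p.2.1) p.2.2.1 p.2.2.2} ×ˢ P.nearSet p.1 p.2.1 p.2.2.1

/-- The vertices with second copy index `j` that are neither targets nor tail vertices. -/
noncomputable def innerSet (j : ℕ) : Finset Vert :=
  ((Finset.Ico 1 P.N).biUnion fun k =>
    (P.lines.filter fun ℓ => ℓ.j = j).image fun ℓ => P.node ℓ k) ∪
  ((Finset.range P.N₁ ×ˢ P.tvecs ×ˢ P.cube ×ˢ Finset.range (4 * P.s ^ 2)).image fun p =>
      .slice₁ p.1 j p.2.1 p.2.2.1 p.2.2.2) ∪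
  ((Finset.range P.N₁ ×ˢ P.tvecs ×ˢ P.cube ×ˢ Finset.range (4 * P.s ^ 2)).image fun p =>
      .slice₂ p.1 j p.2.1 p.2.2.1 p.2.2.2)

/-- The targets and tail vertices with copy index `j`. -/
noncomputable def outerSet (j : ℕ) : Finset Vert :=
  (P.cube ×ˢ Finset.range (4 * P.s ^ 2) ×ˢ Finset.range (P.Y + 1)).image fun p =>
    if p.2.2 = P.Y then .core 0 j P.N (toQ p.1) p.2.1 else .tail j (toQ p.1) p.2.1 p.2.2

/-- The pairs of vertices with the same copy index whose first element is inner. -/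
noncomputable def innerPairs : Finset (Vert × Vert) :=
  (Finset.range P.N₂).biUnion fun j => P.innerSet j ×ˢ (P.innerSet j ∪ P.outerSet j)

/-- The pairs of vertices in the same tail. -/
noncomputable def tailPairs : Finset (Vert × Vert) :=
  (Finset.range P.N₂ ×ˢ P.cube ×ˢ Finset.range (4 * P.s ^ 2) ×ˢ Finset.range P.Y ×ˢ
    Finset.range P.Y).image fun p => (.tail p.1 (toQ p.2.1) p.2.2.1 p.2.2.2.1,
      .tail p.1 (toQ p.2.1) p.2.2.1 p.2.2.2.2)

theorem card_criticalPairs_le :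
    P.criticalPairs.card ≤ P.N₁ * P.N₂ * P.s ^ 8 * ((P.W + 1) * (P.Y + 1)) := by
  refine Finset.card_image_le.trans (le_of_eq ?_)
  simp only [Finset.card_product, Finset.card_range, card_lines]

theorem card_tailPairs_le : P.tailPairs.card ≤ 4 * P.N₂ * P.s ^ 5 * P.Y ^ 2 := by
  refine Finset.card_image_le.trans (le_of_eq ?_)
  simp only [Finset.card_product, Finset.card_range, card_cube]; ring

theorem card_outerSet_le (j : ℕ) : (P.outerSet j).card ≤ 4 * P.s ^ 5 * (P.Y + 1) := by
  refine Finset.card_image_le.trans (le_of_eq ?_)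
  simp only [Finset.card_product, Finset.card_range, card_cube]; ring

theorem card_level_le {k : ℕ} (hk0 : 1 ≤ k) (hk : k < P.N) (A : Finset (ℕ × ℕ))
    (S : Finset Line) (hS : ∀ ℓ ∈ S, ℓ.Valid P ∧ (ℓ.i, ℓ.j) ∈ A) :
    (S.image fun ℓ => P.node ℓ k).card ≤ A.card * ((4 * P.B * P.s) ^ 3 * (4 * P.s ^ 2)) := by
  refine P.card_core_le hk.le A (fun _ => 0) (4 * P.s ^ 2) _ fun v hv => ?_
  obtain ⟨ℓ, hℓ, rfl⟩ := Finset.mem_image.1 hv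
  obtain ⟨h1, h2⟩ := hS ℓ hℓ
  refine ⟨ℓ, h1, _, h2, ?_, ℓ.z_nonneg P hk.le, ?_⟩
  · rw [node, if_neg hk.ne, if_neg (by omega)]
  · have := h1.z_lt hk.le
    push_cast
    linarith

/-- An upper bound for the size of `innerSet`. -/
def innerBound : ℕ := P.N * (P.N₁ * ((4 * P.B * P.s) ^ 3 * (4 * P.s ^ 2))) +
  8 * P.N₁ * (3 * P.J + 2) * P.s ^ 5

theorem card_innerSet_le {j : ℕ} : (P.innerSet j).card ≤ P.innerBound := by
  have h1 : ((Finset.Ico 1 P.N).biUnion fun k =>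
      (P.lines.filter fun ℓ => ℓ.j = j).image fun ℓ => P.node ℓ k).card ≤
      P.N * (P.N₁ * ((4 * P.B * P.s) ^ 3 * (4 * P.s ^ 2))) := by
    refine (Finset.card_biUnion_le_card_mul _ _
      (P.N₁ * ((4 * P.B * P.s) ^ 3 * (4 * P.s ^ 2))) fun k hk => ?_).trans ?_
    · rw [Finset.mem_Ico] at hk
      have := P.card_level_le hk.1 hk.2 (Finset.range P.N₁ ×ˢ {j})
        (P.lines.filter fun ℓ => ℓ.j = j) (by
          intro ℓ hℓ
          rw [Finset.mem_filter, mem_lines] at hℓ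
          refine ⟨hℓ.1, ?_⟩
          simp [hℓ.2, hℓ.1.i_lt])
      simpa using this
    · rw [Nat.card_Ico]
      exact Nat.mul_le_mul_right _ (Nat.sub_le _ _)
  have hT := P.card_tvecs_le
  have h2 : ∀ g : ℕ × (Fin 3 → ℚ) × (Fin 3 → ℕ) × ℕ → Vert,
      ((Finset.range P.N₁ ×ˢ P.tvecs ×ˢ P.cube ×ˢ Finset.range (4 * P.s ^ 2)).image g).card ≤
      4 * P.N₁ * (3 * P.J + 2) * P.s ^ 5 := fun g => by
    refine Finset.card_image_le.trans ?_
    simp only [Finset.card_product, Finset.card_range, card_cube]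
    calc _ ≤ P.N₁ * ((3 * P.J + 2) * (P.s ^ 3 * (4 * P.s ^ 2))) := by gcongr
      _ = _ := by ring
  unfold innerSet innerBound
  refine (Finset.card_union_le _ _).trans ?_
  refine (Nat.add_le_add_right (Finset.card_union_le _ _) _).trans ?_
  refine (Nat.add_le_add (Nat.add_le_add h1 (h2 _)) (h2 _)).trans (le_of_eq ?_)
  ring

/-- An upper bound for the size of `nearSet`. -/
def nearBound : ℕ := P.N₂ * (4 * P.B * P.s) ^ 3 * (8 * P.s ^ 2 + P.N * (3 * P.J + 21))

theorem card_nearSet_le {i : ℕ} {α : Fin 3 → ℕ} {ζ : ℕ} :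
    (P.nearSet i α ζ).card ≤ P.nearBound := by
  by_cases hN3 : P.N ≤ 2
  · unfold N at hN3; omega
  have h1 : ((Finset.Ico 1 3).biUnion fun k =>
      (P.lines.filter fun ℓ => ℓ.i = i).image fun ℓ => P.node ℓ k).card ≤
      2 * (P.N₂ * ((4 * P.B * P.s) ^ 3 * (4 * P.s ^ 2))) := by
    refine (Finset.card_biUnion_le_card_mul _ _
      (P.N₂ * ((4 * P.B * P.s) ^ 3 * (4 * P.s ^ 2))) fun k hk => ?_).trans (by simp)
    rw [Finset.mem_Ico] at hk
    have := P.card_level_le hk.1 (by omega) ({i} ×ˢ Finset.range P.N₂)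
      (P.lines.filter fun ℓ => ℓ.i = i) (by
        intro ℓ hℓ
        rw [Finset.mem_filter, mem_lines] at hℓ
        refine ⟨hℓ.1, ?_⟩
        simp [hℓ.2, hℓ.1.j_lt])
    simpa using this
  have h2 : ((Finset.Ico 3 P.N).biUnion fun k => (P.lines.filter fun ℓ => ℓ.i = i ∧
      (ζ : ℚ) + ∑ c, (ℓ.pos P k c - α c) ^ 2 / P.clk k c ≤ ℓ.z P k ∧
      ℓ.z P k < (ζ : ℚ) + ∑ c, (ℓ.pos P k c - α c) ^ 2 / P.clk k c + (3 * P.J + 21 : ℕ)).image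
      fun ℓ => P.node ℓ k).card ≤
      P.N * (P.N₂ * ((4 * P.B * P.s) ^ 3 * (3 * P.J + 21))) := by
    refine (Finset.card_biUnion_le_card_mul _ _
      (P.N₂ * ((4 * P.B * P.s) ^ 3 * (3 * P.J + 21))) fun k hk => ?_).trans ?_
    · rw [Finset.mem_Ico] at hk
      have := P.card_core_le hk.2.le ({i} ×ˢ Finset.range P.N₂)
        (fun x => ζ + ∑ c, (x c - α c) ^ 2 / P.clk k c) (3 * P.J + 21)
        ((P.lines.filter fun ℓ => ℓ.i = i ∧
          (ζ : ℚ) + ∑ c, (ℓ.pos P k c - α c) ^ 2 / P.clk k c ≤ ℓ.z P k ∧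
          ℓ.z P k < (ζ : ℚ) + ∑ c, (ℓ.pos P k c - α c) ^ 2 / P.clk k c +
            (3 * P.J + 21 : ℕ)).image fun ℓ => P.node ℓ k) (by
          intro v hv
          obtain ⟨ℓ, hℓ, rfl⟩ := Finset.mem_image.1 hv
          rw [Finset.mem_filter, mem_lines] at hℓ
          refine ⟨ℓ, hℓ.1, (i, ℓ.j), by simp [hℓ.1.j_lt], ?_, hℓ.2.2.1, hℓ.2.2.2⟩
          rw [node, if_neg hk.2.ne, if_neg (by omega), hℓ.2.1])
      simpa using this
    · rw [Nat.card_Ico]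
      exact Nat.mul_le_mul_right _ (Nat.sub_le _ _)
  unfold nearSet nearBound
  refine (Finset.card_union_le _ _).trans ((Nat.add_le_add h1 h2).trans (le_of_eq ?_))
  ring

theorem card_nearPairs_le :
    P.nearPairs.card ≤ P.N₁ * P.s ^ 5 * (P.W + 1) * P.nearBound := by
  refine (Finset.card_biUnion_le_card_mul _ _ P.nearBound fun p _ => ?_).trans (le_of_eq ?_)
  · rw [Finset.card_product, Finset.card_singleton, one_mul]
    exact P.card_nearSet_le
  · simp only [Finset.card_product, Finset.card_range, card_cube]; ring

theorem card_innerPairs_le : P.innerPairs.card ≤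
    P.N₂ * (P.innerBound * (P.innerBound + 4 * P.s ^ 5 * (P.Y + 1))) := by
  refine (Finset.card_biUnion_le_card_mul _ _
    (P.innerBound * (P.innerBound + 4 * P.s ^ 5 * (P.Y + 1))) fun j _ => ?_).trans (by simp)
  rw [Finset.card_product]
  exact Nat.mul_le_mul P.card_innerSet_le ((Finset.card_union_le _ _).trans
    (Nat.add_le_add P.card_innerSet_le (P.card_outerSet_le j)))

theorem mem_innerSet_node {ℓ : Line} (hℓ : ℓ.Valid P) {k : ℕ} (hk0 : 1 ≤ k) (hk : k < P.N) :
    P.node ℓ k ∈ P.innerSet ℓ.j := by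
  unfold innerSet
  refine Finset.mem_union_left _ (Finset.mem_union_left _ (Finset.mem_biUnion.2 ⟨k,
    Finset.mem_Ico.2 ⟨hk0, hk⟩, Finset.mem_image.2 ⟨ℓ, ?_, rfl⟩⟩))
  rw [Finset.mem_filter, mem_lines]
  exact ⟨hℓ, rfl⟩

theorem mem_innerSet_slice₁ {i j : ℕ} {t : Fin 3 → ℚ} {x : Fin 3 → ℕ} {z : ℕ} (hi : i < P.N₁)
    (ht : t ∈ P.tvecs) (hx : ∀ c, x c < P.s) (hz : z < 4 * P.s ^ 2) :
    .slice₁ i j t x z ∈ P.innerSet j := by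
  unfold innerSet
  refine Finset.mem_union_left _ (Finset.mem_union_right _ (Finset.mem_image.2
    ⟨(i, t, x, z), ?_, rfl⟩))
  simp only [Finset.mem_product, Finset.mem_range, mem_cube]
  exact ⟨hi, ht, hx, hz⟩

theorem mem_innerSet_slice₂ {i j : ℕ} {t : Fin 3 → ℚ} {x : Fin 3 → ℕ} {z : ℕ} (hi : i < P.N₁)
    (ht : t ∈ P.tvecs) (hx : ∀ c, x c < P.s) (hz : z < 4 * P.s ^ 2) :
    .slice₂ i j t x z ∈ P.innerSet j := by
  unfold innerSet
  refine Finset.mem_union_right _ (Finset.mem_image.2 ⟨(i, t, x, z), ?_, rfl⟩)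
  simp only [Finset.mem_product, Finset.mem_range, mem_cube]
  exact ⟨hi, ht, hx, hz⟩

theorem mem_outerSet_tgt {j : ℕ} {β : Fin 3 → ℕ} {η : ℕ} (hβ : ∀ c, β c < P.s)
    (hη : η < 4 * P.s ^ 2) : .core 0 j P.N (toQ β) η ∈ P.outerSet j := by
  refine Finset.mem_image.2 ⟨(β, η, P.Y), ?_, by simp⟩
  simp only [Finset.mem_product, Finset.mem_range, mem_cube]
  exact ⟨hβ, hη, by omega⟩

theorem mem_outerSet_tail {j : ℕ} {β : Fin 3 → ℕ} {η r : ℕ} (hβ : ∀ c, β c < P.s)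
    (hη : η < 4 * P.s ^ 2) (hr : r < P.Y) : .tail j (toQ β) η r ∈ P.outerSet j := by
  refine Finset.mem_image.2 ⟨(β, η, r), ?_, by simp [hr.ne]⟩
  simp only [Finset.mem_product, Finset.mem_range, mem_cube]
  exact ⟨hβ, hη, by omega⟩

theorem node_N {ℓ : Line} (hℓ : ℓ.Valid P) : ∃ η < 4 * P.s ^ 2,
    P.node ℓ P.N = .core 0 ℓ.j P.N (toQ ℓ.β) η := by
  obtain ⟨η, h1, h2⟩ := P.z_N ℓ
  refine ⟨η, h2 hℓ, ?_⟩
  rw [node, if_pos rfl, if_neg P.N_pos.ne', h1, ℓ.pos_N]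

theorem mem_innerSet_or_outerSet {v : Vert} (hv : v ∈ P.hard) {j : ℕ} (hj : copy v = some j) :
    v ∈ P.innerSet j ∪ P.outerSet j := by
  rw [Finset.mem_union]
  rw [mem_hard, mem_leafSet, mem_coreSet, mem_tgtSet, mem_slice₁Set, mem_slice₂Set,
    mem_tailSet] at hv
  rcases hv with ⟨i, _, α, _, ζ, _, r, _, rfl⟩ | ⟨ℓ, hℓ, k, hk, rfl⟩ | ⟨j, _, β, hβ, η, hη, rfl⟩ |
    ⟨i, hi, j, _, t, ht, x, hx, z, hz, rfl⟩ | ⟨i, hi, j, _, t, ht, x, hx, z, hz, rfl⟩ |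
    ⟨j, _, β, hβ, η, hη, r, hr, rfl⟩
  · simp [copy] at hj
  · have hk0 : k ≠ 0 := by rintro rfl; simp [copy, node] at hj
    have : ℓ.j = j := by simpa [copy, node, hk0] using hj
    subst this
    rcases hk.eq_or_lt with rfl | hk
    · obtain ⟨η, hη, e⟩ := P.node_N hℓ
      rw [e]
      exact Or.inr (P.mem_outerSet_tgt hℓ.β_lt hη)
    · exact Or.inl (P.mem_innerSet_node hℓ (by omega) hk)
  · simp only [copy, P.N_pos.ne', if_false, Option.some.injEq] at hj
    subst hj
    exact Or.inr (P.mem_outerSet_tgt hβ hη)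
  · simp only [copy, Option.some.injEq] at hj
    subst hj
    exact Or.inl (P.mem_innerSet_slice₁ hi ht hx hz)
  · simp only [copy, Option.some.injEq] at hj
    subst hj
    exact Or.inl (P.mem_innerSet_slice₂ hi ht hx hz)
  · simp only [copy, Option.some.injEq] at hj
    subst hj
    exact Or.inr (P.mem_outerSet_tail hβ hη hr)

/-- All pairs of vertices that may have a large distance. -/
noncomputable def badPairs : Finset (Vert × Vert) :=
  P.criticalPairs ∪ P.nearPairs ∪ P.innerPairs

/-- An inner vertex shows its second index, so it reaches only vertices of the same copy. With many
copies these pairs are few, and each may be charged the maximal distance. -/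
theorem stepDist_inner {u v : Vert} {j : ℕ} (hj : j < P.N₂) (hu : u ∈ P.innerSet j)
    (hc : copy u = some j) (hut : ∀ j x z r, u ≠ .tail j x z r) (hv : v ∈ P.hard) :
    stepDist P.Adj u v ≤ 6 ∨ ((u, v) ∈ P.badPairs ∧ stepDist P.Adj u v ≤ P.N + 6) := by
  by_cases h : ReflTransGen P.Adj u v
  · refine Or.inr ⟨?_, P.stepDist_le_add_six hut hv⟩
    have hcv : copy v = some j := by
      rcases P.copy_eq_of_reach h with h | h
      · rw [hc] at h; simp at h
      · rw [← h, hc]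
    exact Finset.mem_union_right _ (Finset.mem_biUnion.2 ⟨j, Finset.mem_range.2 hj,
      Finset.mem_product.2 ⟨hu, P.mem_innerSet_or_outerSet hv hcv⟩⟩)
  · rw [stepDist_eq_zero h]; exact Or.inl (by omega)

/-- The distances from sources and leaves. -/
theorem stepDist_source {i : ℕ} {α : Fin 3 → ℕ} {ζ r : ℕ} {u v : Vert} (hi : i < P.N₁)
    (hα : ∀ c, α c < P.s) (hζ : ζ < P.s ^ 2) (hr : r ≤ P.W)
    (hu : u = if r = P.W then .core i 0 0 (toQ α) ζ else .leaf i (toQ α) ζ r) (hv : v ∈ P.hard) :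
    stepDist P.Adj u v ≤ 6 ∨ ((u, v) ∈ P.badPairs ∧ stepDist P.Adj u v ≤ P.N + 6) := by
  have hN := P.N_pos
  by_cases h : ReflTransGen P.Adj u v
  swap
  · rw [stepDist_eq_zero h]; exact Or.inl (by omega)
  have hut : ∀ j x z r, u ≠ .tail j x z r := by
    intro j x z r; rw [hu]; split_ifs <;> simp
  have hfar := P.stepDist_le_add_six hut hv
  have hrank := P.stepDist_le_rank h
  obtain ⟨l, hl, hlu⟩ : ∃ l ≤ 1, WalkOf P.Adj l u (.core i 0 0 (toQ α) ζ) := by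
    rw [hu]
    split_ifs with h1
    · exact ⟨0, by omega, .nil _⟩
    · exact ⟨1, le_rfl, .single (.leaf i α ζ r hi hα hζ (by omega) _ rfl _ rfl)⟩
  -- every vertex other than leaves that is reachable is reachable from the source
  have hsrc : P.rank v ≠ 0 → ReflTransGen P.Adj (.core i 0 0 (toQ α) ζ) v := by
    intro hv0
    by_cases h1 : r = P.W
    · rw [hu, if_pos h1] at h; exact h
    · rw [hu, if_neg h1] at h
      rcases ReflTransGen.cases_head h with rfl | ⟨w, h1, h2⟩
      · simp [rank] at hv0
      · generalize hz : Vert.leaf i (toQ α) ζ r = u' at h1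
        cases h1 with
        | line ℓ k _ hk _ _ hu' hv' => rw [hu'] at hz; simp [node] at hz
        | leaf =>
          simp only [Vert.leaf.injEq] at hz
          rwa [hz.1, hz.2.1, hz.2.2.1]
        | _ => simp at hz
  -- targets
  have htgt : ∀ j < P.N₂, ∀ β : Fin 3 → ℕ, (∀ c, β c < P.s) → ∀ η < 4 * P.s ^ 2,
      ReflTransGen P.Adj u (.core 0 j P.N (toQ β) η) →
      stepDist P.Adj u (.core 0 j P.N (toQ β) η) ≤ 4 ∨ ∃ ℓ : Line, ℓ.Valid P ∧
        ∀ r' ≤ P.Y, (u, if r' = P.Y then .core 0 j P.N (toQ β) η else .tail j (toQ β) η r') ∈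
          P.criticalPairs := by
    intro j hj β hβ η hη hreach
    have h1 : ReflTransGen P.Adj (.core i 0 0 (toQ α) ζ) (.core 0 j P.N (toQ β) η) := by
      by_cases h1 : r = P.W
      · rw [hu, if_pos h1] at hreach; exact hreach
      · rw [hu, if_neg h1] at hreach
        rcases ReflTransGen.cases_head hreach with hz | ⟨w, h1, h2⟩
        · simp at hz
        · generalize hz : Vert.leaf i (toQ α) ζ r = u' at h1
          cases h1 with
          | line ℓ k _ hk _ _ hu' hv' => rw [hu'] at hz; simp [node] at hz
          | leaf =>
            simp only [Vert.leaf.injEq] at hz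
            rwa [hz.1, hz.2.1, hz.2.2.1]
          | _ => simp at hz
    have h2 := P.excess_tgt_nonneg h1
    -- Excess zero means that the target is the end of the line from `α` to `β`: a critical pair. A
    -- positive excess is at least one, which pays for the unit lost in the slice at time `1`.
    rcases h2.eq_or_lt with h2 | h2
    · right
      have hℓ : Line.Valid P ⟨i, j, α, β, ζ⟩ := ⟨hi, hj, hα, hβ, hζ⟩
      refine ⟨⟨i, j, α, β, ζ⟩, hℓ, fun r' hr' => ?_⟩
      have hz : Line.z P ⟨i, j, α, β, ζ⟩ P.N = η := by
        have h3 : (((ζ : ℤ) + ∑ c, ((β c : ℤ) - α c) ^ 2 : ℤ) : ℚ) = ((η : ℤ) : ℚ) := by rw [h2]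
        push_cast at h3
        simp only [Line.z, P.clk_N, one_mul, Line.D, h3]
      refine Finset.mem_image.2 ⟨(⟨i, j, α, β, ζ⟩, r, r'), ?_, ?_⟩
      · simp only [Finset.mem_product, Finset.mem_range, mem_lines]
        exact ⟨hℓ, by omega, by omega⟩
      · rw [hu]
        simp only [node, Line.pos_zero, Line.pos_N, Line.z_zero, hz, hN.ne, hN.ne', if_true,
          if_false]
    · left
      have := stepDist_le (hlu.append (P.walk_to_tgt hi hj hα hβ hζ hη (by omega)))
      omega
  have hv' := hv
  rw [mem_hard, mem_leafSet, mem_coreSet, mem_tgtSet, mem_slice₁Set, mem_slice₂Set,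
    mem_tailSet] at hv
  rcases hv with ⟨i', _, α', _, ζ', _, r', _, rfl⟩ | ⟨ℓ, hℓ, k, hk, rfl⟩ |
    ⟨j, hj, β, hβ, η, hη, rfl⟩ | ⟨i', hi', j, _, t, ht, x, hx, z, hz, rfl⟩ |
    ⟨i', hi', j, _, t, ht, x, hx, z, hz, rfl⟩ | ⟨j, hj, β, hβ, η, hη, r', hr', rfl⟩
  · simp only [rank] at hrank; exact Or.inl (by omega)
  · rcases hk.eq_or_lt with rfl | hk
    · obtain ⟨η, hη, e⟩ := P.node_N hℓ
      rw [e] at h hfar ⊢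
      rcases htgt ℓ.j hℓ.j_lt ℓ.β hℓ.β_lt η hη h with h1 | ⟨ℓ', _, h1⟩
      · exact Or.inl (by omega)
      · have := h1 P.Y le_rfl
        rw [if_pos rfl] at this
        exact Or.inr ⟨Finset.mem_union_left _ (Finset.mem_union_left _ this), hfar⟩
    rcases Nat.eq_zero_or_pos k with rfl | hk0
    · have : P.rank (P.node ℓ 0) = 1 := by simp [rank, node]
      exact Or.inl (by omega)
    have hreach := hsrc (by
      simp [rank, node, hk0.ne'])
    have hii : ℓ.i = i := by
      rcases P.copy₁_eq_of_reach hreach with h | h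
      · simp [copy₁, node, hk.ne] at h
      · simpa [copy₁, node, hk.ne, hN.ne, eq_comm] using h
    have hnear : P.node ℓ k ∈ P.nearSet i α ζ → (u, P.node ℓ k) ∈ P.badPairs := by
      intro hm
      refine Finset.mem_union_left _ (Finset.mem_union_right _ (Finset.mem_biUnion.2
        ⟨(i, α, ζ, r), ?_, ?_⟩))
      · simp only [Finset.mem_product, Finset.mem_range, mem_cube]
        exact ⟨hi, hα, hζ, by omega⟩
      · rw [Finset.mem_product, Finset.mem_singleton]
        exact ⟨hu, hm⟩
    by_cases hk3 : 3 ≤ k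
    · have hE := P.excess_nonneg (fun c => by
        have := P.third_le_clk hk3 hk.le c; linarith) hreach
      -- Vertices high above the source are reached through a slice; the others have their height in
      -- a window of length `3 * J + 21` over each position.
      by_cases hbig : 3 * (P.J : ℚ) + 21 ≤
          ℓ.z P k - ζ - ∑ c, (ℓ.pos P k c - α c) ^ 2 / P.clk k c
      · have := P.walk_to_node hℓ hk3 hk hα hζ hbig
        rw [hii] at this
        have := stepDist_le (hlu.append this)
        exact Or.inl (by omega)
      · refine Or.inr ⟨hnear (Finset.mem_union_right _ (Finset.mem_biUnion.2 ⟨k,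
          Finset.mem_Ico.2 ⟨hk3, hk⟩, Finset.mem_image.2 ⟨ℓ, ?_, rfl⟩⟩)), hfar⟩
        rw [Finset.mem_filter, mem_lines]
        push_cast
        refine ⟨hℓ, hii, by linarith, by linarith⟩
    -- The levels `1` and `2` have no slices below them and are charged completely.
    · refine Or.inr ⟨hnear (Finset.mem_union_left _ (Finset.mem_biUnion.2 ⟨k,
          Finset.mem_Ico.2 ⟨hk0, by omega⟩, Finset.mem_image.2 ⟨ℓ, ?_, rfl⟩⟩)), hfar⟩
      rw [Finset.mem_filter, mem_lines]
      exact ⟨hℓ, hii⟩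
  · rcases htgt j hj β hβ η hη h with h1 | ⟨ℓ', _, h1⟩
    · exact Or.inl (by omega)
    · have := h1 P.Y le_rfl
      rw [if_pos rfl] at this
      exact Or.inr ⟨Finset.mem_union_left _ (Finset.mem_union_left _ this), hfar⟩
  · simp only [rank] at hrank; exact Or.inl (by omega)
  · simp only [rank] at hrank; exact Or.inl (by omega)
  · rcases P.reach_to_tail h with ⟨r', h⟩ | ⟨h1, h2⟩
    · exact absurd h (hut _ _ _ _)
    · rcases htgt j hj β hβ η hη h1 with h3 | ⟨ℓ', _, h3⟩
      · have h4 := stepDist_triangle h1 (.single h2)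
        have h5 := stepDist_le (WalkOf.single h2)
        exact Or.inl (by omega)
      · have := h3 r' hr'.le
        rw [if_neg hr'.ne] at this
        exact Or.inr ⟨Finset.mem_union_left _ (Finset.mem_union_left _ this), hfar⟩

theorem stepDist_tgt_le {j : ℕ} {x : Fin 3 → ℚ} {z : ℚ} {v : Vert} :
    stepDist P.Adj (.core 0 j P.N x z) v ≤ 6 := by
  by_cases h : ReflTransGen P.Adj (.core 0 j P.N x z) v
  · rcases P.reach_from_tgt h with rfl | h
    · exact (stepDist_le (.nil _)).trans (by omega)
    · exact (stepDist_le (.single h)).trans (by omega)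
  · rw [stepDist_eq_zero h]; omega

/-- Most pairs of vertices have distance at most six. -/
theorem stepDist_le_six_or {u v : Vert} (hu : u ∈ P.hard) (hv : v ∈ P.hard) :
    stepDist P.Adj u v ≤ 6 ∨ ((u, v) ∈ P.badPairs ∧ stepDist P.Adj u v ≤ P.N + 6) ∨
      ((u, v) ∈ P.tailPairs ∧ stepDist P.Adj u v ≤ P.Y) := by
  have hN := P.N_pos
  rw [mem_hard, mem_leafSet, mem_coreSet, mem_tgtSet, mem_slice₁Set, mem_slice₂Set,
    mem_tailSet] at hu
  rcases hu with ⟨i, hi, α, hα, ζ, hζ, r, hr, rfl⟩ | ⟨ℓ, hℓ, k, hk, rfl⟩ |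
    ⟨j, hj, β, hβ, η, hη, rfl⟩ | ⟨i, hi, j, hj, t, ht, x, hx, z, hz, rfl⟩ |
    ⟨i, hi, j, hj, t, ht, x, hx, z, hz, rfl⟩ | ⟨j, hj, β, hβ, η, hη, r, hr, rfl⟩
  · exact (P.stepDist_source hi hα hζ hr.le (by rw [if_neg hr.ne]) hv).imp id Or.inl
  · rcases hk.eq_or_lt with rfl | hk
    · obtain ⟨η, hη, e⟩ := P.node_N hℓ
      rw [e]
      exact Or.inl P.stepDist_tgt_le
    rcases Nat.eq_zero_or_pos k with rfl | hk0
    · refine (P.stepDist_source hℓ.i_lt hℓ.α_lt hℓ.ζ_lt le_rfl ?_ hv).imp id Or.inl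
      rw [if_pos rfl, node, if_neg hN.ne, if_pos rfl, Line.pos_zero, Line.z_zero]
    · refine (P.stepDist_inner hℓ.j_lt (P.mem_innerSet_node hℓ hk0 hk) ?_ ?_ hv).imp id Or.inl
      · simp [copy, node, hk0.ne']
      · simp [node]
  · exact Or.inl P.stepDist_tgt_le
  · exact (P.stepDist_inner hj (P.mem_innerSet_slice₁ hi ht hx hz) rfl (by simp) hv).imp id Or.inl
  · exact (P.stepDist_inner hj (P.mem_innerSet_slice₂ hi ht hx hz) rfl (by simp) hv).imp id Or.inl
  · by_cases h : ReflTransGen P.Adj (.tail j (toQ β) η r) v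
    · obtain ⟨r', rfl⟩ := P.reach_from_tail h
      have h1 := P.stepDist_le_rank h
      have hr' : r' < P.Y := by
        rw [mem_hard, mem_leafSet, mem_coreSet, mem_tgtSet, mem_slice₁Set, mem_slice₂Set,
          mem_tailSet] at hv
        rcases hv with ⟨_, _, _, _, _, _, _, _, h⟩ | ⟨_, _, _, _, h⟩ | ⟨_, _, _, _, _, _, h⟩ |
          ⟨_, _, _, _, _, _, _, _, _, _, h⟩ | ⟨_, _, _, _, _, _, _, _, _, _, h⟩ |
          ⟨_, _, _, _, _, _, _, hr, h⟩
        · simp at h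
        · simp [node] at h
        · simp at h
        · simp at h
        · simp at h
        · simp only [Vert.tail.injEq] at h; omega
      refine Or.inr (Or.inr ⟨Finset.mem_image.2 ⟨(j, β, η, r, r'), ?_, rfl⟩, ?_⟩)
      · simp only [Finset.mem_product, Finset.mem_range, mem_cube]
        exact ⟨hj, hβ, hη, hr, hr'⟩
      · simp only [rank] at h1; omega
    · rw [stepDist_eq_zero h]; exact Or.inl (by omega)

/-- An upper bound for the part of the potential caused by pairs of large distance. -/
def potBound : ℕ := (P.N + 6) * (P.N₁ * P.N₂ * P.s ^ 8 * ((P.W + 1) * (P.Y + 1)) +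
    P.N₁ * P.s ^ 5 * (P.W + 1) * P.nearBound +
    P.N₂ * (P.innerBound * (P.innerBound + 4 * P.s ^ 5 * (P.Y + 1)))) +
  P.Y * (4 * P.N₂ * P.s ^ 5 * P.Y ^ 2)

theorem sum_stepDist_le (n : ℕ) (S : Finset Vert) (hn : S.card = n)
    (hS : ∀ v ∈ S, v ∈ P.hard ∨ ∃ r, v = .extra r) :
    ∑ u ∈ S, ∑ v ∈ S, stepDist P.Adj u v ≤ 6 * n ^ 2 + P.potBound := by
  have key : ∀ p ∈ S ×ˢ S, stepDist P.Adj p.1 p.2 ≤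
      6 + (if p ∈ P.badPairs then P.N + 6 else 0) + (if p ∈ P.tailPairs then P.Y else 0) := by
    rintro ⟨u, v⟩ hp
    rw [Finset.mem_product] at hp
    simp only
    by_cases h : ReflTransGen P.Adj u v
    swap
    · rw [stepDist_eq_zero h]; omega
    rcases hS u hp.1 with hu | ⟨r, rfl⟩
    · rcases hS v hp.2 with hv | ⟨r, rfl⟩
      · rcases P.stepDist_le_six_or hu hv with h | ⟨h, h'⟩ | ⟨h, h'⟩
        · omega
        · rw [if_pos h]; omega
        · rw [if_pos h]; omega
      · obtain ⟨r', rfl⟩ := P.reach_to_extra h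
        rcases P.reach_from_extra h with h | h
        · rw [h]; exact (stepDist_le (.nil _)).trans (by omega)
        · exact (stepDist_le (.single h)).trans (by omega)
    · rcases P.reach_from_extra h with rfl | h
      · exact (stepDist_le (.nil _)).trans (by omega)
      · exact (stepDist_le (.single h)).trans (by omega)
  rw [← Finset.sum_product']
  refine (Finset.sum_le_sum key).trans ?_
  rw [Finset.sum_add_distrib, Finset.sum_add_distrib, Finset.sum_const, Finset.card_product, hn,
    ← Finset.sum_filter, ← Finset.sum_filter, Finset.sum_const, Finset.sum_const]
  simp only [smul_eq_mul]
  have h1 : ((S ×ˢ S).filter fun p => p ∈ P.badPairs).card ≤ P.badPairs.card :=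
    Finset.card_le_card fun p hp => (Finset.mem_filter.1 hp).2
  have h2 : ((S ×ˢ S).filter fun p => p ∈ P.tailPairs).card ≤ P.tailPairs.card :=
    Finset.card_le_card fun p hp => (Finset.mem_filter.1 hp).2
  have h3 : P.badPairs.card ≤ P.N₁ * P.N₂ * P.s ^ 8 * ((P.W + 1) * (P.Y + 1)) +
    P.N₁ * P.s ^ 5 * (P.W + 1) * P.nearBound +
    P.N₂ * (P.innerBound * (P.innerBound + 4 * P.s ^ 5 * (P.Y + 1))) := by
    unfold badPairs
    refine (Finset.card_union_le _ _).trans (Nat.add_le_add ((Finset.card_union_le _ _).trans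
      (Nat.add_le_add P.card_criticalPairs_le P.card_nearPairs_le)) P.card_innerPairs_le)
  have h4 := Nat.mul_le_mul_right (P.N + 6) (h1.trans h3)
  have h5 := Nat.mul_le_mul_right P.Y (h2.trans P.card_tailPairs_le)
  unfold potBound
  rw [mul_comm (P.N + 6), mul_comm P.Y]
  have : n * n * 6 = 6 * n ^ 2 := by ring
  omega

end Par

end CertifiedShortcuts

/-! ### The directed graph on a given number of vertices -/

namespace CertifiedShortcuts

theorem sq_le_card_pairs_lt (F : ℕ) : (F - 1) ^ 2 ≤
    2 * ((Finset.univ : Finset (Fin F × Fin F)).filter fun p => p.1 < p.2).card := by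
  have e1 : ((Finset.univ : Finset (Fin F × Fin F)).filter fun p => p.1 < p.2).card =
      ∑ b : Fin F, (b : ℕ) := by
    rw [← Finset.univ_product_univ, Finset.card_filter, Finset.sum_product_right]
    refine Finset.sum_congr rfl fun b _ => ?_
    rw [← Finset.card_filter]
    have : (Finset.univ.filter fun a : Fin F => a < b) = Finset.Iio b := by
      ext; simp
    rw [this, Fin.card_Iio]
  rw [e1, Fin.sum_univ_eq_sum_range (fun i => i), Finset.sum_range_id]
  rcases Nat.eq_zero_or_pos F with rfl | h0
  · simp
  obtain ⟨f, rfl⟩ := Nat.exists_eq_add_of_lt h0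
  simp only [zero_add, Nat.add_sub_cancel]
  have h3 := Nat.div_mul_cancel (Nat.even_mul_succ_self f).two_dvd
  have h4 : (f + 1) * f / 2 * 2 = (f + 1) * f := by rw [mul_comm (f + 1)]; exact h3
  nlinarith

namespace Par

open Relation

variable (P : Par)

/-- The vertices of the construction with a filling that makes their number equal to `n`. -/
noncomputable def verts (n : ℕ) : Finset Vert :=
  P.hard ∪ (Finset.range (n - P.hard.card)).image Vert.extra

theorem extra_notMem_hard (r : ℕ) : Vert.extra r ∉ P.hard := by
  rw [mem_hard, mem_leafSet, mem_coreSet, mem_tgtSet, mem_slice₁Set, mem_slice₂Set, mem_tailSet]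
  simp [node]

theorem card_verts {n : ℕ} (hn : P.hard.card ≤ n) : (P.verts n).card = n := by
  rw [verts, Finset.card_union_of_disjoint, Finset.card_image_of_injective, Finset.card_range]
  · omega
  · intro r r' h; simpa using h
  · refine Finset.disjoint_left.2 fun v hv hv' => ?_
    obtain ⟨r, _, rfl⟩ := Finset.mem_image.1 hv'
    exact P.extra_notMem_hard r hv

theorem mem_verts_of_adj {n : ℕ} (hn : P.hard.card + P.F ≤ n) {u v : Vert} (h : P.Adj u v) :
    u ∈ P.verts n ∧ v ∈ P.verts n := by
  rcases P.mem_hard_of_adj h with h | ⟨r, r', rfl, rfl, h1, h2⟩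
  · exact ⟨Finset.mem_union_left _ h.1, Finset.mem_union_left _ h.2⟩
  · constructor <;> refine Finset.mem_union_right _ (Finset.mem_image_of_mem _
      (Finset.mem_range.2 ?_)) <;> omega

theorem card_tgtSet : P.tgtSet.card = 4 * P.N₂ * P.s ^ 5 := by
  rw [tgtSet, Finset.card_image_of_injective]
  · simp only [Finset.card_product, Finset.card_range, card_cube]; ring
  · rintro ⟨j, β, η⟩ ⟨j', β', η'⟩ h
    simp only [Vert.core.injEq, true_and, Nat.cast_inj] at h
    obtain ⟨h1, h2, h3⟩ := h
    have : β = β' := funext fun c => by exact_mod_cast congrFun h2 c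
    simp [h1, h3, this]

theorem node_N_eq {ℓ ℓ' : Line} (h : P.node ℓ P.N = P.node ℓ' P.N) (hi : ℓ.i = ℓ'.i)
    (hα : ℓ.α = ℓ'.α) : ℓ = ℓ' := by
  simp only [node, Vert.core.injEq, if_neg P.N_pos.ne', if_true, true_and, Line.pos_N] at h
  obtain ⟨hj, hβ, hz⟩ := h
  have hβ' : ℓ.β = ℓ'.β := funext fun c => by exact_mod_cast congrFun hβ c
  have hD : ℓ.D = ℓ'.D := by
    ext c; simp only [Line.D, hα, hβ']
  have hζ : ℓ.ζ = ℓ'.ζ := by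
    simp only [Line.z, hD] at hz
    exact_mod_cast add_right_cancel hz
  exact Line.ext hi hj hα hβ' hζ

/-- A target shows the second index, the end position and the final height, so a line to it is
determined by its first index and start position. -/
theorem card_lines_to_le (t : Vert) :
    Nat.card {ℓ : {ℓ : Line // ℓ.Valid P} // P.node ℓ P.N = t} ≤ P.N₁ * P.s ^ 3 := by
  have : Nat.card (Finset.range P.N₁ ×ˢ P.cube : Finset (ℕ × (Fin 3 → ℕ))) = P.N₁ * P.s ^ 3 := by
    rw [Nat.card_eq_fintype_card, Fintype.card_coe, Finset.card_product, Finset.card_range,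
      card_cube]
  rw [← this]
  refine Nat.card_le_card_of_injective (fun ℓ => ⟨(ℓ.1.1.i, ℓ.1.1.α), ?_⟩) ?_
  · rw [Finset.mem_product, Finset.mem_range, mem_cube]
    exact ⟨ℓ.1.2.i_lt, ℓ.1.2.α_lt⟩
  · intro ℓ ℓ' h
    simp only [Subtype.mk.injEq, Prod.mk.injEq] at h
    exact Subtype.ext (Subtype.ext (P.node_N_eq (ℓ.2.trans ℓ'.2.symm) h.1 h.2))

/-- The construction on exactly `n` vertices. -/
theorem exists_digraph (n : ℕ) (hn : P.hardBound + P.F ≤ n) : ∃ G : Digraph (Fin n), IsDAG G ∧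
    (P.F - 1) ^ 2 ≤ 2 * edgeCount G ∧ edgeCount G ≤ P.edgeBound + P.F ^ 2 ∧
    (∀ (k a : ℕ) (H : Finset (Fin n × Fin n)), 6 * n ^ 2 + P.potBound < k * (P.W * P.Y * a) →
      GreedyShortcut G k H → P.N₁ * P.N₂ * P.s ^ 8 * P.N ≤
        3 * certComplexity G H + P.N₁ * P.N₂ * P.s ^ 8 * (2 * (a + 3))) ∧
    (∀ (k a R M : ℕ) (H : Finset (Fin n × Fin n)) (𝒞 : Finset (List (Fin n))) (L B : ℝ),
      IsChainCover G 𝒞 L B → B * n / L ≤ P.Y / 2 → 20 * M * L ≤ P.Y * (4 * P.N₂ * P.s ^ 5 : ℕ) →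
      0 < P.Y → 6 * n ^ 2 + P.potBound < k * (P.W * M * a) → GreedyChainShortcut G 𝒞 R k H →
      P.N₁ * P.N₂ * P.s ^ 8 * P.N ≤ 6 * certComplexity G H +
        P.N₁ * P.N₂ * P.s ^ 8 * (2 * (a + R + 2) + P.N / 2)) := by
  have hn' : P.hard.card + P.F ≤ n := (Nat.add_le_add_right P.card_hard_le _).trans hn
  have hcard := P.card_verts (n := n) (by omega)
  let E := (P.verts n).equivFinOfCardEq hcard
  let e : Fin n → Vert := fun x => (E.symm x).1
  have he : Function.Injective e := Subtype.val_injective.comp E.symm.injective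
  have hrange : ∀ v, v ∈ Set.range e ↔ v ∈ P.verts n := by
    intro v
    constructor
    · rintro ⟨x, rfl⟩; exact (E.symm x).2
    · intro hv; exact ⟨E ⟨v, hv⟩, by simp [e]⟩
  have hr : ∀ u v, P.graph.Adj u v → u ∈ Set.range e ∧ v ∈ Set.range e := by
    intro u v h
    rw [hrange, hrange]
    exact P.mem_verts_of_adj hn' h
  have hr' : ∀ u v, P.Adj u v → u ∈ Set.range e ∧ v ∈ Set.range e := hr
  let G : Digraph (Fin n) := ⟨fun a b => P.graph.Adj (e a) (e b)⟩
  obtain ⟨src, tgt, hsrc, htgt⟩ := P.lineSystem.exists_src_tgt e hr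
  let D : LineSystem G {ℓ : Line // ℓ.Valid P} P.N P.W P.Y :=
    P.lineSystem.comap e he hr src tgt hsrc htgt
  have hpot : potential G ∅ ≤ 6 * n ^ 2 + P.potBound := by
    have h1 : ∀ x y, stepDist (AugAdj G ∅) x y = stepDist P.Adj (e x) (e y) := by
      intro x y
      rw [← stepDist_comap he hr']
      congr 1
      ext a b
      simp [AugAdj, G, graph]
    have h2 : ∀ f : Vert → ℕ, ∑ x : Fin n, f (e x) = ∑ v ∈ P.verts n, f v := by
      intro f
      rw [← Finset.sum_coe_sort (P.verts n) f]
      exact Fintype.sum_equiv E.symm _ _ fun x => rfl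
    rw [potential]
    simp only [h1]
    rw [h2 fun u => ∑ y : Fin n, stepDist P.Adj u (e y)]
    simp only [h2]
    refine P.sum_stepDist_le n _ hcard fun v hv => ?_
    rcases Finset.mem_union.1 hv with h | h
    · exact Or.inl h
    · obtain ⟨r, _, rfl⟩ := Finset.mem_image.1 h
      exact Or.inr ⟨r, rfl⟩
  have hΛ := P.card_validLines
  refine ⟨G, isDAG_of_rank D.rk D.rk_lt, ?_, ?_, ?_, ?_⟩
  · -- lower bound for the number of edges
    choose ex hex using fun r : Fin P.F => (hrange (.extra r)).2 (Finset.mem_union_right _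
      (Finset.mem_image_of_mem _ (Finset.mem_range.2 (by have := r.2; omega))))
    have hinj : Function.Injective ex := fun r r' h => by
      have := hex r
      rw [h, hex r'] at this
      simp only [Vert.extra.injEq] at this
      exact Fin.ext this.symm
    have h1 : ((Finset.univ : Finset (Fin P.F × Fin P.F)).filter fun p => p.1 < p.2).card ≤
        edgeCount G := by
      rw [edgeCount, ← Set.ncard_coe_finset]
      refine Set.ncard_le_ncard_of_injOn (fun p => (ex p.1, ex p.2)) ?_ ?_ (Set.toFinite _)
      · intro p hp
        have hp' : p.1 < p.2 := by simpa using hp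
        change P.Adj (e (ex p.1)) (e (ex p.2))
        rw [hex, hex]
        exact .extra _ _ hp' p.2.2
      · intro p _ p' _ h
        simp only [Prod.mk.injEq] at h
        exact Prod.ext (hinj h.1) (hinj h.2)
    exact (sq_le_card_pairs_lt P.F).trans (Nat.mul_le_mul_left 2 h1)
  · obtain ⟨F, hF, hFc⟩ := P.exists_edges
    refine le_trans ?_ hFc
    rw [edgeCount, ← Set.ncard_coe_finset]
    refine Set.ncard_le_ncard_of_injOn (fun p => (e p.1, e p.2)) ?_ ?_ (Finset.finite_toSet _)
    · intro p hp
      exact hF _ _ hp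
    · intro p _ p' _ h
      simp only [Prod.mk.injEq] at h
      exact Prod.ext (he h.1) (he h.2)
  · intro k a H hk hH
    have := D.le_certComplexity_greedyShortcut (a := a) (hpot.trans_lt hk) hH
    rwa [hΛ] at this
  · intro k a R M H 𝒞 L B h𝒞 hB hM hY hk hH
    let T : Finset (Fin n) := P.tgtSet.preimage e he.injOn
    have htsub : ∀ v ∈ P.tgtSet, v ∈ Set.range e := fun v hv => (hrange v).2
      (Finset.mem_union_left _ (P.mem_hard.2 (Or.inr (Or.inr (Or.inl hv)))))
    have hTcard : T.card = 4 * P.N₂ * P.s ^ 5 := by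
      rw [Finset.card_preimage, Finset.filter_true_of_mem htsub, card_tgtSet]
    have hT : ∀ t ∈ T, ∃ j < P.N₂, ∃ β : Fin 3 → ℕ, (∀ c, β c < P.s) ∧
        ∃ η < 4 * P.s ^ 2, e t = .core 0 j P.N (toQ β) η := fun t ht =>
      P.mem_tgtSet.1 (Finset.mem_preimage.1 ht)
    have htails : ∀ t v, v ∈ D.tails t ↔ e v ∈ P.tailsOf (e t) := fun t v => Finset.mem_preimage (hf := he.injOn)
    have hadj : ∀ {j : ℕ} {β : Fin 3 → ℕ} {η : ℕ}, j < P.N₂ → (∀ c, β c < P.s) →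
        η < 4 * P.s ^ 2 → ∀ r < P.Y, ∃ v, e v = .tail j (toQ β) η r := by
      intro j β η hj hβ hη r hr
      exact (hr' _ _ (.tail j β η r hj hβ hη hr _ rfl _ rfl)).2
    have := D.le_certComplexity_greedyChainShortcut (a := a) (R := R) (M := M) (H := H)
      (P := P.N₁ * P.s ^ 3) (L := L) (B := B) (𝒞 := 𝒞) (k := k) T ?_ ?_ ?_ ?_ ?_ ?_ h𝒞 ?_ ?_ hY
      (hpot.trans_lt hk) hH
    · rwa [hΛ] at this
    · intro ℓ
      rw [Finset.mem_preimage]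
      obtain ⟨η, hη, h⟩ := P.node_N ℓ.2
      have : e (D.tgt ℓ) = P.node ℓ P.N := htgt ℓ
      rw [this, h]
      exact P.mem_tgtSet.2 ⟨_, ℓ.2.j_lt, _, ℓ.2.β_lt, η, hη, rfl⟩
    · intro t ht t' ht' v hv v' hv' hvv
      obtain ⟨j, _, β, _, η, _, h⟩ := hT t ht
      obtain ⟨j', _, β', _, η', _, h'⟩ := hT t' ht'
      rw [htails, h, tailsOf] at hv
      rw [htails, h', tailsOf] at hv'
      obtain ⟨r, _, hrv⟩ := Finset.mem_image.1 hv
      obtain ⟨r', _, hrv'⟩ := Finset.mem_image.1 hv'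
      have hreach : ReflTransGen P.Adj (e v) (e v') := by
        rcases hvv with rfl | hvv
        · exact .refl
        · exact ((transGen_comap hr).1 hvv).to_reflTransGen
      rw [← hrv, ← hrv'] at hreach
      obtain ⟨r'', h''⟩ := P.reach_from_tail hreach
      simp only [Vert.tail.injEq] at h''
      apply he
      rw [h, h', h''.1, h''.2.1, h''.2.2.1]
    · intro t ht
      obtain ⟨j, hj, β, hβ, η, hη, h⟩ := hT t ht
      choose g hg using fun r : Fin P.Y => hadj hj hβ hη r r.2
      refine ⟨List.ofFn g, ?_, ?_⟩
      · rw [List.isChain_iff_getElem]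
        intro i hi
        rw [List.length_ofFn] at hi
        simp only [List.getElem_ofFn]
        change P.Adj (e _) (e _)
        rw [hg, hg]
        exact .next j β η i hj hβ hη hi _ rfl _ rfl
      · intro v hv
        rw [htails, h, tailsOf] at hv
        obtain ⟨r, hrY, hr⟩ := Finset.mem_image.1 hv
        rw [List.mem_ofFn]
        exact ⟨⟨r, Finset.mem_range.1 hrY⟩, he (by rw [hg, ← hr])⟩
    · intro t ht
      obtain ⟨j, hj, β, hβ, η, hη, h⟩ := hT t ht
      refine (P.card_tailsOf 0 j P.N (toQ β) η).symm.le.trans (le_of_eq ?_)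
      rw [← h]
      change _ = ((P.tailsOf (e t)).preimage e he.injOn).card
      rw [Finset.card_preimage, Finset.filter_true_of_mem]
      intro v hv
      rw [h, tailsOf] at hv
      obtain ⟨r, hrY, rfl⟩ := Finset.mem_image.1 hv
      exact hadj hj hβ hη r (Finset.mem_range.1 hrY)
    · intro t _
      refine le_trans (le_of_eq ?_) (P.card_lines_to_le (e t))
      refine Nat.card_congr (Equiv.subtypeEquivRight fun ℓ => ?_)
      have : e (D.tgt ℓ) = P.node ℓ P.N := htgt ℓ
      rw [← this]
      exact he.eq_iff.symm
    -- The product is four times the number of lines, since final heights range over `4 * s ^ 2`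
    -- values and initial heights over `s ^ 2`.
    · rw [hTcard, hΛ]
      have : P.N₁ * P.s ^ 3 * (4 * P.N₂ * P.s ^ 5) = 4 * (P.N₁ * P.N₂ * P.s ^ 8) := by ring
      omega
    · rwa [Fintype.card_fin]
    · rwa [hTcard]

end Par

end CertifiedShortcuts

/-! ### The choice of the parameters for directed graphs -/

namespace CertifiedShortcuts

namespace Par

/-- The parameters with all sizes but one given by powers of `X`. -/
structure Scaled (P : Par) (X : ℕ) : Prop where
  B : P.B = X ^ 5
  s : P.s = X ^ 7
  J : P.J = X ^ 6
  N₁ : P.N₁ = X ^ 2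
  N_le : P.N ≤ 6 * X ^ 10
  N_ge : 3 * X ^ 10 ≤ 8 * P.N
  X_ge : 32 ≤ X

variable {P : Par} {X : ℕ}

namespace Scaled

theorem pow_le (h : P.Scaled X) {i j : ℕ} (hij : i ≤ j) : X ^ i ≤ X ^ j :=
  Nat.pow_le_pow_right (by have := h.X_ge; omega) hij

theorem one_le_pow (h : P.Scaled X) (i : ℕ) : 1 ≤ X ^ i :=
  Nat.one_le_pow _ _ (by have := h.X_ge; omega)

theorem threeJ_le (h : P.Scaled X) : 3 * P.J + 2 ≤ 5 * X ^ 6 := by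
  rw [h.J]; have := h.one_le_pow 6; omega

/-- The main term counts the vertices on lines: of order `X ^ 10` levels, `X ^ 2 * N₂` copies, `X ^
36` positions and `X ^ 14` heights. The first two terms are the leaves and tails. -/
theorem hardBound_le (h : P.Scaled X) :
    P.hardBound ≤ X ^ 37 * P.W + 4 * (P.N₂ * X ^ 35) * P.Y + 2000 * (X ^ 62 * P.N₂) := by
  have h1 : (P.N + 1) * (P.N₁ * P.N₂ * ((4 * P.B * P.s) ^ 3 * (4 * P.s ^ 2))) ≤
      1792 * (X ^ 62 * P.N₂) := by
    calc _ ≤ (7 * X ^ 10) * (X ^ 2 * P.N₂ * ((4 * X ^ 5 * X ^ 7) ^ 3 * (4 * (X ^ 7) ^ 2))) := by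
          rw [h.N₁, h.B, h.s]
          gcongr
          have := h.N_le
          have := h.one_le_pow 10
          omega
      _ = _ := by ring
  have h2 : 4 * P.N₂ * P.s ^ 5 ≤ 4 * (X ^ 62 * P.N₂) := by
    calc _ = 4 * (X ^ 35 * P.N₂) := by rw [h.s]; ring
      _ ≤ _ := by gcongr 4 * (?_ * _); exact h.pow_le (by norm_num)
  have h3 : 2 * (4 * P.N₁ * P.N₂ * (3 * P.J + 2) * P.s ^ 5) ≤ 40 * (X ^ 62 * P.N₂) := by
    calc _ ≤ 2 * (4 * X ^ 2 * P.N₂ * (5 * X ^ 6) * (X ^ 7) ^ 5) := by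
          rw [h.N₁, h.s]
          gcongr
          exact h.threeJ_le
      _ = 40 * (X ^ 43 * P.N₂) := by ring
      _ ≤ _ := by gcongr 40 * (?_ * _); exact h.pow_le (by norm_num)
  have h4 : P.N₁ * P.s ^ 5 * P.W = X ^ 37 * P.W := by rw [h.N₁, h.s]; ring
  have h5 : 4 * P.N₂ * P.s ^ 5 * P.Y = 4 * (P.N₂ * X ^ 35) * P.Y := by rw [h.s]; ring
  rw [hardBound, h4, h5]
  omega

/-- The exits dominate, with of order `X ^ 3` for each of `X ^ 62 * N₂` vertices. Line edges and
entries are of order `X ^ 64 * N₂`. -/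
theorem edgeBound_le (h : P.Scaled X) : P.edgeBound ≤
    X ^ 37 * P.W + 8 * (P.N₂ * X ^ 35) * P.Y + 15000000 * (X ^ 65 * P.N₂) := by
  have h1 : (P.N + 1) * (P.N₁ * P.N₂ * ((4 * P.B * P.s) ^ 3 * (4 * P.s ^ 2))) *
      (16 * P.s / P.J + 4) ^ 3 ≤ 14336000 * (X ^ 65 * P.N₂) := by
    calc _ ≤ (7 * X ^ 10) * (X ^ 2 * P.N₂ * ((4 * X ^ 5 * X ^ 7) ^ 3 * (4 * (X ^ 7) ^ 2))) *
          (20 * X) ^ 3 := by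
          have h0 : 16 * P.s / P.J = 16 * X := by
            rw [h.s, h.J, show 16 * X ^ 7 = 16 * X * X ^ 6 by ring]
            exact Nat.mul_div_cancel _ (h.one_le_pow 6)
          rw [h0, h.N₁, h.B, h.s]
          gcongr
          · have := h.N_le
            have := h.one_le_pow 10
            omega
          · have := h.X_ge
            omega
      _ = _ := by ring
  have h2 : P.N * (P.N₁ * P.N₂ * (P.s ^ 2 * (4 * P.B * P.s) ^ 2 * (4 * P.s ^ 2))) ≤
      384 * (X ^ 65 * P.N₂) := by
    calc _ ≤ (6 * X ^ 10) * (X ^ 2 * P.N₂ *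
          ((X ^ 7) ^ 2 * (4 * X ^ 5 * X ^ 7) ^ 2 * (4 * (X ^ 7) ^ 2))) := by
          rw [h.N₁, h.B, h.s]
          gcongr
          exact h.N_le
      _ = 384 * (X ^ 64 * P.N₂) := by ring
      _ ≤ _ := by gcongr 384 * (?_ * _); exact h.pow_le (by norm_num)
  have h3 : P.N₁ * P.N₂ * (3 * P.J + 2) * P.s ^ 8 ≤ 5 * (X ^ 65 * P.N₂) := by
    calc _ ≤ X ^ 2 * P.N₂ * (5 * X ^ 6) * (X ^ 7) ^ 8 := by
          rw [h.N₁, h.s]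
          gcongr
          exact h.threeJ_le
      _ = 5 * (X ^ 64 * P.N₂) := by ring
      _ ≤ _ := by gcongr 5 * (?_ * _); exact h.pow_le (by norm_num)
  have h4 : 16 * P.N₁ * P.N₂ * (3 * P.J + 2) * P.s ^ 7 ≤ 80 * (X ^ 65 * P.N₂) := by
    calc _ ≤ 16 * X ^ 2 * P.N₂ * (5 * X ^ 6) * (X ^ 7) ^ 7 := by
          rw [h.N₁, h.s]
          gcongr
          exact h.threeJ_le
      _ = 80 * (X ^ 57 * P.N₂) := by ring
      _ ≤ _ := by gcongr 80 * (?_ * _); exact h.pow_le (by norm_num)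
  have h5 : 4 * P.N₁ * P.N₂ * P.s ^ 5 ≤ 4 * (X ^ 65 * P.N₂) := by
    calc _ = 4 * (X ^ 37 * P.N₂) := by rw [h.N₁, h.s]; ring
      _ ≤ _ := by gcongr 4 * (?_ * _); exact h.pow_le (by norm_num)
  have h6 : P.N₁ * P.s ^ 5 * P.W = X ^ 37 * P.W := by rw [h.N₁, h.s]; ring
  have h7 : 2 * (4 * P.N₂ * P.s ^ 5 * P.Y) = 8 * (P.N₂ * X ^ 35) * P.Y := by rw [h.s]; ring
  rw [edgeBound, h6, h7]
  omega

theorem nearBound_le (h : P.Scaled X) : P.nearBound ≤ 10000 * (X ^ 52 * P.N₂) := by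
  calc _ ≤ P.N₂ * (4 * X ^ 5 * X ^ 7) ^ 3 * (8 * X ^ 16 + 6 * X ^ 10 * (24 * X ^ 6)) := by
        rw [nearBound, h.B, h.s]
        have h1 : 3 * P.J + 21 ≤ 24 * X ^ 6 := by rw [h.J]; have := h.one_le_pow 6; omega
        have h2 : (X ^ 7) ^ 2 ≤ X ^ 16 := by rw [← pow_mul]; exact h.pow_le (by norm_num)
        have h3 := h.N_le
        gcongr
    _ = 9728 * (X ^ 52 * P.N₂) := by ring
    _ ≤ _ := by gcongr; norm_num

theorem innerBound_le (h : P.Scaled X) : P.innerBound ≤ 1600 * X ^ 62 := by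
  calc _ ≤ 6 * X ^ 10 * (X ^ 2 * ((4 * X ^ 5 * X ^ 7) ^ 3 * (4 * (X ^ 7) ^ 2))) +
        8 * X ^ 2 * (5 * X ^ 6) * (X ^ 7) ^ 5 := by
        rw [innerBound, h.N₁, h.B, h.s]
        have h1 := h.threeJ_le
        have h3 := h.N_le
        gcongr
    _ = 1536 * X ^ 62 + 40 * X ^ 43 := by ring
    _ ≤ _ := by have := h.pow_le (i := 43) (j := 62) (by norm_num); omega

/-- Each kind of distant pair, weighted by its distance, contributes at most a multiple of `n ^ 2`.
Critical pairs use `X ^ 68 ≤ X ^ 72`; near pairs give (leaves) · `X ^ 62 * N₂`; inner pairs need `X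
^ 10 ≤ N₂`, so that the copies outweigh the distance; tails need `Y ^ 2 ≤ n`, which follows from
`hn'`. -/
theorem potBound_le (h : P.Scaled X) {n : ℕ} (hN₂ : X ^ 10 ≤ P.N₂) (hn : X ^ 62 * P.N₂ ≤ n)
    (hn' : n ≤ X ^ 70 * P.N₂ ^ 2) (hW : X ^ 37 * P.W ≤ n) (hY : P.N₂ * X ^ 35 * P.Y ≤ n)
    (hW1 : 1 ≤ P.W) (hY1 : 1 ≤ P.Y) : P.potBound ≤ 2 ^ 27 * n ^ 2 := by
  have hX72 : X ^ 72 ≤ n := by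
    calc X ^ 72 = X ^ 62 * X ^ 10 := by ring
      _ ≤ X ^ 62 * P.N₂ := by gcongr
      _ ≤ n := hn
  have hXpos : 0 < X := by have := h.X_ge; omega
  have hN : P.N + 6 ≤ 12 * X ^ 10 := by
    have := h.N_le
    have := h.one_le_pow 10
    omega
  have h1 : P.N₁ * P.N₂ * P.s ^ 8 * ((P.W + 1) * (P.Y + 1)) * X ^ 10 ≤ 4 * n ^ 2 := by
    have hp : X ^ 68 ≤ X ^ 72 := h.pow_le (by norm_num)
    calc _ ≤ X ^ 2 * P.N₂ * (X ^ 7) ^ 8 * ((P.W + P.W) * (P.Y + P.Y)) * X ^ 10 := by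
          rw [h.N₁, h.s]; gcongr
      _ = 4 * (X ^ 68 * P.N₂ * P.W * P.Y) := by ring
      _ ≤ 4 * (X ^ 72 * P.N₂ * P.W * P.Y) := by gcongr
      _ = 4 * ((X ^ 37 * P.W) * (P.N₂ * X ^ 35 * P.Y)) := by ring
      _ ≤ 4 * (n * n) := by gcongr
      _ = _ := by ring
  have h2 : P.N₁ * P.s ^ 5 * (P.W + 1) * P.nearBound * X ^ 10 ≤ 20000 * n ^ 2 := by
    calc _ ≤ X ^ 2 * (X ^ 7) ^ 5 * (P.W + P.W) * (10000 * (X ^ 52 * P.N₂)) * X ^ 10 := by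
          rw [h.N₁, h.s]
          have := h.nearBound_le
          gcongr
      _ = 20000 * ((X ^ 37 * P.W) * (X ^ 62 * P.N₂)) := by ring
      _ ≤ 20000 * (n * n) := by gcongr
      _ = _ := by ring
  have h3 : P.N₂ * (P.innerBound * (P.innerBound + 4 * P.s ^ 5 * (P.Y + 1))) * X ^ 10 ≤
      5000000 * n ^ 2 := by
    calc _ ≤ P.N₂ * (1600 * X ^ 62 * (1600 * X ^ 62 + 4 * (X ^ 7) ^ 5 * (P.Y + P.Y))) *
          X ^ 10 := by
          rw [h.s]
          have := h.innerBound_le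
          gcongr
      _ = 2560000 * ((X ^ 62 * P.N₂) * (X ^ 62 * X ^ 10)) +
          12800 * (X ^ 72 * (P.N₂ * X ^ 35 * P.Y)) := by ring
      _ ≤ 2560000 * ((X ^ 62 * P.N₂) * (X ^ 62 * P.N₂)) +
          12800 * (X ^ 72 * (P.N₂ * X ^ 35 * P.Y)) := by gcongr
      _ ≤ 2560000 * (n * n) + 12800 * (n * n) := by gcongr
      _ ≤ _ := by nlinarith [sq_nonneg n]
  have h4 : P.Y * (4 * P.N₂ * P.s ^ 5 * P.Y ^ 2) ≤ 4 * n ^ 2 := by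
    have hY2 : P.Y ^ 2 ≤ n := by
      have h0 : 0 < X ^ 70 * P.N₂ ^ 2 := by have := P.N₂_pos; positivity
      refine Nat.le_of_mul_le_mul_left ?_ h0
      calc X ^ 70 * P.N₂ ^ 2 * P.Y ^ 2 = (P.N₂ * X ^ 35 * P.Y) ^ 2 := by ring
        _ ≤ n ^ 2 := by gcongr
        _ = n * n := by ring
        _ ≤ X ^ 70 * P.N₂ ^ 2 * n := by gcongr
    calc _ = 4 * (P.N₂ * X ^ 35 * P.Y) * P.Y ^ 2 := by rw [h.s]; ring
      _ ≤ 4 * n * n := by gcongr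
      _ = _ := by ring
  calc P.potBound ≤ 12 * X ^ 10 * (P.N₁ * P.N₂ * P.s ^ 8 * ((P.W + 1) * (P.Y + 1)) +
        P.N₁ * P.s ^ 5 * (P.W + 1) * P.nearBound +
        P.N₂ * (P.innerBound * (P.innerBound + 4 * P.s ^ 5 * (P.Y + 1)))) +
        P.Y * (4 * P.N₂ * P.s ^ 5 * P.Y ^ 2) := by
        rw [potBound]; gcongr
    _ = 12 * (P.N₁ * P.N₂ * P.s ^ 8 * ((P.W + 1) * (P.Y + 1)) * X ^ 10) +
        12 * (P.N₁ * P.s ^ 5 * (P.W + 1) * P.nearBound * X ^ 10) +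
        12 * (P.N₂ * (P.innerBound * (P.innerBound + 4 * P.s ^ 5 * (P.Y + 1))) * X ^ 10) +
        P.Y * (4 * P.N₂ * P.s ^ 5 * P.Y ^ 2) := by ring
    _ ≤ 2 ^ 27 * n ^ 2 := by omega

end Scaled

theorem exists_scaled {X : ℕ} (hX : 32 ≤ X) {N₂ : ℕ} (hN₂ : 0 < N₂) (W Y F : ℕ) :
    ∃ P : Par, P.Scaled X ∧ P.N₂ = N₂ ∧ P.W = W ∧ P.Y = Y ∧ P.F = F := by
  have hp : ∀ i, 1 ≤ i → 32 ≤ X ^ i := fun i hi =>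
    hX.trans (Nat.le_self_pow (by omega) X)
  have hp5 : 32 ^ 5 ≤ X ^ 5 := by gcongr
  obtain ⟨L, f, h0, h1, h2, h3, h4, h5, h6⟩ := exists_layers (X ^ 5) (by omega)
  have h7 : (X ^ 5) ^ 2 = X ^ 10 := by ring
  rw [h7] at h5 h6
  have := hp 10 (by norm_num)
  have := hp 6 (by norm_num)
  have := hp 2 (by norm_num)
  exact ⟨⟨X ^ 5, X ^ 7, X ^ 6, X ^ 2, N₂, W, Y, F, L, f, h0, h1, h2, h3, h4, by positivity,
    by omega, by omega, hN₂⟩, ⟨rfl, rfl, rfl, rfl, by simp only [N]; omega,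
    by simp only [N]; omega, hX⟩, rfl, rfl, rfl, rfl⟩

/-- The construction, with sizes given by powers of a single parameter. -/
theorem exists_digraph_of_pow {X N₂ F n : ℕ} (hX : 32 ≤ X) (hN₂ : X ^ 10 ≤ N₂)
    (hn : 20000 * (X ^ 62 * N₂) ≤ n) (hn' : n ≤ X ^ 70 * N₂ ^ 2) (hF : 4 * F ≤ n) :
    ∃ G : Digraph (Fin n), IsDAG G ∧ (F - 1) ^ 2 ≤ 2 * edgeCount G ∧
    edgeCount G ≤ 2 * n + 15000000 * (X ^ 65 * N₂) + F ^ 2 ∧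
    (∀ (k : ℕ) (H : Finset (Fin n × Fin n)), 2 ^ 46 * (X ^ 62 * N₂) < k →
      GreedyShortcut G k H → X ^ 68 * N₂ ≤ 16 * certComplexity G H) ∧
    (∀ (k R M : ℕ) (H : Finset (Fin n × Fin n)) (𝒞 : Finset (List (Fin n))) (L B : ℝ),
      IsChainCover G 𝒞 L B → 0 < L → 256 * (X ^ 35 * N₂ : ℕ) * B ≤ L → 1280 * M * L ≤ n →
      2 ^ 40 * (X ^ 27 * n) < k * M → 64 * R + 128 ≤ X ^ 10 → GreedyChainShortcut G 𝒞 R k H →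
      X ^ 68 * N₂ ≤ 64 * certComplexity G H) := by
  have hp2 : 32 ^ 10 ≤ X ^ 10 := by gcongr
  have hN₂' : 0 < N₂ := by omega
  -- With these values the leaves and the tail vertices each take up at most a sixteenth of the `n`
  -- vertices, and a fixed fraction of them at least.
  obtain ⟨P, h, rfl, hW, hY, rfl⟩ := exists_scaled hX hN₂' (n / (16 * X ^ 37))
    (n / (64 * (N₂ * X ^ 35))) F
  have hX0 : 0 < X := by omega
  have e1 : X ^ 37 * P.N₂ ≤ X ^ 62 * P.N₂ := by gcongr ?_ * _; exact h.pow_le (by norm_num)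
  have e2 : X ^ 35 * P.N₂ ≤ X ^ 62 * P.N₂ := by gcongr ?_ * _; exact h.pow_le (by norm_num)
  have e3 : X ^ 37 * 1 ≤ X ^ 37 * P.N₂ := by gcongr; omega
  have e4 : P.N₂ * X ^ 35 = X ^ 35 * P.N₂ := mul_comm _ _
  have pos1 : 0 < X ^ 37 := by positivity
  have pos2 : 0 < P.N₂ * X ^ 35 := by positivity
  have hWle : X ^ 37 * P.W * 16 ≤ n := by
    rw [hW]; calc _ = n / (16 * X ^ 37) * (16 * X ^ 37) := by ring
      _ ≤ n := Nat.div_mul_le_self _ _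
  have hYle : P.N₂ * X ^ 35 * P.Y * 64 ≤ n := by
    rw [hY]; calc _ = n / (64 * (P.N₂ * X ^ 35)) * (64 * (P.N₂ * X ^ 35)) := by ring
      _ ≤ n := Nat.div_mul_le_self _ _
  have hW1 : 1 ≤ P.W := by rw [hW, Nat.one_le_div_iff (by omega)]; omega
  have hY1 : 1 ≤ P.Y := by rw [hY, Nat.one_le_div_iff (by omega)]; omega
  have hWge : n ≤ 2 ^ 5 * (X ^ 37 * P.W) := by
    have : n < (P.W + 1) * (16 * X ^ 37) := by
      rw [hW]; exact Nat.lt_mul_of_div_lt (Nat.lt_succ_self _) (by omega)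
    have : (P.W + 1) * (16 * X ^ 37) ≤ (P.W + P.W) * (16 * X ^ 37) := by gcongr
    have e : (P.W + P.W) * (16 * X ^ 37) = 2 ^ 5 * (X ^ 37 * P.W) := by ring
    omega
  have hYge : n ≤ 2 ^ 7 * (P.N₂ * X ^ 35 * P.Y) := by
    have : n < (P.Y + 1) * (64 * (P.N₂ * X ^ 35)) := by
      rw [hY]; exact Nat.lt_mul_of_div_lt (Nat.lt_succ_self _) (by omega)
    have : (P.Y + 1) * (64 * (P.N₂ * X ^ 35)) ≤ (P.Y + P.Y) * (64 * (P.N₂ * X ^ 35)) := by gcongr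
    have e : (P.Y + P.Y) * (64 * (P.N₂ * X ^ 35)) = 2 ^ 7 * (P.N₂ * X ^ 35 * P.Y) := by ring
    omega
  have hpot : 6 * n ^ 2 + P.potBound < 2 ^ 28 * n ^ 2 := by
    have := h.potBound_le (n := n) hN₂ (by omega) hn' (by omega) (by omega) hW1 hY1
    have : 0 < n ^ 2 := pow_pos (by omega) 2
    omega
  have e5 : 4 * (P.N₂ * X ^ 35) * P.Y = 4 * (P.N₂ * X ^ 35 * P.Y) := by ring
  have e6 : 8 * (P.N₂ * X ^ 35) * P.Y = 8 * (P.N₂ * X ^ 35 * P.Y) := by ring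
  obtain ⟨G, hG, hE, hE', hS, hC⟩ := P.exists_digraph n (by
    have := h.hardBound_le
    omega)
  have hN := h.N_ge
  have hq : P.N₁ * P.N₂ * P.s ^ 8 = X ^ 58 * P.N₂ := by rw [h.N₁, h.s]; ring
  rw [hq] at hS hC
  have hq' : X ^ 68 * P.N₂ = X ^ 58 * P.N₂ * X ^ 10 := by ring
  refine ⟨G, hG, hE, hE'.trans ?_, ?_, ?_⟩
  · have := h.edgeBound_le
    omega
  · intro k H hk hH
    -- With `a = X ^ 10 / 32` the loss `2 * (a + 3)` stays well below `N ≥ 3 * X ^ 10 / 8`; at least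
    -- `X ^ 10 / 5` levels per line remain.
    have ha : X ^ 10 ≤ 2 ^ 6 * (X ^ 10 / 32) := by omega
    have := hS k (X ^ 10 / 32) H (hpot.trans_le ?_) hH
    · have h2 : X ^ 58 * P.N₂ * (2 * (X ^ 10 / 32 + 3)) ≤ X ^ 58 * P.N₂ * (P.N - X ^ 10 / 5) :=
        Nat.mul_le_mul_left _ (by omega)
      have h3 : X ^ 58 * P.N₂ * (P.N - X ^ 10 / 5) + X ^ 58 * P.N₂ * (X ^ 10 / 5) =
          X ^ 58 * P.N₂ * P.N := by
        rw [← Nat.mul_add]; congr 1; omega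
      have h4 : X ^ 58 * P.N₂ * X ^ 10 ≤ X ^ 58 * P.N₂ * (5 * (X ^ 10 / 5) + 4) :=
        Nat.mul_le_mul_left _ (by omega)
      have h5 : X ^ 58 * P.N₂ * 4 ≤ X ^ 58 * P.N₂ * (X ^ 10 / 5 / 30) :=
        Nat.mul_le_mul_left _ (by omega)
      have h6 : X ^ 58 * P.N₂ * (X ^ 10 / 5 / 30) * 30 ≤ X ^ 58 * P.N₂ * (X ^ 10 / 5) := by
        rw [mul_assoc]; exact Nat.mul_le_mul_left _ (Nat.div_mul_le_self _ _)
      rw [hq']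
      rw [mul_add] at h4
      have h7 : X ^ 58 * P.N₂ * (5 * (X ^ 10 / 5)) = 5 * (X ^ 58 * P.N₂ * (X ^ 10 / 5)) := by ring
      omega
    -- Up to constants `W * Y * X ^ 10` is `n ^ 2 / (X ^ 62 * N₂)`, so more than a multiple of `X ^
    -- 62 * N₂` rounds exceed a potential of order `n ^ 2`.
    · have h0 : 0 < X ^ 62 * P.N₂ := by positivity
      refine Nat.le_of_mul_le_mul_left ?_ h0
      calc X ^ 62 * P.N₂ * (2 ^ 28 * n ^ 2) = 2 ^ 28 * (X ^ 62 * P.N₂) * (n * n) := by ring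
        _ ≤ 2 ^ 28 * (X ^ 62 * P.N₂) *
            (2 ^ 5 * (X ^ 37 * P.W) * (2 ^ 7 * (P.N₂ * X ^ 35 * P.Y))) := by gcongr
        _ = 2 ^ 40 * (X ^ 62 * P.N₂) * (X ^ 62 * P.N₂ * (P.W * P.Y * X ^ 10)) := by ring
        _ ≤ 2 ^ 40 * (X ^ 62 * P.N₂) * (X ^ 62 * P.N₂ * (P.W * P.Y * (2 ^ 6 * (X ^ 10 / 32)))) := by
            gcongr
        _ = 2 ^ 46 * (X ^ 62 * P.N₂) * (X ^ 62 * P.N₂ * (P.W * P.Y * (X ^ 10 / 32))) := by ring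
        _ ≤ k * (X ^ 62 * P.N₂ * (P.W * P.Y * (X ^ 10 / 32))) := by gcongr
        _ = _ := by ring
  · intro k R M H 𝒞 L B h𝒞 hL hB hM hk hR hH
    -- Here half of `N` is already lost to the bad targets; `hR` makes `2 * (R + 2)` at most `X ^ 10
    -- / 32`, and `X ^ 10 / 10` levels per line remain.
    have ha : X ^ 10 ≤ 2 ^ 7 * (X ^ 10 / 64) := by omega
    have hYR : (n : ℝ) ≤ 2 ^ 7 * ((X ^ 35 * P.N₂ : ℕ) * P.Y) := by
      rw [e4] at hYge
      exact_mod_cast hYge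
    have hs5 : 4 * P.N₂ * P.s ^ 5 = 4 * (X ^ 35 * P.N₂) := by rw [h.s]; ring
    have := hC k (X ^ 10 / 64) R M H 𝒞 L B h𝒞 ?_ ?_ hY1 (hpot.trans_le ?_) hH
    · have h2 : X ^ 58 * P.N₂ * (2 * (X ^ 10 / 64 + R + 2) + P.N / 2) ≤
          X ^ 58 * P.N₂ * (P.N - X ^ 10 / 10) := Nat.mul_le_mul_left _ (by omega)
      have h3 : X ^ 58 * P.N₂ * (P.N - X ^ 10 / 10) + X ^ 58 * P.N₂ * (X ^ 10 / 10) =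
          X ^ 58 * P.N₂ * P.N := by
        rw [← Nat.mul_add]; congr 1; omega
      have h4 : X ^ 58 * P.N₂ * X ^ 10 ≤ X ^ 58 * P.N₂ * (10 * (X ^ 10 / 10) + 9) :=
        Nat.mul_le_mul_left _ (by omega)
      have h5 : X ^ 58 * P.N₂ * 9 ≤ X ^ 58 * P.N₂ * (X ^ 10 / 10 / 30) :=
        Nat.mul_le_mul_left _ (by omega)
      have h6 : X ^ 58 * P.N₂ * (X ^ 10 / 10 / 30) * 30 ≤ X ^ 58 * P.N₂ * (X ^ 10 / 10) := by
        rw [mul_assoc]; exact Nat.mul_le_mul_left _ (Nat.div_mul_le_self _ _)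
      rw [hq']
      rw [mul_add] at h4
      have h7 : X ^ 58 * P.N₂ * (10 * (X ^ 10 / 10)) = 10 * (X ^ 58 * P.N₂ * (X ^ 10 / 10)) := by
        ring
      omega
    · rw [div_le_iff₀ hL]
      have hx : (0 : ℝ) < (X ^ 35 * P.N₂ : ℕ) := by exact_mod_cast e4 ▸ pos2
      generalize ((X ^ 35 * P.N₂ : ℕ) : ℝ) = x at hB hYR hx
      have h1 : 256 * x * (B * n) ≤ L * (2 ^ 7 * (x * P.Y)) :=
        calc _ = 256 * x * B * n := by ring
          _ ≤ L * n := by gcongr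
          _ ≤ _ := by gcongr
      refine le_of_mul_le_mul_left (h1.trans (le_of_eq ?_)) (show 0 < 256 * x by positivity)
      ring
    · rw [hs5]
      push_cast at hYR ⊢
      linarith
    -- Up to constants `W * X ^ 10` is `n / X ^ 27`, so the product `k * M` has to exceed a multiple
    -- of `X ^ 27 * n`.
    · have hn0 : 0 < n := by omega
      have h0 : 0 < X ^ 27 * n := by positivity
      refine Nat.le_of_mul_le_mul_left ?_ h0
      calc X ^ 27 * n * (2 ^ 28 * n ^ 2) = 2 ^ 28 * n * (X ^ 27 * n) * n := by ring
        _ ≤ 2 ^ 28 * n * (X ^ 27 * n) * (2 ^ 5 * (X ^ 37 * P.W)) := by gcongr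
        _ = 2 ^ 33 * n * (X ^ 27 * n) * (X ^ 27 * P.W) * X ^ 10 := by ring
        _ ≤ 2 ^ 33 * n * (X ^ 27 * n) * (X ^ 27 * P.W) * (2 ^ 7 * (X ^ 10 / 64)) := by gcongr
        _ = (2 ^ 40 * (X ^ 27 * n)) * (X ^ 27 * n * (P.W * (X ^ 10 / 64))) := by ring
        _ ≤ (k * M) * (X ^ 27 * n * (P.W * (X ^ 10 / 64))) := by gcongr
        _ = _ := by ring

end Par

end CertifiedShortcuts

/-! ### Asymptotics, and the two families of directed graphs -/

namespace CertifiedShortcuts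

open Filter

/-- The integer part of `n ^ ((1 + ε) / E)`. -/
noncomputable def scale (ε : ℝ) (E n : ℕ) : ℕ := ⌊(n : ℝ) ^ ((1 + ε) / E)⌋₊

section Scale

variable {ε : ℝ} {E : ℕ}

theorem tendsto_scale (hε : 0 ≤ ε) (hE : 0 < E) : Tendsto (scale ε E) atTop atTop := by
  have h : 0 < (1 + ε) / E := by positivity
  exact tendsto_nat_floor_atTop.comp ((tendsto_rpow_atTop h).comp tendsto_natCast_atTop_atTop)

theorem rpow_div_pow (n p : ℕ) : ((n : ℝ) ^ ((1 + ε) / E)) ^ p = (n : ℝ) ^ (p * (1 + ε) / E) := by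
  rw [← Real.rpow_natCast, ← Real.rpow_mul n.cast_nonneg]
  congr 1
  ring

theorem scale_pow_le' (n p : ℕ) : (scale ε E n : ℝ) ^ p ≤ (n : ℝ) ^ (p * (1 + ε) / E) := by
  rw [← rpow_div_pow]
  gcongr
  exact Nat.floor_le (by positivity)

theorem scale_pow_le (hE : 0 < E) (n : ℕ) : (scale ε E n : ℝ) ^ E ≤ (n : ℝ) ^ (1 + ε) := by
  have hE' : (E : ℝ) ≠ 0 := by positivity
  have h := scale_pow_le' (ε := ε) (E := E) n E
  rwa [mul_div_right_comm, div_self hE', one_mul] at h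

theorem eventually_le_scale_pow' (hε : 0 ≤ ε) (hE : 0 < E) (p : ℕ) : ∀ᶠ n : ℕ in atTop,
    (n : ℝ) ^ (p * (1 + ε) / E) ≤ 2 ^ p * (scale ε E n : ℝ) ^ p := by
  filter_upwards [(tendsto_scale hε hE).eventually_ge_atTop 1] with n hn
  rw [← rpow_div_pow, ← mul_pow]
  gcongr
  have h1 : (n : ℝ) ^ ((1 + ε) / E) < scale ε E n + 1 := Nat.lt_floor_add_one _
  have h2 : (1 : ℝ) ≤ scale ε E n := by exact_mod_cast hn
  linarith

theorem eventually_le_scale_pow (hε : 0 ≤ ε) (hE : 0 < E) : ∀ᶠ n : ℕ in atTop,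
    (n : ℝ) ^ (1 + ε) ≤ 2 ^ E * (scale ε E n : ℝ) ^ E := by
  have hE' : (E : ℝ) ≠ 0 := by positivity
  have h := eventually_le_scale_pow' hε hE E
  rwa [mul_div_right_comm, div_self hE', one_mul] at h

theorem eventually_rpow_le_scale_pow (hε : 0 ≤ ε) (hE : 0 < E) {p : ℕ}
    (hp : E * (1 + 2 * ε) ≤ p * (1 + ε)) : ∀ᶠ n : ℕ in atTop,
    (n : ℝ) ^ (1 + ε) * (n : ℝ) ^ ε ≤ 2 ^ p * (scale ε E n : ℝ) ^ p := by
  filter_upwards [eventually_le_scale_pow' hε hE p, eventually_ge_atTop 1] with n hn hn1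
  have hn1' : (1 : ℝ) ≤ n := by exact_mod_cast hn1
  rw [← Real.rpow_add (by positivity)]
  refine le_trans (Real.rpow_le_rpow_of_exponent_le hn1' ?_) hn
  have hE' : (0 : ℝ) < E := by positivity
  rw [le_div_iff₀ hE']
  linarith

/-- The power is at most `n` to an exponent strictly below `1`, so every constant is absorbed. This
is why `k ≥ c * n` suffices for every `c > 0`. -/
theorem eventually_mul_scale_pow_le {p : ℕ} (hE : 0 < E) (hp : p * (1 + ε) < E) (C : ℝ) :
    ∀ᶠ n : ℕ in atTop, C * (scale ε E n : ℝ) ^ p ≤ n := by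
  have hE' : (0 : ℝ) < E := by positivity
  have h1 : 0 < 1 - p * (1 + ε) / E := by rw [sub_pos, div_lt_one hE']; exact hp
  have h2 := ((tendsto_rpow_atTop h1).comp tendsto_natCast_atTop_atTop).eventually_ge_atTop |C|
  filter_upwards [h2, eventually_ge_atTop 1] with n hn hn1
  have hn1' : (0 : ℝ) < n := by exact_mod_cast hn1
  calc C * (scale ε E n : ℝ) ^ p ≤ |C| * (n : ℝ) ^ (p * (1 + ε) / E) := by
        gcongr
        · exact le_abs_self C
        · exact scale_pow_le' n p
    _ ≤ (n : ℝ) ^ (1 - p * (1 + ε) / E) * (n : ℝ) ^ (p * (1 + ε) / E) := by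
        gcongr
        exact hn
    _ = n := by rw [← Real.rpow_add hn1']; simp

theorem eventually_le_scale (hε : 0 ≤ ε) (hE : 0 < E) (C : ℕ) :
    ∀ᶠ n : ℕ in atTop, C ≤ scale ε E n :=
  (tendsto_scale hε hE).eventually_ge_atTop C

/-- The filling has about `n ^ ((1 + ε) / 2)` vertices, of smaller order than `n`; the summand `1`
compensates the `F - 1` in the count of its edges. -/
theorem eventually_filling_le (hε : ε < 1) :
    ∀ᶠ n : ℕ in atTop, 4 * (scale ε 2 n + 1) ≤ n := by
  filter_upwards [eventually_mul_scale_pow_le (ε := ε) (E := 2) (p := 1) two_pos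
    (by norm_num; linarith) 8, eventually_ge_atTop 8] with n h1 h2
  have : 8 * scale ε 2 n ≤ n := by
    rw [pow_one] at h1
    exact_mod_cast h1
  omega

theorem le_rpow_one_add (hε : 0 ≤ ε) (n : ℕ) : (n : ℝ) ≤ (n : ℝ) ^ (1 + ε) := by
  rcases Nat.eq_zero_or_pos n with rfl | hn
  · simp only [Nat.cast_zero]
    exact Real.rpow_nonneg le_rfl _
  · have hn' : (1 : ℝ) ≤ n := by exact_mod_cast hn
    calc (n : ℝ) = (n : ℝ) ^ (1 : ℝ) := (Real.rpow_one _).symm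
      _ ≤ _ := Real.rpow_le_rpow_of_exponent_le hn' (by linarith)

/-- Both bounds for the number of edges, from bounds in terms of the parameters. -/
theorem eventually_edge_bounds (hε : 0 ≤ ε) (hE : 0 < E) (C : ℕ) : ∀ᶠ n : ℕ in atTop,
    ∀ m : ℕ, (scale ε 2 n) ^ 2 ≤ 2 * m →
      m ≤ 2 * n + C * scale ε E n ^ E + (scale ε 2 n + 1) ^ 2 →
      1 / 8 * (n : ℝ) ^ (1 + ε) ≤ m ∧ (m : ℝ) ≤ (C + 6) * (n : ℝ) ^ (1 + ε) := by
  filter_upwards [eventually_le_scale_pow hε two_pos, eventually_le_scale hε two_pos 1]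
    with n h1 h2 m hm hm'
  have h3 := scale_pow_le (ε := ε) two_pos n
  have h4 := scale_pow_le (ε := ε) hE n
  have h5 := le_rpow_one_add hε n
  have h6 : (scale ε 2 n : ℝ) ^ 2 ≤ 2 * m := by exact_mod_cast hm
  have h7 : (m : ℝ) ≤ 2 * n + C * (scale ε E n : ℝ) ^ E + ((scale ε 2 n : ℝ) + 1) ^ 2 := by
    exact_mod_cast hm'
  have h8 : ((scale ε 2 n : ℝ) + 1) ^ 2 ≤ 4 * (scale ε 2 n : ℝ) ^ 2 := by
    have : (1 : ℝ) ≤ scale ε 2 n := by exact_mod_cast h2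
    nlinarith
  have h9 : (C : ℝ) * (scale ε E n : ℝ) ^ E ≤ C * (n : ℝ) ^ (1 + ε) := by gcongr
  constructor <;> nlinarith

theorem eventually_complexity_bound (hε : 0 ≤ ε) (hE : 0 < E) {p : ℕ}
    (hp : E * (1 + 2 * ε) ≤ p * (1 + ε)) {b D : ℝ} (hb : 0 < b) (hD : 0 < D) :
    ∀ᶠ n : ℕ in atTop, ∀ m x : ℕ, (m : ℝ) ≤ b * (n : ℝ) ^ (1 + ε) →
      (scale ε E n : ℝ) ^ p ≤ D * x → 1 / (b * 2 ^ p * D) * (m * (n : ℝ) ^ ε) ≤ x := by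
  filter_upwards [eventually_rpow_le_scale_pow hε hE hp] with n hn m x hm hx
  rw [div_mul_eq_mul_div, one_mul, div_le_iff₀ (by positivity)]
  calc (m : ℝ) * (n : ℝ) ^ ε ≤ b * (n : ℝ) ^ (1 + ε) * (n : ℝ) ^ ε := by gcongr
    _ = b * ((n : ℝ) ^ (1 + ε) * (n : ℝ) ^ ε) := by ring
    _ ≤ b * (2 ^ p * (scale ε E n : ℝ) ^ p) := by gcongr
    _ ≤ b * (2 ^ p * (D * x)) := by gcongr
    _ = _ := by ring

/-- One spare factor `scale ε E n` absorbs the constant `2 ^ E`. -/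
theorem eventually_le_scale_pow_of_lt (hε : 0 ≤ ε) (hE : 0 < E) {p : ℕ} (hp : E < p) :
    ∀ᶠ n : ℕ in atTop, n ≤ scale ε E n ^ p := by
  filter_upwards [eventually_le_scale_pow hε hE, eventually_le_scale hε hE (2 ^ E)] with n h1 h2
  have h3 := (le_rpow_one_add hε n).trans h1
  have h4 : n ≤ 2 ^ E * scale ε E n ^ E := by exact_mod_cast h3
  calc n ≤ 2 ^ E * scale ε E n ^ E := h4
    _ ≤ scale ε E n * scale ε E n ^ E := by gcongr
    _ = scale ε E n ^ (E + 1) := by ring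
    _ ≤ scale ε E n ^ p := Nat.pow_le_pow_right (le_trans Nat.one_le_two_pow h2) hp

end Scale

/-- With `N₂ = X ^ 10` and `X` of order `n ^ ((1 + ε) / 75)` the edge bound is `X ^ 75` and the
complexity is of order `X ^ 78`. The vertices and the number of rounds need `72 * (1 + ε) < 75`, the
complexity needs `75 * (1 + 2 * ε) ≤ 78 * (1 + ε)`; both hold for `ε < 1 / 24`. -/
theorem exists_greedyShortcut_family {ε : ℝ} (hε : 0 ≤ ε) (hε' : ε < 1 / 25) :
    ∃ (G : (n : ℕ) → Digraph (Fin n)) (a b κ : ℝ), 0 < a ∧ 0 < b ∧ 0 < κ ∧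
      (∀ᶠ n : ℕ in atTop, IsDAG (G n) ∧ a * (n : ℝ) ^ (1 + ε) ≤ edgeCount (G n) ∧
        (edgeCount (G n) : ℝ) ≤ b * (n : ℝ) ^ (1 + ε)) ∧
      ∀ c : ℝ, 0 < c → ∀ᶠ n : ℕ in atTop, ∀ (k : ℕ) (H : Finset (Fin n × Fin n)), c * n ≤ k →
        GreedyShortcut (G n) k H →
        κ * (edgeCount (G n) * (n : ℝ) ^ ε) ≤ certComplexity (G n) H := by
  have hE : 0 < 75 := by norm_num
  set X := scale ε 75
  have hcond : ∀ᶠ n : ℕ in atTop, 32 ≤ X n ∧ 20000 * (X n ^ 62 * X n ^ 10) ≤ n ∧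
      n ≤ X n ^ 70 * (X n ^ 10) ^ 2 ∧ 4 * (scale ε 2 n + 1) ≤ n := by
    filter_upwards [eventually_le_scale hε hE 32, eventually_mul_scale_pow_le (p := 72) (ε := ε) hE
      (by norm_num; linarith) 20000, eventually_le_scale_pow_of_lt hε hE (p := 90) (by norm_num),
      eventually_filling_le (ε := ε) (by linarith)] with n h1 h2 h3 h4
    refine ⟨h1, ?_, ?_, h4⟩
    · rw [← pow_add]; exact_mod_cast h2
    · rwa [← pow_mul, ← pow_add]
  have key := fun n (h : 32 ≤ X n ∧ 20000 * (X n ^ 62 * X n ^ 10) ≤ n ∧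
      n ≤ X n ^ 70 * (X n ^ 10) ^ 2 ∧ 4 * (scale ε 2 n + 1) ≤ n) =>
    Par.exists_digraph_of_pow h.1 le_rfl h.2.1 h.2.2.1 h.2.2.2
  choose! G hG using key
  refine ⟨G, 1 / 8, (15000000 : ℕ) + 6, 1 / (((15000000 : ℕ) + 6) * 2 ^ 78 * 16), by norm_num,
    by positivity, by positivity, ?_, fun c hc => ?_⟩
  · filter_upwards [hcond, eventually_edge_bounds hε hE 15000000] with n hn hb
    obtain ⟨h1, h2, h3, -⟩ := hG n hn
    rw [← pow_add] at h3
    exact ⟨h1, hb _ h2 h3⟩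
  · filter_upwards [hcond, eventually_edge_bounds hε hE 15000000,
      eventually_complexity_bound hε hE (p := 78) (b := (15000000 : ℕ) + 6) (D := 16)
        (by norm_num; linarith) (by positivity) (by norm_num),
      eventually_mul_scale_pow_le (p := 72) (ε := ε) hE (by norm_num; linarith)
        ((2 ^ 46 + 1) / c)] with n hn hb hx hk k H hck hH
    obtain ⟨h1, h2, h3, h4, -⟩ := hG n hn
    rw [← pow_add] at h3
    refine hx _ _ (hb _ h2 h3).2 ?_
    have := h4 k H ?_ hH
    · rw [← pow_add] at this
      exact_mod_cast this
    · have h5 : (0 : ℝ) < (X n : ℝ) ^ 72 := by have := hn.1; positivity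
      have h6 : (2 ^ 46 + 1) * (X n : ℝ) ^ 72 ≤ c * n := by
        rw [div_mul_eq_mul_div, div_le_iff₀ hc] at hk
        linarith
      have h7 : (2 ^ 46 : ℝ) * (X n : ℝ) ^ 72 < k := by linarith
      rw [← pow_add]
      exact_mod_cast h7

/-- Now `N₂ = X ^ 19` and `X` is of order `n ^ ((1 + ε) / 84)`, so that `X ^ 81` is of smaller order
than `n` and `X ^ 27` of smaller order than its cube root `y`. Then the number `X ^ 54` of tails, up
to a constant, is small against `n ^ (2 / 3)`, so tails are long compared with what chains may leave
uncovered, and chains with `M`, of order `y`, vertices in a tail give enough gain. -/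
theorem exists_greedyChainShortcut_family {ε : ℝ} (hε : 0 ≤ ε) (hε' : ε < 2 / 75) :
    ∃ (G : (n : ℕ) → Digraph (Fin n)) (a b κ : ℝ), 0 < a ∧ 0 < b ∧ 0 < κ ∧
      (∀ᶠ n : ℕ in atTop, IsDAG (G n) ∧ a * (n : ℝ) ^ (1 + ε) ≤ edgeCount (G n) ∧
        (edgeCount (G n) : ℝ) ≤ b * (n : ℝ) ^ (1 + ε)) ∧
      ∀ (A B c : ℝ) (R : ℕ), 0 < A → 0 < B → 0 < c → ∀ᶠ n : ℕ in atTop,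
        ∀ (𝒞 : Finset (List (Fin n))) (k : ℕ) (H : Finset (Fin n × Fin n)),
          IsChainCover (G n) 𝒞 (A * (n : ℝ) ^ (2 / 3 : ℝ)) B → c * n ≤ k →
          GreedyChainShortcut (G n) 𝒞 R k H →
          κ * (edgeCount (G n) * (n : ℝ) ^ ε) ≤ certComplexity (G n) H := by
  have hE : 0 < 84 := by norm_num
  set X := scale ε 84
  have hcond : ∀ᶠ n : ℕ in atTop, 32 ≤ X n ∧ X n ^ 10 ≤ X n ^ 19 ∧
      20000 * (X n ^ 62 * X n ^ 19) ≤ n ∧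
      n ≤ X n ^ 70 * (X n ^ 19) ^ 2 ∧ 4 * (scale ε 2 n + 1) ≤ n := by
    filter_upwards [eventually_le_scale hε hE 32, eventually_mul_scale_pow_le (p := 81) (ε := ε) hE
      (by norm_num; linarith) 20000, eventually_le_scale_pow_of_lt hε hE (p := 108) (by norm_num),
      eventually_filling_le (ε := ε) (by linarith)] with n h1 h2 h3 h4
    refine ⟨h1, Nat.pow_le_pow_right (le_trans (by norm_num) h1) (by norm_num), ?_, ?_, h4⟩
    · rw [← pow_add]; exact_mod_cast h2
    · rwa [← pow_mul, ← pow_add]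
  have key := fun n (h : 32 ≤ X n ∧ X n ^ 10 ≤ X n ^ 19 ∧ 20000 * (X n ^ 62 * X n ^ 19) ≤ n ∧
      n ≤ X n ^ 70 * (X n ^ 19) ^ 2 ∧ 4 * (scale ε 2 n + 1) ≤ n) =>
    Par.exists_digraph_of_pow h.1 h.2.1 h.2.2.1 h.2.2.2.1 h.2.2.2.2
  choose! G hG using key
  refine ⟨G, 1 / 8, (15000000 : ℕ) + 6, 1 / (((15000000 : ℕ) + 6) * 2 ^ 87 * 64), by norm_num,
    by positivity, by positivity, ?_, fun A B c R hA hB hc => ?_⟩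
  · filter_upwards [hcond, eventually_edge_bounds hε hE 15000000] with n hn hb
    obtain ⟨h1, h2, h3, -⟩ := hG n hn
    rw [← pow_add] at h3
    exact ⟨h1, hb _ h2 h3⟩
  -- One constant for both comparisons of `X ^ 27` with `y`: the first summand serves the length of
  -- the tails, the second the number of rounds, and the last gives `C ≤ C * C`.
  · set C : ℝ := 256 * B / A + 1280 * A * (2 ^ 40 / c + 1) + 1 with hC
    have hC1 : 1 ≤ C := le_add_of_nonneg_left (by positivity)
    filter_upwards [hcond, eventually_edge_bounds hε hE 15000000,
      eventually_complexity_bound hε hE (p := 87) (b := (15000000 : ℕ) + 6) (D := 64)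
        (by norm_num; linarith) (by positivity) (by norm_num),
      eventually_mul_scale_pow_le (p := 81) (ε := ε) hE (by norm_num; linarith) (C ^ 3),
      eventually_le_scale hε hE (64 * R + 128), eventually_ge_atTop 1]
      with n hn hb hx hk hR hn1 𝒞 k H h𝒞 hck hH
    obtain ⟨h1, h2, h3, -, h4⟩ := hG n hn
    rw [← pow_add] at h3
    refine hx _ _ (hb _ h2 h3).2 ?_
    have hn0 : (0 : ℝ) < n := by exact_mod_cast hn1
    obtain ⟨y, hy, hyn⟩ : ∃ y : ℝ, 0 < y ∧ y ^ 3 = n :=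
      ⟨(n : ℝ) ^ (1 / 3 : ℝ), by positivity, by
        rw [← Real.rpow_natCast, ← Real.rpow_mul hn0.le]; norm_num⟩
    have hy2 : (n : ℝ) ^ (2 / 3 : ℝ) = y ^ 2 := by
      rw [← hyn, ← Real.rpow_natCast, ← Real.rpow_mul hy.le, ← Real.rpow_natCast]
      norm_num
    have hX1 : (1 : ℝ) ≤ (X n : ℝ) ^ 27 :=
      one_le_pow₀ (by exact_mod_cast le_trans (by norm_num) hn.1)
    have hyX : C * (X n : ℝ) ^ 27 ≤ y := by
      refine le_of_pow_le_pow_left₀ three_ne_zero hy.le ?_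
      rw [hyn, mul_pow, ← pow_mul]
      exact hk
    rw [hy2] at h𝒞
    have := h4 k R ⌊y / (1280 * A)⌋₊ H 𝒞 _ B h𝒞 (by positivity) ?_ ?_ ?_ ?_ hH
    · rw [← pow_add] at this
      exact_mod_cast this
    · have hCB : 256 * B ≤ A * C := by
        rw [hC, mul_add, mul_add, mul_div_cancel₀ _ hA.ne']
        have : 0 ≤ A * (1280 * A * (2 ^ 40 / c + 1)) := by positivity
        linarith
      push_cast
      calc 256 * ((X n : ℝ) ^ 35 * (X n : ℝ) ^ 19) * B = 256 * B * ((X n : ℝ) ^ 27) ^ 2 := by ring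
        _ ≤ A * C * ((X n : ℝ) ^ 27) ^ 2 := by gcongr
        _ ≤ A * (C * C) * ((X n : ℝ) ^ 27) ^ 2 := by gcongr; nlinarith
        _ = A * (C * (X n : ℝ) ^ 27) ^ 2 := by ring
        _ ≤ A * y ^ 2 := by gcongr
    · calc 1280 * (⌊y / (1280 * A)⌋₊ : ℝ) * (A * y ^ 2) ≤ 1280 * (y / (1280 * A)) * (A * y ^ 2) := by
            gcongr; exact Nat.floor_le (by positivity)
        _ = y ^ 3 := by field_simp
        _ = n := hyn
    · have h5 : (2 ^ 40 / c) * (X n : ℝ) ^ 27 < ⌊y / (1280 * A)⌋₊ := by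
        refine lt_of_le_of_lt ?_ (Nat.sub_one_lt_floor _)
        rw [le_sub_iff_add_le, le_div_iff₀ (by positivity)]
        calc (2 ^ 40 / c * (X n : ℝ) ^ 27 + 1) * (1280 * A) ≤
              (2 ^ 40 / c * (X n : ℝ) ^ 27 + (X n : ℝ) ^ 27) * (1280 * A) := by gcongr
          _ = 1280 * A * (2 ^ 40 / c + 1) * (X n : ℝ) ^ 27 := by ring
          _ ≤ C * (X n : ℝ) ^ 27 := by
            gcongr
            have : 0 ≤ 256 * B / A := by positivity
            linarith
          _ ≤ y := hyX
      have h6 : (2 ^ 40 : ℝ) * ((X n : ℝ) ^ 27 * n) < k * ⌊y / (1280 * A)⌋₊ := by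
        calc (2 ^ 40 : ℝ) * ((X n : ℝ) ^ 27 * n) = c * n * ((2 ^ 40 / c) * (X n : ℝ) ^ 27) := by
              field_simp
          _ < c * n * ⌊y / (1280 * A)⌋₊ := by gcongr
          _ ≤ _ := by gcongr
      exact_mod_cast h6
    · exact hR.trans (Nat.le_self_pow (by norm_num) _)

end CertifiedShortcuts

namespace CertifiedShortcuts

/-! ### Walks and hopsets of undirected graphs -/

section HopWalks

variable {V : Type*} {G : SimpleGraph V} {H K : Finset (Sym2 V × ℝ)}

theorem WalkOf.exists_walk {k : ℕ} {u v : V} (h : WalkOf G.Adj k u v) :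
    ∃ p : G.Walk u v, p.length = k := by
  induction h with
  | nil v => exact ⟨.nil, rfl⟩
  | cons e _ ih => obtain ⟨p, rfl⟩ := ih; exact ⟨.cons e p, rfl⟩

theorem WalkOf.reachable {k : ℕ} {u v : V} (h : WalkOf G.Adj k u v) : G.Reachable u v :=
  h.exists_walk.elim fun p _ => ⟨p⟩

theorem WalkOf.dist_le {k : ℕ} {u v : V} (h : WalkOf G.Adj k u v) : G.dist u v ≤ k := by
  obtain ⟨p, rfl⟩ := h.exists_walk
  exact G.dist_le p

theorem walkOf_length {u v : V} (p : G.Walk u v) : WalkOf G.Adj p.length u v := by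
  induction p with
  | nil => exact .nil _
  | cons h _ ih => exact .cons h ih

theorem walkOf_dist {u v : V} (h : G.Reachable u v) : WalkOf G.Adj (G.dist u v) u v := by
  obtain ⟨p, hp⟩ := h.exists_walk_length_eq_dist
  rw [← hp]
  exact walkOf_length p

theorem dist_triangle {u v w : V} (h : G.Reachable u v) :
    (G.dist u w : ℝ) ≤ G.dist u v + G.dist v w := by
  exact_mod_cast h.dist_triangle_left w

theorem HopEdge.mono (h : H ⊆ K) {u v : V} {x : ℝ} (e : HopEdge G H u v x) : HopEdge G K u v x :=
  e.imp id fun e => h e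

theorem HopWalk.mono (h : H ⊆ K) {k : ℕ} {u v : V} {x : ℝ} (w : HopWalk G H k x u v) :
    HopWalk G K k x u v := by
  induction w with
  | nil v => exact .nil v
  | cons e _ ih => exact .cons (e.mono h) ih

theorem HopEdge.hopWalk {u v : V} {x : ℝ} (h : HopEdge G H u v x) : HopWalk G H 1 x u v := by
  simpa using HopWalk.cons h (.nil v)

theorem WalkOf.hopWalk {k : ℕ} {u v : V} (h : WalkOf G.Adj k u v) : HopWalk G H k k u v := by
  induction h with
  | nil v => simpa using HopWalk.nil v
  | @cons k u v w e _ ih =>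
    have := HopWalk.cons (H := H) (Or.inl ⟨e, rfl⟩) ih
    rwa [show (1 : ℝ) + k = ((k + 1 : ℕ) : ℝ) by push_cast; ring] at this

theorem IsHopset.le_of_hopEdge (hH : IsHopset G H) {u v : V} {x : ℝ} (h : HopEdge G H u v x) :
    G.Reachable u v ∧ (G.dist u v : ℝ) ≤ x := hH.2 u v 1 x h.hopWalk

theorem IsHopset.ne_of_hopEdge (hH : IsHopset G H) {u v : V} {x : ℝ} (h : HopEdge G H u v x) :
    u ≠ v := by
  rcases h with ⟨h, -⟩ | h
  · exact h.ne
  · intro huv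
    exact hH.1 _ h huv

theorem hopDist_le {k : ℕ} {u v : V} (h : HopWalk G H k (G.dist u v) u v) : hopDist G H u v ≤ k :=
  Nat.sInf_le h

theorem hopWalk_hopDist {u v : V} (h : G.Reachable u v) :
    HopWalk G H (hopDist G H u v) (G.dist u v) u v :=
  Nat.sInf_mem (s := {k | HopWalk G H k (G.dist u v) u v}) ⟨_, (walkOf_dist h).hopWalk⟩

theorem hopDist_le_dist (H : Finset (Sym2 V × ℝ)) {u v : V} (h : G.Reachable u v) :
    hopDist G H u v ≤ G.dist u v := hopDist_le (walkOf_dist h).hopWalk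

theorem hopDist_eq_zero (hH : IsHopset G H) {u v : V} (h : ¬ G.Reachable u v) :
    hopDist G H u v = 0 := by
  have : {k | HopWalk G H k (G.dist u v) u v} = ∅ := by
    ext k
    simp only [Set.mem_ofPred_eq, Set.mem_empty_iff_false, iff_false]
    exact fun hk => h (hH.2 _ _ _ _ hk).1
  rw [hopDist, this, Nat.sInf_empty]

theorem hopDist_anti (hK : IsHopset G K) (hHK : H ⊆ K) (u v : V) :
    hopDist G K u v ≤ hopDist G H u v := by
  by_cases h : G.Reachable u v
  · exact hopDist_le ((hopWalk_hopDist h).mono hHK)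
  · rw [hopDist_eq_zero hK h]
    exact Nat.zero_le _

/-- If a larger hopset brings all pairs of `S × T` from hop distance at least `a + b` to hop
distance at most `b`, the potential decreases by at least `|S| |T| a`. -/
theorem hopPotential_add_le [Fintype V] (hK : IsHopset G K) (hHK : H ⊆ K)
    (S T : Finset V) (a b : ℕ) (h : ∀ u ∈ S, ∀ v ∈ T, hopDist G K u v ≤ b ∧
      a + b ≤ hopDist G H u v) :
    hopPotential G K + S.card * T.card * a ≤ hopPotential G H := by
  classical
  have key : ∀ u v, hopDist G K u v + (if u ∈ S ∧ v ∈ T then a else 0) ≤ hopDist G H u v := by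
    intro u v
    split_ifs with huv
    · have := h u huv.1 v huv.2; omega
    · exact hopDist_anti hK hHK u v
  have e : S.card * T.card * a = ∑ u : V, ∑ v : V, if u ∈ S ∧ v ∈ T then a else 0 := by
    have : ∀ u v : V, (if u ∈ S ∧ v ∈ T then a else 0) =
        if u ∈ S then (if v ∈ T then a else 0) else 0 := by
      intro u v; split_ifs <;> simp_all
    simp [this, Finset.sum_ite_mem, mul_assoc]
  rw [e, hopPotential, hopPotential, ← Finset.sum_add_distrib]
  refine Finset.sum_le_sum fun u _ => ?_
  rw [← Finset.sum_add_distrib]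
  exact Finset.sum_le_sum fun v _ => key u v

/-- The edges between distinct, nonadjacent, connected vertices, weighted by the distance. -/
def exactEdges (G : SimpleGraph V) : Set (Sym2 V × ℝ) :=
  {e | ∃ u v, u ≠ v ∧ ¬ G.Adj u v ∧ G.Reachable u v ∧ e = (s(u, v), (G.dist u v : ℝ))}

theorem mem_exactEdges {u v : V} {x : ℝ} : (s(u, v), x) ∈ exactEdges G ↔
    u ≠ v ∧ ¬ G.Adj u v ∧ G.Reachable u v ∧ x = G.dist u v := by
  constructor
  · rintro ⟨u', v', h1, h2, h3, h4⟩
    rw [Prod.mk.injEq, Sym2.eq_iff] at h4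
    obtain ⟨⟨rfl, rfl⟩ | ⟨rfl, rfl⟩, rfl⟩ := h4
    · exact ⟨h1, h2, h3, rfl⟩
    · exact ⟨h1.symm, fun h => h2 h.symm, h3.symm, by rw [G.dist_comm]⟩
  · rintro ⟨h1, h2, h3, rfl⟩
    exact ⟨u, v, h1, h2, h3, rfl⟩

theorem isHopset_of_subset_exactEdges (hH : ↑H ⊆ exactEdges G) : IsHopset G H := by
  constructor
  · rintro e he hd
    obtain ⟨u, v, h, -, -, rfl⟩ := hH he
    exact h hd
  · intro u v k x h
    induction h with
    | nil v => exact ⟨.refl _, by simp⟩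
    | @cons k x y u v w e h ih =>
      have he : G.Reachable u v ∧ (G.dist u v : ℝ) ≤ x := by
        rcases e with ⟨e, rfl⟩ | e
        · exact ⟨e.reachable, by rw [SimpleGraph.dist_eq_one_iff_adj.2 e]; simp⟩
        · obtain ⟨-, -, h1, h2⟩ := mem_exactEdges.1 (hH e)
          exact ⟨h1, h2.ge⟩
      exact ⟨he.1.trans ih.1, (dist_triangle he.1).trans (add_le_add he.2 ih.2)⟩

/-- Every set of exact edges is contained in a certified hopset of least size. -/
theorem exists_hopsetCertComplexity [Fintype V] (hH : ↑H ⊆ exactEdges G) :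
    ∃ K : Finset (Sym2 V × ℝ), IsHopset G K ∧ IsCertifiedHopset G K ∧ H ⊆ K ∧
      K.card = hopsetCertComplexity G H := by
  classical
  let K : Finset (Sym2 V × ℝ) := (Finset.univ.filter fun e : V × V => e.1 ≠ e.2 ∧
    ¬ G.Adj e.1 e.2 ∧ G.Reachable e.1 e.2).image fun e => (s(e.1, e.2), (G.dist e.1 e.2 : ℝ))
  have hK : (K : Set (Sym2 V × ℝ)) = exactEdges G := by
    ext e
    simp only [K, Finset.coe_image, Finset.coe_filter, Finset.mem_univ, true_and, Set.mem_image,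
      Prod.exists]
    constructor
    · rintro ⟨u, v, ⟨h1, h2, h3⟩, rfl⟩; exact ⟨u, v, h1, h2, h3, rfl⟩
    · rintro ⟨u, v, h1, h2, h3, rfl⟩; exact ⟨u, v, ⟨h1, h2, h3⟩, rfl⟩
  refine Nat.sInf_mem (s := {k | ∃ K : Finset (Sym2 V × ℝ), IsHopset G K ∧ IsCertifiedHopset G K ∧
    H ⊆ K ∧ K.card = k}) ⟨K.card, K, isHopset_of_subset_exactEdges hK.le, ?_, ?_, rfl⟩
  · intro u v x h
    rw [← Finset.mem_coe, hK, mem_exactEdges] at h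
    obtain ⟨h1, h2, h3, rfl⟩ := h
    obtain ⟨p, hp⟩ := h3.exists_walk_length_eq_dist
    cases p with
    | nil => exact absurd rfl h1
    -- The first vertex of a shortest path splits the distance as `1 + dist w v` and certifies the
    -- edge.
    | @cons _ w _ huw q =>
      rw [SimpleGraph.Walk.length_cons] at hp
      have h4 := G.dist_le q
      have h5 := huw.reachable.dist_triangle_left v
      rw [SimpleGraph.dist_eq_one_iff_adj.2 huw] at h5
      have h6 : G.dist u v = 1 + G.dist w v := by omega
      refine ⟨w, 1, G.dist w v, Or.inl ⟨huw, rfl⟩, ?_, by exact_mod_cast h6⟩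
      by_cases hwv : G.Adj w v
      · exact Or.inl ⟨hwv, by rw [SimpleGraph.dist_eq_one_iff_adj.2 hwv]; simp⟩
      · right
        rw [← Finset.mem_coe, hK, mem_exactEdges]
        exact ⟨by rintro rfl; exact h2 huw, hwv, ⟨q⟩, rfl⟩
  · rw [← Finset.coe_subset, hK]
    exact hH

end HopWalks

/-! ### Systems of lines in an undirected graph -/

/-- A system of lines in an undirected graph: every line `ℓ` is a set of vertices with a
`1`-Lipschitz function `pot ℓ`, and every edge from a vertex of the line along which this function
increases by one stays in the line and increases the level by at most one. Two vertices of level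
difference at least three determine the line. Each line comes with a source and a target that are
joined by a path along which `pot ℓ` always increases by one, and both have many leaves. -/
structure HopSystem {V : Type*} (G : SimpleGraph V) (Λ : Type*) (N W : ℕ) where
  mem : Λ → V → Prop
  lev : V → ℕ
  pot : Λ → V → ℚ
  pot_le : ∀ ℓ u v, G.Adj u v → pot ℓ v ≤ pot ℓ u + 1
  tight : ∀ ℓ u v, mem ℓ u → G.Adj u v → pot ℓ v = pot ℓ u + 1 →
    mem ℓ v ∧ lev u ≤ lev v ∧ lev v ≤ lev u + 1
  ident : ∀ ℓ ℓ' x y, mem ℓ x → mem ℓ y → mem ℓ' x → mem ℓ' y → lev x + 3 ≤ lev y → ℓ = ℓ'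
  src : Λ → V
  tgt : Λ → V
  mem_src : ∀ ℓ, mem ℓ (src ℓ)
  lev_src : ∀ ℓ, lev (src ℓ) = 0
  lev_tgt : ∀ ℓ, lev (tgt ℓ) = N
  walk : ∀ ℓ, ∃ k : ℕ, WalkOf G.Adj k (src ℓ) (tgt ℓ) ∧ pot ℓ (tgt ℓ) = pot ℓ (src ℓ) + k
  leavesS : Λ → Finset V
  leavesT : Λ → Finset V
  card_leavesS : ∀ ℓ, W ≤ (leavesS ℓ).card
  card_leavesT : ∀ ℓ, W ≤ (leavesT ℓ).card
  mem_leavesS : ∀ ℓ, ∀ v ∈ leavesS ℓ, mem ℓ v ∧ lev v = 0 ∧ G.Adj v (src ℓ) ∧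
    pot ℓ (src ℓ) = pot ℓ v + 1
  mem_leavesT : ∀ ℓ, ∀ v ∈ leavesT ℓ, lev v = N ∧ G.Adj (tgt ℓ) v ∧ pot ℓ v = pot ℓ (tgt ℓ) + 1

namespace HopSystem

variable {V : Type*} {G : SimpleGraph V} {Λ : Type*} {N W : ℕ} (D : HopSystem G Λ N W)
include D

theorem pot_le_of_walk (ℓ : Λ) {k : ℕ} {u v : V} (h : WalkOf G.Adj k u v) :
    D.pot ℓ v ≤ D.pot ℓ u + k := by
  induction h with
  | nil v => simp
  | @cons k u v w e _ ih =>
    have := D.pot_le ℓ _ _ e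
    push_cast
    linarith

theorem pot_le_dist (ℓ : Λ) {u v : V} (h : G.Reachable u v) :
    D.pot ℓ v ≤ D.pot ℓ u + G.dist u v := D.pot_le_of_walk ℓ (walkOf_dist h)

/-- If a walk is no longer than the increase of a `1`-Lipschitz function, the function increases by
one in every step, and `tight` applies throughout. -/
theorem mem_of_walk (ℓ : Λ) {k : ℕ} {u v : V} (h : WalkOf G.Adj k u v) (hu : D.mem ℓ u)
    (hk : D.pot ℓ v = D.pot ℓ u + k) : D.mem ℓ v ∧ D.lev u ≤ D.lev v := by
  induction h with
  | nil v => exact ⟨hu, le_rfl⟩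
  | @cons k u v w e h ih =>
    have h1 := D.pot_le ℓ _ _ e
    have h2 := D.pot_le_of_walk ℓ h
    push_cast at hk
    obtain ⟨m, h3, -⟩ := D.tight ℓ u v hu e (by linarith)
    obtain ⟨m', h4⟩ := ih m (by linarith)
    exact ⟨m', h3.trans h4⟩

/-- The pair `x`, `y` lies in this order on a shortest path along the line. -/
def Geod (ℓ : Λ) (x y : V) : Prop :=
  D.mem ℓ x ∧ G.Reachable x y ∧ D.pot ℓ y = D.pot ℓ x + G.dist x y

variable {D}

theorem Geod.mem {ℓ : Λ} {x y : V} (h : D.Geod ℓ x y) : D.mem ℓ y ∧ D.lev x ≤ D.lev y :=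
  D.mem_of_walk ℓ (walkOf_dist h.2.1) h.1 h.2.2

/-- The weights are at least the distances and add up to the distance of `x` and `y`, so the
triangle inequality is an equality and the potential also increases exactly. This takes the place of
the closure property of directed lines. -/
theorem Geod.split {ℓ : Λ} {x y w : V} (h : D.Geod ℓ x y) {a b : ℝ} (hxw : G.Reachable x w)
    (hwy : G.Reachable w y) (ha : G.dist x w ≤ a) (hb : G.dist w y ≤ b)
    (hab : (G.dist x y : ℝ) = a + b) :
    D.Geod ℓ x w ∧ D.Geod ℓ w y ∧ a = G.dist x w ∧ b = G.dist w y := by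
  have h1 : (G.dist x y : ℝ) ≤ G.dist x w + G.dist w y := dist_triangle hxw
  have h2 : (G.dist x y : ℝ) = G.dist x w + G.dist w y := by linarith
  have h3 : (G.dist x y : ℚ) = G.dist x w + G.dist w y := by exact_mod_cast h2
  have p1 := D.pot_le_dist ℓ hxw
  have p2 := D.pot_le_dist ℓ hwy
  have p3 := h.2.2
  have g : D.Geod ℓ x w := ⟨h.1, hxw, by linarith⟩
  exact ⟨g, ⟨g.mem.1, hwy, by linarith⟩, by linarith, by linarith⟩

theorem Geod.lev_le {ℓ : Λ} {x y : V} (h : D.Geod ℓ x y) (hxy : G.Adj x y) :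
    D.lev y ≤ D.lev x + 1 := by
  have h1 := h.2.2
  rw [SimpleGraph.dist_eq_one_iff_adj.2 hxy] at h1
  exact (D.tight ℓ x y h.1 hxy (by simpa using h1)).2.2

variable (D)

open Classical in
/-- The oriented exact edges of a hopset that increase the level. -/
noncomputable def upEdges [Fintype V] (K : Finset (Sym2 V × ℝ)) : Finset (V × V) :=
  Finset.univ.filter fun e => (s(e.1, e.2), (G.dist e.1 e.2 : ℝ)) ∈ K ∧ D.lev e.1 < D.lev e.2

open Classical in
/-- The oriented exact edges of a hopset that lie along a line and increase the level. -/
noncomputable def lineEdges [Fintype V] (K : Finset (Sym2 V × ℝ)) (ℓ : Λ) : Finset (V × V) :=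
  (D.upEdges K).filter fun e => D.Geod ℓ e.1 e.2

theorem mem_upEdges [Fintype V] {K : Finset (Sym2 V × ℝ)} {e : V × V} : e ∈ D.upEdges K ↔
    (s(e.1, e.2), (G.dist e.1 e.2 : ℝ)) ∈ K ∧ D.lev e.1 < D.lev e.2 := by
  simp [upEdges]

theorem mem_lineEdges [Fintype V] {K : Finset (Sym2 V × ℝ)} {ℓ : Λ} {e : V × V} :
    e ∈ D.lineEdges K ℓ ↔ e ∈ D.upEdges K ∧ D.Geod ℓ e.1 e.2 := by
  simp [lineEdges]

/-- An undirected edge has at most one orientation that raises the level. -/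
theorem card_upEdges_le [Fintype V] (K : Finset (Sym2 V × ℝ)) : (D.upEdges K).card ≤ K.card := by
  refine Finset.card_le_card_of_injOn (fun e => (s(e.1, e.2), (G.dist e.1 e.2 : ℝ))) ?_ ?_
  · intro e he
    exact (D.mem_upEdges.1 he).1
  · rintro ⟨u, v⟩ h ⟨u', v'⟩ h' heq
    have h1 := (D.mem_upEdges.1 h).2
    have h2 := (D.mem_upEdges.1 h').2
    simp only [Prod.mk.injEq, Sym2.eq_iff] at heq
    obtain ⟨⟨rfl, rfl⟩ | ⟨rfl, rfl⟩, -⟩ := heq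
    · rfl
    · simp only at h1 h2
      omega

variable {K H : Finset (Sym2 V × ℝ)}

theorem mem_lineEdges_or [Fintype V] {ℓ : Λ} {x y : V} (h : D.Geod ℓ x y)
    (e : HopEdge G K x y (G.dist x y)) : (x, y) ∈ D.lineEdges K ℓ ∨ D.lev y < D.lev x + 3 := by
  rcases e with ⟨e, -⟩ | e
  · have := h.lev_le e
    omega
  · by_cases hl : D.lev x < D.lev y
    · exact Or.inl (D.mem_lineEdges.2 ⟨D.mem_upEdges.2 ⟨e, hl⟩, h⟩)
    · omega

/-- The undirected form of `LineSystem.le_card_pieces_of_walk`: since all weights along an exact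
walk are exact distances, the walk and all certification trees stay on the line. -/
theorem le_card_pieces_of_hopWalk [Fintype V] (hK : IsHopset G K) (hc : IsCertifiedHopset G K)
    (hHK : H ⊆ K) (ℓ : Λ) {k : ℕ} {r : ℝ} {x y : V} (h : HopWalk G H k r x y) :
    D.Geod ℓ x y → r = G.dist x y → D.lev y ≤ D.lev x + 2 * k +
      3 * (pieces (D.lineEdges K ℓ) (D.mem ℓ) D.lev 3 (D.lev x) (D.lev y)).card := by
  intro hg
  -- A natural number that increases along the trees: every edge has weight at least `1`, so the
  -- integer part of the potential, measured from `x`, grows.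
  have hedge : ∀ {u w : V} {a : ℝ}, HopEdge G K u w a → D.pot ℓ u + a = D.pot ℓ w →
      D.pot ℓ x ≤ D.pot ℓ u → ⌊D.pot ℓ u - D.pot ℓ x⌋.toNat < ⌊D.pot ℓ w - D.pot ℓ x⌋.toNat := by
    intro u w a e h1 h2
    have h3 := hK.le_of_hopEdge e
    have h4 : 1 ≤ G.dist u w := h3.1.pos_dist_of_ne (hK.ne_of_hopEdge e)
    have h5 : (1 : ℝ) ≤ G.dist u w := by exact_mod_cast h4
    have h6 : (D.pot ℓ u : ℝ) + 1 ≤ D.pot ℓ w := by linarith [h3.2]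
    have h7 : D.pot ℓ u + 1 ≤ D.pot ℓ w := by exact_mod_cast h6
    have h8 : ⌊D.pot ℓ u - D.pot ℓ x⌋ + 1 ≤ ⌊D.pot ℓ w - D.pot ℓ x⌋ := by
      rw [← Int.floor_add_one]
      exact Int.floor_le_floor (by linarith)
    have h9 : 0 ≤ ⌊D.pot ℓ u - D.pot ℓ x⌋ := Int.floor_nonneg.2 (by linarith)
    omega
  -- Membership is restricted to vertices of potential at least that of `x`, so that the conversion
  -- to natural numbers does not truncate.
  have tree := card_pieces_tree (K := D.lineEdges K ℓ)
    (M := fun v => D.mem ℓ v ∧ D.pot ℓ x ≤ D.pot ℓ v) (φ := D.lev) (g := 3)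
    (by norm_num) (fun v => ⌊D.pot ℓ v - D.pot ℓ x⌋.toNat) (by
      intro u v huv hu hv _
      obtain ⟨huv, hg'⟩ := D.mem_lineEdges.1 huv
      obtain ⟨w, a, b, e1, e2, hab⟩ := hc u v _ (D.mem_upEdges.1 huv).1
      have r1 := hK.le_of_hopEdge e1
      have r2 := hK.le_of_hopEdge e2
      obtain ⟨g1, g2, rfl, rfl⟩ := hg'.split r1.1 r2.1 r1.2 r2.2 hab
      have p1 : D.pot ℓ u ≤ D.pot ℓ w := by rw [g1.2.2]; simp
      refine ⟨w, ⟨g2.1, hu.2.trans p1⟩, g1.mem.2, g2.mem.2,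
        hedge e1 (by rw [g1.2.2]; push_cast; rfl) hu.2,
        hedge e2 (by rw [g2.2.2]; push_cast; rfl) (hu.2.trans p1), D.mem_lineEdges_or g1 e1,
        D.mem_lineEdges_or g2 e2⟩)
  have hsub : ∀ lo hi, (pieces (D.lineEdges K ℓ) (fun v => D.mem ℓ v ∧ D.pot ℓ x ≤ D.pot ℓ v) D.lev
      3 lo hi).card ≤ (pieces (D.lineEdges K ℓ) (D.mem ℓ) D.lev 3 lo hi).card := by
    intro lo hi
    refine Finset.card_le_card fun e he => ?_
    rw [mem_pieces] at he ⊢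
    exact ⟨he.1, he.2.1.1, he.2.2.1.1, he.2.2.2⟩
  suffices hs : ∀ {k : ℕ} {r : ℝ} {u y : V}, HopWalk G H k r u y → D.pot ℓ x ≤ D.pot ℓ u →
      D.Geod ℓ u y → r = G.dist u y → D.lev y ≤ D.lev u + 2 * k +
      3 * (pieces (D.lineEdges K ℓ) (D.mem ℓ) D.lev 3 (D.lev u) (D.lev y)).card from
    hs h le_rfl hg
  clear h hg y
  intro k r u y h
  induction h with
  | nil v => intros; omega
  | @cons k a b u v w e h ih =>
    intro hu hg hr
    have r1 := hK.le_of_hopEdge (e.mono hHK)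
    have r2 := hK.2 _ _ _ _ (h.mono hHK)
    obtain ⟨g1, g2, rfl, rfl⟩ := hg.split r1.1 r2.1 r1.2 r2.2 hr.symm
    have hv : D.pot ℓ x ≤ D.pot ℓ v := by
      rw [g1.2.2]
      have : (0 : ℚ) ≤ G.dist u v := by positivity
      linarith
    have e1 := tree u v ⟨hg.1, hu⟩ ⟨g2.1, hv⟩ (D.mem_lineEdges_or g1 (e.mono hHK))
    have e2 := ih hv g2 rfl
    have e3 := card_pieces_add (K := D.lineEdges K ℓ) (M := D.mem ℓ) (φ := D.lev) (g := 3)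
      (by norm_num) g1.mem.2 g2.mem.2
    have e4 := hsub (D.lev u) (D.lev v)
    omega

/-- The potential bounds the distances from below and the given walk bounds them from above, so both
are attained. -/
theorem walk_leaves {ℓ : Λ} {x y : V} (hx : x ∈ D.leavesS ℓ) (hy : y ∈ D.leavesT ℓ) :
    D.Geod ℓ (D.src ℓ) (D.tgt ℓ) ∧ D.Geod ℓ x y ∧ G.dist x y = G.dist (D.src ℓ) (D.tgt ℓ) + 2 := by
  obtain ⟨k, hk, hp⟩ := D.walk ℓ
  obtain ⟨m1, -, a1, p1⟩ := D.mem_leavesS ℓ x hx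
  obtain ⟨-, a2, p2⟩ := D.mem_leavesT ℓ y hy
  have hw : WalkOf G.Adj (k + 2) x y := by
    have := (WalkOf.cons a1 hk).append (.single a2)
    exact this
  have h1 := D.pot_le_dist ℓ hk.reachable
  have h2 := D.pot_le_dist ℓ hw.reachable
  have h3 : (G.dist (D.src ℓ) (D.tgt ℓ) : ℚ) ≤ k := by exact_mod_cast hk.dist_le
  have h4 : (G.dist x y : ℚ) ≤ k + 2 := by exact_mod_cast hw.dist_le
  have e1 : (G.dist (D.src ℓ) (D.tgt ℓ) : ℚ) = k := by linarith
  have e2 : (G.dist x y : ℚ) = k + 2 := by linarith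
  refine ⟨⟨D.mem_src ℓ, hk.reachable, by linarith⟩, ⟨m1, hw.reachable, by linarith⟩, ?_⟩
  rw [← e1] at e2
  exact_mod_cast e2

theorem card_mul_le [Fintype V] (hK : IsHopset G K) (hc : IsCertifiedHopset G K)
    (hHK : H ⊆ K) (s : Finset Λ) (m : ℕ)
    (hs : ∀ ℓ ∈ s, ∃ x ∈ D.leavesS ℓ, ∃ y ∈ D.leavesT ℓ, hopDist G H x y ≤ m) :
    s.card * N ≤ 3 * K.card + s.card * (2 * m) := by
  have h1 : ∀ ℓ ∈ s, N ≤ 3 * (pieces (D.upEdges K) (D.mem ℓ) D.lev 3 0 N).card + 2 * m := by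
    intro ℓ hℓ
    obtain ⟨x, hx, y, hy, hxy⟩ := hs ℓ hℓ
    have hg := (D.walk_leaves hx hy).2.1
    have := D.le_card_pieces_of_hopWalk hK hc hHK ℓ (hopWalk_hopDist hg.2.1) hg rfl
    rw [(D.mem_leavesS ℓ x hx).2.1, (D.mem_leavesT ℓ y hy).1] at this
    have hsub : (pieces (D.lineEdges K ℓ) (D.mem ℓ) D.lev 3 0 N).card ≤
        (pieces (D.upEdges K) (D.mem ℓ) D.lev 3 0 N).card := by
      refine Finset.card_le_card fun e he => ?_
      rw [mem_pieces] at he ⊢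
      exact ⟨(D.mem_lineEdges.1 he.1).1, he.2⟩
    omega
  have h2 := Finset.sum_le_sum h1
  rw [Finset.sum_const, Finset.sum_add_distrib, ← Finset.mul_sum, Finset.sum_const] at h2
  have h3 := sum_card_pieces_le (K := D.upEdges K) (φ := D.lev) (g := 3) s D.mem 0 N
    fun ℓ ℓ' x y h1 h2 h3 h4 h => D.ident ℓ ℓ' x y h1 h2 h3 h4 h
  have h4 := D.card_upEdges_le K
  simp only [smul_eq_mul] at h2
  omega

/-- The certification complexity of greedy hopsets of a graph with a system of lines. -/
theorem le_hopsetCertComplexity_greedyHopset [Fintype V] [DecidableEq V] [Fintype Λ] {a k : ℕ}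
    (hN : 2 ≤ N) (hpot : hopPotential G ∅ < k * (W * W * a)) (hH : GreedyHopset G k H) :
    Fintype.card Λ * N ≤ 3 * hopsetCertComplexity G H + Fintype.card Λ * (2 * (a + 3)) := by
  have hex : ↑H ⊆ exactEdges G := by
    intro e he
    rcases hH.mem_cand he with he | ⟨K, he⟩
    · simp at he
    · exact he.2
  obtain ⟨K, hK, hc, hHK, hcard⟩ := exists_hopsetCertComplexity hex
  obtain ⟨H', -, hH', hst⟩ := GreedyRun.exists_stage hH hpot
  have hex' : ↑H' ⊆ exactEdges G := (Finset.coe_subset.2 hH').trans hex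
  rw [← hcard, ← Finset.card_univ]
  refine D.card_mul_le hK hc (hH'.trans hHK) _ (a + 3) ?_
  intro ℓ _
  by_contra! hcon
  have hW := D.card_leavesS ℓ
  have hY := D.card_leavesT ℓ
  have hpos : 0 < W * W * a := by
    by_contra! h0
    have : W * W * a = 0 := by omega
    rw [this] at hpot
    omega
  have hWpos : 0 < W := Nat.pos_of_ne_zero (by rintro rfl; simp at hpos)
  obtain ⟨x, hx⟩ := Finset.card_pos.1 (hWpos.trans_le hW)
  obtain ⟨y, hy⟩ := Finset.card_pos.1 (hWpos.trans_le hY)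
  have hg := (D.walk_leaves hx hy).1
  have hthree : ∀ K', HopEdge G K' (D.src ℓ) (D.tgt ℓ) (G.dist (D.src ℓ) (D.tgt ℓ)) →
      ∀ x ∈ D.leavesS ℓ, ∀ y ∈ D.leavesT ℓ, hopDist G K' x y ≤ 3 := by
    intro K' h x hx y hy
    refine hopDist_le ?_
    have := HopWalk.cons (H := K') (Or.inl ⟨(D.mem_leavesS ℓ x hx).2.2.1, rfl⟩) (.cons h
      (HopEdge.hopWalk (Or.inl ⟨(D.mem_leavesT ℓ y hy).2.1, rfl⟩)))
    convert this using 1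
    rw [(D.walk_leaves hx hy).2.2]
    push_cast
    ring
  -- Since `N ≥ 2`, source and target are neither equal nor adjacent, so the edge is an admissible
  -- candidate.
  have hexact : (s(D.src ℓ, D.tgt ℓ), (G.dist (D.src ℓ) (D.tgt ℓ) : ℝ)) ∈ exactEdges G := by
    refine mem_exactEdges.2 ⟨fun h => ?_, fun h => ?_, hg.2.1, rfl⟩
    · have := D.lev_src ℓ
      rw [h, D.lev_tgt] at this
      omega
    · have := hg.lev_le h
      rw [D.lev_src, D.lev_tgt] at this
      omega
  have hnew : (s(D.src ℓ, D.tgt ℓ), (G.dist (D.src ℓ) (D.tgt ℓ) : ℝ)) ∈ newHopEdges G H' := by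
    refine ⟨fun h => ?_, hexact⟩
    have h1 := hthree H' (Or.inr h) x hx y hy
    have h2 := hcon x hx y hy
    omega
  have hins : ↑(insert (s(D.src ℓ, D.tgt ℓ), (G.dist (D.src ℓ) (D.tgt ℓ) : ℝ)) H') ⊆
      exactEdges G := by
    rw [Finset.coe_insert, Set.insert_subset_iff]
    exact ⟨hexact, hex'⟩
  have hgain := hopPotential_add_le (isHopset_of_subset_exactEdges hins) (Finset.subset_insert _ _) (D.leavesS ℓ) (D.leavesT ℓ)
    a 3 fun u hu v hv => ⟨hthree _ (Or.inr (Finset.mem_insert_self _ _)) u hu v hv,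
      (hcon u hu v hv).le⟩
  have := hst _ hnew
  have hle : W * W * a ≤ (D.leavesS ℓ).card * (D.leavesT ℓ).card * a := by gcongr
  omega

end HopSystem

end CertifiedShortcuts

/-! ### The construction for undirected graphs -/

namespace CertifiedShortcuts

/-- The parameters of the construction for undirected graphs: heights are taken modulo `Q`. -/
structure HopPar extends Par where
  Q : ℕ
  Q_pos : 0 < Q
  Q_le : Q ≤ s ^ 2

/-- The vertices of the construction for undirected graphs. -/
inductive HopVert
  | leafS (x : Fin 3 → ℚ) (z : ℚ) (r : ℕ)
  | leafT (x : Fin 3 → ℚ) (z : ℚ) (r : ℕ)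
  | core (k : ℕ) (x : Fin 3 → ℚ) (z : ℚ)
  | mid (k : ℕ) (x : Fin 3 → ℚ) (z : ℚ) (x' : Fin 3 → ℚ) (z' : ℚ) (r : ℕ)
  | spoke (x : Fin 3 → ℚ) (z : ℚ) (r : ℕ)
  | root
  | extra (r : ℕ)

noncomputable instance : DecidableEq HopVert := Classical.decEq _

/-- The numbers occurring in a line are in the allowed range. -/
structure Line.HopValid (P : HopPar) (ℓ : Line) : Prop where
  i_eq : ℓ.i = 0
  j_eq : ℓ.j = 0
  α_lt : ∀ i, ℓ.α i < P.s
  β_lt : ∀ i, ℓ.β i < P.s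
  ζ_lt : ℓ.ζ < P.Q

theorem Line.HopValid.valid {P : HopPar} {ℓ : Line} (h : ℓ.HopValid P) : ℓ.Valid P.toPar :=
  ⟨h.i_eq ▸ P.N₁_pos, h.j_eq ▸ P.N₂_pos, h.α_lt, h.β_lt, h.ζ_lt.trans_le P.Q_le⟩

theorem Line.HopValid.abs_D_le {P : HopPar} {ℓ : Line} (h : ℓ.HopValid P) (i : Fin 3) :
    |ℓ.D i| ≤ P.s := by
  have h1 : (ℓ.α i : ℚ) < P.s := by exact_mod_cast h.α_lt i
  have h2 : (ℓ.β i : ℚ) < P.s := by exact_mod_cast h.β_lt i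
  have h3 : (0 : ℚ) ≤ ℓ.α i := by positivity
  have h4 : (0 : ℚ) ≤ ℓ.β i := by positivity
  rw [abs_le, Line.D]
  constructor <;> linarith

namespace HopPar

variable (P : HopPar)

/-- The number of complete turns of the height of a line at a level. -/
def turns (ℓ : Line) (k : ℕ) : ℤ := ⌊ℓ.z P.toPar k / P.Q⌋

/-- The reduced height of a line at a level. -/
def zr (ℓ : Line) (k : ℕ) : ℚ := ℓ.z P.toPar k - P.Q * P.turns ℓ k

/-- The increase of the time at a step. -/
def gap (k : ℕ) : ℚ := ∑ i, (P.clk (k + 1) i - P.clk k i)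

/-- The basic delay of a step. -/
def delay (k : ℕ) : ℕ := ⌈4 * P.gap k * P.s ^ 2 / P.Q⌉₊ + 1

/-- The number of interior vertices of a step of a line. -/
def len (ℓ : Line) (k : ℕ) : ℕ := P.delay k + (P.turns ℓ (k + 1) - P.turns ℓ k).toNat

/-- The accumulated basic delay. -/
def cum (k : ℕ) : ℕ := ∑ k' ∈ Finset.range k, (P.delay k' + 1)

/-- The length of a spoke. -/
def R : ℕ := 6 * P.s ^ 2 / P.Q + 2

/-- The vertex of a line at a level. -/
def node (ℓ : Line) (k : ℕ) : HopVert := .core k (ℓ.pos P.toPar k) (P.zr ℓ k)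

/-- An interior vertex of a step of a line. -/
def inner (ℓ : Line) (k r : ℕ) : HopVert :=
  .mid k (ℓ.pos P.toPar k) (P.zr ℓ k) (ℓ.pos P.toPar (k + 1)) (P.zr ℓ (k + 1)) r

/-- The edges of the construction for undirected graphs, with an orientation. -/
inductive Arc : HopVert → HopVert → Prop
  | leafS (ℓ : Line) (r : ℕ) (hℓ : ℓ.HopValid P) (hr : r < P.W) (u v : HopVert)
      (hu : u = .leafS (ℓ.pos P.toPar 0) (P.zr ℓ 0) r) (hv : v = P.node ℓ 0) : Arc u v
  | enter (ℓ : Line) (k : ℕ) (hℓ : ℓ.HopValid P) (hk : k < P.N) (u v : HopVert)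
      (hu : u = P.node ℓ k) (hv : v = P.inner ℓ k (P.len ℓ k - 1)) : Arc u v
  | along (ℓ : Line) (k r : ℕ) (hℓ : ℓ.HopValid P) (hk : k < P.N) (hr : r + 1 < P.len ℓ k)
      (u v : HopVert) (hu : u = P.inner ℓ k (r + 1)) (hv : v = P.inner ℓ k r) : Arc u v
  | exit (ℓ : Line) (k : ℕ) (hℓ : ℓ.HopValid P) (hk : k < P.N) (u v : HopVert)
      (hu : u = P.inner ℓ k 0) (hv : v = P.node ℓ (k + 1)) : Arc u v
  | leafT (ℓ : Line) (r : ℕ) (hℓ : ℓ.HopValid P) (hr : r < P.W) (u v : HopVert)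
      (hu : u = P.node ℓ P.N) (hv : v = .leafT (ℓ.pos P.toPar P.N) (P.zr ℓ P.N) r) : Arc u v
  | fork (ℓ : Line) (hℓ : ℓ.HopValid P) (u v : HopVert)
      (hu : u = P.node ℓ 0) (hv : v = .spoke (ℓ.pos P.toPar 0) (P.zr ℓ 0) 0) : Arc u v
  | spoke (ℓ : Line) (r : ℕ) (hℓ : ℓ.HopValid P) (hr : r + 1 < P.R) (u v : HopVert)
      (hu : u = .spoke (ℓ.pos P.toPar 0) (P.zr ℓ 0) r)
      (hv : v = .spoke (ℓ.pos P.toPar 0) (P.zr ℓ 0) (r + 1)) : Arc u v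
  | root (ℓ : Line) (hℓ : ℓ.HopValid P) (u v : HopVert)
      (hu : u = .spoke (ℓ.pos P.toPar 0) (P.zr ℓ 0) (P.R - 1)) (hv : v = .root) : Arc u v
  | extra (r r' : ℕ) (h : r < r') (h' : r' < P.F) : Arc (.extra r) (.extra r')

/-- The undirected graph of the construction. -/
def graph : SimpleGraph HopVert := SimpleGraph.fromRel P.Arc

variable {P}

theorem Arc.ne {u v : HopVert} (h : P.Arc u v) : u ≠ v := by
  cases h <;> (try subst_vars) <;> simp [node, inner]
  omega

theorem Arc.adj {u v : HopVert} (h : P.Arc u v) : P.graph.Adj u v :=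
  (SimpleGraph.fromRel_adj _ _ _).2 ⟨h.ne, Or.inl h⟩

theorem graph_adj {u v : HopVert} : P.graph.Adj u v ↔ P.Arc u v ∨ P.Arc v u := by
  rw [graph, SimpleGraph.fromRel_adj]
  exact ⟨fun h => h.2, fun h => h.elim (fun h => ⟨h.ne, Or.inl h⟩) fun h => ⟨h.ne.symm, Or.inr h⟩⟩

variable (P)

theorem Q_pos' : (0 : ℚ) < P.Q := by exact_mod_cast P.Q_pos

theorem zr_nonneg (ℓ : Line) (k : ℕ) : 0 ≤ P.zr ℓ k := by
  have h := Int.floor_le (ℓ.z P.toPar k / P.Q)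
  rw [le_div_iff₀ P.Q_pos'] at h
  unfold zr turns
  linarith

theorem zr_lt (ℓ : Line) (k : ℕ) : P.zr ℓ k < P.Q := by
  have h := Int.lt_floor_add_one (ℓ.z P.toPar k / P.Q)
  rw [div_lt_iff₀ P.Q_pos'] at h
  unfold zr turns
  linarith

theorem zr_eq_of_sub {ℓ ℓ' : Line} {k : ℕ} {m : ℤ}
    (h : ℓ.z P.toPar k - ℓ'.z P.toPar k = P.Q * m) : P.zr ℓ k = P.zr ℓ' k := by
  have e : ℓ.z P.toPar k / P.Q = ℓ'.z P.toPar k / P.Q + m := by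
    have := P.Q_pos'
    field_simp
    linarith
  have : P.turns ℓ k = P.turns ℓ' k + m := by
    unfold turns
    rw [e, Int.floor_add_intCast]
  unfold zr
  rw [this]
  push_cast
  linarith

theorem sub_of_zr_eq {ℓ ℓ' : Line} {k : ℕ} (h : P.zr ℓ k = P.zr ℓ' k) :
    ∃ m : ℤ, ℓ.z P.toPar k - ℓ'.z P.toPar k = P.Q * m := by
  refine ⟨P.turns ℓ k - P.turns ℓ' k, ?_⟩
  unfold zr at h
  push_cast
  linarith

theorem clk_le_succ {k : ℕ} (hk : k < P.N) (i : Fin 3) : P.clk k i ≤ P.clk (k + 1) i :=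
  P.clk_mono (Nat.le_succ k) hk i

theorem gap_nonneg {k : ℕ} (hk : k < P.N) : 0 ≤ P.gap k :=
  Finset.sum_nonneg fun i _ => sub_nonneg.2 (P.clk_le_succ hk i)

theorem z_succ (ℓ : Line) (k : ℕ) : ℓ.z P.toPar (k + 1) =
    ℓ.z P.toPar k + ∑ i, (P.clk (k + 1) i - P.clk k i) * ℓ.D i ^ 2 := by
  simp only [Line.z, sub_mul, Finset.sum_sub_distrib]
  ring

theorem turns_le_succ (ℓ : Line) {k : ℕ} (hk : k < P.N) : P.turns ℓ k ≤ P.turns ℓ (k + 1) := by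
  refine Int.floor_le_floor ?_
  have h0 : 0 ≤ ∑ i, (P.clk (k + 1) i - P.clk k i) * ℓ.D i ^ 2 :=
    Finset.sum_nonneg fun i _ => mul_nonneg (sub_nonneg.2 (P.clk_le_succ hk i)) (sq_nonneg _)
  have := P.Q_pos'
  rw [z_succ]
  gcongr
  linarith

theorem turns_nonneg (ℓ : Line) {k : ℕ} (hk : k ≤ P.N) : 0 ≤ P.turns ℓ k :=
  Int.floor_nonneg.2 (div_nonneg (ℓ.z_nonneg P.toPar hk) P.Q_pos'.le)

theorem turns_zero {ℓ : Line} (hℓ : ℓ.HopValid P) : P.turns ℓ 0 = 0 := by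
  have h1 : (ℓ.ζ : ℚ) < P.Q := by exact_mod_cast hℓ.ζ_lt
  rw [turns, ℓ.z_zero, Int.floor_eq_zero_iff]
  exact ⟨div_nonneg (by positivity) P.Q_pos'.le, (div_lt_one P.Q_pos').2 h1⟩

theorem len_pos (ℓ : Line) (k : ℕ) : 0 < P.len ℓ k := by unfold len delay; omega

theorem len_eq (ℓ : Line) {k : ℕ} (hk : k < P.N) :
    (P.len ℓ k : ℚ) = P.delay k + (P.turns ℓ (k + 1) - P.turns ℓ k) := by
  have h := Int.toNat_of_nonneg (sub_nonneg.2 (P.turns_le_succ ℓ hk))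
  have h' : (((P.turns ℓ (k + 1) - P.turns ℓ k).toNat : ℤ) : ℚ) =
    (P.turns ℓ (k + 1) - P.turns ℓ k : ℤ) := by rw [h]
  unfold len
  push_cast at h' ⊢
  rw [h']

theorem cum_succ (k : ℕ) : P.cum (k + 1) = P.cum k + (P.delay k + 1) := Finset.sum_range_succ _ _

/-! ### The potential of a direction -/

/-- The potential at the vertices of the levels. -/
def corePot (D : Fin 3 → ℚ) (k : ℕ) (x : Fin 3 → ℚ) (z : ℚ) : ℚ :=
  P.cum k - lamAt D (P.clk k) x z / P.Q

/-- The potential of a direction. -/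
def pot (D : Fin 3 → ℚ) : HopVert → ℚ
  | .leafS x z _ => P.corePot D 0 x z - 1
  | .leafT x z _ => P.corePot D P.N x z + 1
  | .core k x z => P.corePot D k x z
  -- The index counts backwards from the far end of the step. The value falls at unit rate from
  -- there but never below that of the near end, so the whole defect of a foreign direction sits
  -- next to the near end.
  | .mid k x z x' z' r => max (P.corePot D (k + 1) x' z' - (r + 1)) (P.corePot D k x z)
  -- Linear interpolation between the source and the root, which is `R + 1` edges away.
  | .spoke x z r => P.corePot D 0 x z * ((P.R - r) / (P.R + 1))
  | .root => 0
  | .extra _ => 0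

/-- The level of a vertex. -/
def lev : HopVert → ℕ
  | .core k _ _ => k
  | .mid k _ _ _ _ _ => k
  | .leafT _ _ _ => P.N
  | _ => 0

/-- The excess of a direction at a step of a line. -/
def excess (D : Fin 3 → ℚ) (ℓ : Line) (k : ℕ) : ℚ :=
  ∑ i, (P.clk (k + 1) i - P.clk k i) * (ℓ.D i - D i) ^ 2

theorem excess_nonneg (D : Fin 3 → ℚ) (ℓ : Line) {k : ℕ} (hk : k < P.N) : 0 ≤ P.excess D ℓ k :=
  Finset.sum_nonneg fun i _ => mul_nonneg (sub_nonneg.2 (P.clk_le_succ hk i)) (sq_nonneg _)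

theorem corePot_node (D : Fin 3 → ℚ) (ℓ : Line) (k : ℕ) :
    P.corePot D k (ℓ.pos P.toPar k) (P.zr ℓ k) = P.cum k + P.turns ℓ k -
      (ℓ.ζ - ∑ i, 2 * D i * ℓ.α i + ∑ i, P.clk k i * (ℓ.D i - D i) ^ 2) / P.Q := by
  have h := ℓ.lamAt_eq P.toPar k D
  have h1 : lamAt D (P.clk k) (ℓ.pos P.toPar k) (P.zr ℓ k) =
      lamAt D (P.clk k) (ℓ.pos P.toPar k) (ℓ.z P.toPar k) - P.Q * P.turns ℓ k := by
    unfold lamAt zr; ring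
  have := P.Q_pos'
  rw [corePot, h1, h]
  field_simp
  ring

/-- A step has `len + 1` edges, `delay + 1` of them counted in `cum` and one for each turn of the
height. So the potential of the line's own direction grows by exactly one per edge, and another
direction falls short by `excess / Q`. -/
theorem corePot_succ (D : Fin 3 → ℚ) (ℓ : Line) {k : ℕ} (hk : k < P.N) :
    P.corePot D (k + 1) (ℓ.pos P.toPar (k + 1)) (P.zr ℓ (k + 1)) =
      P.corePot D k (ℓ.pos P.toPar k) (P.zr ℓ k) + P.len ℓ k + 1 - P.excess D ℓ k / P.Q := by
  have h : P.excess D ℓ k = ∑ i, P.clk (k + 1) i * (ℓ.D i - D i) ^ 2 -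
      ∑ i, P.clk k i * (ℓ.D i - D i) ^ 2 := by
    simp only [excess, sub_mul, Finset.sum_sub_distrib]
  rw [corePot_node, corePot_node, P.len_eq ℓ hk, cum_succ, h]
  push_cast
  ring

/-- The purpose of the delay: velocities differ by at most `2 * s` in each coordinate, so the defect
of any direction on any step is at most the delay. Hence no potential falls along a step. -/
theorem excess_div_le {ℓ ℓ' : Line} (hℓ : ℓ.HopValid P) (hℓ' : ℓ'.HopValid P) {k : ℕ}
    (hk : k < P.N) : P.excess ℓ'.D ℓ k / P.Q ≤ P.len ℓ k := by
  have h1 : P.excess ℓ'.D ℓ k ≤ 4 * P.gap k * P.s ^ 2 := by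
    have e : 4 * P.gap k * (P.s : ℚ) ^ 2 =
        ∑ i, (P.clk (k + 1) i - P.clk k i) * (2 * (P.s : ℚ)) ^ 2 := by
      rw [← Finset.sum_mul, gap]; ring
    rw [e]
    refine Finset.sum_le_sum fun i _ => ?_
    have := abs_le.1 (hℓ.abs_D_le i)
    have := abs_le.1 (hℓ'.abs_D_le i)
    refine mul_le_mul_of_nonneg_left (sq_le_sq' ?_ ?_) (sub_nonneg.2 (P.clk_le_succ hk i)) <;>
      linarith
  have h2 := Nat.le_ceil (4 * P.gap k * (P.s : ℚ) ^ 2 / P.Q)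
  have h3 : (P.delay k : ℚ) ≤ P.len ℓ k := by exact_mod_cast Nat.le_add_right _ _
  have h4 : ((⌈4 * P.gap k * (P.s : ℚ) ^ 2 / P.Q⌉₊ : ℕ) : ℚ) + 1 = P.delay k := by
    simp [delay]
  have h5 : P.excess ℓ'.D ℓ k / P.Q ≤ 4 * P.gap k * P.s ^ 2 / P.Q := by
    have := P.Q_pos'
    gcongr
  linarith

/-- The length `R` of the spokes exceeds `6 * s ^ 2 / Q`, so every potential can be brought to `0`
at the root with a change below one per edge. -/
theorem abs_corePot_zero_lt {ℓ ℓ' : Line} (hℓ : ℓ.HopValid P) (hℓ' : ℓ'.HopValid P) :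
    |P.corePot ℓ'.D 0 (ℓ.pos P.toPar 0) (P.zr ℓ 0)| < P.R + 1 := by
  have hQ := P.Q_pos'
  have h1 : (ℓ.ζ : ℚ) < P.Q := by exact_mod_cast hℓ.ζ_lt
  have h2 : ∀ i, |2 * ℓ'.D i * ℓ.α i| ≤ 2 * (P.s : ℚ) ^ 2 := fun i => by
    have h3 := hℓ'.abs_D_le i
    have h4 : (ℓ.α i : ℚ) ≤ P.s := by exact_mod_cast (hℓ.α_lt i).le
    rw [abs_mul, abs_mul, Nat.abs_cast, abs_of_pos (by norm_num : (0 : ℚ) < 2)]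
    calc 2 * |ℓ'.D i| * (ℓ.α i : ℚ) ≤ 2 * P.s * P.s := by gcongr
      _ = _ := by ring
  have h3 : |∑ i, 2 * ℓ'.D i * ℓ.α i| ≤ 6 * (P.s : ℚ) ^ 2 := by
    refine (Finset.abs_sum_le_sum_abs _ _).trans ((Finset.sum_le_sum fun i _ => h2 i).trans ?_)
    rw [Finset.sum_const, Finset.card_univ, Fintype.card_fin, nsmul_eq_mul]
    push_cast
    linarith
  have h4 : 6 * (P.s : ℚ) ^ 2 / P.Q < P.R := by
    have h5 : 6 * P.s ^ 2 < (6 * P.s ^ 2 / P.Q + 1) * P.Q :=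
      Nat.lt_mul_of_div_lt (Nat.lt_succ_self _) P.Q_pos
    have h6 : 6 * P.s ^ 2 < P.R * P.Q := h5.trans_le (Nat.mul_le_mul_right _ (by unfold R; omega))
    rw [div_lt_iff₀ hQ]
    exact_mod_cast h6
  rw [div_lt_iff₀ hQ] at h4
  have h5 : P.corePot ℓ'.D 0 (ℓ.pos P.toPar 0) (P.zr ℓ 0) =
      (∑ i, 2 * ℓ'.D i * ℓ.α i - ℓ.ζ) / P.Q := by
    rw [corePot_node, P.turns_zero hℓ]
    simp only [cum, Finset.range_zero, Finset.sum_empty, P.clk_zero, zero_mul,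
      Finset.sum_const_zero]
    push_cast
    ring
  have h6 : (0 : ℚ) ≤ ℓ.ζ := by positivity
  have h7 := abs_le.1 h3
  rw [h5, abs_div, abs_of_pos hQ, div_lt_iff₀ hQ, abs_lt]
  constructor <;> linarith

theorem R_pos : 0 < P.R := Nat.succ_pos _

/-- Along every arc the potential increases by at most one and decreases by less than one. -/
theorem pot_arc {ℓ' : Line} (hℓ' : ℓ'.HopValid P) {u v : HopVert} (h : P.Arc u v) :
    P.pot ℓ'.D v ≤ P.pot ℓ'.D u + 1 ∧ P.pot ℓ'.D u < P.pot ℓ'.D v + 1 := by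
  have hQ := P.Q_pos'
  have hR : (0 : ℚ) < P.R + 1 := by positivity
  have hspoke : ∀ ℓ : Line, ℓ.HopValid P → ∀ t : ℚ, 0 ≤ t →
      P.corePot ℓ'.D 0 (ℓ.pos P.toPar 0) (P.zr ℓ 0) * ((t + 1) / (P.R + 1)) -
        P.corePot ℓ'.D 0 (ℓ.pos P.toPar 0) (P.zr ℓ 0) * (t / (P.R + 1)) < 1 ∧
      P.corePot ℓ'.D 0 (ℓ.pos P.toPar 0) (P.zr ℓ 0) * (t / (P.R + 1)) -
        P.corePot ℓ'.D 0 (ℓ.pos P.toPar 0) (P.zr ℓ 0) * ((t + 1) / (P.R + 1)) < 1 := by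
    intro ℓ hℓ t _
    have h1 := abs_lt.1 (P.abs_corePot_zero_lt hℓ hℓ')
    generalize P.corePot ℓ'.D 0 (ℓ.pos P.toPar 0) (P.zr ℓ 0) = c at h1
    have e : c * ((t + 1) / (P.R + 1)) - c * (t / (P.R + 1)) = c / (P.R + 1) := by ring
    have e1 : c / (P.R + 1) < 1 := (div_lt_one hR).2 h1.2
    have e2 : -1 < c / (P.R + 1) := by rw [lt_div_iff₀ hR]; linarith
    constructor <;> linarith
  cases h with
  | leafS ℓ r hℓ hr _ _ hu hv => subst hu hv; simp only [pot, node]; constructor <;> linarith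
  | leafT ℓ r hℓ hr _ _ hu hv => subst hu hv; simp only [pot, node]; constructor <;> linarith
  | enter ℓ k hℓ hk _ _ hu hv =>
    subst hu hv
    have h1 := P.corePot_succ ℓ'.D ℓ hk
    have h2 : 0 ≤ P.excess ℓ'.D ℓ k / P.Q := div_nonneg (P.excess_nonneg _ ℓ hk) hQ.le
    have h3 : ((P.len ℓ k - 1 : ℕ) : ℚ) + 1 = P.len ℓ k := by
      have := P.len_pos ℓ k
      exact_mod_cast Nat.sub_add_cancel this
    simp only [pot, node, inner, h3]
    refine ⟨max_le (by linarith) (by linarith), ?_⟩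
    have := le_max_right (P.corePot ℓ'.D (k + 1) (ℓ.pos P.toPar (k + 1)) (P.zr ℓ (k + 1)) -
      P.len ℓ k) (P.corePot ℓ'.D k (ℓ.pos P.toPar k) (P.zr ℓ k))
    linarith
  | along ℓ k r hℓ hk hr _ _ hu hv =>
    subst hu hv
    simp only [pot, inner]
    push_cast
    constructor
    · rw [← max_add_add_right]
      exact max_le_max (by linarith) (by linarith)
    · refine lt_of_le_of_lt (max_le_max ?_ le_rfl) (lt_add_one _)
      linarith
  | exit ℓ k hℓ hk _ _ hu hv =>
    subst hu hv
    have h1 := P.corePot_succ ℓ'.D ℓ hk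
    have h2 := P.excess_div_le hℓ hℓ' hk
    simp only [pot, inner, node]
    push_cast
    constructor
    · rw [← max_add_add_right]
      exact le_max_of_le_left (by linarith)
    · exact max_lt (by linarith) (by linarith)
  | fork ℓ hℓ _ _ hu hv =>
    subst hu hv
    have h1 := hspoke ℓ hℓ P.R (by positivity)
    rw [div_self hR.ne', mul_one] at h1
    simp only [pot, node]
    push_cast
    rw [sub_zero]
    constructor <;> linarith [h1.1, h1.2]
  | spoke ℓ r hℓ hr _ _ hu hv =>
    subst hu hv
    have hr' : ((r + 1 : ℕ) : ℚ) ≤ P.R := by exact_mod_cast hr.le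
    have h1 := hspoke ℓ hℓ (P.R - (r + 1 : ℕ)) (by linarith)
    push_cast at h1
    rw [show (P.R : ℚ) - (r + 1) + 1 = P.R - r by ring] at h1
    simp only [pot]
    push_cast
    constructor <;> linarith [h1.1, h1.2]
  | root ℓ hℓ _ _ hu hv =>
    subst hu hv
    have h1 := hspoke ℓ hℓ 0 le_rfl
    have h2 : (P.R : ℚ) - ((P.R - 1 : ℕ) : ℚ) = 0 + 1 := by
      rw [Nat.cast_sub P.R_pos]; push_cast; ring
    simp only [pot, h2]
    rw [zero_div, mul_zero] at h1
    constructor <;> linarith [h1.1, h1.2]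
  | extra => simp [pot]

/-! ### The lines -/

/-- The vertices that belong to a line. -/
def Mem (ℓ : Line) : HopVert → Prop
  | .leafS x z _ => x = ℓ.pos P.toPar 0 ∧ z = P.zr ℓ 0
  | .leafT x z _ => x = ℓ.pos P.toPar P.N ∧ z = P.zr ℓ P.N
  | .core k x z => k ≤ P.N ∧ x = ℓ.pos P.toPar k ∧ z = P.zr ℓ k
  | .mid k x z x' z' _ => k < P.N ∧ x = ℓ.pos P.toPar k ∧ z = P.zr ℓ k ∧
      x' = ℓ.pos P.toPar (k + 1) ∧ z' = P.zr ℓ (k + 1)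
  | _ => False

/-- Without excess, every coordinate that moves has the same speed on both lines. The climbs agree,
so the heights keep their difference, a multiple of `Q`. -/
theorem step_eq_of_excess {ℓ ℓ' : Line} {k : ℕ} (hk : k < P.N)
    (hpos : ℓ'.pos P.toPar k = ℓ.pos P.toPar k) (hz : P.zr ℓ' k = P.zr ℓ k)
    (h : P.excess ℓ.D ℓ' k = 0) : ℓ'.pos P.toPar (k + 1) = ℓ.pos P.toPar (k + 1) ∧
      P.zr ℓ' (k + 1) = P.zr ℓ (k + 1) := by
  rw [excess, Finset.sum_eq_zero_iff_of_nonneg fun i _ =>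
    mul_nonneg (sub_nonneg.2 (P.clk_le_succ hk i)) (sq_nonneg _)] at h
  have hclk : ∀ i, P.clk (k + 1) i = P.clk k i ∨ ℓ'.D i = ℓ.D i := fun i => by
    rcases mul_eq_zero.1 (h i (Finset.mem_univ i)) with h | h
    · exact Or.inl (by linarith)
    · exact Or.inr (by have := pow_eq_zero_iff (two_ne_zero) |>.1 h; linarith)
  constructor
  · ext i
    have := congrFun hpos i
    simp only [Line.pos] at this ⊢
    rcases hclk i with h | h
    · rw [h, this]
    · rw [h] at this ⊢; linarith
  · obtain ⟨m, hm⟩ := P.sub_of_zr_eq hz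
    refine P.zr_eq_of_sub (m := m) ?_
    have h1 : ∑ i, (P.clk (k + 1) i - P.clk k i) * ℓ'.D i ^ 2 =
        ∑ i, (P.clk (k + 1) i - P.clk k i) * ℓ.D i ^ 2 :=
      Finset.sum_congr rfl fun i _ => by
        rcases hclk i with h | h
        · rw [h]; ring
        · rw [h]
    rw [z_succ, z_succ, h1]
    linarith

/-- An arc from a line along which the potential increases by one stays in the line. -/
theorem mem_of_arc {ℓ : Line} (hℓ : ℓ.HopValid P) {u v : HopVert} (hu : P.Mem ℓ u)
    (h : P.Arc u v) (ht : P.pot ℓ.D v = P.pot ℓ.D u + 1) :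
    P.Mem ℓ v ∧ P.lev u ≤ P.lev v ∧ P.lev v ≤ P.lev u + 1 := by
  have hQ := P.Q_pos'
  cases h with
  | leafS ℓ' r hℓ' hr _ _ hu' hv' =>
    subst hu' hv'
    exact ⟨⟨Nat.zero_le _, hu⟩, by simp [lev, node]⟩
  | leafT ℓ' r hℓ' hr _ _ hu' hv' =>
    subst hu' hv'
    exact ⟨hu.2, by simp [lev, node]⟩
  | enter ℓ' k hℓ' hk _ _ hu' hv' =>
    subst hu' hv'
    obtain ⟨-, hx, hz⟩ := hu
    have h1 := P.corePot_succ ℓ.D ℓ' hk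
    have h3 : ((P.len ℓ' k - 1 : ℕ) : ℚ) + 1 = P.len ℓ' k := by
      have := P.len_pos ℓ' k
      exact_mod_cast Nat.sub_add_cancel this
    simp only [pot, node, inner, h3] at ht
    -- A full unit of increase at the first edge of a step is possible only if nothing is lost on
    -- the step.
    have h4 : P.excess ℓ.D ℓ' k / P.Q = 0 := by
      rcases max_choice (P.corePot ℓ.D (k + 1) (ℓ'.pos P.toPar (k + 1)) (P.zr ℓ' (k + 1)) -
        P.len ℓ' k) (P.corePot ℓ.D k (ℓ'.pos P.toPar k) (P.zr ℓ' k)) with h | h <;> linarith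
    rw [div_eq_zero_iff, or_iff_left hQ.ne'] at h4
    obtain ⟨hx', hz'⟩ := P.step_eq_of_excess hk hx hz h4
    exact ⟨⟨hk, hx, hz, hx', hz'⟩, by simp [lev, node, inner]⟩
  | along ℓ' k r hℓ' hk hr _ _ hu' hv' =>
    subst hu' hv'
    exact ⟨hu, by simp [lev, inner]⟩
  | exit ℓ' k hℓ' hk _ _ hu' hv' =>
    subst hu' hv'
    exact ⟨⟨hk, hu.2.2.2⟩, by simp [lev, node, inner]⟩
  | fork ℓ' hℓ' _ _ hu' hv' =>
    subst hu' hv'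
    -- The potential changes by less than one along spokes, so a tight edge never enters one.
    exfalso
    have h1 := abs_lt.1 (P.abs_corePot_zero_lt hℓ' hℓ)
    have hR : (0 : ℚ) < P.R + 1 := by positivity
    simp only [pot, node] at ht
    generalize P.corePot ℓ.D 0 (ℓ'.pos P.toPar 0) (P.zr ℓ' 0) = c at h1 ht
    have e : c * ((P.R - (0 : ℕ)) / (P.R + 1)) = c - c / (P.R + 1) := by
      rw [Nat.cast_zero, sub_zero]
      field_simp
      ring
    have e2 : -1 < c / (P.R + 1) := by rw [lt_div_iff₀ hR]; linarith
    linarith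
  | spoke ℓ' r hℓ' hr _ _ hu' hv' => subst hu'; exact hu.elim
  | root ℓ' hℓ' _ _ hu' hv' => subst hu'; exact hu.elim
  | extra => exact hu.elim

theorem Mem.data {P : HopPar} {ℓ ℓ' : Line} {v : HopVert} (h : P.Mem ℓ v) (h' : P.Mem ℓ' v) :
    P.lev v ≤ P.N ∧ ℓ.pos P.toPar (P.lev v) = ℓ'.pos P.toPar (P.lev v) ∧
      P.zr ℓ (P.lev v) = P.zr ℓ' (P.lev v) := by
  cases v with
  | leafS => exact ⟨Nat.zero_le _, h.1.symm.trans h'.1, h.2.symm.trans h'.2⟩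
  | leafT => exact ⟨le_rfl, h.1.symm.trans h'.1, h.2.symm.trans h'.2⟩
  | core => exact ⟨h.1, h.2.1.symm.trans h'.2.1, h.2.2.symm.trans h'.2.2⟩
  | mid => exact ⟨h.1.le, h.2.1.symm.trans h'.2.1, h.2.2.1.symm.trans h'.2.2.1⟩
  | spoke => exact h.elim
  | root => exact h.elim
  | extra => exact h.elim

/-- As for directed graphs, except that heights are known only modulo `Q`; since the initial heights
are below `Q`, this is enough. -/
theorem Mem.eq_of_lev {P : HopPar} {ℓ ℓ' : Line} (hℓ : ℓ.HopValid P) (hℓ' : ℓ'.HopValid P)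
    {x y : HopVert} (h1 : P.Mem ℓ x) (h2 : P.Mem ℓ y) (h3 : P.Mem ℓ' x) (h4 : P.Mem ℓ' y)
    (h : P.lev x + 3 ≤ P.lev y) : ℓ = ℓ' := by
  obtain ⟨-, px, zx⟩ := h1.data h3
  obtain ⟨hy, py, -⟩ := h2.data h4
  have hD : ∀ i, ℓ.D i = ℓ'.D i := fun i => by
    have e1 := congrFun px i
    have e2 := congrFun py i
    simp only [Line.pos] at e1 e2
    have hc := P.clk_lt h hy i
    have : (P.clk (P.lev y) i - P.clk (P.lev x) i) * (ℓ.D i - ℓ'.D i) = 0 := by linarith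
    rcases mul_eq_zero.1 this with h | h <;> linarith
  have hα : ∀ i, ℓ.α i = ℓ'.α i := fun i => by
    have e1 := congrFun px i
    simp only [Line.pos] at e1
    rw [hD i] at e1
    exact_mod_cast add_right_cancel e1
  have hβ : ∀ i, ℓ.β i = ℓ'.β i := fun i => by
    have e1 := hD i
    simp only [Line.D, hα i] at e1
    exact_mod_cast sub_left_injective e1
  have hζ : ℓ.ζ = ℓ'.ζ := by
    obtain ⟨m, hm⟩ := P.sub_of_zr_eq zx
    simp only [Line.z, hD, add_sub_add_right_eq_sub] at hm
    have hm' : (ℓ.ζ : ℤ) - ℓ'.ζ = P.Q * m := by exact_mod_cast hm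
    have b1 : (ℓ.ζ : ℤ) < P.Q := by exact_mod_cast hℓ.ζ_lt
    have b2 : (ℓ'.ζ : ℤ) < P.Q := by exact_mod_cast hℓ'.ζ_lt
    have hQ : (0 : ℤ) < P.Q := by exact_mod_cast P.Q_pos
    have g1 : m < 1 := by
      by_contra! hc
      nlinarith
    have g2 : -1 < m := by
      by_contra! hc
      nlinarith
    have : m = 0 := by omega
    rw [this] at hm'
    omega
  exact Line.ext (hℓ.i_eq.trans hℓ'.i_eq.symm) (hℓ.j_eq.trans hℓ'.j_eq.symm) (funext hα)
    (funext hβ) hζ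

variable {P}

theorem walkOf_inner {ℓ : Line} (hℓ : ℓ.HopValid P) {k : ℕ} (hk : k < P.N) {r : ℕ}
    (hr : r < P.len ℓ k) : WalkOf P.graph.Adj (r + 1) (P.inner ℓ k r) (P.node ℓ (k + 1)) := by
  induction r with
  | zero => exact .single (Arc.exit ℓ k hℓ hk _ _ rfl rfl).adj
  | succ r ih => exact .cons (Arc.along ℓ k r hℓ hk hr _ _ rfl rfl).adj (ih (by omega))

theorem walkOf_step {ℓ : Line} (hℓ : ℓ.HopValid P) {k : ℕ} (hk : k < P.N) :
    WalkOf P.graph.Adj (P.len ℓ k + 1) (P.node ℓ k) (P.node ℓ (k + 1)) := by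
  have h := P.len_pos ℓ k
  have := walkOf_inner hℓ hk (r := P.len ℓ k - 1) (by omega)
  rw [Nat.sub_add_cancel h] at this
  exact .cons (Arc.enter ℓ k hℓ hk _ _ rfl rfl).adj this

theorem walkOf_node {ℓ : Line} (hℓ : ℓ.HopValid P) {k : ℕ} (hk : k ≤ P.N) :
    WalkOf P.graph.Adj (P.cum k + (P.turns ℓ k).toNat) (P.node ℓ 0) (P.node ℓ k) := by
  induction k with
  | zero =>
    rw [P.turns_zero hℓ]
    exact .nil _
  | succ k ih =>
    have := (ih (by omega)).append (walkOf_step hℓ hk)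
    convert this using 1
    have h1 := P.turns_le_succ ℓ hk
    have h2 := P.turns_nonneg ℓ (k := k) (by omega)
    rw [cum_succ, len]
    omega

variable (P)

/-- The lines of the construction. -/
noncomputable def hopSystem : HopSystem P.graph {ℓ : Line // ℓ.HopValid P} P.N P.W where
  mem ℓ := P.Mem ℓ
  lev := P.lev
  pot ℓ := P.pot ℓ.1.D
  pot_le ℓ u v h := by
    rcases graph_adj.1 h with h | h
    · exact (P.pot_arc ℓ.2 h).1
    · exact (P.pot_arc ℓ.2 h).2.le
  tight ℓ u v hu h ht := by
    rcases graph_adj.1 h with h | h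
    · exact P.mem_of_arc ℓ.2 hu h ht
    · exact absurd ht (P.pot_arc ℓ.2 h).2.ne
  ident ℓ ℓ' x y h1 h2 h3 h4 h := Subtype.ext (h1.eq_of_lev ℓ.2 ℓ'.2 h2 h3 h4 h)
  src ℓ := P.node ℓ 0
  tgt ℓ := P.node ℓ P.N
  mem_src ℓ := ⟨Nat.zero_le _, rfl, rfl⟩
  lev_src ℓ := rfl
  lev_tgt ℓ := rfl
  walk ℓ := by
    refine ⟨_, walkOf_node ℓ.2 le_rfl, ?_⟩
    have h1 := P.turns_nonneg ℓ.1 le_rfl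
    have h2 : (((P.turns ℓ.1 P.N).toNat : ℤ) : ℚ) = P.turns ℓ.1 P.N := by
      rw [Int.toNat_of_nonneg h1]
    simp only [pot, node, corePot_node, P.turns_zero ℓ.2]
    simp only [cum, sub_self, Finset.range_zero, Finset.sum_empty, ne_eq, OfNat.ofNat_ne_zero,
      not_false_eq_true, zero_pow, mul_zero, Finset.sum_const_zero]
    push_cast at h2 ⊢
    rw [h2]
    ring
  leavesS ℓ := (Finset.range P.W).image fun r => .leafS (ℓ.1.pos P.toPar 0) (P.zr ℓ.1 0) r
  leavesT ℓ := (Finset.range P.W).image fun r => .leafT (ℓ.1.pos P.toPar P.N) (P.zr ℓ.1 P.N) r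
  card_leavesS ℓ := by
    rw [Finset.card_image_of_injective, Finset.card_range]
    intro r r' h
    simpa using h
  card_leavesT ℓ := by
    rw [Finset.card_image_of_injective, Finset.card_range]
    intro r r' h
    simpa using h
  mem_leavesS ℓ v hv := by
    obtain ⟨r, hr, rfl⟩ := Finset.mem_image.1 hv
    exact ⟨⟨rfl, rfl⟩, rfl, (Arc.leafS ℓ.1 r ℓ.2 (Finset.mem_range.1 hr) _ _ rfl rfl).adj,
      by simp [pot, node]⟩
  mem_leavesT ℓ v hv := by
    obtain ⟨r, hr, rfl⟩ := Finset.mem_image.1 hv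
    exact ⟨rfl, (Arc.leafT ℓ.1 r ℓ.2 (Finset.mem_range.1 hr) _ _ rfl rfl).adj,
      by simp [pot, node]⟩

end HopPar

end CertifiedShortcuts

namespace CertifiedShortcuts

namespace HopPar

variable (P : HopPar)

/-! ### Counting the vertices -/

/-- The lines of the construction. -/
noncomputable def lines : Finset Line :=
  (P.cube ×ˢ P.cube ×ˢ Finset.range P.Q).image fun p => ⟨0, 0, p.1, p.2.1, p.2.2⟩

theorem mem_lines {ℓ : Line} : ℓ ∈ P.lines ↔ ℓ.HopValid P := by
  simp only [lines, Finset.mem_image, Finset.mem_product, Finset.mem_range, Par.mem_cube,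
    Prod.exists]
  constructor
  · rintro ⟨a, b, c, ⟨h1, h2, h3⟩, rfl⟩
    exact ⟨rfl, rfl, h1, h2, h3⟩
  · intro h
    exact ⟨ℓ.α, ℓ.β, ℓ.ζ, ⟨h.3, h.4, h.5⟩, Line.ext h.1.symm h.2.symm rfl rfl rfl⟩

noncomputable instance : Fintype {ℓ : Line // ℓ.HopValid P} :=
  Fintype.subtype P.lines fun _ => P.mem_lines

theorem card_hopLines : Fintype.card {ℓ : Line // ℓ.HopValid P} = P.s ^ 6 * P.Q := by
  rw [Fintype.card_of_subtype P.lines fun _ => P.mem_lines, lines, Finset.card_image_of_injective]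
  · simp only [Finset.card_product, Finset.card_range, Par.card_cube]; ring
  · rintro ⟨a, b, c⟩ ⟨a', b', c'⟩ h
    simpa using h

theorem zr_eq_of_floor_eq {ℓ ℓ' : Line} {k : ℕ}
    (hpos : ℓ.pos P.toPar k = ℓ'.pos P.toPar k) (h : ⌊P.zr ℓ k⌋₊ = ⌊P.zr ℓ' k⌋₊) :
    P.zr ℓ k = P.zr ℓ' k := by
  obtain ⟨m, hm⟩ := Line.exists_int_z_sub P.toPar hpos
  have f1 := Nat.floor_le (P.zr_nonneg ℓ k)
  have f2 := Nat.lt_floor_add_one (P.zr ℓ k)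
  have f3 := Nat.floor_le (P.zr_nonneg ℓ' k)
  have f4 := Nat.lt_floor_add_one (P.zr ℓ' k)
  rw [h] at f1 f2
  have e : P.zr ℓ k - P.zr ℓ' k = (m - P.Q * (P.turns ℓ k - P.turns ℓ' k) : ℤ) := by
    push_cast
    rw [← hm]
    unfold zr
    ring
  generalize m - P.Q * (P.turns ℓ k - P.turns ℓ' k) = d at e
  have g1 : (d : ℚ) < 1 := by linarith
  have g2 : (-1 : ℚ) < d := by linarith
  have g1' : d < 1 := by exact_mod_cast g1
  have g2' : -1 < d := by exact_mod_cast g2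
  have : d = 0 := by omega
  rw [this] at e
  push_cast at e
  linarith

/-- The vertices at a level. -/
noncomputable def nodes (k : ℕ) : Finset HopVert := P.lines.image fun ℓ => P.node ℓ k

theorem card_nodes_le {k : ℕ} (hk : k ≤ P.N) :
    (P.nodes k).card ≤ (4 * P.B * P.s) ^ 3 * P.Q := by
  classical
  let g : HopVert → (Fin 3 → ℕ) × ℕ := fun v => match v with
    | .core _ x z => (fun c => ⌊x c * (P.clk k c).den⌋₊, ⌊z⌋₊)
    | _ => 0
  have hcard : ((Fintype.piFinset fun _ : Fin 3 => Finset.range (4 * P.B * P.s)) ×ˢ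
      Finset.range P.Q).card = (4 * P.B * P.s) ^ 3 * P.Q := by simp
  rw [← hcard]
  refine Finset.card_le_card_of_injOn g ?_ ?_
  · intro v hv
    obtain ⟨ℓ, hℓ, rfl⟩ := Finset.mem_image.1 hv
    simp only [Finset.coe_product, Set.mem_prod, Finset.mem_coe, Fintype.mem_piFinset,
      Finset.mem_range, g, node]
    refine ⟨fun c => ?_, ?_⟩
    · obtain ⟨m, hm, e⟩ := (P.mem_lines.1 hℓ).valid.exists_num hk c
      rw [e, Nat.floor_natCast]
      exact hm
    · rw [Nat.floor_lt (P.zr_nonneg ℓ k)]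
      exact P.zr_lt ℓ k
  · intro v hv v' hv' h
    obtain ⟨ℓ, hℓ, rfl⟩ := Finset.mem_image.1 hv
    obtain ⟨ℓ', hℓ', rfl⟩ := Finset.mem_image.1 hv'
    simp only [g, node, Prod.mk.injEq] at h
    have hpos : ℓ.pos P.toPar k = ℓ'.pos P.toPar k := by
      ext c
      have := congrFun h.1 c
      obtain ⟨m, _, e⟩ := (P.mem_lines.1 hℓ).valid.exists_num hk c
      obtain ⟨m', _, e'⟩ := (P.mem_lines.1 hℓ').valid.exists_num hk c
      rw [e, e', Nat.floor_natCast, Nat.floor_natCast] at this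
      have hd : ((P.clk k c).den : ℚ) ≠ 0 := by exact_mod_cast (P.clk k c).den_pos.ne'
      apply mul_right_cancel₀ hd
      rw [e, e', this]
    simp only [node, hpos, P.zr_eq_of_floor_eq hpos h.2]

theorem zr_zero {ℓ : Line} (hℓ : ℓ.HopValid P) : P.zr ℓ 0 = ℓ.ζ := by
  rw [zr, P.turns_zero hℓ, ℓ.z_zero]; simp

/-- At both ends of the lines positions and heights are integers, so there are only few sources and
targets, and each may receive many leaves. -/
theorem card_nodes_zero_le : (P.nodes 0).card ≤ P.s ^ 3 * P.Q := by
  have hsub : P.nodes 0 ⊆ (P.cube ×ˢ Finset.range P.Q).image fun p =>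
      HopVert.core 0 (fun i => (p.1 i : ℚ)) p.2 := by
    intro v hv
    obtain ⟨ℓ, hℓ, rfl⟩ := Finset.mem_image.1 hv
    have h := P.mem_lines.1 hℓ
    refine Finset.mem_image.2 ⟨(ℓ.α, ℓ.ζ), Finset.mem_product.2
      ⟨P.mem_cube.2 h.α_lt, Finset.mem_range.2 h.ζ_lt⟩, ?_⟩
    simp only [node, ℓ.pos_zero, P.zr_zero h]
  refine (Finset.card_le_card hsub).trans (Finset.card_image_le.trans (le_of_eq ?_))
  rw [Finset.card_product, Par.card_cube, Finset.card_range]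

theorem card_nodes_N_le : (P.nodes P.N).card ≤ P.s ^ 3 * P.Q := by
  have hsub : P.nodes P.N ⊆ (P.cube ×ˢ Finset.range P.Q).image fun p =>
      HopVert.core P.N (fun i => (p.1 i : ℚ)) p.2 := by
    intro v hv
    obtain ⟨ℓ, hℓ, rfl⟩ := Finset.mem_image.1 hv
    have h := P.mem_lines.1 hℓ
    obtain ⟨η, hη, -⟩ := P.toPar.z_N ℓ
    have h0 := P.zr_nonneg ℓ P.N
    have h1 := P.zr_lt ℓ P.N
    have e : P.zr ℓ P.N = ((η - P.Q * P.turns ℓ P.N : ℤ) : ℚ) := by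
      rw [zr, hη]; push_cast; rfl
    rw [e] at h0 h1
    have h0' : 0 ≤ (η - P.Q * P.turns ℓ P.N : ℤ) := by exact_mod_cast h0
    have h1' : (η - P.Q * P.turns ℓ P.N : ℤ) < P.Q := by exact_mod_cast h1
    obtain ⟨m, hm⟩ := Int.eq_ofNat_of_zero_le h0'
    rw [hm] at e h1'
    refine Finset.mem_image.2 ⟨(ℓ.β, m), Finset.mem_product.2
      ⟨P.mem_cube.2 h.β_lt, Finset.mem_range.2 (by exact_mod_cast h1')⟩, ?_⟩
    simp only [node, ℓ.pos_N, e, Int.cast_natCast]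
  refine (Finset.card_le_card hsub).trans (Finset.card_image_le.trans (le_of_eq ?_))
  rw [Finset.card_product, Par.card_cube, Finset.card_range]

/-- The steps of the lines at a level. -/
noncomputable def steps (k : ℕ) : Finset (HopVert × HopVert) :=
  P.lines.image fun ℓ => (P.node ℓ k, P.node ℓ (k + 1))

theorem card_steps_le {k : ℕ} (hk : k < P.N) :
    (P.steps k).card ≤ P.s ^ 2 * (4 * P.B * P.s) ^ 2 * P.Q := by
  classical
  have hS : ∀ e ∈ P.steps k, ∃ ℓ : Line, ℓ.HopValid P ∧ e = (P.node ℓ k, P.node ℓ (k + 1)) := by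
    intro e he
    obtain ⟨ℓ, hℓ, rfl⟩ := Finset.mem_image.1 he
    exact ⟨ℓ, P.mem_lines.1 hℓ, rfl⟩
  choose! L hL heq using hS
  let c₀ : Fin 3 := ⟨k % 3, Nat.mod_lt _ (by norm_num)⟩
  let g : HopVert × HopVert → (Fin 3 → ℕ) × ℕ := fun e =>
    (fun c => if c = c₀ then (L e).α c * P.s + (L e).β c else
      ⌊(L e).pos P.toPar k c * (P.clk k c).den⌋₊, ⌊P.zr (L e) k⌋₊)
  have hcard : ((Fintype.piFinset fun c : Fin 3 => Finset.range (if c = c₀ then P.s ^ 2 else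
        4 * P.B * P.s)) ×ˢ Finset.range P.Q).card = P.s ^ 2 * (4 * P.B * P.s) ^ 2 * P.Q := by
    simp only [Finset.card_product, Finset.card_range, Fintype.card_piFinset,
      Par.prod_ite_fin_three]
  rw [← hcard]
  refine Finset.card_le_card_of_injOn g ?_ ?_
  · intro e he
    have hv := (hL e he).valid
    simp only [Finset.coe_product, Set.mem_prod, Finset.mem_coe, Fintype.mem_piFinset,
      Finset.mem_range, g]
    refine ⟨fun c => ?_, ?_⟩
    · split_ifs with h
      · have h1 := hv.α_lt c
        have h2 := hv.β_lt c
        nlinarith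
      · obtain ⟨m, hm, e⟩ := hv.exists_num hk.le c
        rw [e, Nat.floor_natCast]
        exact hm
    · rw [Nat.floor_lt (P.zr_nonneg _ k)]
      exact P.zr_lt _ k
  · intro e he e' he' h
    have hv := (hL e he).valid
    have hv' := (hL e' he').valid
    simp only [g, Prod.mk.injEq] at h
    obtain ⟨hx, hz⟩ := h
    have h0 := congrFun hx c₀
    simp only [if_true] at h0
    have hb := hv.β_lt c₀
    have hb' := hv'.β_lt c₀
    have hα : (L e).α c₀ = (L e').α c₀ := by
      have h1 := congrArg (· / P.s) h0
      simp only [mul_comm _ P.s, Nat.mul_add_div P.s_pos, Nat.div_eq_of_lt hb,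
        Nat.div_eq_of_lt hb'] at h1
      omega
    have hβ : (L e).β c₀ = (L e').β c₀ := by
      rw [hα] at h0; omega
    have hD : (L e).D c₀ = (L e').D c₀ := by simp only [Line.D, hα, hβ]
    have hpos : (L e).pos P.toPar k = (L e').pos P.toPar k := by
      ext c
      by_cases hc : c = c₀
      · subst hc; simp only [Line.pos, hα, hD]
      · have h1 := congrFun hx c
        simp only [if_neg hc] at h1
        obtain ⟨m, _, e⟩ := hv.exists_num hk.le c
        obtain ⟨m', _, e'⟩ := hv'.exists_num hk.le c
        rw [e, e', Nat.floor_natCast, Nat.floor_natCast] at h1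
        have hd : ((P.clk k c).den : ℚ) ≠ 0 := by exact_mod_cast (P.clk k c).den_pos.ne'
        apply mul_right_cancel₀ hd
        rw [e, e', h1]
    have hzr := P.zr_eq_of_floor_eq hpos hz
    have hex : P.excess (L e').D (L e) k = 0 := by
      refine Finset.sum_eq_zero fun c _ => ?_
      by_cases hc : c = c₀
      · subst hc; rw [hD]; ring
      · rw [P.clk_succ_eq fun h => hc (Fin.ext h)]; ring
    obtain ⟨q1, q2⟩ := P.step_eq_of_excess hk hpos hzr hex
    rw [heq e he, heq e' he']
    simp only [node, hpos, hzr, q1, q2]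

/-- A step climbs at most `gap * s ^ 2`, which the delay dominates. This bounds the number of
interior vertices of a step independently of the line. -/
theorem turns_succ_le {ℓ : Line} (hℓ : ℓ.HopValid P) {k : ℕ} (hk : k < P.N) :
    P.turns ℓ (k + 1) ≤ P.turns ℓ k + P.delay k := by
  have hQ := P.Q_pos'
  have h1 : ∑ i, (P.clk (k + 1) i - P.clk k i) * ℓ.D i ^ 2 ≤ 4 * P.gap k * P.s ^ 2 := by
    have hg := P.gap_nonneg hk
    calc _ ≤ ∑ i, (P.clk (k + 1) i - P.clk k i) * (P.s : ℚ) ^ 2 :=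
          Finset.sum_le_sum fun i _ => mul_le_mul_of_nonneg_left
            (sq_le_sq' (abs_le.1 (hℓ.abs_D_le i)).1 (abs_le.1 (hℓ.abs_D_le i)).2)
            (sub_nonneg.2 (P.clk_le_succ hk i))
      _ = P.gap k * (P.s : ℚ) ^ 2 := by rw [← Finset.sum_mul, gap]
      _ ≤ _ := by
        have : 0 ≤ P.gap k * (P.s : ℚ) ^ 2 := by positivity
        linarith
  have h2 := Nat.le_ceil (4 * P.gap k * (P.s : ℚ) ^ 2 / P.Q)
  have h3 : ((⌈4 * P.gap k * (P.s : ℚ) ^ 2 / P.Q⌉₊ : ℕ) : ℚ) + 1 = P.delay k := by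
    simp [delay]
  have h4 : (∑ i, (P.clk (k + 1) i - P.clk k i) * ℓ.D i ^ 2) / P.Q ≤
      4 * P.gap k * P.s ^ 2 / P.Q := by gcongr
  have h5 : ℓ.z P.toPar (k + 1) / P.Q ≤ ℓ.z P.toPar k / P.Q + P.delay k := by
    rw [z_succ, add_div]
    linarith
  have h6 : ⌊ℓ.z P.toPar k / P.Q + (P.delay k : ℕ)⌋ = P.turns ℓ k + P.delay k :=
    Int.floor_add_natCast _ _
  rw [← h6]
  exact Int.floor_le_floor h5

theorem len_le {ℓ : Line} (hℓ : ℓ.HopValid P) {k : ℕ} (hk : k < P.N) :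
    P.len ℓ k ≤ 2 * P.delay k := by
  have := P.turns_succ_le hℓ hk
  unfold len
  omega

theorem turns_le {ℓ : Line} (hℓ : ℓ.HopValid P) {k : ℕ} (hk : k ≤ P.N) :
    P.turns ℓ k ≤ P.cum k := by
  induction k with
  | zero => rw [P.turns_zero hℓ]; positivity
  | succ k ih =>
    have h1 := ih (by omega)
    have h2 := P.turns_succ_le hℓ hk
    rw [cum_succ]
    push_cast
    omega

theorem cum_mono {k k' : ℕ} (h : k ≤ k') : P.cum k ≤ P.cum k' :=
  Finset.sum_le_sum_of_subset (Finset.range_subset_range.2 h)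

theorem delay_le_cum {k : ℕ} (hk : k < P.N) : P.delay k ≤ P.cum P.N := by
  have := P.cum_mono (k := k + 1) hk
  rw [cum_succ] at this
  omega

/-- The increments of each of the three clocks telescope to `1`, so the delays add up to `12 * s ^ 2
/ Q` apart from rounding, at most three per level including the extra edge. -/
theorem cum_N_le : P.cum P.N ≤ 3 * P.N + (12 * P.s ^ 2 / P.Q + 1) := by
  have hQ := P.Q_pos'
  have h1 : ∀ k ∈ Finset.range P.N, ((P.delay k : ℚ) + 1) ≤ 4 * P.gap k * P.s ^ 2 / P.Q + 3 := by
    intro k hk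
    have hg := P.gap_nonneg (Finset.mem_range.1 hk)
    have h2 := Nat.ceil_lt_add_one (a := 4 * P.gap k * (P.s : ℚ) ^ 2 / P.Q) (by positivity)
    have h3 : ((⌈4 * P.gap k * (P.s : ℚ) ^ 2 / P.Q⌉₊ : ℕ) : ℚ) + 1 = P.delay k := by
      simp [delay]
    linarith
  have h2 : ∑ k ∈ Finset.range P.N, P.gap k = 3 := by
    simp only [gap]
    rw [Finset.sum_comm]
    rw [Fin.sum_univ_three, Finset.sum_range_sub (fun k => P.clk k 0),
      Finset.sum_range_sub (fun k => P.clk k 1), Finset.sum_range_sub (fun k => P.clk k 2)]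
    simp only [P.clk_N, P.clk_zero]
    norm_num
  have h3 : (P.cum P.N : ℚ) ≤ 12 * P.s ^ 2 / P.Q + 3 * P.N := by
    have h4 := Finset.sum_le_sum h1
    rw [Finset.sum_add_distrib (f := fun k => 4 * P.gap k * (P.s : ℚ) ^ 2 / P.Q),
      ← Finset.sum_div, ← Finset.sum_mul, ← Finset.mul_sum, h2,
      Finset.sum_const, Finset.card_range, nsmul_eq_mul] at h4
    unfold cum
    push_cast
    have e : 4 * 3 * (P.s : ℚ) ^ 2 / P.Q = 12 * P.s ^ 2 / P.Q := by norm_num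
    rw [e] at h4
    linarith
  have h4 : (12 : ℚ) * P.s ^ 2 / P.Q ≤ (12 * P.s ^ 2 / P.Q + 1 : ℕ) := by
    have h5 : 12 * P.s ^ 2 < (12 * P.s ^ 2 / P.Q + 1) * P.Q :=
      Nat.lt_mul_of_div_lt (Nat.lt_succ_self _) P.Q_pos
    rw [div_le_iff₀ hQ]
    exact_mod_cast h5.le
  have h5 : (P.cum P.N : ℚ) ≤ (3 * P.N + (12 * P.s ^ 2 / P.Q + 1) : ℕ) := by
    rw [Nat.cast_add]
    push_cast at h4 ⊢
    linarith
  exact_mod_cast h5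

/-- The vertex of the given kind that is attached to a vertex of a level. -/
def attach (f : (Fin 3 → ℚ) → ℚ → ℕ → HopVert) : HopVert × ℕ → HopVert
  | (.core _ x z, r) => f x z r
  | _ => .root

/-- The interior vertices of a step. -/
def interior : (HopVert × HopVert) × ℕ → HopVert
  | ((.core k x z, .core _ x' z'), r) => .mid k x z x' z' r
  | _ => .root

/-- The vertices of the construction that lie on some edge, apart from the filling. -/
noncomputable def hard : Finset HopVert :=
  (P.nodes 0 ×ˢ Finset.range P.W).image (attach .leafS) ∪
  (P.nodes P.N ×ˢ Finset.range P.W).image (attach .leafT) ∪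
  (Finset.range (P.N + 1)).biUnion P.nodes ∪
  ((Finset.range P.N).biUnion fun k =>
    (P.steps k ×ˢ Finset.range (2 * P.delay k)).image interior) ∪
  (P.nodes 0 ×ˢ Finset.range P.R).image (attach .spoke) ∪ {.root}

/-- A bound for the number of vertices without the filling. -/
def hardBound : ℕ := 2 * (P.s ^ 3 * P.Q * P.W) + (P.N + 1) * ((4 * P.B * P.s) ^ 3 * P.Q) +
  2 * P.cum P.N * (P.s ^ 2 * (4 * P.B * P.s) ^ 2 * P.Q) + P.s ^ 3 * P.Q * P.R + 1

theorem card_hard_le : P.hard.card ≤ P.hardBound := by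
  have h1 : ((P.nodes 0 ×ˢ Finset.range P.W).image (attach .leafS)).card ≤
      P.s ^ 3 * P.Q * P.W := by
    refine Finset.card_image_le.trans ?_
    rw [Finset.card_product, Finset.card_range]
    exact Nat.mul_le_mul_right _ P.card_nodes_zero_le
  have h2 : ((P.nodes P.N ×ˢ Finset.range P.W).image (attach .leafT)).card ≤
      P.s ^ 3 * P.Q * P.W := by
    refine Finset.card_image_le.trans ?_
    rw [Finset.card_product, Finset.card_range]
    exact Nat.mul_le_mul_right _ P.card_nodes_N_le
  have h3 : ((Finset.range (P.N + 1)).biUnion P.nodes).card ≤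
      (P.N + 1) * ((4 * P.B * P.s) ^ 3 * P.Q) := by
    refine (Finset.card_biUnion_le_card_mul _ _ _ fun k hk => P.card_nodes_le
      (Nat.lt_succ_iff.1 (Finset.mem_range.1 hk))).trans (le_of_eq ?_)
    rw [Finset.card_range]
  have h4 : ((Finset.range P.N).biUnion fun k =>
      (P.steps k ×ˢ Finset.range (2 * P.delay k)).image interior).card ≤
      2 * P.cum P.N * (P.s ^ 2 * (4 * P.B * P.s) ^ 2 * P.Q) := by
    refine Finset.card_biUnion_le.trans ?_
    have h5 : ∀ k ∈ Finset.range P.N,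
        ((P.steps k ×ˢ Finset.range (2 * P.delay k)).image interior).card ≤
        (P.delay k + 1) * (2 * (P.s ^ 2 * (4 * P.B * P.s) ^ 2 * P.Q)) := by
      intro k hk
      refine Finset.card_image_le.trans ?_
      rw [Finset.card_product, Finset.card_range]
      calc _ ≤ (P.s ^ 2 * (4 * P.B * P.s) ^ 2 * P.Q) * (2 * (P.delay k + 1)) := by
            gcongr
            · exact P.card_steps_le (Finset.mem_range.1 hk)
            · omega
        _ = _ := by ring
    refine (Finset.sum_le_sum h5).trans (le_of_eq ?_)
    rw [← Finset.sum_mul, ← cum]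
    ring
  have h6 : ((P.nodes 0 ×ˢ Finset.range P.R).image (attach .spoke)).card ≤
      P.s ^ 3 * P.Q * P.R := by
    refine Finset.card_image_le.trans ?_
    rw [Finset.card_product, Finset.card_range]
    exact Nat.mul_le_mul_right _ P.card_nodes_zero_le
  unfold hard
  refine (Finset.card_union_le _ _).trans ?_
  refine (Nat.add_le_add_right (Finset.card_union_le _ _) _).trans ?_
  have h7 := Finset.card_union_le
    ((P.nodes 0 ×ˢ Finset.range P.W).image (attach .leafS) ∪
      (P.nodes P.N ×ˢ Finset.range P.W).image (attach .leafT) ∪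
      (Finset.range (P.N + 1)).biUnion P.nodes)
    ((Finset.range P.N).biUnion fun k =>
      (P.steps k ×ˢ Finset.range (2 * P.delay k)).image interior)
  have h8 := Finset.card_union_le
    ((P.nodes 0 ×ˢ Finset.range P.W).image (attach .leafS) ∪
      (P.nodes P.N ×ˢ Finset.range P.W).image (attach .leafT))
    ((Finset.range (P.N + 1)).biUnion P.nodes)
  have h9 := Finset.card_union_le ((P.nodes 0 ×ˢ Finset.range P.W).image (attach .leafS))
    ((P.nodes P.N ×ˢ Finset.range P.W).image (attach .leafT))
  rw [Finset.card_singleton]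
  unfold hardBound
  omega

/-- The vertices without the filling. -/
inductive IsHard : HopVert → Prop
  | leafS (ℓ : Line) (r : ℕ) (hℓ : ℓ.HopValid P) (hr : r < P.W) :
      IsHard (.leafS (ℓ.pos P.toPar 0) (P.zr ℓ 0) r)
  | leafT (ℓ : Line) (r : ℕ) (hℓ : ℓ.HopValid P) (hr : r < P.W) :
      IsHard (.leafT (ℓ.pos P.toPar P.N) (P.zr ℓ P.N) r)
  | node (ℓ : Line) (k : ℕ) (hℓ : ℓ.HopValid P) (hk : k ≤ P.N) : IsHard (P.node ℓ k)
  | inner (ℓ : Line) (k r : ℕ) (hℓ : ℓ.HopValid P) (hk : k < P.N) (hr : r < P.len ℓ k) :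
      IsHard (P.inner ℓ k r)
  | spoke (ℓ : Line) (r : ℕ) (hℓ : ℓ.HopValid P) (hr : r < P.R) :
      IsHard (.spoke (ℓ.pos P.toPar 0) (P.zr ℓ 0) r)
  | root : IsHard .root

variable {P}

theorem node_mem_nodes {ℓ : Line} (hℓ : ℓ.HopValid P) (k : ℕ) : P.node ℓ k ∈ P.nodes k :=
  Finset.mem_image_of_mem _ (P.mem_lines.2 hℓ)

theorem IsHard.mem_hard {v : HopVert} (h : P.IsHard v) : v ∈ P.hard := by
  unfold hard
  simp only [Finset.mem_union, Finset.mem_image, Finset.mem_product, Finset.mem_biUnion,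
    Finset.mem_range, Finset.mem_singleton, Prod.exists]
  cases h with
  | leafS ℓ r hℓ hr =>
    exact Or.inl (Or.inl (Or.inl (Or.inl (Or.inl ⟨_, r, ⟨node_mem_nodes hℓ 0, hr⟩, rfl⟩))))
  | leafT ℓ r hℓ hr =>
    exact Or.inl (Or.inl (Or.inl (Or.inl (Or.inr ⟨_, r, ⟨node_mem_nodes hℓ P.N, hr⟩, rfl⟩))))
  | node ℓ k hℓ hk =>
    exact Or.inl (Or.inl (Or.inl (Or.inr ⟨k, by omega, node_mem_nodes hℓ k⟩)))
  | inner ℓ k r hℓ hk hr =>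
    have := P.len_le hℓ hk
    exact Or.inl (Or.inl (Or.inr ⟨k, hk, _, _, r,
      ⟨Finset.mem_image_of_mem _ (P.mem_lines.2 hℓ), by omega⟩, rfl⟩))
  | spoke ℓ r hℓ hr =>
    exact Or.inl (Or.inr ⟨_, r, ⟨node_mem_nodes hℓ 0, hr⟩, rfl⟩)
  | root => exact Or.inr rfl

theorem extra_notMem_hard (r : ℕ) : HopVert.extra r ∉ P.hard := by
  have hn : ∀ k, ∀ v ∈ P.nodes k, ∃ ℓ, v = P.node ℓ k := fun k v hv => by
    obtain ⟨ℓ, -, rfl⟩ := Finset.mem_image.1 hv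
    exact ⟨ℓ, rfl⟩
  unfold hard
  simp only [Finset.mem_union, Finset.mem_image, Finset.mem_product, Finset.mem_biUnion,
    Finset.mem_range, Finset.mem_singleton, Prod.exists]
  rintro (((((⟨v, r', ⟨hv, -⟩, h⟩ | ⟨v, r', ⟨hv, -⟩, h⟩) | ⟨k, -, hv⟩) |
    ⟨k, -, v, w, r', ⟨hv, -⟩, h⟩) | ⟨v, r', ⟨hv, -⟩, h⟩) | h)
  · obtain ⟨ℓ, rfl⟩ := hn _ _ hv
    simp [attach, node] at h
  · obtain ⟨ℓ, rfl⟩ := hn _ _ hv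
    simp [attach, node] at h
  · obtain ⟨ℓ, hℓ⟩ := hn _ _ hv
    simp [node] at hℓ
  · obtain ⟨ℓ, -, hℓ⟩ := Finset.mem_image.1 hv
    simp only [Prod.mk.injEq] at hℓ
    obtain ⟨rfl, rfl⟩ := hℓ
    simp [interior, node] at h
  · obtain ⟨ℓ, rfl⟩ := hn _ _ hv
    simp [attach, node] at h
  · simp at h

theorem Arc.isHard {u v : HopVert} (h : P.Arc u v) : (P.IsHard u ∧ P.IsHard v) ∨
    ∃ r r', u = .extra r ∧ v = .extra r' ∧ r < P.F ∧ r' < P.F := by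
  have hR := P.R_pos
  cases h with
  | extra r r' h h' => exact Or.inr ⟨r, r', rfl, rfl, h.trans h', h'⟩
  | _ =>
    left
    subst_vars
    constructor <;> constructor <;> (try assumption) <;> (try omega)
    all_goals first | exact Nat.sub_lt (P.len_pos _ _) one_pos | exact P.len_pos _ _

end HopPar

end CertifiedShortcuts

namespace CertifiedShortcuts

theorem WalkOf.symm_of_graph {V : Type*} {G : SimpleGraph V} {k : ℕ} {u v : V}
    (h : WalkOf G.Adj k u v) : WalkOf G.Adj k v u := by
  obtain ⟨p, rfl⟩ := h.exists_walk
  rw [← p.length_reverse]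
  exact walkOf_length _

/-- The restriction of a system of lines to a set that contains all edges. -/
noncomputable def HopSystem.comap {V V' Λ : Type*} {G : SimpleGraph V} {N W : ℕ}
    (D : HopSystem G Λ N W) (e : V' → V) (he : Function.Injective e)
    (hr : ∀ u v, G.Adj u v → u ∈ Set.range e ∧ v ∈ Set.range e) (src tgt : Λ → V')
    (hsrc : ∀ ℓ, e (src ℓ) = D.src ℓ) (htgt : ∀ ℓ, e (tgt ℓ) = D.tgt ℓ) :
    HopSystem (G.comap e) Λ N W where
  mem ℓ v := D.mem ℓ (e v)
  lev v := D.lev (e v)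
  pot ℓ v := D.pot ℓ (e v)
  pot_le ℓ _ _ h := D.pot_le ℓ _ _ h
  tight ℓ _ _ hu h ht := D.tight ℓ _ _ hu h ht
  ident ℓ ℓ' _ _ h1 h2 h3 h4 h := D.ident ℓ ℓ' _ _ h1 h2 h3 h4 h
  src := src
  tgt := tgt
  mem_src ℓ := by rw [hsrc]; exact D.mem_src ℓ
  lev_src ℓ := by rw [hsrc]; exact D.lev_src ℓ
  lev_tgt ℓ := by rw [htgt]; exact D.lev_tgt ℓ
  walk ℓ := by
    obtain ⟨k, h1, h2⟩ := D.walk ℓ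
    rw [← hsrc, ← htgt] at h1 h2
    exact ⟨k, (walkOf_comap he hr).2 h1, h2⟩
  leavesS ℓ := (D.leavesS ℓ).preimage e he.injOn
  leavesT ℓ := (D.leavesT ℓ).preimage e he.injOn
  card_leavesS ℓ := by
    classical
    refine (D.card_leavesS ℓ).trans (le_of_eq ?_)
    rw [Finset.card_preimage, Finset.filter_true_of_mem]
    exact fun v hv => (hr _ _ (D.mem_leavesS ℓ v hv).2.2.1).1
  card_leavesT ℓ := by
    classical
    refine (D.card_leavesT ℓ).trans (le_of_eq ?_)
    rw [Finset.card_preimage, Finset.filter_true_of_mem]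
    exact fun v hv => (hr _ _ (D.mem_leavesT ℓ v hv).2.1).2
  mem_leavesS ℓ v hv := by
    have := D.mem_leavesS ℓ _ (Finset.mem_preimage.1 hv)
    rwa [← hsrc] at this
  mem_leavesT ℓ v hv := by
    have := D.mem_leavesT ℓ _ (Finset.mem_preimage.1 hv)
    rwa [← htgt] at this

namespace HopPar

variable (P : HopPar)

/-! ### Distances -/

/-- A bound for the distance of a vertex from the root. -/
def radius : ℕ := P.R + 2 + 4 * P.cum P.N

variable {P}

theorem walkOf_spoke {ℓ : Line} (hℓ : ℓ.HopValid P) (d : ℕ) : ∀ r, r + d + 1 = P.R →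
    WalkOf P.graph.Adj (d + 1) (.spoke (ℓ.pos P.toPar 0) (P.zr ℓ 0) r) .root := by
  induction d with
  | zero =>
    intro r hr
    have hr' : r = P.R - 1 := by omega
    subst hr'
    exact .single (Arc.root ℓ hℓ _ _ rfl rfl).adj
  | succ d ih =>
    intro r hr
    exact .cons (Arc.spoke ℓ r hℓ (by omega) _ _ rfl rfl).adj (ih (r + 1) (by omega))

/-- Back along the line to its source, which takes at most `2 * cum N` edges because the turns are
bounded by the delays, and then along the spoke. -/
theorem walkOf_node_root {ℓ : Line} (hℓ : ℓ.HopValid P) {k : ℕ} (hk : k ≤ P.N) :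
    ∃ d ≤ P.R + 1 + 2 * P.cum P.N, WalkOf P.graph.Adj d (P.node ℓ k) .root := by
  have hR := P.R_pos
  have h1 := walkOf_spoke hℓ (P.R - 1) 0 (by omega)
  have h2 := (walkOf_node hℓ hk).symm_of_graph.append
    (.cons (Arc.fork ℓ hℓ _ _ rfl rfl).adj h1)
  refine ⟨_, ?_, h2⟩
  have h3 := P.turns_le hℓ hk
  have h4 := P.cum_mono hk
  omega

theorem IsHard.exists_walk {v : HopVert} (h : P.IsHard v) :
    ∃ d ≤ P.radius, WalkOf P.graph.Adj d v .root := by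
  unfold radius
  cases h with
  | leafS ℓ r hℓ hr =>
    obtain ⟨d, hd, h⟩ := walkOf_node_root hℓ (Nat.zero_le _)
    exact ⟨_, by omega, .cons (Arc.leafS ℓ r hℓ hr _ _ rfl rfl).adj h⟩
  | leafT ℓ r hℓ hr =>
    obtain ⟨d, hd, h⟩ := walkOf_node_root hℓ le_rfl
    exact ⟨_, by omega, .cons (Arc.leafT ℓ r hℓ hr _ _ rfl rfl).adj.symm h⟩
  | node ℓ k hℓ hk =>
    obtain ⟨d, hd, h⟩ := walkOf_node_root hℓ hk
    exact ⟨d, by omega, h⟩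
  | inner ℓ k r hℓ hk hr =>
    obtain ⟨d, hd, h⟩ := walkOf_node_root hℓ (k := k + 1) hk
    have h1 := P.len_le hℓ hk
    have h2 := P.delay_le_cum hk
    exact ⟨_, by omega, (walkOf_inner hℓ hk hr).append h⟩
  | spoke ℓ r hℓ hr =>
    exact ⟨_, by omega, walkOf_spoke hℓ (P.R - 1 - r) r (by omega)⟩
  | root => exact ⟨0, Nat.zero_le _, .nil _⟩

theorem isHard_of_adj {u v : HopVert} (h : P.graph.Adj u v) : (P.IsHard u ∧ P.IsHard v) ∨
    ∃ r r', u = .extra r ∧ v = .extra r' ∧ r < P.F ∧ r' < P.F := by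
  rcases graph_adj.1 h with h | h
  · exact h.isHard
  · rcases h.isHard with h | ⟨r, r', rfl, rfl, h, h'⟩
    · exact Or.inl h.symm
    · exact Or.inr ⟨r', r, rfl, rfl, h', h⟩

theorem not_isHard_extra (r : ℕ) : ¬ P.IsHard (.extra r) :=
  fun h => extra_notMem_hard r h.mem_hard

/-- The filling is a complete graph without edges to the rest. -/
theorem WalkOf.eq_or_isHard_or_adj {k : ℕ} {u v : HopVert} (h : WalkOf P.graph.Adj k u v) :
    u = v ∨ (P.IsHard u ∧ P.IsHard v) ∨ P.graph.Adj u v := by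
  induction h with
  | nil => exact Or.inl rfl
  | @cons k u w v h _ ih =>
    rcases ih with rfl | ih | ih
    · exact Or.inr (Or.inr h)
    · rcases isHard_of_adj h with h | ⟨r, r', -, rfl, -⟩
      · exact Or.inr (Or.inl ⟨h.1, ih.2⟩)
      · exact absurd ih.1 (not_isHard_extra r')
    · rcases isHard_of_adj h with h | ⟨r, r', rfl, rfl, hr, -⟩
      · rcases isHard_of_adj ih with ih | ⟨r, r', rfl, -⟩
        · exact Or.inr (Or.inl ⟨h.1, ih.2⟩)
        · exact absurd h.2 (not_isHard_extra r)
      · rcases isHard_of_adj ih with ih | ⟨r₁, r₂, -, rfl, -, hr₂⟩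
        · exact absurd ih.1 (not_isHard_extra r')
        · rcases lt_trichotomy r r₂ with h | rfl | h
          · exact Or.inr (Or.inr (Arc.extra _ _ h hr₂).adj)
          · exact Or.inl rfl
          · exact Or.inr (Or.inr (Arc.extra _ _ h hr).adj.symm)

theorem exists_walkOf_le {k : ℕ} {u v : HopVert} (h : WalkOf P.graph.Adj k u v) :
    ∃ d ≤ 2 * P.radius, WalkOf P.graph.Adj d u v := by
  rcases WalkOf.eq_or_isHard_or_adj h with rfl | ⟨hu, hv⟩ | h
  · exact ⟨0, Nat.zero_le _, .nil _⟩
  · obtain ⟨d, hd, h⟩ := hu.exists_walk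
    obtain ⟨d', hd', h'⟩ := hv.exists_walk
    exact ⟨_, by omega, h.append h'.symm_of_graph⟩
  · exact ⟨1, by unfold radius; omega, .single h⟩

/-! ### Counting the edges -/

variable (P)

/-- The other endpoint of the first edge assigned to a vertex. -/
def next : HopVert → HopVert
  | .leafS x z _ => .core 0 x z
  | .leafT x z _ => .core P.N x z
  | .mid k _ _ x' z' 0 => .core (k + 1) x' z'
  | .mid k x z x' z' (r + 1) => .mid k x z x' z' r
  | .spoke x z 0 => .core 0 x z
  | .spoke x z (r + 1) => .spoke x z r
  | _ => .root

/-- The other endpoint of the second edge assigned to a vertex. -/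
def next' : HopVert → HopVert
  | .mid k x z _ _ _ => .core k x z
  | _ => .root

variable {P}

/-- Every edge outside the filling is assigned to one of its ends, and every vertex receives at most
two edges, so their number is linear in the number of vertices. -/
theorem Arc.eq_next {u v : HopVert} (h : P.Arc u v) :
    (∃ w ∈ P.hard, s(u, v) = s(w, P.next w) ∨ s(u, v) = s(w, next' w)) ∨
      ∃ r < P.F, ∃ r' < P.F, s(u, v) = s(.extra r, .extra r') := by
  rcases h.isHard with ⟨hu, hv⟩ | ⟨r, r', rfl, rfl, hr, hr'⟩
  swap
  · exact Or.inr ⟨r, hr, r', hr', rfl⟩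
  left
  cases h with
  | leafS ℓ r hℓ hr _ _ hu' hv' => exact ⟨u, hu.mem_hard, Or.inl (by subst hu' hv'; rfl)⟩
  | leafT ℓ r hℓ hr _ _ hu' hv' =>
    exact ⟨v, hv.mem_hard, Or.inl (by subst hu' hv'; exact Sym2.eq_swap)⟩
  | enter ℓ k hℓ hk _ _ hu' hv' =>
    exact ⟨v, hv.mem_hard, Or.inr (by subst hu' hv'; exact Sym2.eq_swap)⟩
  | along ℓ k r hℓ hk hr _ _ hu' hv' => exact ⟨u, hu.mem_hard, Or.inl (by subst hu' hv'; rfl)⟩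
  | exit ℓ k hℓ hk _ _ hu' hv' => exact ⟨u, hu.mem_hard, Or.inl (by subst hu' hv'; rfl)⟩
  | fork ℓ hℓ _ _ hu' hv' =>
    exact ⟨v, hv.mem_hard, Or.inl (by subst hu' hv'; exact Sym2.eq_swap)⟩
  | spoke ℓ r hℓ hr _ _ hu' hv' =>
    exact ⟨v, hv.mem_hard, Or.inl (by subst hu' hv'; exact Sym2.eq_swap)⟩
  | root ℓ hℓ _ _ hu' hv' => exact ⟨u, hu.mem_hard, Or.inr (by subst hu' hv'; rfl)⟩
  | extra r => exact absurd hu (not_isHard_extra r)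

variable (P)

/-- A set of pairs that contains all edges. -/
noncomputable def edges : Finset (Sym2 HopVert) :=
  (P.hard.image fun w => s(w, P.next w)) ∪ (P.hard.image fun w => s(w, next' w)) ∪
    (Finset.range P.F ×ˢ Finset.range P.F).image fun p => s(.extra p.1, .extra p.2)

theorem card_edges_le : P.edges.card ≤ 2 * P.hardBound + P.F ^ 2 := by
  have h1 : (P.hard.image fun w => s(w, P.next w)).card ≤ P.hardBound :=
    Finset.card_image_le.trans P.card_hard_le
  have h2 : (P.hard.image fun w => s(w, next' w)).card ≤ P.hardBound :=
    Finset.card_image_le.trans P.card_hard_le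
  have h3 : ((Finset.range P.F ×ˢ Finset.range P.F).image fun p =>
      s(HopVert.extra p.1, HopVert.extra p.2)).card ≤ P.F ^ 2 := by
    refine Finset.card_image_le.trans (le_of_eq ?_)
    rw [Finset.card_product, Finset.card_range, sq]
  refine (Finset.card_union_le _ _).trans ?_
  have h4 := Finset.card_union_le (P.hard.image fun w => s(w, P.next w))
    (P.hard.image fun w => s(w, next' w))
  omega

variable {P}

theorem mem_edges {u v : HopVert} (h : P.graph.Adj u v) : s(u, v) ∈ P.edges := by
  have key : ∀ {u v : HopVert}, P.Arc u v → s(u, v) ∈ P.edges := by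
    intro u v h
    rcases h.eq_next with ⟨w, hw, h | h⟩ | ⟨r, hr, r', hr', h⟩ <;> rw [h]
    · exact Finset.mem_union_left _ (Finset.mem_union_left _
        (Finset.mem_image_of_mem (fun w => s(w, P.next w)) hw))
    · exact Finset.mem_union_left _ (Finset.mem_union_right _
        (Finset.mem_image_of_mem (fun w => s(w, next' w)) hw))
    · exact Finset.mem_union_right _ (Finset.mem_image.2 ⟨(r, r'), Finset.mem_product.2
        ⟨Finset.mem_range.2 hr, Finset.mem_range.2 hr'⟩, rfl⟩)
  rcases graph_adj.1 h with h | h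
  · exact key h
  · rw [Sym2.eq_swap]; exact key h

/-! ### The graph on a given number of vertices -/

variable (P)

/-- The vertices of the construction with a filling that makes their number equal to `n`. -/
noncomputable def verts (n : ℕ) : Finset HopVert :=
  P.hard ∪ (Finset.range (n - P.hard.card)).image HopVert.extra

theorem card_verts {n : ℕ} (hn : P.hard.card ≤ n) : (P.verts n).card = n := by
  rw [verts, Finset.card_union_of_disjoint, Finset.card_image_of_injective, Finset.card_range]
  · omega
  · intro r r' h; simpa using h
  · refine Finset.disjoint_left.2 fun v hv hv' => ?_
    obtain ⟨r, _, rfl⟩ := Finset.mem_image.1 hv'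
    exact extra_notMem_hard r hv

theorem mem_verts_of_adj {n : ℕ} (hn : P.hard.card + P.F ≤ n) {u v : HopVert}
    (h : P.graph.Adj u v) : u ∈ P.verts n ∧ v ∈ P.verts n := by
  rcases isHard_of_adj h with h | ⟨r, r', rfl, rfl, h1, h2⟩
  · exact ⟨Finset.mem_union_left _ h.1.mem_hard, Finset.mem_union_left _ h.2.mem_hard⟩
  · constructor <;> refine Finset.mem_union_right _ (Finset.mem_image_of_mem _
      (Finset.mem_range.2 ?_)) <;> omega

/-- The construction for undirected graphs on exactly `n` vertices. -/
theorem exists_graph (n : ℕ) (hn : P.hardBound + P.F ≤ n) : ∃ G : SimpleGraph (Fin n),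
    (P.F - 1) ^ 2 ≤ 2 * G.edgeSet.ncard ∧ G.edgeSet.ncard ≤ 2 * n + P.F ^ 2 ∧
    ∀ (k a : ℕ) (H : Finset (Sym2 (Fin n) × ℝ)), n ^ 2 * (2 * P.radius) < k * (P.W * P.W * a) →
      GreedyHopset G k H → P.s ^ 6 * P.Q * P.N ≤
        3 * hopsetCertComplexity G H + P.s ^ 6 * P.Q * (2 * (a + 3)) := by
  have hn' : P.hard.card + P.F ≤ n := (Nat.add_le_add_right P.card_hard_le _).trans hn
  have hcard := P.card_verts (n := n) (by omega)
  let E := (P.verts n).equivFinOfCardEq hcard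
  let e : Fin n → HopVert := fun x => (E.symm x).1
  have he : Function.Injective e := Subtype.val_injective.comp E.symm.injective
  have hrange : ∀ v, v ∈ P.verts n → ∃ x, e x = v := fun v hv => ⟨E ⟨v, hv⟩, by simp [e]⟩
  have hr : ∀ u v, P.graph.Adj u v → u ∈ Set.range e ∧ v ∈ Set.range e := fun u v h =>
    ⟨hrange u (P.mem_verts_of_adj hn' h).1, hrange v (P.mem_verts_of_adj hn' h).2⟩
  choose src hsrc using fun ℓ : {ℓ : Line // ℓ.HopValid P} => hrange (P.node ℓ 0)
    (Finset.mem_union_left _ (IsHard.node ℓ.1 0 ℓ.2 (Nat.zero_le _)).mem_hard)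
  choose tgt htgt using fun ℓ : {ℓ : Line // ℓ.HopValid P} => hrange (P.node ℓ P.N)
    (Finset.mem_union_left _ (IsHard.node ℓ.1 P.N ℓ.2 le_rfl).mem_hard)
  let D : HopSystem (P.graph.comap e) {ℓ : Line // ℓ.HopValid P} P.N P.W :=
    P.hopSystem.comap e he hr src tgt hsrc htgt
  have hinj : Function.Injective (Sym2.map e) := Sym2.map.injective he
  refine ⟨P.graph.comap e, ?_, ?_, fun k a H hk hH => ?_⟩
  · choose ex hex using fun r : Fin P.F => hrange (.extra r) (Finset.mem_union_right _
      (Finset.mem_image_of_mem _ (Finset.mem_range.2 (by have := r.2; omega))))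
    have h1 : ((Finset.univ : Finset (Fin P.F × Fin P.F)).filter fun p => p.1 < p.2).card ≤
        (P.graph.comap e).edgeSet.ncard := by
      rw [← Set.ncard_coe_finset]
      refine Set.ncard_le_ncard_of_injOn (fun p => s(ex p.1, ex p.2)) ?_ ?_ (Set.toFinite _)
      · intro p hp
        have hp' : p.1 < p.2 := by simpa using hp
        change P.graph.Adj (e (ex p.1)) (e (ex p.2))
        rw [hex, hex]
        exact (Arc.extra _ _ hp' p.2.2).adj
      · intro p hp p' hp' h
        have hp : p.1 < p.2 := by simpa using hp
        have hp' : p'.1 < p'.2 := by simpa using hp'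
        have h2 := congrArg (Sym2.map e) h
        simp only [Sym2.map_mk, hex, Sym2.eq_iff, HopVert.extra.injEq] at h2
        rcases h2 with h2 | h2
        · exact Prod.ext (Fin.ext h2.1) (Fin.ext h2.2)
        · rw [Fin.lt_def] at hp hp'
          omega
    exact (sq_le_card_pairs_lt P.F).trans (Nat.mul_le_mul_left 2 h1)
  · refine le_trans ?_ (P.card_edges_le.trans (by omega))
    rw [← Set.ncard_coe_finset]
    refine Set.ncard_le_ncard_of_injOn (Sym2.map e) ?_ hinj.injOn (Finset.finite_toSet _)
    intro p hp
    induction p using Sym2.ind with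
    | _ x y => exact mem_edges hp
  · have hdist : ∀ x y, hopDist (P.graph.comap e) ∅ x y ≤ 2 * P.radius := by
      intro x y
      by_cases h : (P.graph.comap e).Reachable x y
      · obtain ⟨d, hd, h'⟩ := exists_walkOf_le ((walkOf_comap he hr).1 (walkOf_dist h))
        have h2 : WalkOf (P.graph.comap e).Adj d x y := (walkOf_comap he hr).2 h'
        exact (hopDist_le_dist ∅ h).trans (h2.dist_le.trans hd)
      · have h0 : IsHopset (P.graph.comap e) ∅ :=
          isHopset_of_subset_exactEdges (by simp)
        rw [hopDist_eq_zero h0 h]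
        exact Nat.zero_le _
    have hpot : hopPotential (P.graph.comap e) ∅ ≤ n ^ 2 * (2 * P.radius) := by
      refine (Finset.sum_le_sum fun x _ => Finset.sum_le_sum fun y _ => hdist x y).trans
        (le_of_eq ?_)
      simp only [Finset.sum_const, Finset.card_univ, Fintype.card_fin, smul_eq_mul]
      ring
    have hN : 2 ≤ P.N := by unfold Par.N; omega
    have := D.le_hopsetCertComplexity_greedyHopset (a := a) hN (hpot.trans_lt hk) hH
    rwa [P.card_hopLines] at this

end HopPar

end CertifiedShortcuts

/-! ### The choice of the parameters for undirected graphs -/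

namespace CertifiedShortcuts

namespace HopPar

/-- The construction for undirected graphs, with sizes given by powers of a single parameter. -/
theorem exists_graph_of_pow {X F n : ℕ} (hX : 32 ≤ X) (hn : 10000 * X ^ 22 ≤ n)
    (hF : 4 * F ≤ n) : ∃ G : SimpleGraph (Fin n),
    (F - 1) ^ 2 ≤ 2 * G.edgeSet.ncard ∧ G.edgeSet.ncard ≤ 2 * n + F ^ 2 ∧
    ∀ (k : ℕ) (H : Finset (Sym2 (Fin n) × ℝ)), 2 ^ 26 * X ^ 22 < k → GreedyHopset G k H →
      X ^ 24 ≤ 48 * hopsetCertComplexity G H := by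
  have hX0 : 0 < X := by omega
  have hp2 : 32 ^ 2 ≤ X ^ 2 := by gcongr
  have hp4 : 32 ^ 4 ≤ X ^ 4 := by gcongr
  obtain ⟨L, f, h0, h1, h2, h3, h4, h5, h6⟩ := exists_layers (X ^ 2) (by omega)
  rw [show (X ^ 2) ^ 2 = X ^ 4 by ring] at h5 h6
  -- There are `X ^ 20` lines with of order `X ^ 4` levels. The interior vertices of the steps
  -- dominate, with order `X ^ 22`, and the diameter apart from the filling is of order `X ^ 4`. The
  -- values of `J`, `N₁`, `N₂` and `Y` belong to the directed construction and are merely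
  -- admissible.
  let P : HopPar :=
    { B := X ^ 2, s := X ^ 3, J := 12, N₁ := 1, N₂ := 1, W := n / (16 * X ^ 11), Y := 0, F := F,
      L := L, f := f, f_zero := h0, f_last := h1, f_lt := h2, f_mid := h3, f_den := h4,
      s_pos := by positivity, J_ge := le_rfl, N₁_pos := one_pos, N₂_pos := one_pos, Q := X ^ 2,
      Q_pos := by positivity,
      Q_le := by rw [← pow_mul]; exact Nat.pow_le_pow_right hX0 (by norm_num) }
  have hPN : P.N = 3 * (L + 1) := rfl
  have hN : P.N ≤ 4 * X ^ 4 := by omega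
  have hN' : 3 * X ^ 4 ≤ 8 * P.N := by omega
  have hq : ∀ c, c * (X ^ 3) ^ 2 / X ^ 2 = c * X ^ 4 := fun c =>
    Nat.div_eq_of_eq_mul_left (by positivity) (by ring)
  have hR : P.R ≤ 7 * X ^ 4 := by
    have : P.R = 6 * (X ^ 3) ^ 2 / X ^ 2 + 2 := rfl
    rw [this, hq]
    omega
  have hcum : P.cum P.N ≤ 25 * X ^ 4 := by
    have h : P.cum P.N ≤ 3 * P.N + (12 * (X ^ 3) ^ 2 / X ^ 2 + 1) := P.cum_N_le
    rw [hq] at h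
    omega
  have hrad : 2 * P.radius ≤ 2 ^ 8 * X ^ 4 := by unfold radius; omega
  have hXn : ∀ i ≤ 22, X ^ i ≤ X ^ 22 := fun i hi => Nat.pow_le_pow_right hX0 hi
  have hW : P.W = n / (16 * X ^ 11) := rfl
  have pos1 : 0 < X ^ 11 := by positivity
  have hWle : X ^ 11 * P.W * 16 ≤ n := by
    rw [hW]; calc _ = n / (16 * X ^ 11) * (16 * X ^ 11) := by ring
      _ ≤ n := Nat.div_mul_le_self _ _
  have hW1 : 1 ≤ P.W := by
    have := hXn 11 (by norm_num)
    rw [hW, Nat.one_le_div_iff (by omega)]; omega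
  have hWge : n ≤ 2 ^ 5 * (X ^ 11 * P.W) := by
    have : n < (P.W + 1) * (16 * X ^ 11) := by
      rw [hW]; exact Nat.lt_mul_of_div_lt (Nat.lt_succ_self _) (by omega)
    have : (P.W + 1) * (16 * X ^ 11) ≤ (P.W + P.W) * (16 * X ^ 11) := by gcongr
    have e : (P.W + P.W) * (16 * X ^ 11) = 2 ^ 5 * (X ^ 11 * P.W) := by ring
    omega
  have hhard : P.hardBound + P.F ≤ n := by
    have a1 : P.s ^ 3 * P.Q * P.W = X ^ 11 * P.W := by
      change (X ^ 3) ^ 3 * X ^ 2 * P.W = _; ring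
    have a2 : (P.N + 1) * ((4 * P.B * P.s) ^ 3 * P.Q) ≤ 320 * X ^ 22 := by
      calc _ ≤ (5 * X ^ 4) * ((4 * X ^ 2 * X ^ 3) ^ 3 * X ^ 2) :=
            Nat.mul_le_mul_right _ (by omega)
        _ = 320 * X ^ 21 := by ring
        _ ≤ _ := Nat.mul_le_mul_left _ (hXn 21 (by norm_num))
    have a3 : 2 * P.cum P.N * (P.s ^ 2 * (4 * P.B * P.s) ^ 2 * P.Q) ≤ 800 * X ^ 22 := by
      calc _ ≤ 2 * (25 * X ^ 4) * ((X ^ 3) ^ 2 * (4 * X ^ 2 * X ^ 3) ^ 2 * X ^ 2) :=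
            Nat.mul_le_mul_right _ (by omega)
        _ = 800 * X ^ 22 := by ring
    have a4 : P.s ^ 3 * P.Q * P.R ≤ 7 * X ^ 22 := by
      calc _ ≤ (X ^ 3) ^ 3 * X ^ 2 * (7 * X ^ 4) := Nat.mul_le_mul_left _ hR
        _ = 7 * X ^ 15 := by ring
        _ ≤ _ := Nat.mul_le_mul_left _ (hXn 15 (by norm_num))
    have a5 : 1 ≤ X ^ 22 := Nat.one_le_pow _ _ hX0
    have a6 : P.F = F := rfl
    unfold hardBound
    rw [a1, a6]
    omega
  obtain ⟨G, hE, hE', hG⟩ := P.exists_graph n hhard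
  refine ⟨G, hE, hE', fun k H hk hH => ?_⟩
  have ha : X ^ 4 ≤ 2 ^ 6 * (X ^ 4 / 32) := by omega
  have hs : P.s ^ 6 * P.Q = X ^ 20 := by change (X ^ 3) ^ 6 * X ^ 2 = _; ring
  have := hG k (X ^ 4 / 32) H ?_ hH
  · rw [hs] at this
    have b1 : X ^ 20 * (2 * (X ^ 4 / 32 + 3)) + X ^ 20 * (X ^ 4 / 8) ≤ X ^ 20 * P.N := by
      rw [← Nat.mul_add]
      exact Nat.mul_le_mul_left _ (by omega)
    have b2 : X ^ 24 ≤ 16 * (X ^ 20 * (X ^ 4 / 8)) := by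
      calc X ^ 24 = X ^ 20 * X ^ 4 := by ring
        _ ≤ X ^ 20 * (16 * (X ^ 4 / 8)) := Nat.mul_le_mul_left _ (by omega)
        _ = _ := by ring
    omega
  -- The potential is at most `n ^ 2` times the diameter and the gain is of order `n ^ 2 / X ^ 22`
  -- times `X ^ 4`. The diameter cancels, so no slices are needed.
  · have h0 : 0 < X ^ 22 := by positivity
    have hn0 : 0 < n := by omega
    refine Nat.lt_of_mul_lt_mul_left (a := X ^ 22) ?_
    have hpos : 0 < X ^ 22 * (P.W * P.W * (X ^ 4 / 32)) :=
      Nat.mul_pos h0 (Nat.mul_pos (Nat.mul_pos hW1 hW1) (by omega))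
    calc X ^ 22 * (n ^ 2 * (2 * P.radius)) ≤ X ^ 22 * (n ^ 2 * (2 ^ 8 * X ^ 4)) := by gcongr
      _ = 2 ^ 8 * X ^ 22 * X ^ 4 * (n * n) := by ring
      _ ≤ 2 ^ 8 * X ^ 22 * (2 ^ 6 * (X ^ 4 / 32)) *
          (2 ^ 5 * (X ^ 11 * P.W) * (2 ^ 5 * (X ^ 11 * P.W))) := by gcongr
      _ = 2 ^ 24 * X ^ 22 * (X ^ 22 * (P.W * P.W * (X ^ 4 / 32))) := by ring
      _ ≤ 2 ^ 26 * X ^ 22 * (X ^ 22 * (P.W * P.W * (X ^ 4 / 32))) := by gcongr <;> norm_num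
      _ < k * (X ^ 22 * (P.W * P.W * (X ^ 4 / 32))) := Nat.mul_lt_mul_of_pos_right hk hpos
      _ = _ := by ring

end HopPar

open Filter

/-- With `X` of order `n ^ ((1 + ε) / 23)` the complexity is of order `X ^ 24`, while the filling
alone supplies the edges beyond linearly many. The exponents need `22 * (1 + ε) < 23` and `23 * (1 +
2 * ε) ≤ 24 * (1 + ε)`, which hold for `ε < 1 / 22`. -/
theorem exists_greedyHopset_family {ε : ℝ} (hε : 0 ≤ ε) (hε' : ε < 1 / 25) :
    ∃ (G : (n : ℕ) → SimpleGraph (Fin n)) (a b κ : ℝ), 0 < a ∧ 0 < b ∧ 0 < κ ∧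
      (∀ᶠ n : ℕ in atTop, a * (n : ℝ) ^ (1 + ε) ≤ (G n).edgeSet.ncard ∧
        ((G n).edgeSet.ncard : ℝ) ≤ b * (n : ℝ) ^ (1 + ε)) ∧
      ∀ c : ℝ, 0 < c → ∀ᶠ n : ℕ in atTop, ∀ (k : ℕ) (H : Finset (Sym2 (Fin n) × ℝ)), c * n ≤ k →
        GreedyHopset (G n) k H →
        κ * ((G n).edgeSet.ncard * (n : ℝ) ^ ε) ≤ hopsetCertComplexity (G n) H := by
  have hE : 0 < 23 := by norm_num
  set X := scale ε 23
  have hcond : ∀ᶠ n : ℕ in atTop, 32 ≤ X n ∧ 10000 * X n ^ 22 ≤ n ∧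
      4 * (scale ε 2 n + 1) ≤ n := by
    filter_upwards [eventually_le_scale hε hE 32, eventually_mul_scale_pow_le (p := 22) (ε := ε) hE
      (by norm_num; linarith) 10000, eventually_filling_le (ε := ε) (by linarith)] with n h1 h2 h3
    exact ⟨h1, by exact_mod_cast h2, h3⟩
  have key := fun n (h : 32 ≤ X n ∧ 10000 * X n ^ 22 ≤ n ∧ 4 * (scale ε 2 n + 1) ≤ n) =>
    HopPar.exists_graph_of_pow h.1 h.2.1 h.2.2
  choose! G hG using key
  have hedge : ∀ᶠ n : ℕ in atTop, 1 / 8 * (n : ℝ) ^ (1 + ε) ≤ (G n).edgeSet.ncard ∧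
      ((G n).edgeSet.ncard : ℝ) ≤ 6 * (n : ℝ) ^ (1 + ε) := by
    filter_upwards [hcond, eventually_edge_bounds hε hE 0] with n hn hb
    obtain ⟨h1, h2, -⟩ := hG n hn
    have := hb _ h1 (by omega)
    rwa [Nat.cast_zero, zero_add] at this
  refine ⟨G, 1 / 8, 6, 1 / (6 * 2 ^ 24 * 48), by norm_num, by norm_num, by positivity, hedge,
    fun c hc => ?_⟩
  filter_upwards [hcond, hedge,
    eventually_complexity_bound hε hE (p := 24) (b := 6) (D := 48)
      (by norm_num; linarith) (by norm_num) (by norm_num),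
    eventually_mul_scale_pow_le (p := 22) (ε := ε) hE (by norm_num; linarith)
      ((2 ^ 26 + 1) / c)] with n hn hb hx hk k H hck hH
  obtain ⟨-, -, h⟩ := hG n hn
  refine hx _ _ hb.2 ?_
  have := h k H ?_ hH
  · exact_mod_cast this
  · have h5 : (0 : ℝ) < (X n : ℝ) ^ 22 := by have := hn.1; positivity
    have h6 : (2 ^ 26 + 1) * (X n : ℝ) ^ 22 ≤ c * n := by
      rw [div_mul_eq_mul_div, div_le_iff₀ hc] at hk
      linarith
    have h7 : (2 ^ 26 : ℝ) * (X n : ℝ) ^ 22 < k := by linarith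
    exact_mod_cast h7

end CertifiedShortcuts

theorem mainTheorem9 :
    -- greedy shortcuts of directed acyclic graphs
    (∀ ε : ℝ, 0 ≤ ε → ε < 1 / 25 →
      ∃ (G : (n : ℕ) → Digraph (Fin n)) (a b κ : ℝ), 0 < a ∧ 0 < b ∧ 0 < κ ∧
        (∀ᶠ n : ℕ in Filter.atTop, CertifiedShortcuts.IsDAG (G n) ∧
          a * (n : ℝ) ^ (1 + ε) ≤ CertifiedShortcuts.edgeCount (G n) ∧
          (CertifiedShortcuts.edgeCount (G n) : ℝ) ≤ b * (n : ℝ) ^ (1 + ε)) ∧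
        ∀ c : ℝ, 0 < c → ∀ᶠ n : ℕ in Filter.atTop,
          ∀ (k : ℕ) (H : Finset (Fin n × Fin n)), c * n ≤ k →
            CertifiedShortcuts.GreedyShortcut (G n) k H →
            κ * (CertifiedShortcuts.edgeCount (G n) * (n : ℝ) ^ ε) ≤
              CertifiedShortcuts.certComplexity (G n) H) ∧
    -- greedy hopsets of unweighted undirected graphs
    (∀ ε : ℝ, 0 ≤ ε → ε < 1 / 25 →
      ∃ (G : (n : ℕ) → SimpleGraph (Fin n)) (a b κ : ℝ), 0 < a ∧ 0 < b ∧ 0 < κ ∧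
        (∀ᶠ n : ℕ in Filter.atTop,
          a * (n : ℝ) ^ (1 + ε) ≤ (G n).edgeSet.ncard ∧
          ((G n).edgeSet.ncard : ℝ) ≤ b * (n : ℝ) ^ (1 + ε)) ∧
        ∀ c : ℝ, 0 < c → ∀ᶠ n : ℕ in Filter.atTop,
          ∀ (k : ℕ) (H : Finset (Sym2 (Fin n) × ℝ)), c * n ≤ k →
            CertifiedShortcuts.GreedyHopset (G n) k H →
            κ * ((G n).edgeSet.ncard * (n : ℝ) ^ ε) ≤
              CertifiedShortcuts.hopsetCertComplexity (G n) H) ∧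
    -- greedy shortcuts based on chain covers
    (∀ ε : ℝ, 0 ≤ ε → ε < 2 / 75 →
      ∃ (G : (n : ℕ) → Digraph (Fin n)) (a b κ : ℝ), 0 < a ∧ 0 < b ∧ 0 < κ ∧
        (∀ᶠ n : ℕ in Filter.atTop, CertifiedShortcuts.IsDAG (G n) ∧
          a * (n : ℝ) ^ (1 + ε) ≤ CertifiedShortcuts.edgeCount (G n) ∧
          (CertifiedShortcuts.edgeCount (G n) : ℝ) ≤ b * (n : ℝ) ^ (1 + ε)) ∧
        ∀ (A B c : ℝ) (R : ℕ), 0 < A → 0 < B → 0 < c → ∀ᶠ n : ℕ in Filter.atTop,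
          ∀ (𝒞 : Finset (List (Fin n))) (k : ℕ) (H : Finset (Fin n × Fin n)),
            CertifiedShortcuts.IsChainCover (G n) 𝒞 (A * (n : ℝ) ^ (2 / 3 : ℝ)) B → c * n ≤ k →
            CertifiedShortcuts.GreedyChainShortcut (G n) 𝒞 R k H →
            κ * (CertifiedShortcuts.edgeCount (G n) * (n : ℝ) ^ ε) ≤
              CertifiedShortcuts.certComplexity (G n) H) := by
  refine ⟨fun ε h h' => CertifiedShortcuts.exists_greedyShortcut_family h h',
    fun ε h h' => CertifiedShortcuts.exists_greedyHopset_family h h',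
    fun ε h h' => CertifiedShortcuts.exists_greedyChainShortcut_family h h'⟩
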